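/- Let $\lambda_1, \lambda_3 \ge 0$ be fixed, let $N \ge 1$ and $k$ be integers with $k > 1 + N/2$, and let $T > 0$. For integers $j \ge 1$, let $\mathcal{E}^j(\mathbb{R}^N)$ be the set of maps $v = (v_1, v_2, v_3) \in L^1_{\rm loc}(\mathbb{R}^N, \mathbb{S}^2)$ with $v_1, v_3 \in L^2(\mathbb{R}^N)$ and $\nabla v \in H^{j-1}(\mathbb{R}^N)$, endowed with the distance given by the norm $$\|v\|_{Z^j} = \big( \|v_1\|_{H^j}^2 + \|v_2\|_{L^\infty}^2 + \|\nabla v_2\|_{H^{j-1}}^2 + \|v_3\|_{H^j}^2 \big)^{1/2}.$$ Assume that $m \in C^0([0,T], \mathcal{E}^{k+2}(\mathbb{R}^N))$, with $\partial_t m \in C^0([0,T], H^k(\mathbb{R}^N))$, is a solution of the Landau–Lifshitz equation $$\partial_t m + m \times \big( \Delta m - \lambda_1 m_1 e_1 - \lambda_3 m_3 e_3 \big) = 0 \quad \text{on } \mathbb{R}^N \times [0,T].$$ Set $$E_{\rm LL}^1(t) = \frac12 \int_{\mathbb{R}^N} \big( |\nabla m|^2 + \lambda_1 m_1^2 + \lambda_3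 m_3^2 \big)(x,t) \, dx,$$ and, for any integer $\ell \ge 2$, $$E_{\rm LL}^\ell(t) = \frac12 \sum_{|\alpha| = \ell-2} \int_{\mathbb{R}^N} \Big( |\partial_t \partial_x^\alpha m|^2 + |\Delta \partial_x^\alpha m|^2 + (\lambda_1+\lambda_3) \big( |\nabla \partial_x^\alpha m_1|^2 + |\nabla \partial_x^\alpha m_3|^2 \big) + \lambda_1 \lambda_3 \big( |\partial_x^\alpha m_1|^2 + |\partial_x^\alpha m_3|^2 \big) \Big)(x,t) \, dx.$$ (i) The Landau–Lifshitz energy is well-defined and conserved: $E_{\rm LL}^1(t) = E_{\rm LL}^1(0)$ for any $t \in [0,T]$. (ii) For any integer $2 \le \ell \le k$, the energy $E_{\rm LL}^\ell$ is well-defined and of class $C^1$ on $[0,T]$, the functions $m_1(\cdot,t)$, $m_3(\cdot,t)$ and $\nabla m(\cdot,t)$ are bounded, and $$\big[ E_{\rm LL}^\ell \big]'(t) \le C_k \big( 1 + \|m_1(\cdot,t)\|_{L^\infty}^2 + \|m_3(\cdot,t)\|_{L^\infty}^2 + \|\nabla m(\cdot,t)\|_{L^\infty}^2 \big) \sum_{j=1}^{\ell}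 E_{\rm LL}^j(t)$$ for any $t \in [0,T]$, where the positive number $C_k$ depends only on $k$ and on the fixed parameters $\lambda_1$ and $\lambda_3$ (not on $N$, $T$, $\ell$, $t$ or $m$). -/

import Mathlib

open MeasureTheory Filter Set
open scoped ENNReal Topology ContDiff Matrix

namespace LandauLifshitz

/-- The physical space `ℝ^N`. -/
abbrev Space (N : ℕ) : Type := EuclideanSpace ℝ (Fin N)

/-- The target space `ℝ³`; the components `v_1, v_2, v_3` are indexed by `0, 1, 2`. -/
abbrev Vec3 : Type := EuclideanSpace ℝ (Fin 3)

section Sobolev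

variable {N : ℕ} {F : Type*} [NormedAddCommGroup F] [NormedSpace ℝ F]

/-- The length `|α|` of a multi-index. -/
def length (α : Fin N → ℕ) : ℕ := ∑ i, α i

/-- The classical partial derivative `∂_i φ`. -/
noncomputable def partialDeriv (i : Fin N) (φ : Space N → ℝ) : Space N → ℝ :=
  fun x => fderiv ℝ φ x (EuclideanSpace.single i 1)

/-- The classical derivative `∂_{x_1}^{α_1} ⋯ ∂_{x_N}^{α_N} φ`. -/
noncomputable def multiDeriv (α : Fin N → ℕ) (φ : Space N → ℝ) : Space N → ℝ :=
  (List.finRange N).foldr (fun i g => (partialDeriv i)^[α i] g) φ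

/-- A test function: smooth with compact support. -/
def IsTest (φ : Space N → ℝ) : Prop := ContDiff ℝ ∞ φ ∧ HasCompactSupport φ

/-- `g` is the derivative `∂^α f` in the sense of distributions, both being `L¹_loc`. -/
structure HasWeakDeriv (α : Fin N → ℕ) (f g : Space N → F) : Prop where
  locallyIntegrable : LocallyIntegrable f
  locallyIntegrable_deriv : LocallyIntegrable g
  integral_eq : ∀ φ : Space N → ℝ, IsTest φ →
    ∫ x, multiDeriv α φ x • f x = (-1 : ℝ) ^ length α • ∫ x, φ x • g x

open Classical in
/-- A representative of the weak derivative `∂^α f` (unique up to null sets), with the value `0`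
if the distributional derivative is not a locally integrable function. -/
noncomputable def weakDeriv (α : Fin N → ℕ) (f : Space N → F) : Space N → F :=
  if h : ∃ g, HasWeakDeriv α f g then h.choose else 0

/-- The weak first-order derivative `∂_i f`. -/
noncomputable def weakPartial (i : Fin N) (f : Space N → F) : Space N → F :=
  weakDeriv (Pi.single i 1) f

/-- The weak Laplacian `Δ f = ∑_i ∂_i² f`. -/
noncomputable def weakLaplacian (f : Space N → F) : Space N → F :=
  fun x => ∑ i : Fin N, weakDeriv (Pi.single i 2) f x

/-- `|∇ f|² = ∑_i |∂_i f|²`, pointwise. -/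
noncomputable def gradSq (f : Space N → F) : Space N → ℝ :=
  fun x => ∑ i : Fin N, ‖weakPartial i f x‖ ^ 2

/-- `|∇ f|`, pointwise. -/
noncomputable def gradNorm (f : Space N → F) : Space N → ℝ :=
  fun x => Real.sqrt (gradSq f x)

/-- Membership in the Sobolev space `H^k(ℝ^N)`. -/
def MemH (k : ℕ) (f : Space N → F) : Prop :=
  ∀ α : Fin N → ℕ, length α ≤ k → ∃ g, HasWeakDeriv α f g ∧ MemLp g 2

/-- The `H^k`-norm, `(∑_{|α| ≤ k} ‖∂^α f‖_{L²}²)^{1/2}`. -/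
noncomputable def hNorm (k : ℕ) (f : Space N → F) : ℝ≥0∞ :=
  (∑ j ∈ Finset.range (k + 1), ∑ α ∈ Finset.piAntidiag (Finset.univ : Finset (Fin N)) j,
    eLpNorm (weakDeriv α f) 2 volume ^ 2) ^ (1 / 2 : ℝ)

/-- `w ∈ C⁰([0, T], H^k(ℝ^N))`. -/
structure ContInH (k : ℕ) (T : ℝ) (w : ℝ → Space N → F) : Prop where
  mem : ∀ t ∈ Icc 0 T, MemH k (w t)
  tendsto : ∀ t ∈ Icc 0 T,
    Tendsto (fun s => hNorm k (fun x => w s x - w t x)) (𝓝[Icc 0 T] t) (𝓝 0)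

/-- `∂_t m = w` in the sense of distributions on `[0, T]`: for each test function `φ` on `ℝ^N`, the
function `t ↦ ∫ φ m(t)` is differentiable on `[0, T]` with derivative `t ↦ ∫ φ w(t)`. -/
def IsTimeDeriv (T : ℝ) (m w : ℝ → Space N → F) : Prop :=
  ∀ φ : Space N → ℝ, IsTest φ → ∀ t ∈ Icc 0 T,
    HasDerivWithinAt (fun s => ∫ x, φ x • m s x) (∫ x, φ x • w t x) (Icc 0 T) t

end Sobolev

variable {N : ℕ}

/-- The component of index `i` of an `ℝ³`-valued map. -/
def comp (i : Fin 3) (v : Space N → Vec3) : Space N → ℝ := fun x => v x i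

/-- Membership in the set `𝓔^k(ℝ^N)`, `k ≥ 1`, of `𝕊²`-valued maps `v` with `v_1, v_3 ∈ L²` and
`∇v ∈ H^{k-1}`. -/
structure MemEnergySet (k : ℕ) (v : Space N → Vec3) : Prop where
  locallyIntegrable : LocallyIntegrable v
  sphere : ∀ᵐ x, ‖v x‖ = 1
  memLp_one : MemLp (comp 0 v) 2
  memLp_three : MemLp (comp 2 v) 2
  grad : ∀ i : Fin N, (∃ g, HasWeakDeriv (Pi.single i 1) v g) ∧ MemH (k - 1) (weakPartial i v)

/-- The `Z^k`-norm, `k ≥ 1`: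
`(‖v_1‖_{H^k}² + ‖v_2‖_{L^∞}² + ‖∇v_2‖_{H^{k-1}}² + ‖v_3‖_{H^k}²)^{1/2}`. -/
noncomputable def zNorm (k : ℕ) (v : Space N → Vec3) : ℝ≥0∞ :=
  (hNorm k (comp 0 v) ^ 2 + eLpNorm (comp 1 v) ∞ volume ^ 2
    + ∑ i : Fin N, hNorm (k - 1) (weakPartial i (comp 1 v)) ^ 2
    + hNorm k (comp 2 v) ^ 2) ^ (1 / 2 : ℝ)

/-- `m ∈ C⁰([0, T], 𝓔^k(ℝ^N))`, for the distance given by the `Z^k`-norm. -/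
structure ContInEnergySet (k : ℕ) (T : ℝ) (m : ℝ → Space N → Vec3) : Prop where
  mem : ∀ t ∈ Icc 0 T, MemEnergySet k (m t)
  tendsto : ∀ t ∈ Icc 0 T,
    Tendsto (fun s => zNorm k (fun x => m s x - m t x)) (𝓝[Icc 0 T] t) (𝓝 0)

/-- The anisotropy vector `(λ_1 v_1, 0, λ_3 v_3)`. -/
def aniso (lam1 lam3 : ℝ) (v : Vec3) : Vec3 := !₂[lam1 * v 0, 0, lam3 * v 2]

/-- `m` solves `∂_t m + m × (Δm - λ_1 m_1 e_1 - λ_3 m_3 e_3) = 0` on `ℝ^N × [0, T]`, where `mt` is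
its time derivative. -/
def SolvesLL (lam1 lam3 T : ℝ) (m mt : ℝ → Space N → Vec3) : Prop :=
  ∀ t ∈ Icc 0 T, ∀ᵐ x,
    (mt t x).ofLp
      + (m t x).ofLp ⨯₃ (weakLaplacian (m t) x - aniso lam1 lam3 (m t x)).ofLp = 0

/-- `m` is a solution of the Landau–Lifshitz equation in `C⁰([0, T], 𝓔^{k+2}(ℝ^N))`, with time
derivative `mt = ∂_t m` in `C⁰([0, T], H^k(ℝ^N))`. -/
structure IsSmoothSolution (lam1 lam3 : ℝ) (k : ℕ) (T : ℝ) (m mt : ℝ → Space N → Vec3) :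
    Prop where
  cont : ContInEnergySet (k + 2) T m
  cont_deriv : ContInH k T mt
  timeDeriv : IsTimeDeriv T m mt
  solves : SolvesLL lam1 lam3 T m mt

/-- Twice the density of the Landau–Lifshitz energy: `|∇v|² + λ_1 v_1² + λ_3 v_3²`. -/
noncomputable def energyDensity (lam1 lam3 : ℝ) (v : Space N → Vec3) : Space N → ℝ :=
  fun x => gradSq v x + lam1 * v x 0 ^ 2 + lam3 * v x 2 ^ 2

/-- The Landau–Lifshitz energy `E_LL(v)`. -/
noncomputable def energy (lam1 lam3 : ℝ) (v : Space N → Vec3) : ℝ :=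
  1 / 2 * ∫ x, energyDensity lam1 lam3 v x

/-- `|∂^α w|² + |Δ∂^α v|² + (λ_1 + λ_3) (|∇∂^α v_1|² + |∇∂^α v_3|²)
  + λ_1 λ_3 (|∂^α v_1|² + |∂^α v_3|²)`, to be used with `v = m(t)` and `w = ∂_t m(t)`. -/
noncomputable def higherDensity (lam1 lam3 : ℝ) (α : Fin N → ℕ) (v w : Space N → Vec3) :
    Space N → ℝ :=
  fun x => ‖weakDeriv α w x‖ ^ 2 + ‖weakLaplacian (weakDeriv α v) x‖ ^ 2
    + (lam1 + lam3) *
      (gradSq (weakDeriv α (comp 0 v)) x + gradSq (weakDeriv α (comp 2 v)) x)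
    + lam1 * lam3 *
      (weakDeriv α (comp 0 v) x ^ 2 + weakDeriv α (comp 2 v) x ^ 2)

/-- The energies `E_LL^j(t)`, `j ≥ 1`, of `m` with time derivative `mt`: the Landau–Lifshitz energy
for `j = 1`, and for `j ≥ 2` the sum over `|α| = j - 2` of half the integrals of the higher-order
densities. -/
noncomputable def energyOrder (lam1 lam3 : ℝ) (m mt : ℝ → Space N → Vec3) : ℕ → ℝ → ℝ
  | 0, _ => 0
  | 1, t => energy lam1 lam3 (m t)
  | j + 2, t => 1 / 2 * ∑ α ∈ Finset.piAntidiag (Finset.univ : Finset (Fin N)) j,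
      ∫ x, higherDensity lam1 lam3 α (m t) (mt t) x

/-- `Σ_LL^ℓ(t) = ∑_{j=1}^ℓ E_LL^j(t)`. -/
noncomputable def energySum (lam1 lam3 : ℝ) (m mt : ℝ → Space N → Vec3) (l : ℕ) (t : ℝ) : ℝ :=
  ∑ j ∈ Finset.Icc 1 l, energyOrder lam1 lam3 m mt j t

/-- The `L^∞`-norm (essential supremum) of a real-valued function. -/
noncomputable def supNorm (f : Space N → ℝ) : ℝ := (eLpNorm f ∞ volume).toReal

end LandauLifshitz

open LandauLifshitz

/-! Write h = Δm − (λ₁m₁, 0, λ₃m₃) and w = ∂_t m = −m × h. Integration by parts gives [E¹]' = −∫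
h·w, which vanishes because w is orthogonal to h.

For the higher energies the equation is differentiated in time. The constraint |m|² = 1,
differentiated up to four times, turns the result into ∂_t²m + Δ²m = F. Here F consists of cubic
terms ∂m ∂m ∂²m, of anisotropy terms with at most two derivatives, and of the vector m multiplied by
−2 ∑ ∂_i∂_j(∂_i m·∂_j m) (`accel_add_bilaplacian_eq`, `llAccel_add_bilaplacian_ae_eq`). The
derivative of ½∫(|∂^α w|² + |Δ∂^α m|²) is then ∫ ∂^α w·∂^α F. Let |α| = ℓ − 2, let K be the L^∞-norm
of ∇m, and let X² be a multiple of the sum of the energies up to order ℓ.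

The cubic and anisotropy terms are bounded in L² by C(1 + K²)X through Moser's inequality
(`exists_moser`), which is linear in the highest-order norms; |m| = 1 makes the sup norms of the
components of m harmless. The remaining term contains ℓ + 1 derivatives of m, one too many. The
commutator of ∂^α with the factor m is again a Moser term (`exists_commutator`). The leading part is
∫ (m·∂^α w) ∂^α∂_i∂_j(∂_i m·∂_j m). Since m·w = 0, the Leibniz formula expresses m·∂^α w through
derivatives of w of order at most ℓ − 3, so one integration by parts restores the balance
(`derivBound_inner_velocity`, `abs_sum_integral_le`). No sup bound on w by K is at hand, but w = −∑
∂_r(m × ∂_r m) + lower order is a divergence of fields bounded by multiples of K, and Moser's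
inequality is applied to those fields (`velocity_ae_eq`).

Moser's inequality comes from a Gagliardo–Nirenberg inequality: integration by parts makes the norms
of the j-th derivatives in L^{2s/j} logarithmically convex in j. The estimate is proved on
mollifications, where every integral converges, and passes to the limit by Fatou's lemma.

Derivatives in space are weak and derivatives in time are distributional. A distributional time
derivative that is continuous into L² is a strong one (`hasDerivWithinAt_toL2`), so the energies are
C¹ once ∂_t²m is continuous into H^{k−2}. The condition k > 1 + N/2 provides this, since then ∂_i w
lies in H^{k−1} and is bounded (`LLCurve.contH_accel`). The same condition gives N < 2k, so finitely
many dimensions occur and the constant can be taken independent of N. The second component of m need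
not be square integrable; every term containing it undifferentiated must have a bounded factor in
that place or a vanishing coefficient. -/

namespace LandauLifshitz

/-! ### Multi-indices and the calculus of weak derivatives. -/

section WeakDerivatives

variable {N : ℕ} {F : Type*} [NormedAddCommGroup F] [NormedSpace ℝ F]

theorem length_add (α β : Fin N → ℕ) : length (α + β) = length α + length β := by
  simp [length, Finset.sum_add_distrib]

@[simp] theorem length_single (i : Fin N) (n : ℕ) : length (Pi.single i n) = n := by
  simp [length, Finset.sum_pi_single']

@[simp] theorem length_zero : length (0 : Fin N → ℕ) = 0 := by simp [length]

theorem length_eq_zero {α : Fin N → ℕ} : length α = 0 ↔ α = 0 := by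
  simp [length, funext_iff]

theorem length_mono {α β : Fin N → ℕ} (h : α ≤ β) : length α ≤ length β :=
  Finset.sum_le_sum fun i _ => h i

theorem exists_eq_add_single {α : Fin N → ℕ} (h : 0 < length α) :
    ∃ (i : Fin N) (β : Fin N → ℕ), α = β + Pi.single i 1 := by
  have : ∃ i, α i ≠ 0 := by
    by_contra! hc
    exact h.ne' (length_eq_zero.2 (funext hc))
  obtain ⟨i, hi⟩ := this
  refine ⟨i, α - Pi.single i 1, ?_⟩
  ext j
  by_cases hj : j = i
  · subst hj; simp; omega
  · simp [hj]

/-- Induction on multi-indices. -/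
theorem multiIndex_induction {p : (Fin N → ℕ) → Prop} (zero : p 0)
    (add_single : ∀ α i, p α → p (α + Pi.single i 1)) (α : Fin N → ℕ) : p α := by
  induction h : length α generalizing α with
  | zero => rw [length_eq_zero.1 h]; exact zero
  | succ n ih =>
    obtain ⟨i, β, rfl⟩ := exists_eq_add_single (α := α) (by omega)
    exact add_single _ _ (ih _ (by simpa [length_add] using h))

theorem _root_.ContDiff.partialDeriv {φ : Space N → ℝ} (hφ : ContDiff ℝ ∞ φ) (i : Fin N) :
    ContDiff ℝ ∞ (partialDeriv i φ) :=
  (hφ.fderiv_right (m := ∞) (by simp)).clm_apply contDiff_const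

theorem IsTest.partialDeriv {φ : Space N → ℝ} (hφ : IsTest φ) (i : Fin N) :
    IsTest (partialDeriv i φ) :=
  ⟨hφ.1.partialDeriv i, hφ.2.fderiv_apply (𝕜 := ℝ) (EuclideanSpace.single i 1)⟩

theorem partialDeriv_comm {φ : Space N → ℝ} (hφ : ContDiff ℝ ∞ φ) (i j : Fin N) :
    partialDeriv i (partialDeriv j φ) = partialDeriv j (partialDeriv i φ) := by
  ext x
  have hd : DifferentiableAt ℝ (fderiv ℝ φ) x :=
    (hφ.fderiv_right (m := ∞) (by simp)).differentiable (by simp) x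
  have key : ∀ a b : Fin N, partialDeriv a (partialDeriv b φ) x =
      fderiv ℝ (fderiv ℝ φ) x (EuclideanSpace.single a 1) (EuclideanSpace.single b 1) := by
    intro a b
    unfold partialDeriv
    rw [fderiv_clm_apply hd (differentiableAt_const _)]
    simp
  rw [key, key]
  exact (hφ.contDiffAt (x := x)).isSymmSndFDerivAt
    (by simpa using ENat.LEInfty.out) _ _

theorem contDiff_iterate_partialDeriv {φ : Space N → ℝ} (hφ : ContDiff ℝ ∞ φ) (i : Fin N)
    (n : ℕ) : ContDiff ℝ ∞ ((partialDeriv i)^[n] φ) := by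
  induction n with
  | zero => exact hφ
  | succ n ih => rw [Function.iterate_succ_apply']; exact ih.partialDeriv i

theorem contDiff_foldr_partialDeriv {φ : Space N → ℝ} (hφ : ContDiff ℝ ∞ φ) (α : Fin N → ℕ)
    (l : List (Fin N)) : ContDiff ℝ ∞ (l.foldr (fun i g => (partialDeriv i)^[α i] g) φ) := by
  induction l with
  | nil => exact hφ
  | cons a l ih => exact contDiff_iterate_partialDeriv ih a _

theorem iterate_partialDeriv_comm {φ : Space N → ℝ} (hφ : ContDiff ℝ ∞ φ) (i j : Fin N)
    (n : ℕ) : (partialDeriv i)^[n] (partialDeriv j φ) = partialDeriv j ((partialDeriv i)^[n] φ) := by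
  induction n with
  | zero => rfl
  | succ n ih =>
    rw [Function.iterate_succ_apply', ih, partialDeriv_comm (contDiff_iterate_partialDeriv hφ i n),
      Function.iterate_succ_apply']

/-- The fold applies the partial derivatives in a fixed order. Since partial derivatives of smooth
functions commute, an extra ∂_j can be pulled to the outside; without repetitions in the list it is
met at most once. -/
theorem foldr_add_single {φ : Space N → ℝ} (hφ : ContDiff ℝ ∞ φ) (α : Fin N → ℕ) (j : Fin N)
    (l : List (Fin N)) (hl : l.Nodup) :
    l.foldr (fun i g => (partialDeriv i)^[(α + Pi.single j 1 : Fin N → ℕ) i] g) φ =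
      if j ∈ l then partialDeriv j (l.foldr (fun i g => (partialDeriv i)^[α i] g) φ)
      else l.foldr (fun i g => (partialDeriv i)^[α i] g) φ := by
  induction l with
  | nil => simp
  | cons a l ih =>
    rw [List.nodup_cons] at hl
    simp only [List.foldr_cons]
    rw [ih hl.2]
    by_cases hja : j = a
    · subst hja
      simp [hl.1, Function.iterate_succ_apply']
    · have : (Pi.single j 1 : Fin N → ℕ) a = 0 := by simp [Ne.symm hja]
      by_cases hjl : j ∈ l
      · simp only [hjl, if_true, List.mem_cons, or_true, Pi.add_apply, this, add_zero]
        exact iterate_partialDeriv_comm (contDiff_foldr_partialDeriv hφ α l) a j _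
      · simp [hjl, hja]

theorem multiDeriv_add_single {φ : Space N → ℝ} (hφ : ContDiff ℝ ∞ φ) (α : Fin N → ℕ)
    (j : Fin N) : multiDeriv (α + Pi.single j 1) φ = partialDeriv j (multiDeriv α φ) := by
  have := foldr_add_single hφ α j (List.finRange N) (List.nodup_finRange N)
  simpa [multiDeriv] using this

theorem multiDeriv_zero (φ : Space N → ℝ) : multiDeriv 0 φ = φ := by
  unfold multiDeriv
  induction List.finRange N with
  | nil => rfl
  | cons a l ih => simp

theorem multiDeriv_single (i : Fin N) {φ : Space N → ℝ} (hφ : ContDiff ℝ ∞ φ) :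
    multiDeriv (Pi.single i 1) φ = partialDeriv i φ := by
  have := multiDeriv_add_single hφ 0 i
  rwa [zero_add, multiDeriv_zero] at this

theorem IsTest.multiDeriv {φ : Space N → ℝ} (hφ : IsTest φ) (α : Fin N → ℕ) :
    IsTest (multiDeriv α φ) := by
  induction α using multiIndex_induction with
  | zero => rwa [multiDeriv_zero]
  | add_single α i ih => rw [multiDeriv_add_single hφ.1]; exact ih.partialDeriv i

theorem multiDeriv_add {φ : Space N → ℝ} (hφ : IsTest φ) (α β : Fin N → ℕ) :
    multiDeriv (α + β) φ = multiDeriv α (multiDeriv β φ) := by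
  induction α using multiIndex_induction with
  | zero => rw [zero_add, multiDeriv_zero]
  | add_single α i ih =>
    rw [multiDeriv_add_single (hφ.multiDeriv β).1, ← ih, ← multiDeriv_add_single hφ.1]
    congr 1
    abel

theorem IsTest.continuous {φ : Space N → ℝ} (hφ : IsTest φ) : Continuous φ := hφ.1.continuous

theorem IsTest.integrable_smul {φ : Space N → ℝ} (hφ : IsTest φ) {f : Space N → F}
    (hf : LocallyIntegrable f) : Integrable (fun x => φ x • f x) :=
  hf.integrable_smul_left_of_hasCompactSupport hφ.continuous hφ.2

theorem ae_eq_of_forall_test [CompleteSpace F] {f g : Space N → F} (hf : LocallyIntegrable f)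
    (hg : LocallyIntegrable g)
    (h : ∀ φ : Space N → ℝ, IsTest φ → ∫ x, φ x • f x = ∫ x, φ x • g x) : f =ᵐ[volume] g :=
  ae_eq_of_integral_contDiff_smul_eq hf hg fun φ h1 h2 => h φ ⟨h1, h2⟩

namespace HasWeakDeriv

variable {α β : Fin N → ℕ} {f f' g g' h : Space N → F}

theorem unique [CompleteSpace F] (h1 : HasWeakDeriv α f g) (h2 : HasWeakDeriv α f g') :
    g =ᵐ[volume] g' := by
  refine ae_eq_of_forall_test h1.2 h2.2 fun φ hφ => ?_
  have := (h1.3 φ hφ).symm.trans (h2.3 φ hφ)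
  have hne : (-1 : ℝ) ^ length α ≠ 0 := pow_ne_zero _ (by norm_num)
  exact smul_right_injective _ hne this

theorem congr (h1 : HasWeakDeriv α f g) (hf : f =ᵐ[volume] f') (hg : g =ᵐ[volume] g') :
    HasWeakDeriv α f' g' := by
  refine ⟨h1.1.congr hf, h1.2.congr hg, fun φ hφ => ?_⟩
  have e1 : ∫ x, multiDeriv α φ x • f' x = ∫ x, multiDeriv α φ x • f x :=
    integral_congr_ae (hf.mono fun x hx => by simp [hx])
  have e2 : ∫ x, φ x • g' x = ∫ x, φ x • g x :=
    integral_congr_ae (hg.mono fun x hx => by simp [hx])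
  rw [e1, e2, h1.3 φ hφ]

theorem zero_index (hf : LocallyIntegrable f) : HasWeakDeriv 0 f f :=
  ⟨hf, hf, fun φ _ => by simp [multiDeriv_zero]⟩

theorem trans (h1 : HasWeakDeriv α f g) (h2 : HasWeakDeriv β g h) :
    HasWeakDeriv (α + β) f h := by
  refine ⟨h1.1, h2.2, fun φ hφ => ?_⟩
  rw [multiDeriv_add hφ, h1.3 _ (hφ.multiDeriv β), h2.3 φ hφ, smul_smul, ← pow_add, length_add]

/-- Testing the first relation with ∂^β φ and the second with φ produces the same left-hand side,
and the common sign (−1)^{|α|} cancels. Derivatives of derivatives are identified in this way. -/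
theorem of_add (h1 : HasWeakDeriv α f g) (h2 : HasWeakDeriv (α + β) f h) :
    HasWeakDeriv β g h := by
  refine ⟨h1.2, h2.2, fun φ hφ => ?_⟩
  have e1 := h1.3 _ (hφ.multiDeriv β)
  have e2 := h2.3 φ hφ
  rw [multiDeriv_add hφ, e1, length_add, pow_add, mul_smul] at e2
  have hne : (-1 : ℝ) ^ length α ≠ 0 := pow_ne_zero _ (by norm_num)
  exact smul_right_injective _ hne e2

theorem add (h1 : HasWeakDeriv α f g) (h2 : HasWeakDeriv α f' g') :
    HasWeakDeriv α (fun x => f x + f' x) (fun x => g x + g' x) := by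
  refine ⟨h1.1.add h2.1, h1.2.add h2.2, fun φ hφ => ?_⟩
  simp only [smul_add]
  rw [integral_add ((hφ.multiDeriv α).integrable_smul h1.1)
    ((hφ.multiDeriv α).integrable_smul h2.1), integral_add (hφ.integrable_smul h1.2)
    (hφ.integrable_smul h2.2), h1.3 φ hφ, h2.3 φ hφ, smul_add]

theorem const_smul (c : ℝ) (h1 : HasWeakDeriv α f g) :
    HasWeakDeriv α (fun x => c • f x) (fun x => c • g x) := by
  refine ⟨h1.1.smul c, h1.2.smul c, fun φ hφ => ?_⟩
  simp only [smul_comm _ c]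
  rw [integral_smul, integral_smul, h1.3 φ hφ, smul_comm]

theorem const_mul {f g : Space N → ℝ} (c : ℝ) (h1 : HasWeakDeriv α f g) :
    HasWeakDeriv α (fun x => c * f x) (fun x => c * g x) := h1.const_smul c

theorem neg (h1 : HasWeakDeriv α f g) :
    HasWeakDeriv α (fun x => -f x) (fun x => -g x) := by
  simpa using h1.const_smul (-1)

theorem sub (h1 : HasWeakDeriv α f g) (h2 : HasWeakDeriv α f' g') :
    HasWeakDeriv α (fun x => f x - f' x) (fun x => g x - g' x) := by
  simpa [sub_eq_add_neg] using h1.add h2.neg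

theorem zero (α : Fin N → ℕ) :
    HasWeakDeriv α (fun _ : Space N => (0 : F)) (fun _ => 0) :=
  ⟨locallyIntegrable_const 0, locallyIntegrable_const 0, fun φ _ => by simp⟩

theorem sum {ι : Type*} (s : Finset ι) {u v : ι → Space N → F}
    (h1 : ∀ i ∈ s, HasWeakDeriv α (u i) (v i)) :
    HasWeakDeriv α (fun x => ∑ i ∈ s, u i x) (fun x => ∑ i ∈ s, v i x) := by
  classical
  induction s using Finset.induction_on with
  | empty => simpa using zero α
  | insert a s ha ih =>
    simp only [Finset.sum_insert ha]
    exact (h1 a (by simp)).add (ih fun i hi => h1 i (by simp [hi]))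

/-- The integral of a partial derivative of a test function is zero. This is what allows the
constraint |m|² = 1 to be differentiated. -/
theorem const_single [CompleteSpace F] (c : F) (i : Fin N) :
    HasWeakDeriv (Pi.single i 1) (fun _ : Space N => c) (fun _ => 0) := by
  refine ⟨locallyIntegrable_const c, locallyIntegrable_const 0, fun φ hφ => ?_⟩
  have hi : Integrable φ volume := hφ.continuous.integrable_of_hasCompactSupport hφ.2
  have hi' : Integrable (partialDeriv i φ) volume :=
    (hφ.partialDeriv i).continuous.integrable_of_hasCompactSupport (hφ.partialDeriv i).2
  have : ∫ x, partialDeriv i φ x = 0 := by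
    have h0 := integral_mul_fderiv_eq_neg_fderiv_mul_of_integrable (μ := volume)
      (f := fun _ : Space N => (1 : ℝ)) (g := φ) (v := EuclideanSpace.single i 1)
      (by simp) (by simpa using! hi') (by simpa using hi)
      (fun x _ => differentiableAt_const _) (fun x _ => hφ.1.differentiable (by simp) x)
    simpa [partialDeriv] using h0
  rw [multiDeriv_single i hφ.1, integral_smul_const, this]
  simp

theorem weakDeriv (h1 : HasWeakDeriv α f g) : HasWeakDeriv α f (weakDeriv α f) := by
  have : ∃ g, HasWeakDeriv α f g := ⟨g, h1⟩
  rw [LandauLifshitz.weakDeriv, dif_pos this]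
  exact this.choose_spec

theorem weakDeriv_ae_eq [CompleteSpace F] (h1 : HasWeakDeriv α f g) :
    LandauLifshitz.weakDeriv α f =ᵐ[volume] g := h1.weakDeriv.unique h1

theorem comp_clm {G : Type*} [NormedAddCommGroup G] [NormedSpace ℝ G] [CompleteSpace F]
    [CompleteSpace G] (L : F →L[ℝ] G) (h1 : HasWeakDeriv α f g) :
    HasWeakDeriv α (fun x => L (f x)) (fun x => L (g x)) := by
  have hL : ∀ u : Space N → F, LocallyIntegrable u → LocallyIntegrable fun x => L (u x) :=
    fun u hu x => by
      obtain ⟨s, hs, hi⟩ := hu x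
      exact ⟨s, hs, L.integrable_comp hi⟩
  refine ⟨hL _ h1.1, hL _ h1.2, fun φ hφ => ?_⟩
  simp only [← map_smul]
  rw [L.integral_comp_comm ((hφ.multiDeriv α).integrable_smul h1.1),
    L.integral_comp_comm (hφ.integrable_smul h1.2), h1.3 φ hφ, map_smul]

theorem comp {f g : Space N → Vec3} (h1 : HasWeakDeriv α f g) (c : Fin 3) :
    HasWeakDeriv α (LandauLifshitz.comp c f) (LandauLifshitz.comp c g) :=
  h1.comp_clm (EuclideanSpace.proj c)

end HasWeakDeriv

theorem weakDeriv_zero_ae_eq [CompleteSpace F] {f : Space N → F} (hf : LocallyIntegrable f) :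
    weakDeriv 0 f =ᵐ[volume] f := (HasWeakDeriv.zero_index hf).weakDeriv_ae_eq

/-- This is an equality of functions and not only almost everywhere: the representative is chosen
from a predicate that depends on the class of f alone, and equal predicates yield the same choice.
-/
theorem weakDeriv_congr {f g : Space N → F} (α : Fin N → ℕ) (h : f =ᵐ[volume] g) :
    weakDeriv α f = weakDeriv α g := by
  have : (fun u => HasWeakDeriv α f u) = fun u => HasWeakDeriv α g u := by
    ext u
    exact ⟨fun hu => hu.congr h (ae_eq_refl _), fun hu => hu.congr h.symm (ae_eq_refl _)⟩
  have key : ∀ p q : (Space N → F) → Prop, p = q → ∀ [Decidable (∃ u, p u)]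
      [Decidable (∃ u, q u)], (if h : ∃ u, p u then h.choose else 0) =
        if h : ∃ u, q u then h.choose else 0 := by
    rintro p q rfl _ _
    congr
  classical
  exact key _ _ this

end WeakDerivatives

end LandauLifshitz
namespace LandauLifshitz

/-! ### Mollification: smoothness, contraction and convergence in L². -/

section Mollifier

variable {N : ℕ}

/-- A sequence of bump functions whose supports shrink to the origin. -/
noncomputable def bump (N n : ℕ) : ContDiffBump (0 : Space N) where
  rIn := 1 / (n + 1)
  rOut := 2 / (n + 1)
  rIn_pos := by positivity
  rIn_lt_rOut := by gcongr; norm_num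

/-- The mollifying kernel. -/
noncomputable def rho (n : ℕ) : Space N → ℝ := (bump N n).normed volume

theorem rho_nonneg (n : ℕ) (x : Space N) : 0 ≤ rho n x := (bump N n).nonneg_normed x

theorem integral_rho (n : ℕ) : ∫ x : Space N, rho n x = 1 := (bump N n).integral_normed

theorem isTest_rho (n : ℕ) : IsTest (rho (N := N) n) :=
  ⟨(bump N n).contDiff_normed, (bump N n).hasCompactSupport_normed⟩

theorem norm_lt_of_rho_ne_zero {n : ℕ} {x : Space N} (h : rho n x ≠ 0) : ‖x‖ < 2 := by
  have : x ∈ Function.support ((bump N n).normed volume) := h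
  rw [(bump N n).support_normed_eq, mem_ball_zero_iff] at this
  refine this.trans_le ?_
  change 2 / ((n : ℝ) + 1) ≤ 2
  exact div_le_self (by norm_num) (by linarith [Nat.cast_nonneg (α := ℝ) n])

theorem isTest_rho_sub (n : ℕ) (x : Space N) : IsTest (fun y => rho n (x - y)) := by
  refine ⟨(isTest_rho n).1.comp (contDiff_const.sub contDiff_id), ?_⟩
  exact (isTest_rho n).2.comp_homeomorph (Homeomorph.subLeft x)

theorem integral_rho_sub (n : ℕ) (x : Space N) : ∫ y, rho n (x - y) = 1 := by
  rw [integral_sub_left_eq_self (fun y => rho n y) volume x, integral_rho]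

/-- Mollification. -/
noncomputable def moll (n : ℕ) (f : Space N → ℝ) : Space N → ℝ :=
  fun x => ∫ y, rho n (x - y) * f y

theorem moll_eq_convolution (n : ℕ) (f : Space N → ℝ) :
    moll n f = convolution (rho n) f (ContinuousLinearMap.lsmul ℝ ℝ) volume := by
  ext x
  rw [convolution_eq_swap]
  rfl

theorem integrable_rho_mul (n : ℕ) (x : Space N) {f : Space N → ℝ} (hf : LocallyIntegrable f) :
    Integrable (fun y => rho n (x - y) * f y) :=
  (isTest_rho_sub n x).integrable_smul hf

theorem contDiff_moll (n : ℕ) {f : Space N → ℝ} (hf : LocallyIntegrable f) :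
    ContDiff ℝ ∞ (moll n f) := by
  rw [moll_eq_convolution]
  exact (isTest_rho n).2.contDiff_convolution_left _ (isTest_rho n).1 hf

/-- The kernel y ↦ ρ(x − y) is itself a test function. The sign from the inner derivative cancels
the one in the definition of the weak derivative. -/
theorem partialDeriv_moll (n : ℕ) {i : Fin N} {f g : Space N → ℝ}
    (h : HasWeakDeriv (Pi.single i 1) f g) : partialDeriv i (moll n f) = moll n g := by
  ext x
  have h1 := (isTest_rho (N := N) n).2.hasFDerivAt_convolution_left
    (ContinuousLinearMap.lsmul ℝ ℝ) ((isTest_rho n).1.of_le (by simp)) h.1 x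
  have h2 := h.3 _ (isTest_rho_sub n x)
  rw [multiDeriv_single i (isTest_rho_sub n x).1] at h2
  have h3 : ∀ y, partialDeriv i (fun y => rho n (x - y)) y = - partialDeriv i (rho n) (x - y) := by
    intro y
    have hd : HasFDerivAt (rho n) (fderiv ℝ (rho n) (x - y)) (x - y) :=
      ((isTest_rho n).1.differentiable (by simp) _).hasFDerivAt
    have := hd.comp y ((hasFDerivAt_id y).const_sub x)
    have e : fderiv ℝ (fun y => rho n (x - y)) y = _ := this.fderiv
    simp [partialDeriv, e]
  have h4 : partialDeriv i (moll n f) x = ∫ y, partialDeriv i (rho n) (x - y) * f y := by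
    rw [moll_eq_convolution]
    unfold partialDeriv
    rw [h1.fderiv, convolution_eq_swap]
    rw [ContinuousLinearMap.integral_apply]
    · rfl
    · have := ((isTest_rho (N := N) n).2.fderiv (𝕜 := ℝ)).convolutionExists_left
        (ContinuousLinearMap.precompL (Space N) (ContinuousLinearMap.lsmul ℝ ℝ))
        ((isTest_rho n).1.continuous_fderiv (by simp)) h.1 x
      exact this.integrable_swap
  rw [h4]
  simp only [h3, length_single, pow_one, smul_eq_mul, neg_mul, integral_neg, one_mul] at h2
  exact neg_injective h2

theorem tendsto_moll_ae {f : Space N → ℝ} (hf : LocallyIntegrable f) :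
    ∀ᵐ x, Tendsto (fun n => moll n f x) atTop (𝓝 (f x)) := by
  simp only [moll_eq_convolution]
  refine ContDiffBump.ae_convolution_tendsto_right_of_locallyIntegrable (φ := bump N) (K := 2)
    ?_ ?_ hf
  · have := (tendsto_one_div_add_atTop_nhds_zero_nat (𝕜 := ℝ)).const_mul 2
    simp only [mul_zero] at this
    refine this.congr fun n => ?_
    simp [bump, div_eq_mul_inv]
  · refine Eventually.of_forall fun n => ?_
    simp [bump, div_eq_mul_inv]

theorem tendsto_moll_of_continuous {f : Space N → ℝ} (hf : Continuous f) (x : Space N) :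
    Tendsto (fun n => moll n f x) atTop (𝓝 (f x)) := by
  simp only [moll_eq_convolution]
  refine ContDiffBump.convolution_tendsto_right_of_continuous (φ := bump N) ?_ hf x
  have := (tendsto_one_div_add_atTop_nhds_zero_nat (𝕜 := ℝ)).const_mul 2
  simp only [mul_zero] at this
  refine this.congr fun n => ?_
  simp [bump, div_eq_mul_inv]

theorem abs_moll_le (n : ℕ) {f : Space N → ℝ} {M : ℝ}
    (h : ∀ᵐ x, |f x| ≤ M) (x : Space N) : |moll n f x| ≤ M := by
  have h1 : ‖∫ y, rho n (x - y) * f y‖ ≤ ∫ y, rho n (x - y) * M := by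
    refine norm_integral_le_of_norm_le
      ((integrable_rho_mul n x (locallyIntegrable_const M))) (h.mono fun y hy => ?_)
    rw [norm_mul, Real.norm_of_nonneg (rho_nonneg _ _)]
    exact mul_le_mul_of_nonneg_left hy (rho_nonneg _ _)
  rwa [integral_mul_const, integral_rho_sub, one_mul] at h1

theorem moll_sub (n : ℕ) {f g : Space N → ℝ} (hf : LocallyIntegrable f)
    (hg : LocallyIntegrable g) : moll n (fun x => f x - g x) = fun x => moll n f x - moll n g x := by
  ext x
  simp only [moll, mul_sub]
  exact integral_sub (integrable_rho_mul n x hf) (integrable_rho_mul n x hg)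

/-- Jensen's inequality for the probability density ρ(x − ·): the variance of f around its mean c is
nonnegative. -/
theorem moll_sq_le (n : ℕ) {f : Space N → ℝ} (hf : LocallyIntegrable f)
    (hf2 : LocallyIntegrable fun x => f x ^ 2) (x : Space N) :
    moll n f x ^ 2 ≤ moll n (fun x => f x ^ 2) x := by
  set c := moll n f x with hc
  have h0 : 0 ≤ ∫ y, rho n (x - y) * (f y - c) ^ 2 :=
    integral_nonneg fun y => mul_nonneg (rho_nonneg _ _) (sq_nonneg _)
  have h1 : ∫ y, rho n (x - y) * (f y - c) ^ 2 =
      moll n (fun x => f x ^ 2) x - 2 * c * moll n f x + c ^ 2 := by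
    have e : ∀ y, rho n (x - y) * (f y - c) ^ 2 =
        rho n (x - y) * f y ^ 2 - (2 * c) * (rho n (x - y) * f y) + rho n (x - y) * c ^ 2 := by
      intro y; ring
    simp only [e]
    rw [integral_add, integral_sub, integral_const_mul, integral_mul_const, integral_rho_sub,
      one_mul]
    · rfl
    · exact integrable_rho_mul n x hf2
    · exact (integrable_rho_mul n x hf).const_mul _
    · exact (integrable_rho_mul n x hf2).sub ((integrable_rho_mul n x hf).const_mul _)
    · exact integrable_rho_mul n x (locallyIntegrable_const _)
  rw [h1, ← hc] at h0
  nlinarith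

theorem _root_.MeasureTheory.MemLp.locallyIntegrable_two {f : Space N → ℝ} (hf : MemLp f 2) :
    LocallyIntegrable f := hf.locallyIntegrable (by norm_num)

theorem integrable_rho (n : ℕ) : Integrable (rho (N := N) n) :=
  (isTest_rho n).continuous.integrable_of_hasCompactSupport (isTest_rho n).2

theorem eLpNorm_two_eq {f : Space N → ℝ} (hf : MemLp f 2) :
    eLpNorm f 2 volume = ENNReal.ofReal (Real.sqrt (∫ x, f x ^ 2)) := by
  rw [hf.eLpNorm_eq_integral_rpow_norm (by norm_num) (by norm_num), Real.sqrt_eq_rpow]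
  simp

theorem memLp_moll (n : ℕ) {f : Space N → ℝ} (hf : MemLp f 2) : MemLp (moll n f) 2 := by
  have hi : Integrable (fun x => f x ^ 2) := hf.integrable_sq
  have hm : Integrable (moll n fun x => f x ^ 2) := by
    rw [moll_eq_convolution]
    exact (integrable_rho n).integrable_convolution _ hi
  have hc := (contDiff_moll n hf.locallyIntegrable_two).continuous
  rw [memLp_two_iff_integrable_sq hc.aestronglyMeasurable]
  refine hm.mono' (hc.pow 2).aestronglyMeasurable (Eventually.of_forall fun x => ?_)
  rw [Real.norm_of_nonneg (sq_nonneg _)]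
  exact moll_sq_le n hf.locallyIntegrable_two hi.locallyIntegrable x

theorem eLpNorm_moll_le (n : ℕ) {f : Space N → ℝ} (hf : MemLp f 2) :
    eLpNorm (moll n f) 2 volume ≤ eLpNorm f 2 volume := by
  have hi : Integrable (fun x => f x ^ 2) := hf.integrable_sq
  rw [eLpNorm_two_eq hf, eLpNorm_two_eq (memLp_moll n hf)]
  refine ENNReal.ofReal_le_ofReal (Real.sqrt_le_sqrt ?_)
  have hm : Integrable (moll n fun x => f x ^ 2) := by
    rw [moll_eq_convolution]
    exact (integrable_rho n).integrable_convolution _ hi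
  calc ∫ x, moll n f x ^ 2 ≤ ∫ x, moll n (fun x => f x ^ 2) x :=
        integral_mono (memLp_moll n hf).integrable_sq hm fun x =>
          moll_sq_le n hf.locallyIntegrable_two hi.locallyIntegrable x
    _ = ∫ x, f x ^ 2 := by
        rw [moll_eq_convolution, integral_convolution _ (integrable_rho n) hi, integral_rho]
        simp

/-- The bound depends on n. It is used qualitatively, to make integrals converge and to
differentiate under the integral sign; it never enters a final constant. -/
theorem exists_abs_moll_le (n : ℕ) {f : Space N → ℝ} (hf : MemLp f 2) :
    ∃ M, ∀ x, |moll n f x| ≤ M := by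
  obtain ⟨R, hR⟩ := (isTest_rho (N := N) n).continuous.bounded_above_of_compact_support
    (isTest_rho n).2
  have hi : Integrable (fun x => f x ^ 2) := hf.integrable_sq
  refine ⟨1 + R * ∫ x, f x ^ 2, fun x => ?_⟩
  have h1 := moll_sq_le n hf.locallyIntegrable_two hi.locallyIntegrable x
  have h2 : moll n (fun x => f x ^ 2) x ≤ R * ∫ x, f x ^ 2 := by
    rw [← integral_const_mul]
    refine integral_mono (integrable_rho_mul n x hi.locallyIntegrable) (hi.const_mul R) fun y => ?_
    exact mul_le_mul_of_nonneg_right ((le_abs_self _).trans (hR _)) (sq_nonneg _)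
  have h3 := sq_nonneg (|moll n f x| - 1)
  nlinarith [sq_abs (moll n f x), abs_nonneg (moll n f x)]

theorem tendsto_eLpNorm_moll_sub_of_continuous {f : Space N → ℝ} (hf : Continuous f)
    (hs : HasCompactSupport f) :
    Tendsto (fun n => eLpNorm (fun x => moll n f x - f x) 2 volume) atTop (𝓝 0) := by
  obtain ⟨M, hM⟩ := hf.bounded_above_of_compact_support hs
  obtain ⟨R, hR⟩ := hs.isCompact.isBounded.subset_closedBall 0
  have hf2 : MemLp f 2 := hf.memLp_of_hasCompactSupport hs
  have hM0 : 0 ≤ M := (norm_nonneg _).trans (hM 0)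
  have hmem : ∀ n, MemLp (fun x => moll n f x - f x) 2 := fun n => (memLp_moll n hf2).sub hf2
  -- The kernels live in the ball of radius 2, so all mollifications vanish outside the ball of
  -- radius R + 2, which supplies the dominating function.
  have hsupp : ∀ n x, x ∉ Metric.closedBall (0 : Space N) (R + 2) → moll n f x - f x = 0 := by
    intro n x hx
    rw [mem_closedBall_zero_iff, not_le] at hx
    have h0 : ∀ y, f y ≠ 0 → ‖y‖ ≤ R := fun y hy => by
      simpa using hR (subset_tsupport f hy)
    have h1 : f x = 0 := by
      by_contra hc
      linarith [h0 x hc]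
    have h2 : moll n f x = 0 := by
      refine integral_eq_zero_of_ae (Eventually.of_forall fun y => ?_)
      simp only [Pi.zero_apply, mul_eq_zero]
      by_contra! hc
      have a1 := norm_lt_of_rho_ne_zero hc.1
      have a2 := h0 y hc.2
      have a3 := norm_sub_norm_le x y
      linarith
    rw [h1, h2, sub_zero]
  have key : Tendsto (fun n => ∫ x, (moll n f x - f x) ^ 2) atTop (𝓝 (∫ _ : Space N, (0 : ℝ))) := by
    refine tendsto_integral_of_dominated_convergence
      ((Metric.closedBall (0 : Space N) (R + 2)).indicator fun _ => (2 * M) ^ 2)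
      (fun n => (hmem n).1.pow 2) ?_ (fun n => Eventually.of_forall fun x => ?_)
      (Eventually.of_forall fun x => ?_)
    · exact (integrable_indicator_iff measurableSet_closedBall).2
        (integrableOn_const (by exact measure_closedBall_lt_top.ne))
    · by_cases hx : x ∈ Metric.closedBall (0 : Space N) (R + 2)
      · rw [indicator_of_mem hx, Real.norm_of_nonneg (sq_nonneg _)]
        have h1 := abs_moll_le n (Eventually.of_forall hM) x
        have h2 := abs_sub (moll n f x) (f x)
        have h3 := hM x
        rw [Real.norm_eq_abs] at h3
        rw [← sq_abs]
        gcongr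
        linarith
      · rw [indicator_of_notMem hx, hsupp n x hx]; simp
    · have := ((tendsto_moll_of_continuous hf x).sub_const (f x)).pow 2
      simpa using this
  simp only [fun n => eLpNorm_two_eq (hmem n)]
  rw [integral_zero] at key
  have := (ENNReal.continuous_ofReal.comp Real.continuous_sqrt).tendsto 0
  simp only [Function.comp_apply, Real.sqrt_zero, ENNReal.ofReal_zero] at this
  exact this.comp key

/-- An ε/3 argument: compactly supported continuous functions are dense in L², and mollification is
a contraction there. -/
theorem tendsto_eLpNorm_moll_sub {f : Space N → ℝ} (hf : MemLp f 2) :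
    Tendsto (fun n => eLpNorm (fun x => moll n f x - f x) 2 volume) atTop (𝓝 0) := by
  rw [ENNReal.tendsto_nhds_zero]
  intro ε hε
  have hε3 : ε / 3 ≠ 0 := (ENNReal.div_pos hε.ne' (by norm_num)).ne'
  obtain ⟨g, hgs, hgf, hgc, hg2⟩ := hf.exists_hasCompactSupport_eLpNorm_sub_le (by norm_num) hε3
  have h1 := (ENNReal.tendsto_nhds_zero.1 (tendsto_eLpNorm_moll_sub_of_continuous hgc hgs)) (ε / 3)
    (pos_iff_ne_zero.2 hε3)
  filter_upwards [h1] with n hn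
  have hd : MemLp (fun x => f x - g x) 2 := hf.sub hg2
  have e : (fun x => moll n f x - f x) = (fun x => moll n (fun x => f x - g x) x) +
      ((fun x => moll n g x - g x) + (fun x => g x - f x)) := by
    ext x
    simp only [Pi.add_apply, moll_sub n hf.locallyIntegrable_two hg2.locallyIntegrable_two]
    ring
  rw [e]
  have m1 := (memLp_moll n hd).1
  have m2 : MemLp (fun x => moll n g x - g x) 2 := (memLp_moll n hg2).sub hg2
  have m3 : MemLp (fun x => g x - f x) 2 := hg2.sub hf
  have a1 := eLpNorm_add_le m1 (m2.1.add m3.1) (p := 2) (μ := volume) (by norm_num)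
  have a2 := eLpNorm_add_le m2.1 m3.1 (p := 2) (μ := volume) (by norm_num)
  have a3 : eLpNorm (fun x => g x - f x) 2 volume ≤ ε / 3 := by
    have := eLpNorm_sub_comm g f 2 volume
    exact this.trans_le hgf
  have a4 := (eLpNorm_moll_le n hd).trans hgf
  calc _ ≤ _ := a1
    _ ≤ ε / 3 + (ε / 3 + ε / 3) := add_le_add a4 (a2.trans (add_le_add hn a3))
    _ = ε := by rw [← add_assoc]; exact ENNReal.add_thirds ε

end Mollifier

end LandauLifshitz
namespace LandauLifshitz

/-! ### Product rule, integration by parts and the Leibniz formula. -/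

section Leibniz

variable {N : ℕ}

/-- Local square integrability. -/
structure L2loc (f : Space N → ℝ) : Prop where
  locallyIntegrable : LocallyIntegrable f
  sq : LocallyIntegrable fun x => f x ^ 2

theorem locallyIntegrable_of_abs_le {f g : Space N → ℝ} (hg : LocallyIntegrable g)
    (hf : AEStronglyMeasurable f) (h : ∀ᵐ x, |f x| ≤ g x) : LocallyIntegrable f :=
  hg.mono hf (h.mono fun x hx => by
    rw [Real.norm_eq_abs, Real.norm_eq_abs]; exact hx.trans (le_abs_self _))

theorem _root_.MeasureTheory.MemLp.l2loc {f : Space N → ℝ} (hf : MemLp f 2) : L2loc f :=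
  ⟨hf.locallyIntegrable_two, hf.integrable_sq.locallyIntegrable⟩

theorem _root_.MeasureTheory.MemLp.ae_abs_le {f : Space N → ℝ} (hf : MemLp f ∞) :
    ∀ᵐ x, |f x| ≤ (eLpNorm f ∞ volume).toReal := by
  filter_upwards [ae_le_eLpNormEssSup (f := f) (μ := volume)] with x hx
  rw [← eLpNorm_exponent_top] at hx
  have := ENNReal.toReal_mono hf.2.ne hx
  simpa using this

theorem _root_.MeasureTheory.MemLp.l2loc_top {f : Space N → ℝ} (hf : MemLp f ∞) : L2loc f := by
  have h := hf.ae_abs_le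
  refine ⟨locallyIntegrable_of_abs_le (locallyIntegrable_const _) hf.1 h,
    locallyIntegrable_of_abs_le
      (locallyIntegrable_const ((eLpNorm f ∞ volume).toReal ^ 2)) (hf.1.pow 2)
      (h.mono fun x hx => ?_)⟩
  rw [abs_of_nonneg (sq_nonneg _), ← sq_abs]
  gcongr

namespace L2loc

variable {f g : Space N → ℝ}

theorem aestronglyMeasurable (hf : L2loc f) : AEStronglyMeasurable f :=
  hf.1.aestronglyMeasurable

theorem congr (hf : L2loc f) (h : f =ᵐ[volume] g) : L2loc g :=
  ⟨hf.1.congr h, hf.2.congr (h.mono fun x hx => by simp [hx])⟩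

theorem mul (hf : L2loc f) (hg : L2loc g) : LocallyIntegrable fun x => f x * g x := by
  refine locallyIntegrable_of_abs_le (hf.2.add hg.2)
    (hf.aestronglyMeasurable.mul hg.aestronglyMeasurable) (Eventually.of_forall fun x => ?_)
  simp only [Pi.add_apply]
  rw [abs_le]
  constructor <;> nlinarith [sq_nonneg (f x + g x), sq_nonneg (f x - g x)]

theorem const_mul (hf : L2loc f) (c : ℝ) : L2loc fun x => c * f x := by
  refine ⟨hf.1.smul c, (hf.2.smul (c ^ 2)).congr (Eventually.of_forall fun x => ?_)⟩
  simp only [Pi.smul_apply, smul_eq_mul]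
  ring

theorem test_mul (hf : L2loc f) {φ : Space N → ℝ} (hφ : IsTest φ) :
    MemLp (fun x => φ x * f x) 2 := by
  have hm : AEStronglyMeasurable (fun x => φ x * f x) :=
    hφ.continuous.aestronglyMeasurable.mul hf.aestronglyMeasurable
  rw [memLp_two_iff_integrable_sq hm]
  have h2 : IsTest (fun x => φ x * φ x) := ⟨hφ.1.mul hφ.1, hφ.2.mul_right⟩
  refine (h2.integrable_smul hf.2).congr (Eventually.of_forall fun x => ?_)
  simp only [smul_eq_mul]
  ring

theorem indicator_closedBall (hf : L2loc f) (R : ℝ) :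
    MemLp ((Metric.closedBall (0 : Space N) R).indicator f) 2 := by
  rw [memLp_two_iff_integrable_sq (hf.aestronglyMeasurable.indicator measurableSet_closedBall)]
  have : (fun x => (Metric.closedBall (0 : Space N) R).indicator f x ^ 2) =
      (Metric.closedBall (0 : Space N) R).indicator fun x => f x ^ 2 := by
    ext x
    by_cases hx : x ∈ Metric.closedBall (0 : Space N) R <;> simp [hx, indicator]
  rw [this, integrable_indicator_iff measurableSet_closedBall]
  exact hf.2.integrableOn_isCompact (isCompact_closedBall _ _)

end L2loc

theorem integral_mul_le_sqrt {f g : Space N → ℝ} (hf : MemLp f 2) (hg : MemLp g 2) :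
    |∫ x, f x * g x| ≤ (eLpNorm f 2 volume).toReal * (eLpNorm g 2 volume).toReal := by
  have h := abs_real_inner_le_norm (hf.toLp f) (hg.toLp g)
  rw [L2.inner_def, Lp.norm_toLp, Lp.norm_toLp] at h
  have e : ∫ x, inner ℝ (hf.toLp f x) (hg.toLp g x) = ∫ x, f x * g x := by
    refine integral_congr_ae ?_
    filter_upwards [hf.coeFn_toLp, hg.coeFn_toLp] with x h1 h2
    rw [h1, h2]
    simp [mul_comm]
  rwa [e] at h

theorem tendsto_integral_test_moll {f g φ : Space N → ℝ} (hf : L2loc f) (hg : L2loc g)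
    (hφ : IsTest φ) :
    Tendsto (fun n => ∫ x, φ x * (moll n f x * g x)) atTop (𝓝 (∫ x, φ x * (f x * g x))) := by
  obtain ⟨R, hR⟩ := hφ.2.isCompact.isBounded.subset_closedBall 0
  -- On the support of φ the mollification only sees f within distance 2, so f may be cut off at
  -- radius R + 2 and the convergence in L² applies.
  set F := (Metric.closedBall (0 : Space N) (R + 2)).indicator f with hF
  have hF2 : MemLp F 2 := hf.indicator_closedBall _
  have hG2 : MemLp (fun x => φ x * g x) 2 := hg.test_mul hφ
  have hsupp : ∀ x, φ x ≠ 0 → ‖x‖ ≤ R := fun x hx => by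
    simpa using hR (subset_tsupport φ hx)
  have e1 : ∀ n x, φ x * (moll n f x * g x) = moll n F x * (φ x * g x) := by
    intro n x
    by_cases hx : φ x = 0
    · simp [hx]
    have : moll n f x = moll n F x := by
      refine integral_congr_ae (Eventually.of_forall fun y => ?_)
      by_cases hy : rho n (x - y) = 0
      · simp [hy]
      have h1 := norm_lt_of_rho_ne_zero hy
      have h2 : ‖y‖ ≤ ‖x‖ + ‖x - y‖ := by
        have := norm_sub_le x (x - y)
        simpa using this
      have h3 : y ∈ Metric.closedBall (0 : Space N) (R + 2) := by
        rw [mem_closedBall_zero_iff]; linarith [hsupp x hx]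
      simp [hF, h3]
    rw [this]; ring
  have e2 : ∀ x, φ x * (f x * g x) = F x * (φ x * g x) := by
    intro x
    by_cases hx : φ x = 0
    · simp [hx]
    have h3 : x ∈ Metric.closedBall (0 : Space N) (R + 2) := by
      rw [mem_closedBall_zero_iff]; linarith [hsupp x hx]
    simp [hF, h3]; ring
  simp only [e1, e2]
  rw [tendsto_iff_dist_tendsto_zero]
  have hb : ∀ n, dist (∫ x, moll n F x * (φ x * g x)) (∫ x, F x * (φ x * g x)) ≤
      (eLpNorm (fun x => moll n F x - F x) 2 volume).toReal *
        (eLpNorm (fun x => φ x * g x) 2 volume).toReal := by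
    intro n
    have i1 : Integrable fun x => moll n F x * (φ x * g x) :=
      (memLp_moll n hF2).integrable_mul hG2
    have i2 : Integrable fun x => F x * (φ x * g x) := hF2.integrable_mul hG2
    rw [Real.dist_eq, ← integral_sub i1 i2]
    simp only [← sub_mul]
    exact integral_mul_le_sqrt ((memLp_moll n hF2).sub hF2) hG2
  refine squeeze_zero (fun _ => dist_nonneg) hb ?_
  have := ((ENNReal.tendsto_toReal ENNReal.zero_ne_top).comp (tendsto_eLpNorm_moll_sub hF2)).mul_const
    (eLpNorm (fun x => φ x * g x) 2 volume).toReal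
  simpa using this

theorem partialDeriv_mul {φ ψ : Space N → ℝ} (hφ : ContDiff ℝ ∞ φ) (hψ : ContDiff ℝ ∞ ψ)
    (i : Fin N) (x : Space N) : partialDeriv i (fun x => φ x * ψ x) x =
      partialDeriv i φ x * ψ x + φ x * partialDeriv i ψ x := by
  unfold partialDeriv
  rw [fderiv_fun_mul (hφ.differentiable (by simp) x) (hψ.differentiable (by simp) x)]
  simp
  ring

/-- The product rule for weak derivatives of locally square integrable functions. -/
theorem HasWeakDeriv.mul {i : Fin N} {f f' g g' : Space N → ℝ}
    (h1 : HasWeakDeriv (Pi.single i 1) f f') (h2 : HasWeakDeriv (Pi.single i 1) g g')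
    (hf : L2loc f) (hf' : L2loc f') (hg : L2loc g) (hg' : L2loc g') :
    HasWeakDeriv (Pi.single i 1) (fun x => f x * g x) (fun x => f' x * g x + f x * g' x) := by
  refine ⟨hf.mul hg, (hf'.mul hg).add (hf.mul hg'), fun φ hφ => ?_⟩
  rw [multiDeriv_single i hφ.1]
  simp only [smul_eq_mul, length_single, pow_one, neg_mul, one_mul]
  -- Only f is mollified: φ times the mollified f is then an admissible test function for the weak
  -- derivative of g. The limit in n is taken afterwards.
  have hmain : ∀ n, ∫ x, partialDeriv i φ x * (moll n f x * g x) =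
      -(∫ x, φ x * (moll n f' x * g x)) - ∫ x, φ x * (moll n f x * g' x) := by
    intro n
    have hs := contDiff_moll n h1.1
    have hs' := contDiff_moll n h1.2
    have ht : IsTest (fun x => φ x * moll n f x) := ⟨hφ.1.mul hs, hφ.2.mul_right⟩
    have ht1 : IsTest (fun x => φ x * moll n f' x) := ⟨hφ.1.mul hs', hφ.2.mul_right⟩
    have ht2 : IsTest (fun x => partialDeriv i φ x * moll n f x) :=
      ⟨(hφ.partialDeriv i).1.mul hs, (hφ.partialDeriv i).2.mul_right⟩
    have := h2.3 _ ht
    rw [multiDeriv_single i ht.1] at this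
    simp only [partialDeriv_mul hφ.1 hs, partialDeriv_moll n h1, smul_eq_mul, length_single,
      pow_one, neg_mul, one_mul, add_mul] at this
    have i1 : Integrable fun x => partialDeriv i φ x * moll n f x * g x := ht2.integrable_smul hg.1
    have i2 : Integrable fun x => φ x * moll n f' x * g x := ht1.integrable_smul hg.1
    rw [integral_add i1 i2] at this
    simp only [← mul_assoc]
    linarith
  have l1 := tendsto_integral_test_moll hf hg (hφ.partialDeriv i)
  have l2 := (tendsto_integral_test_moll hf' hg hφ).neg.sub (tendsto_integral_test_moll hf hg' hφ)
  simp only [hmain] at l1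
  rw [tendsto_nhds_unique l1 l2]
  simp only [mul_add]
  have i1 : Integrable fun x => φ x * (f' x * g x) := hφ.integrable_smul (hf'.mul hg)
  have i2 : Integrable fun x => φ x * (f x * g' x) := hφ.integrable_smul (hf.mul hg')
  rw [integral_add i1 i2]
  ring

/-- The integral of a weak partial derivative vanishes. -/
theorem HasWeakDeriv.integral_eq_zero {i : Fin N} {f g : Space N → ℝ}
    (h : HasWeakDeriv (Pi.single i 1) f g) (hf : Integrable f) (hg : Integrable g) :
    ∫ x, g x = 0 := by
  set b : ContDiffBump (0 : Space N) := bump N 0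
  have hb : IsTest b := ⟨b.contDiff, b.hasCompactSupport⟩
  have hb0 : b (0 : Space N) = 1 := b.one_of_mem_closedBall (by simp [b.rIn_pos.le])
  obtain ⟨M, hM⟩ := (hb.partialDeriv i).continuous.bounded_above_of_compact_support
    (hb.partialDeriv i).2
  set r : ℕ → ℝ := fun n => 1 / ((n : ℝ) + 1) with hr
  have hr0 : ∀ n, 0 < r n := fun n => by positivity
  have hrl : Tendsto r atTop (𝓝 0) := tendsto_one_div_add_atTop_nhds_zero_nat
  -- Dilated cutoffs: they tend to 1 pointwise while their gradients are O(r n), so the boundary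
  -- term vanishes in the limit for integrable f.
  set χ : ℕ → Space N → ℝ := fun n x => b (r n • x) with hχ
  have hχt : ∀ n, IsTest (χ n) := fun n =>
    ⟨hb.1.comp (contDiff_const_smul (r n)),
      hb.2.comp_homeomorph (Homeomorph.smulOfNeZero (r n) (hr0 n).ne')⟩
  have hd : ∀ n x, partialDeriv i (χ n) x = r n * partialDeriv i b (r n • x) := by
    intro n x
    have h1 : HasFDerivAt b (fderiv ℝ b (r n • x)) (r n • x) :=
      (hb.1.differentiable (by simp) _).hasFDerivAt
    have h2 := h1.comp x ((hasFDerivAt_id x).const_smul (r n))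
    have e : fderiv ℝ (χ n) x = _ := h2.fderiv
    simp [partialDeriv, e]
  have key : ∀ n, ∫ x, χ n x * g x = -∫ x, partialDeriv i (χ n) x * f x := by
    intro n
    have := h.3 _ (hχt n)
    rw [multiDeriv_single i (hχt n).1] at this
    simp only [smul_eq_mul, length_single, pow_one, neg_mul, one_mul] at this
    linarith
  have l1 : Tendsto (fun n => ∫ x, χ n x * g x) atTop (𝓝 (∫ x, g x)) := by
    refine tendsto_integral_of_dominated_convergence (fun x => ‖g x‖)
      (fun n => (hχt n).continuous.aestronglyMeasurable.mul hg.1) hg.norm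
      (fun n => Eventually.of_forall fun x => ?_) (Eventually.of_forall fun x => ?_)
    · rw [norm_mul, Real.norm_of_nonneg (b.nonneg)]
      exact mul_le_of_le_one_left (norm_nonneg _) b.le_one
    · have : Tendsto (fun n => χ n x) atTop (𝓝 1) := by
        rw [← hb0]
        refine (hb.continuous.tendsto 0).comp ?_
        simpa using hrl.smul_const x
      simpa using this.mul_const (g x)
  have l2 : Tendsto (fun n => ∫ x, χ n x * g x) atTop (𝓝 0) := by
    refine squeeze_zero_norm (a := fun n => r n * (M * ∫ x, ‖f x‖)) (fun n => ?_) ?_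
    · rw [key, norm_neg, ← integral_const_mul, ← integral_const_mul]
      refine norm_integral_le_of_norm_le ((hf.norm.const_mul M).const_mul _)
        (Eventually.of_forall fun x => ?_)
      rw [hd, norm_mul, norm_mul, Real.norm_of_nonneg (hr0 n).le, mul_assoc]
      have := hM (r n • x)
      have h0 := (hr0 n).le
      gcongr
    · simpa using hrl.mul_const (M * ∫ x, ‖f x‖)
  exact tendsto_nhds_unique l1 l2

/-- Integration by parts for square integrable functions. -/
theorem HasWeakDeriv.integral_mul {i : Fin N} {f f' g g' : Space N → ℝ}
    (h1 : HasWeakDeriv (Pi.single i 1) f f') (h2 : HasWeakDeriv (Pi.single i 1) g g')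
    (hf : MemLp f 2) (hf' : MemLp f' 2) (hg : MemLp g 2) (hg' : MemLp g' 2) :
    ∫ x, f' x * g x = -∫ x, f x * g' x := by
  have h := h1.mul h2 hf.l2loc hf'.l2loc hg.l2loc hg'.l2loc
  have i1 : Integrable fun x => f' x * g x := hf'.integrable_mul hg
  have i2 : Integrable fun x => f x * g' x := hf.integrable_mul hg'
  have := h.integral_eq_zero (hf.integrable_mul hg) (i1.add i2)
  rw [integral_add i1 i2] at this
  linarith

/-- Functions with locally square integrable weak derivatives up to order `s`. -/
def LocH (s : ℕ) (f : Space N → ℝ) : Prop :=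
  ∀ α : Fin N → ℕ, length α ≤ s → ∃ g, HasWeakDeriv α f g ∧ L2loc g

namespace LocH

variable {s : ℕ} {f g : Space N → ℝ}

theorem mono {s' : ℕ} (hf : LocH s f) (h : s' ≤ s) : LocH s' f := fun α hα => hf α (hα.trans h)

theorem hasWeakDeriv (hf : LocH s f) {α : Fin N → ℕ} (hα : length α ≤ s) :
    HasWeakDeriv α f (weakDeriv α f) := by
  obtain ⟨g, hg, -⟩ := hf α hα
  exact hg.weakDeriv

theorem l2loc_weakDeriv (hf : LocH s f) {α : Fin N → ℕ} (hα : length α ≤ s) :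
    L2loc (LandauLifshitz.weakDeriv α f) := by
  obtain ⟨g, hg, h2⟩ := hf α hα
  exact h2.congr hg.weakDeriv_ae_eq.symm

theorem l2loc (hf : LocH s f) : L2loc f := by
  have h := hf.l2loc_weakDeriv (α := 0) (by simp)
  exact h.congr (weakDeriv_zero_ae_eq (hf.hasWeakDeriv (α := 0) (by simp)).1)

theorem hasWeakDeriv_weakDeriv (hf : LocH s f) {α β : Fin N → ℕ}
    (h : length α + length β ≤ s) :
    HasWeakDeriv β (weakDeriv α f) (weakDeriv (α + β) f) :=
  (hf.hasWeakDeriv (α := α) (by omega)).of_add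
    (hf.hasWeakDeriv (α := α + β) (by rw [length_add]; exact h))

theorem weakDeriv_weakDeriv (hf : LocH s f) {α β : Fin N → ℕ}
    (h : length α + length β ≤ s) :
    LandauLifshitz.weakDeriv β (weakDeriv α f) =ᵐ[volume] LandauLifshitz.weakDeriv (α + β) f :=
  (hf.hasWeakDeriv_weakDeriv h).weakDeriv_ae_eq

theorem of_weakDeriv (hf : LocH s f) {α : Fin N → ℕ} {r : ℕ} (h : length α + r ≤ s) :
    LocH r (weakDeriv α f) := fun β hβ =>
  ⟨_, hf.hasWeakDeriv_weakDeriv (by omega),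
    hf.l2loc_weakDeriv (by rw [length_add]; omega)⟩

end LocH

/-- The Leibniz formula. -/
theorem exists_leibniz (α : Fin N → ℕ) : ∃ c : (Fin N → ℕ) → ℝ, c 0 = 1 ∧
    ∀ f g : Space N → ℝ, LocH (length α) f → LocH (length α) g →
      HasWeakDeriv α (fun x => f x * g x)
        (fun x => ∑ β ∈ Finset.Iic α, c β * (weakDeriv β f x * weakDeriv (α - β) g x)) := by
  classical
  induction α using multiIndex_induction with
  | zero =>
    refine ⟨fun _ => 1, rfl, fun f g hf hg => ?_⟩
    have h := HasWeakDeriv.zero_index (hf.l2loc.mul hg.l2loc)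
    refine h.congr (ae_eq_refl _) ?_
    filter_upwards [weakDeriv_zero_ae_eq hf.l2loc.1, weakDeriv_zero_ae_eq hg.l2loc.1] with x h1 h2
    have : Finset.Iic (0 : Fin N → ℕ) = {0} := by
      ext β; simp
    simp [this, h1, h2]
  | add_single α i ih =>
    obtain ⟨c, hc0, hc⟩ := ih
    set I := (Finset.Iic α).image (fun β => β + (Pi.single i 1 : Fin N → ℕ)) with hI
    -- Pascal's recursion: the derivative ∂_i falls on the first factor (shifted index set I) or on
    -- the second. Of the coefficients only the one at β = 0 is recorded; the others will enter
    -- through the sum of their absolute values.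
    refine ⟨fun β => (if β ∈ I then c (β - Pi.single i 1) else 0) +
      (if β ∈ Finset.Iic α then c β else 0), ?_, fun f g hf hg => ?_⟩
    · have h0 : (0 : Fin N → ℕ) ∉ I := by
        rw [hI, Finset.mem_image]
        rintro ⟨β, -, hβ⟩
        have := congrFun hβ i
        simp at this
      simp [h0, hc0]
    · rw [length_add, length_single] at hf hg
      have h1 := hc f g (hf.mono (by omega)) (hg.mono (by omega))
      have h2 : ∀ β ∈ Finset.Iic α, HasWeakDeriv (Pi.single i 1)
          (fun x => c β * (weakDeriv β f x * weakDeriv (α - β) g x))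
          (fun x => c β * (weakDeriv (β + Pi.single i 1) f x * weakDeriv (α - β) g x
            + weakDeriv β f x * weakDeriv (α - β + Pi.single i 1) g x)) := by
        intro β hβ
        have hβ' := Finset.mem_Iic.1 hβ
        have l1 := length_mono hβ'
        have l2 : length (α - β) ≤ length α := length_mono tsub_le_self
        refine ((hf.hasWeakDeriv_weakDeriv (by rw [length_single]; omega)).mul
          (hg.hasWeakDeriv_weakDeriv (by rw [length_single]; omega))
          (hf.l2loc_weakDeriv (by omega)) (hf.l2loc_weakDeriv ?_)
          (hg.l2loc_weakDeriv (by omega)) (hg.l2loc_weakDeriv ?_)).const_mul (c β)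
        · rw [length_add, length_single]; omega
        · rw [length_add, length_single]; omega
      refine (h1.trans (HasWeakDeriv.sum _ h2)).congr (ae_eq_refl _) (Eventually.of_forall ?_)
      intro x
      simp only [add_mul, mul_add, Finset.sum_add_distrib, ite_mul, zero_mul]
      congr 1
      · rw [← Finset.sum_filter]
        have : (Finset.Iic (α + Pi.single i 1)).filter (fun β => β ∈ I) = I := by
          ext β
          simp only [Finset.mem_filter, Finset.mem_Iic, and_iff_right_iff_imp]
          intro hβ
          obtain ⟨γ, hγ, rfl⟩ := Finset.mem_image.1 hβ
          have := Finset.mem_Iic.1 hγ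
          gcongr
        rw [this, hI, Finset.sum_image (fun a _ b _ hab => add_right_cancel hab)]
        refine Finset.sum_congr rfl fun β _ => ?_
        rw [add_tsub_cancel_right, add_tsub_add_eq_tsub_right]
      · rw [← Finset.sum_filter]
        have : (Finset.Iic (α + Pi.single i 1)).filter (fun β => β ∈ Finset.Iic α) =
            Finset.Iic α := by
          ext β
          simp only [Finset.mem_filter, Finset.mem_Iic, and_iff_right_iff_imp]
          intro hβ
          exact hβ.trans le_self_add
        rw [this]
        refine Finset.sum_congr rfl fun β hβ => ?_
        rw [tsub_add_eq_add_tsub (Finset.mem_Iic.1 hβ)]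

end Leibniz

end LandauLifshitz
namespace LandauLifshitz

/-! ### One step of interpolation, and logarithmically convex sequences. -/

section Interpolation

variable {N : ℕ}

theorem hasDerivAt_abs_rpow_mul {q : ℝ} (hq : 0 < q) (x : ℝ) :
    HasDerivAt (fun x : ℝ => |x| ^ q * x) ((q + 1) * |x| ^ q) x := by
  rcases eq_or_ne x 0 with rfl | hx
  · rw [hasDerivAt_iff_tendsto_slope]
    have h1 : Tendsto (fun y : ℝ => |y| ^ q) (𝓝[≠] 0) (𝓝 ((q + 1) * |0| ^ q)) := by
      have : Continuous fun y : ℝ => |y| ^ q := continuous_abs.rpow_const fun _ => Or.inr hq.le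
      have h2 := this.tendsto 0
      simp only [abs_zero, Real.zero_rpow hq.ne', mul_zero] at h2 ⊢
      exact h2.mono_left nhdsWithin_le_nhds
    refine h1.congr' ?_
    filter_upwards [self_mem_nhdsWithin] with y hy
    have hy : y ≠ 0 := hy
    simp [slope_def_field, hy]
  · have h1 : HasDerivAt (fun x : ℝ => |x| ^ q) (SignType.sign x * q * |x| ^ (q - 1)) x := by
      have := (hasDerivAt_abs hx).rpow_const (p := q) (Or.inl (abs_ne_zero.2 hx))
      simpa using this
    refine (h1.mul (hasDerivAt_id x)).congr_deriv ?_
    have h2 : |x| ^ q = |x| ^ (q - 1) * |x| := by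
      rw [← Real.rpow_add_one (abs_ne_zero.2 hx)]; simp
    have h3 : (SignType.sign x : ℝ) * x = |x| := sign_mul_self x
    simp only [id]
    calc (SignType.sign x : ℝ) * q * |x| ^ (q - 1) * x + |x| ^ q * 1
        = q * (|x| ^ (q - 1) * (SignType.sign x * x)) + |x| ^ q := by ring
      _ = (q + 1) * |x| ^ q := by rw [h3, ← h2]; ring

theorem memLp_of_bounded {v : Space N → ℝ} (hv : MemLp v 2) {M : ℝ} (hM : ∀ x, |v x| ≤ M)
    {p : ℝ} (hp : 2 ≤ p) : Integrable (fun x => |v x| ^ p) := by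
  have hM0 : 0 ≤ M := (abs_nonneg _).trans (hM 0)
  have hm : AEStronglyMeasurable (fun x => |v x| ^ p) :=
    (hv.1.aemeasurable.abs.pow_const p).aestronglyMeasurable
  refine (hv.integrable_sq.const_mul (M ^ (p - 2))).mono' hm (Eventually.of_forall fun x => ?_)
  rw [Real.norm_of_nonneg (by positivity)]
  rcases eq_or_ne (v x) 0 with h0 | h0
  · rw [h0, abs_zero, Real.zero_rpow (by linarith)]; simp
  have h1 : |v x| ^ p = |v x| ^ (p - 2) * v x ^ 2 := by
    rw [← sq_abs (v x), ← Real.rpow_natCast, ← Real.rpow_add (abs_pos.2 h0)]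
    norm_num
  rw [h1]
  have := Real.rpow_le_rpow (abs_nonneg _) (hM x) (by linarith : 0 ≤ p - 2)
  exact mul_le_mul_of_nonneg_right this (sq_nonneg _)

/-- One step of the Gagliardo-Nirenberg interpolation. -/
theorem eLpNorm_partialDeriv_sq_le {i : Fin N} {u v z : Space N → ℝ} (hu : ContDiff ℝ ∞ u)
    (hv : ContDiff ℝ ∞ v) (huv : partialDeriv i u = v) (hvz : partialDeriv i v = z)
    {p : ℝ} (hp : 2 < p) (q₁ q₂ : ℝ≥0∞) [ENNReal.HolderTriple q₁ q₂ (ENNReal.ofReal (p / 2))]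
    (hv2 : MemLp v 2) {M : ℝ} (hM : ∀ x, |v x| ≤ M)
    (h1 : Integrable fun x => |v x| ^ (p - 2) * v x * u x)
    (h2 : Integrable fun x => |v x| ^ (p - 2) * z x * u x) :
    eLpNorm v (ENNReal.ofReal p) volume ^ 2 ≤
      ENNReal.ofReal (p - 1) * (eLpNorm u q₁ volume * eLpNorm z q₂ volume) := by
  have hz : ContDiff ℝ ∞ z := hvz ▸ hv.partialDeriv i
  have hA := memLp_of_bounded hv2 hM hp.le
  set A : ℝ≥0∞ := ∫⁻ x, ‖v x‖ₑ ^ p with hAdef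
  have hAeq : A = ENNReal.ofReal (∫ x, |v x| ^ p) := by
    rw [ofReal_integral_eq_lintegral_ofReal hA (Eventually.of_forall fun x => by positivity)]
    refine lintegral_congr fun x => ?_
    rw [← ENNReal.ofReal_rpow_of_nonneg (abs_nonneg _) (by linarith), Real.enorm_eq_ofReal_abs]
  have hAtop : A ≠ ⊤ := by rw [hAeq]; exact ENNReal.ofReal_ne_top
  have hnorm : eLpNorm v (ENNReal.ofReal p) volume = A ^ (1 / p) := by
    rw [eLpNorm_eq_lintegral_rpow_enorm_toReal (by simp; linarith) (by simp),
      ENNReal.toReal_ofReal (by linarith)]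
  have hpow : ∀ x, |v x| ^ p = |v x| ^ (p - 2) * v x * v x := by
    intro x
    rcases eq_or_ne (v x) 0 with h0 | h0
    · rw [h0, abs_zero, Real.zero_rpow (by linarith)]; simp
    rw [mul_assoc, ← sq, ← sq_abs (v x), ← Real.rpow_natCast, ← Real.rpow_add (abs_pos.2 h0)]
    norm_num
  have hfd : ∀ x, HasFDerivAt (fun x => |v x| ^ (p - 2) * v x)
      (((p - 2 + 1) * |v x| ^ (p - 2)) • fderiv ℝ v x) x := fun x =>
    (hasDerivAt_abs_rpow_mul (by linarith) (v x)).comp_hasFDerivAt x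
      (hv.differentiable (by simp) x).hasFDerivAt
  have hfd' : ∀ x, fderiv ℝ (fun x => |v x| ^ (p - 2) * v x) x (EuclideanSpace.single i 1) =
      (p - 1) * (|v x| ^ (p - 2) * z x) := by
    intro x
    rw [(hfd x).fderiv, ← hvz]
    simp [partialDeriv]; ring
  have hu' : ∀ x, fderiv ℝ u x (EuclideanSpace.single i 1) = v x := fun x => by
    rw [← huv]; rfl
  -- With v = ∂_i u and z = ∂_i v, this reads ∫ |v|^p = ∫ |v|^{p−2} v ∂_i u = −(p − 1) ∫ |v|^{p−2} z
  -- u.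
  have hibp := integral_mul_fderiv_eq_neg_fderiv_mul_of_integrable (μ := volume)
      (f := fun x => |v x| ^ (p - 2) * v x) (g := u) (v := EuclideanSpace.single i 1)
      (by
        refine (h2.const_mul (p - 1)).congr (Eventually.of_forall fun x => ?_)
        simp only [hfd']; ring)
      (hA.congr (Eventually.of_forall fun x => by simp only [hu', hpow])) h1
      (fun x _ => (hfd x).differentiableAt) (fun x _ => hu.differentiable (by simp) x)
  simp only [hfd', hu', ← hpow] at hibp
  have step1 : A ≤ ENNReal.ofReal (p - 1) * ∫⁻ x, ‖v x‖ₑ ^ (p - 2) * ‖u x * z x‖ₑ := by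
    rw [hAeq, hibp]
    calc _ ≤ ‖-∫ x, (p - 1) * (|v x| ^ (p - 2) * z x) * u x‖ₑ := by
          rw [Real.enorm_eq_ofReal_abs]; exact ENNReal.ofReal_le_ofReal (le_abs_self _)
      _ ≤ ∫⁻ x, ‖(p - 1) * (|v x| ^ (p - 2) * z x) * u x‖ₑ := by
          rw [enorm_neg]; exact enorm_integral_le_lintegral_enorm _
      _ = _ := by
          rw [← lintegral_const_mul' _ _ ENNReal.ofReal_ne_top]
          refine lintegral_congr fun x => ?_
          have e : (p - 1) * (|v x| ^ (p - 2) * z x) * u x =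
            (p - 1) * (|v x| ^ (p - 2) * (u x * z x)) := by ring
          rw [e, enorm_mul, enorm_mul, Real.enorm_eq_ofReal (by linarith : 0 ≤ p - 1),
            Real.enorm_eq_ofReal (by positivity : 0 ≤ |v x| ^ (p - 2)),
            ← ENNReal.ofReal_rpow_of_nonneg (abs_nonneg _) (by linarith),
            Real.enorm_eq_ofReal_abs (v x)]
  -- Hölder's inequality is used twice: with the exponents p/(p − 2) and p/2 to separate |v|^{p−2}
  -- from uz, then with q₁ and q₂ for the product uz in L^{p/2}.
  have hconj : (p / (p - 2)).HolderConjugate (p / 2) := by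
    rw [Real.holderConjugate_iff]
    constructor
    · rw [lt_div_iff₀ (by linarith)]; linarith
    · field_simp; ring
  have step2 : ∫⁻ x, ‖v x‖ₑ ^ (p - 2) * ‖u x * z x‖ₑ ≤
      A ^ ((p - 2) / p) * (eLpNorm u q₁ volume * eLpNorm z q₂ volume) := by
    refine (ENNReal.lintegral_mul_le_Lp_mul_Lq volume hconj
      (hv.continuous.enorm.aemeasurable.pow_const _)
      (hu.continuous.mul hz.continuous).enorm.aemeasurable).trans ?_
    have e1 : ∀ x, (‖v x‖ₑ ^ (p - 2)) ^ (p / (p - 2)) = ‖v x‖ₑ ^ p := by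
      intro x
      rw [← ENNReal.rpow_mul]
      congr 1
      field_simp [(by linarith : p - 2 ≠ 0)]
    simp only [e1, one_div_div]
    gcongr
    have e2 := eLpNorm_eq_lintegral_rpow_enorm_toReal (f := fun x => u x * z x) (μ := volume)
      (p := ENNReal.ofReal (p / 2)) (by simp; linarith) (by simp)
    rw [ENNReal.toReal_ofReal (by linarith), one_div_div] at e2
    refine (e2.symm.le).trans ?_
    exact eLpNorm_smul_le_mul_eLpNorm (φ := u) hz.continuous.aestronglyMeasurable
      hu.continuous.aestronglyMeasurable
  set B := ENNReal.ofReal (p - 1) * (eLpNorm u q₁ volume * eLpNorm z q₂ volume) with hB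
  have hAB : A ≤ A ^ ((p - 2) / p) * B := by
    refine step1.trans ((mul_le_mul_right step2 _).trans_eq ?_)
    rw [hB]; ring
  rw [hnorm, ← ENNReal.rpow_natCast, ← ENNReal.rpow_mul]
  -- A = ∫ |v|^p is finite, because v is bounded and square integrable. If it is nonzero, dividing
  -- by A^{(p−2)/p} leaves A^{2/p}, the square of the L^p-norm.
  rcases eq_or_ne A 0 with h0 | h0
  · rw [h0, ENNReal.zero_rpow_of_pos (by positivity)]; exact zero_le
  have hp0 : 0 ≤ (p - 2) / p := div_nonneg (by linarith) (by linarith)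
  have hc0 : A ^ ((p - 2) / p) ≠ 0 := by
    simp [ENNReal.rpow_eq_zero_iff, h0, hp0]
  have hct : A ^ ((p - 2) / p) ≠ ⊤ := ENNReal.rpow_ne_top_of_nonneg hp0 hAtop
  have : A = A ^ ((p - 2) / p) * A ^ (1 / p * ((2 : ℕ) : ℝ)) := by
    rw [← ENNReal.rpow_add _ _ h0 hAtop]
    have : (p - 2) / p + 1 / p * ((2 : ℕ) : ℝ) = 1 := by
      field_simp; push_cast; ring
    rw [this, ENNReal.rpow_one]
  rw [this] at hAB
  have h3 : A ^ ((p - 2) / p) * A ^ (1 / p * ((2 : ℕ) : ℝ)) ≤ A ^ ((p - 2) / p) * B := by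
    rwa [← this] at hAB ⊢
  exact (ENNReal.mul_le_mul_iff_right hc0 hct).1 h3

/-- Induction on j: the convexity inequality is raised to the power j + 1, the bound on a_j is
inserted, and a_{j+1}^j is cancelled. The exponent j² suffices since (j + 1) + j² ≤ (j + 1)². -/
theorem pow_succ_le_of_logConvex {C : ℝ} (hC : 1 ≤ C) {s : ℕ} {a : ℕ → ℝ} (ha : ∀ j, 0 ≤ a j)
    (h : ∀ j, j + 2 ≤ s → a (j + 1) ^ 2 ≤ C * (a j * a (j + 2))) (j : ℕ) (hj : j < s) :
    a j ^ (j + 1) ≤ C ^ (j * j) * (a 0 * a (j + 1) ^ j) := by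
  induction j with
  | zero => simp
  | succ j ih =>
    have ih := ih (by omega)
    rcases eq_or_ne (a (j + 1)) 0 with h0 | h0
    · rw [h0, zero_pow (by omega)]
      have := ha 0; have := ha (j + 1 + 1)
      positivity
    have hpos : 0 < a (j + 1) := lt_of_le_of_ne (ha _) (Ne.symm h0)
    have hC0 : 0 ≤ C := by linarith
    have h1 := pow_le_pow_left₀ (sq_nonneg _) (h j (by omega)) (j + 1)
    have a0 := ha 0; have aj := ha j; have aj2 := ha (j + 2)
    have h2 : a (j + 1) ^ j * a (j + 1) ^ (j + 1 + 1) ≤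
        a (j + 1) ^ j * (C ^ ((j + 1) * (j + 1)) * (a 0 * a (j + 2) ^ (j + 1))) := by
      calc a (j + 1) ^ j * a (j + 1) ^ (j + 1 + 1) = (a (j + 1) ^ 2) ^ (j + 1) := by ring
        _ ≤ (C * (a j * a (j + 2))) ^ (j + 1) := h1
        _ = C ^ (j + 1) * a j ^ (j + 1) * a (j + 2) ^ (j + 1) := by
            rw [mul_pow, mul_pow]; ring
        _ ≤ C ^ (j + 1) * (C ^ (j * j) * (a 0 * a (j + 1) ^ j)) * a (j + 2) ^ (j + 1) := by
            gcongr
        _ = C ^ (j + 1 + j * j) * (a 0 * a (j + 1) ^ j * a (j + 2) ^ (j + 1)) := by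
            rw [pow_add]; ring
        _ ≤ C ^ ((j + 1) * (j + 1)) * (a 0 * a (j + 1) ^ j * a (j + 2) ^ (j + 1)) := by
            gcongr ?_ * _
            exact pow_le_pow_right₀ hC (by nlinarith)
        _ = _ := by ring
    exact le_of_mul_le_mul_left h2 (pow_pos hpos j)

/-- Logarithmically convex sequences lie below the geometric interpolation of their end values. -/
theorem exists_pow_le_of_logConvex (C : ℝ) (s : ℕ) : ∃ D : ℝ, 1 ≤ D ∧ ∀ a : ℕ → ℝ,
    (∀ j, 0 ≤ a j) → (∀ j, j + 2 ≤ s → a (j + 1) ^ 2 ≤ C * (a j * a (j + 2))) →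
    ∀ j ≤ s, a j ^ s ≤ D * (a 0 ^ (s - j) * a s ^ j) := by
  set C' := max C 1 with hC'
  have hC1 : 1 ≤ C' := le_max_right _ _
  -- Descending induction on j = s − i: the preceding lemma bounds a_j by a_0 and a_{j+1}, and the
  -- induction hypothesis bounds a_{j+1} by the end values.
  have key : ∀ i ≤ s, ∃ D : ℝ, 1 ≤ D ∧ ∀ a : ℕ → ℝ,
    (∀ j, 0 ≤ a j) → (∀ j, j + 2 ≤ s → a (j + 1) ^ 2 ≤ C' * (a j * a (j + 2))) →
      a (s - i) ^ s ≤ D * (a 0 ^ i * a s ^ (s - i)) := by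
    intro i
    induction i with
    | zero => exact fun _ => ⟨1, le_rfl, fun a _ _ => by simp⟩
    | succ i ih =>
      intro hi
      obtain ⟨D, hD, hDa⟩ := ih (by omega)
      obtain ⟨j, hj⟩ : ∃ j, s = j + 1 + i := ⟨s - (i + 1), by omega⟩
      have hD0 : 0 ≤ D := by linarith
      have hC0 : 0 ≤ C' := by linarith
      -- The constant collects the s-th power of C'^{j²} and the j-th power of D. The (j + 1)-th
      -- root that would be available is not taken; this is harmless because the constant is at
      -- least 1.
      refine ⟨C' ^ (j * j * s) * D ^ j, one_le_mul_of_one_le_of_one_le (one_le_pow₀ hC1)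
        (one_le_pow₀ hD), fun a ha h => ?_⟩
      have e1 : s - i = j + 1 := by omega
      have e2 : s - (i + 1) = j := by omega
      have h1 := hDa a ha h
      rw [e1] at h1
      rw [e2]
      have h2 := pow_le_pow_left₀ (pow_nonneg (ha _) _)
        (pow_succ_le_of_logConvex hC1 ha h j (by omega)) s
      have a0 := ha 0; have as := ha s; have aj1 := ha (j + 1)
      set E := C' ^ (j * j * s) * D ^ j with hE
      have hE1 : 1 ≤ E := one_le_mul_of_one_le_of_one_le (one_le_pow₀ hC1) (one_le_pow₀ hD)
      have h3 : (a j ^ s) ^ (j + 1) ≤ (E * (a 0 ^ (i + 1) * a s ^ j)) ^ (j + 1) := by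
        calc (a j ^ s) ^ (j + 1) = (a j ^ (j + 1)) ^ s := by rw [← pow_mul, ← pow_mul, mul_comm]
          _ ≤ (C' ^ (j * j) * (a 0 * a (j + 1) ^ j)) ^ s := h2
          _ = C' ^ (j * j * s) * (a 0 ^ s * (a (j + 1) ^ s) ^ j) := by
              rw [mul_pow, mul_pow, ← pow_mul, ← pow_mul, ← pow_mul, mul_comm j s]
          _ ≤ C' ^ (j * j * s) * (a 0 ^ s * (D * (a 0 ^ i * a s ^ (j + 1))) ^ j) := by gcongr
          _ = E * (a 0 ^ (i + 1) * a s ^ j) ^ (j + 1) := by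
              rw [hE, mul_pow, mul_pow, mul_pow, ← pow_mul, ← pow_mul, ← pow_mul, ← pow_mul]
              have : a 0 ^ s * a 0 ^ (i * j) = a 0 ^ ((i + 1) * (j + 1)) := by
                rw [← pow_add, hj]; ring_nf
              calc _ = C' ^ (j * j * s) * D ^ j * ((a 0 ^ s * a 0 ^ (i * j)) * a s ^ ((j + 1) * j)) := by
                    ring
                _ = _ := by rw [this, mul_comm (j + 1) j]
          _ ≤ E ^ (j + 1) * (a 0 ^ (i + 1) * a s ^ j) ^ (j + 1) := by
              gcongr
              exact le_self_pow₀ hE1 (by omega)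
          _ = _ := by rw [← mul_pow]
      exact le_of_pow_le_pow_left₀ (by omega) (by positivity) h3
  choose! D hD hDa using key
  -- The sum dominates each D i and makes the constant independent of j.
  refine ⟨∑ i ∈ Finset.range (s + 1), D i, ?_, fun a ha h j hj => ?_⟩
  · refine (hD 0 (by omega)).trans (Finset.single_le_sum (f := D) (fun i hi => ?_) (by simp))
    exact zero_le_one.trans (hD i (by simpa [Nat.lt_succ_iff] using hi))
  · have h' : ∀ j, j + 2 ≤ s → a (j + 1) ^ 2 ≤ C' * (a j * a (j + 2)) := fun j hj =>
      (h j hj).trans (mul_le_mul_of_nonneg_right (le_max_left _ _) (mul_nonneg (ha _) (ha _)))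
    have h1 := hDa (s - j) (by omega) a ha h'
    rw [Nat.sub_sub_self hj] at h1
    refine h1.trans (mul_le_mul_of_nonneg_right ?_ (mul_nonneg (pow_nonneg (ha _) _)
      (pow_nonneg (ha _) _)))
    refine Finset.single_le_sum (f := D) (fun i hi => ?_) (by simp)
    exact zero_le_one.trans (hD i (by simpa [Nat.lt_succ_iff] using hi))

end Interpolation

end LandauLifshitz
namespace LandauLifshitz

/-! ### The Gagliardo–Nirenberg and Moser inequalities. -/

section Moser

variable {N : ℕ}

/-- The multi-indices of length `j`. -/
def indices (N j : ℕ) : Finset (Fin N → ℕ) := Finset.piAntidiag Finset.univ j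

theorem mem_indices {j : ℕ} {α : Fin N → ℕ} : α ∈ indices N j ↔ length α = j := by
  simp [indices, Finset.mem_piAntidiag, length]

/-- The `L²`-norm as a real number. -/
noncomputable def l2n (f : Space N → ℝ) : ℝ := (eLpNorm f 2 volume).toReal

/-- The homogeneous seminorm of order `s`. -/
noncomputable def hsn (s : ℕ) (f : Space N → ℝ) : ℝ := ∑ α ∈ indices N s, l2n (weakDeriv α f)

theorem l2n_nonneg (f : Space N → ℝ) : 0 ≤ l2n f := ENNReal.toReal_nonneg

theorem supNorm_nonneg (f : Space N → ℝ) : 0 ≤ supNorm f := ENNReal.toReal_nonneg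

theorem hsn_nonneg (s : ℕ) (f : Space N → ℝ) : 0 ≤ hsn s f :=
  Finset.sum_nonneg fun _ _ => l2n_nonneg _

theorem l2n_weakDeriv_le_hsn {s : ℕ} (f : Space N → ℝ) {α : Fin N → ℕ} (hα : length α = s) :
    l2n (weakDeriv α f) ≤ hsn s f :=
  Finset.single_le_sum (f := fun α => l2n (weakDeriv α f)) (fun _ _ => l2n_nonneg _)
    (mem_indices.2 hα)

theorem l2n_congr {f g : Space N → ℝ} (h : f =ᵐ[volume] g) : l2n f = l2n g := by
  rw [l2n, l2n, eLpNorm_congr_ae h]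

/-- Bounded functions whose weak derivatives of orders `1, …, s` are square integrable. -/
structure BddH (s : ℕ) (f : Space N → ℝ) : Prop where
  memLp_top : MemLp f ∞
  hasWeakDeriv : ∀ α : Fin N → ℕ, 1 ≤ length α → length α ≤ s → HasWeakDeriv α f (weakDeriv α f)
  memLp : ∀ α : Fin N → ℕ, 1 ≤ length α → length α ≤ s → MemLp (weakDeriv α f) 2

namespace BddH

variable {s : ℕ} {f g : Space N → ℝ}

theorem ae_abs_le (hf : BddH s f) : ∀ᵐ x, |f x| ≤ supNorm f := hf.memLp_top.ae_abs_le

theorem locH (hf : BddH s f) : LocH s f := fun α hα => by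
  rcases Nat.eq_zero_or_pos (length α) with h | h
  · rw [length_eq_zero] at h
    subst h
    exact ⟨f, HasWeakDeriv.zero_index hf.memLp_top.l2loc_top.1, hf.memLp_top.l2loc_top⟩
  · exact ⟨_, hf.hasWeakDeriv α h hα, (hf.memLp α h hα).l2loc⟩

theorem mono {s' : ℕ} (hf : BddH s f) (h : s' ≤ s) : BddH s' f :=
  ⟨hf.1, fun α h1 h2 => hf.2 α h1 (h2.trans h), fun α h1 h2 => hf.3 α h1 (h2.trans h)⟩

theorem moll_weakDeriv_bounded (hf : BddH s f) (n : ℕ) {α : Fin N → ℕ} (hα : length α ≤ s) :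
    ∃ M, ∀ x, |moll n (weakDeriv α f) x| ≤ M := by
  rcases Nat.eq_zero_or_pos (length α) with h | h
  · rw [length_eq_zero] at h
    subst h
    refine ⟨supNorm f, abs_moll_le n ?_⟩
    filter_upwards [hf.ae_abs_le, weakDeriv_zero_ae_eq hf.locH.l2loc.1] with x h1 h2
    rwa [h2]
  · exact exists_abs_moll_le n (hf.memLp α h hα)

theorem contDiff_moll (hf : BddH s f) (n : ℕ) {α : Fin N → ℕ} (hα : length α ≤ s) :
    ContDiff ℝ ∞ (moll n (weakDeriv α f)) :=
  LandauLifshitz.contDiff_moll n (hf.locH.l2loc_weakDeriv hα).1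

theorem partialDeriv_moll (hf : BddH s f) (n : ℕ) {α : Fin N → ℕ} (hα : length α + 1 ≤ s)
    (i : Fin N) : partialDeriv i (moll n (weakDeriv α f)) =
      moll n (weakDeriv (α + Pi.single i 1) f) :=
  LandauLifshitz.partialDeriv_moll n (hf.locH.hasWeakDeriv_weakDeriv (by simpa using hα))

end BddH

/-- The exponent `2s/j`. -/
noncomputable def gnExp (s j : ℕ) : ℝ≥0∞ := (2 * s : ℝ≥0∞) / j

/-- In ℝ≥0∞ division by zero gives ∞, so the L^∞ endpoint j = 0 belongs to the same family of
exponents. -/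
theorem gnExp_zero {s : ℕ} (hs : 1 ≤ s) : gnExp s 0 = ⊤ := by
  rw [gnExp, Nat.cast_zero, ENNReal.div_zero]
  exact mul_ne_zero (by norm_num) (by simp; omega)

theorem gnExp_eq_ofReal (s : ℕ) {j : ℕ} (hj : 1 ≤ j) :
    gnExp s j = ENNReal.ofReal (2 * s / j) := by
  rw [gnExp, ENNReal.ofReal_div_of_pos (by positivity), ENNReal.ofReal_mul (by norm_num)]
  simp

theorem gnExp_self {s : ℕ} (hs : 1 ≤ s) : gnExp s s = 2 := by
  rw [gnExp_eq_ofReal s hs]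
  have : (s : ℝ) ≠ 0 := by positivity
  field_simp
  simp

/-- The reciprocals j/(2s) of the exponents are additive in j. -/
theorem holderTriple_gnExp {s a b : ℕ} (hs : 1 ≤ s) (hab : 1 ≤ a + b) :
    ENNReal.HolderTriple (gnExp s a) (gnExp s b) (ENNReal.ofReal (2 * s / (a + b : ℕ))) := by
  constructor
  rw [← gnExp_eq_ofReal s hab]
  have h : ∀ j, (gnExp s j)⁻¹ = (j : ℝ≥0∞) / (2 * s) := by
    intro j
    rw [gnExp, ENNReal.inv_div (by simp)]
    right
    simp; omega
  rw [h, h, h, ENNReal.div_add_div_same, Nat.cast_add]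

theorem BddH.memLp_moll_gnExp {s : ℕ} {f : Space N → ℝ} (hf : BddH s f) (hs : 1 ≤ s) (n : ℕ)
    {α : Fin N → ℕ} {j : ℕ} (hα : length α = j) (hj : j ≤ s) :
    MemLp (moll n (weakDeriv α f)) (gnExp s j) := by
  have hc := (hf.contDiff_moll n (α := α) (by omega)).continuous.aestronglyMeasurable (μ := volume)
  obtain ⟨M, hM⟩ := hf.moll_weakDeriv_bounded n (α := α) (by omega)
  rcases Nat.eq_zero_or_pos j with h | h
  · rw [h, gnExp_zero hs]
    exact memLp_top_of_bound hc M (Eventually.of_forall hM)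
  · have h2 := memLp_moll n (hf.memLp α (by omega) (by omega))
    have hp : (2 : ℝ) ≤ 2 * s / j := by
      rw [le_div_iff₀ (by positivity)]
      have : (j : ℝ) ≤ s := by exact_mod_cast hj
      linarith
    have := memLp_of_bounded h2 hM hp
    rw [gnExp_eq_ofReal s h, ← integrable_norm_rpow_iff hc (by simp; positivity) (by simp),
      ENNReal.toReal_ofReal (by linarith)]
    exact this

/-- The interpolation step with p = 2s/(j + 1), whose neighbours 2s/j and 2s/(j + 2) satisfy 1/q₁ +
1/q₂ = 2/p. The factor p − 1 is at most 2s. Mollification makes the norms finite and the functions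
smooth. -/
theorem BddH.gn_logConvex {s : ℕ} {f : Space N → ℝ} (hf : BddH s f) (n : ℕ) {j : ℕ}
    (hj : j + 2 ≤ s) {α : Fin N → ℕ} (hα : length α = j) (i : Fin N) :
    (eLpNorm (moll n (weakDeriv (α + Pi.single i 1) f)) (gnExp s (j + 1)) volume).toReal ^ 2 ≤
      2 * s * ((eLpNorm (moll n (weakDeriv α f)) (gnExp s j) volume).toReal *
        (eLpNorm (moll n (weakDeriv (α + Pi.single i 1 + Pi.single i 1) f))
          (gnExp s (j + 2)) volume).toReal) := by
  have hs : 1 ≤ s := by omega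
  have l1 : length (α + Pi.single i 1) = j + 1 := by rw [length_add, length_single, hα]
  have l2 : length (α + Pi.single i 1 + Pi.single i 1) = j + 2 := by
    rw [length_add, length_single, l1]
  set u := moll n (weakDeriv α f) with hu
  set v := moll n (weakDeriv (α + Pi.single i 1) f) with hv
  set z := moll n (weakDeriv (α + Pi.single i 1 + Pi.single i 1) f) with hz
  have hud : partialDeriv i u = v := hf.partialDeriv_moll n (by omega) i
  have hvd : partialDeriv i v = z := hf.partialDeriv_moll n (by omega) i
  have cu := hf.contDiff_moll n (α := α) (by omega)
  have cv := hf.contDiff_moll n (α := α + Pi.single i 1) (by omega)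
  have cz := hf.contDiff_moll n (α := α + Pi.single i 1 + Pi.single i 1) (by omega)
  rw [← hu] at cu; rw [← hv] at cv; rw [← hz] at cz
  have v2 : MemLp v 2 := memLp_moll n (hf.memLp _ (by omega) (by omega))
  have z2 : MemLp z 2 := memLp_moll n (hf.memLp _ (by omega) (by omega))
  obtain ⟨M, hM⟩ := hf.moll_weakDeriv_bounded n (α := α + Pi.single i 1) (by omega)
  obtain ⟨M', hM'⟩ := hf.moll_weakDeriv_bounded n (α := α) (by omega)
  set p : ℝ := 2 * s / ((j + 1 : ℕ) : ℝ) with hpdef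
  have hjs : ((j + 1 : ℕ) : ℝ) + 1 ≤ s := by exact_mod_cast hj
  have hjpos : (0 : ℝ) < ((j + 1 : ℕ) : ℝ) := by positivity
  have hp : 2 < p := by rw [hpdef, lt_div_iff₀ hjpos]; linarith
  have hp2 : p ≤ 2 * s := by
    rw [hpdef]; exact div_le_self (by positivity) (by push_cast; linarith [Nat.cast_nonneg (α := ℝ) j])
  have hint : ∀ y : Space N → ℝ, Continuous y → MemLp y 2 →
      Integrable fun x => |v x| ^ (p - 2) * y x * u x := by
    intro y hyc hy
    have hq : Continuous fun x => |v x| ^ (p - 2) :=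
      cv.continuous.abs.rpow_const fun _ => Or.inr (by linarith)
    -- For j = 0 the function u is only known to be bounded, so |v|^{p−2} has to be square
    -- integrable; this holds because p = 2s ≥ 3. For j ≥ 1 the function u is square integrable and
    -- |v|^{p−2} is bounded.
    rcases Nat.eq_zero_or_pos j with h0 | h0
    · have h3 : 3 ≤ p := by
        have : (2 : ℝ) ≤ s := by exact_mod_cast (by omega : 2 ≤ s)
        rw [hpdef, h0]; push_cast; linarith
      have e := memLp_of_bounded v2 hM (p := 2 * (p - 2)) (by linarith)
      have : MemLp (fun x => |v x| ^ (p - 2)) 2 := by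
        rw [memLp_two_iff_integrable_sq hq.aestronglyMeasurable]
        refine e.congr (Eventually.of_forall fun x => ?_)
        simp only
        rw [← Real.rpow_natCast, ← Real.rpow_mul (abs_nonneg _), mul_comm]
        norm_cast
      have h1 : Integrable fun x => |v x| ^ (p - 2) * y x := this.integrable_mul hy
      exact h1.mul_bdd (c := M') cu.continuous.aestronglyMeasurable (Eventually.of_forall hM')
    · have u2 : MemLp u 2 := memLp_moll n (hf.memLp _ (by omega) (by omega))
      have h1 : Integrable fun x => y x * u x := hy.integrable_mul u2
      have := h1.bdd_mul (f := fun x => |v x| ^ (p - 2)) (c := M ^ (p - 2))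
        hq.aestronglyMeasurable (Eventually.of_forall fun x => by
          rw [Real.norm_of_nonneg (by positivity)]
          exact Real.rpow_le_rpow (abs_nonneg _) (hM x) (by linarith))
      exact this.congr (Eventually.of_forall fun x => by simp only; ring)
  have : ENNReal.HolderTriple (gnExp s j) (gnExp s (j + 2)) (ENNReal.ofReal (p / 2)) := by
    have := holderTriple_gnExp (s := s) (a := j) (b := j + 2) hs (by omega)
    convert this using 2
    rw [hpdef]; push_cast; field_simp; ring
  have key := eLpNorm_partialDeriv_sq_le cu cv hud hvd hp (gnExp s j) (gnExp s (j + 2)) v2 hM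
    (hint v cv.continuous v2) (hint z cz.continuous z2)
  rw [← gnExp_eq_ofReal s (by omega)] at key
  have f1 := (hf.memLp_moll_gnExp hs n hα (by omega)).2.ne
  have f2 := (hf.memLp_moll_gnExp hs n l2 (by omega)).2.ne
  have := ENNReal.toReal_mono (ENNReal.mul_ne_top ENNReal.ofReal_ne_top (ENNReal.mul_ne_top f1 f2))
    key
  rw [ENNReal.toReal_pow, ENNReal.toReal_mul, ENNReal.toReal_mul,
    ENNReal.toReal_ofReal (by linarith)] at this
  refine this.trans (mul_le_mul_of_nonneg_right (by linarith) (by positivity))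

/-- The Gagliardo-Nirenberg inequality for mollified functions. -/
theorem exists_gagliardoNirenberg (N s : ℕ) (hs : 1 ≤ s) : ∃ D : ℝ, 1 ≤ D ∧
    ∀ (f : Space N → ℝ), BddH s f → ∀ (n j : ℕ), j ≤ s → ∀ α : Fin N → ℕ, length α = j →
      (eLpNorm (moll n (weakDeriv α f)) (gnExp s j) volume).toReal ^ s ≤
        D * (supNorm f ^ (s - j) * hsn s f ^ j) := by
  -- m bounds the number of multi-indices of each length up to s. It enters squared: once from
  -- Cauchy–Schwarz, once from the number of summands.
  set m : ℝ := ∑ j ∈ Finset.range (s + 1), ((indices N j).card : ℝ) with hm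
  obtain ⟨D, hD, hDa⟩ := exists_pow_le_of_logConvex (m ^ 2 * (2 * s)) s
  refine ⟨D, hD, fun f hf n j hj α hα => ?_⟩
  set x : ℕ → (Fin N → ℕ) → ℝ := fun j α =>
    (eLpNorm (moll n (weakDeriv α f)) (gnExp s j) volume).toReal with hx
  set a : ℕ → ℝ := fun j => ∑ α ∈ indices N j, x j α with ha
  have hx0 : ∀ j α, 0 ≤ x j α := fun _ _ => ENNReal.toReal_nonneg
  have ha0 : ∀ j, 0 ≤ a j := fun j => Finset.sum_nonneg fun _ _ => hx0 _ _
  have hle : ∀ {j α}, length α = j → x j α ≤ a j := fun {j α} h =>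
    Finset.single_le_sum (f := x j) (fun _ _ => hx0 _ _) (mem_indices.2 h)
  have hcard : ∀ j ≤ s, ((indices N j).card : ℝ) ≤ m := fun j hj =>
    Finset.single_le_sum (f := fun j => ((indices N j).card : ℝ)) (fun _ _ => by positivity)
      (by simp; omega)
  have hlog : ∀ j, j + 2 ≤ s → a (j + 1) ^ 2 ≤ m ^ 2 * (2 * s) * (a j * a (j + 2)) := by
    intro j hj
    have h1 : ∀ α ∈ indices N (j + 1), x (j + 1) α ^ 2 ≤ 2 * s * (a j * a (j + 2)) := by
      intro α hα
      rw [mem_indices] at hα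
      -- Any direction i that occurs in the multi-index may be chosen, and the convexity inequality
      -- is used in that direction alone.
      obtain ⟨i, β, rfl⟩ := exists_eq_add_single (α := α) (by omega)
      have hβ : length β = j := by simpa [length_add] using hα
      refine (hf.gn_logConvex n hj hβ i).trans ?_
      have i1 := hle hβ
      have hβ2 : length (β + Pi.single i 1 + Pi.single i 1) = j + 2 := by
        rw [length_add, length_add, length_single, hβ]
      have i2 := hle hβ2
      have h3 := mul_le_mul i1 i2 (hx0 _ _) (ha0 j)
      have h4 : (0 : ℝ) ≤ 2 * s := by positivity
      exact mul_le_mul_of_nonneg_left h3 h4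
    have h2 := hcard (j + 1) (by omega)
    have b1 := ha0 j; have b2 := ha0 (j + 2)
    calc a (j + 1) ^ 2 ≤ (indices N (j + 1)).card * ∑ α ∈ indices N (j + 1), x (j + 1) α ^ 2 :=
          sq_sum_le_card_mul_sum_sq
      _ ≤ (indices N (j + 1)).card * ((indices N (j + 1)).card * (2 * s * (a j * a (j + 2)))) := by
          gcongr
          have := Finset.sum_le_card_nsmul _ _ _ h1
          rwa [nsmul_eq_mul] at this
      _ ≤ m * (m * (2 * s * (a j * a (j + 2)))) := by
          have h3 : 0 ≤ 2 * s * (a j * a (j + 2)) := mul_nonneg (by positivity) (mul_nonneg b1 b2)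
          have h4 : (0 : ℝ) ≤ (indices N (j + 1)).card := Nat.cast_nonneg _
          exact mul_le_mul h2 (mul_le_mul_of_nonneg_right h2 h3) (mul_nonneg h4 h3) (h4.trans h2)
      _ = _ := by ring
  have h := hDa a ha0 hlog j hj
  have z0 : a 0 ≤ supNorm f := by
    have e : indices N 0 = {0} := by
      ext β; rw [mem_indices, length_eq_zero]; simp
    simp only [ha, e, Finset.sum_singleton, hx, gnExp_zero hs]
    refine ENNReal.toReal_le_of_le_ofReal (supNorm_nonneg f) ?_
    rw [eLpNorm_exponent_top]
    refine eLpNormEssSup_le_of_ae_bound (Eventually.of_forall fun x => ?_)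
    refine abs_moll_le n ?_ x
    filter_upwards [hf.ae_abs_le, weakDeriv_zero_ae_eq hf.locH.l2loc.1] with x h1 h2
    rwa [h2]
  have zs : a s ≤ hsn s f := by
    refine Finset.sum_le_sum fun β hβ => ?_
    rw [mem_indices] at hβ
    simp only [hx, gnExp_self hs]
    have hm := hf.memLp β (by omega) (by omega)
    exact ENNReal.toReal_mono hm.2.ne (eLpNorm_moll_le n hm)
  have w1 := ha0 0; have w2 := ha0 s; have w3 := supNorm_nonneg f
  calc x j α ^ s ≤ a j ^ s := pow_le_pow_left₀ (hx0 _ _) (hle hα) s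
    _ ≤ _ := h
    _ ≤ _ := by gcongr

/-- The bilinear Moser inequality. -/
theorem exists_moser (N s : ℕ) (hs : 1 ≤ s) : ∃ C : ℝ, 0 ≤ C ∧
    ∀ f g : Space N → ℝ, BddH s f → BddH s g → ∀ β γ : Fin N → ℕ, length β + length γ = s →
      MemLp (fun x => weakDeriv β f x * weakDeriv γ g x) 2 ∧
      l2n (fun x => weakDeriv β f x * weakDeriv γ g x) ≤
        C * (supNorm f * hsn s g + hsn s f * supNorm g) := by
  obtain ⟨D, hD, hDa⟩ := exists_gagliardoNirenberg N s hs
  refine ⟨D ^ 2, by positivity, fun f g hf hg β γ hβγ => ?_⟩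
  set K := D ^ 2 * (supNorm f * hsn s g + hsn s f * supNorm g) with hK
  have f0 := supNorm_nonneg f; have g0 := supNorm_nonneg g
  have fs := hsn_nonneg s f; have gs := hsn_nonneg s g
  have hK0 : 0 ≤ K := by positivity
  have hlβ := hf.locH.l2loc_weakDeriv (α := β) (by omega)
  have hlγ := hg.locH.l2loc_weakDeriv (α := γ) (by omega)
  -- Since |β| + |γ| = s, the exponents 2s/|β| and 2s/|γ| are Hölder partners for L². The bound does
  -- not depend on n.
  have hn : ∀ n, eLpNorm (fun x => moll n (weakDeriv β f) x * moll n (weakDeriv γ g) x) 2 volume ≤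
      ENNReal.ofReal K := by
    intro n
    have : ENNReal.HolderTriple (gnExp s (length β)) (gnExp s (length γ)) 2 := by
      have := holderTriple_gnExp (s := s) (a := length β) (b := length γ) hs (by omega)
      rw [hβγ, ← gnExp_eq_ofReal s hs, gnExp_self hs] at this
      exact this
    have m1 := hf.memLp_moll_gnExp hs n (α := β) rfl (by omega)
    have m2 := hg.memLp_moll_gnExp hs n (α := γ) rfl (by omega)
    refine (eLpNorm_smul_le_mul_eLpNorm (φ := moll n (weakDeriv β f))
      (p := gnExp s (length β)) (q := gnExp s (length γ)) m2.1 m1.1).trans ?_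
    rw [ENNReal.le_ofReal_iff_toReal_le (ENNReal.mul_ne_top m1.2.ne m2.2.ne) hK0,
      ENNReal.toReal_mul]
    set x := (eLpNorm (moll n (weakDeriv β f)) (gnExp s (length β)) volume).toReal
    set y := (eLpNorm (moll n (weakDeriv γ g)) (gnExp s (length γ)) volume).toReal
    have hx := hDa f hf n _ (by omega) β rfl
    have hy := hDa g hg n _ (by omega) γ rfl
    have e1 : s - length β = length γ := by omega
    have e2 : s - length γ = length β := by omega
    rw [e1] at hx
    rw [e2] at hy
    refine le_of_pow_le_pow_left₀ (n := s) (by omega) hK0 ?_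
    have hy0 : 0 ≤ y := ENNReal.toReal_nonneg
    set S := supNorm f * hsn s g + hsn s f * supNorm g
    -- The two interpolation bounds regroup as (‖f‖_∞ ‖g‖_s)^{|γ|} (‖f‖_s ‖g‖_∞)^{|β|}, where ‖·‖_s
    -- is the homogeneous seminorm. Each base is at most the sum S, and the exponents add up to s.
    calc (x * y) ^ s = x ^ s * y ^ s := mul_pow _ _ _
      _ ≤ (D * (supNorm f ^ length γ * hsn s f ^ length β)) *
          (D * (supNorm g ^ length β * hsn s g ^ length γ)) := by gcongr
      _ = D ^ 2 * ((supNorm f * hsn s g) ^ length γ * (hsn s f * supNorm g) ^ length β) := by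
          rw [mul_pow, mul_pow]; ring
      _ ≤ D ^ 2 * (S ^ length γ * S ^ length β) := by
          gcongr
          · exact le_add_of_nonneg_right (by positivity)
          · exact le_add_of_nonneg_left (by positivity)
      _ = D ^ 2 * S ^ s := by rw [← pow_add, add_comm, hβγ]
      _ ≤ (D ^ 2) ^ s * S ^ s := by
          gcongr
          exact le_self_pow₀ (one_le_pow₀ hD) (by omega)
      _ = K ^ s := by rw [hK, mul_pow]
  have hlim : ∀ᵐ x, Tendsto (fun n => moll n (weakDeriv β f) x * moll n (weakDeriv γ g) x) atTop
      (𝓝 (weakDeriv β f x * weakDeriv γ g x)) := by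
    filter_upwards [tendsto_moll_ae hlβ.1, tendsto_moll_ae hlγ.1] with x h1 h2
    exact h1.mul h2
  -- Fatou's lemma along the mollifications, which converge almost everywhere.
  have hle : eLpNorm (fun x => weakDeriv β f x * weakDeriv γ g x) 2 volume ≤ ENNReal.ofReal K := by
    refine (Lp.eLpNorm_lim_le_liminf_eLpNorm (fun n => ?_) _ hlim).trans ?_
    · exact ((hf.contDiff_moll n (by omega)).continuous.mul
        (hg.contDiff_moll n (by omega)).continuous).aestronglyMeasurable
    · refine (liminf_le_liminf (Eventually.of_forall hn)).trans ?_
      simp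
  exact ⟨⟨hlβ.aestronglyMeasurable.mul hlγ.aestronglyMeasurable,
    hle.trans_lt ENNReal.ofReal_lt_top⟩, ENNReal.toReal_le_of_le_ofReal hK0 hle⟩

end Moser

end LandauLifshitz
namespace LandauLifshitz

/-! ### Norms of products; bounded functions with square integrable derivatives form an algebra. -/

section Products

variable {N : ℕ}

theorem l2n_add_le {f g : Space N → ℝ} (hf : MemLp f 2) (hg : MemLp g 2) :
    l2n (fun x => f x + g x) ≤ l2n f + l2n g := by
  unfold l2n
  rw [← ENNReal.toReal_add hf.2.ne hg.2.ne]
  exact ENNReal.toReal_mono (ENNReal.add_ne_top.2 ⟨hf.2.ne, hg.2.ne⟩)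
    (eLpNorm_add_le hf.1 hg.1 (by norm_num))

theorem l2n_const_mul (c : ℝ) (f : Space N → ℝ) : l2n (fun x => c * f x) = |c| * l2n f := by
  unfold l2n
  have := eLpNorm_const_smul c f 2 (volume : Measure (Space N))
  have e : (fun x => c * f x) = c • f := rfl
  rw [e, this, ENNReal.toReal_mul]
  simp

theorem memLp_sum {ι : Type*} (s : Finset ι) {u : ι → Space N → ℝ} {p : ℝ≥0∞}
    (h : ∀ i ∈ s, MemLp (u i) p) : MemLp (fun x => ∑ i ∈ s, u i x) p := memLp_finsetSum s h

theorem l2n_sum_le {ι : Type*} (s : Finset ι) {u : ι → Space N → ℝ}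
    (h : ∀ i ∈ s, MemLp (u i) 2) :
    l2n (fun x => ∑ i ∈ s, u i x) ≤ ∑ i ∈ s, l2n (u i) := by
  classical
  induction s using Finset.induction_on with
  | empty => simp [l2n]
  | insert a s ha ih =>
    simp only [Finset.sum_insert ha]
    have h' : ∀ i ∈ s, MemLp (u i) 2 := fun i hi => h i (by simp [hi])
    exact (l2n_add_le (h a (by simp)) (memLp_sum s h')).trans
      (add_le_add le_rfl (ih h'))

theorem memLp_bdd_mul {f g : Space N → ℝ} (hf : MemLp f ∞) (hg : MemLp g 2) :
    MemLp (fun x => f x * g x) 2 := MemLp.mul' hg hf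

theorem l2n_bdd_mul_le {f g : Space N → ℝ} (hf : MemLp f ∞) (hg : MemLp g 2) :
    l2n (fun x => f x * g x) ≤ supNorm f * l2n g := by
  unfold l2n supNorm
  rw [← ENNReal.toReal_mul]
  exact ENNReal.toReal_mono (ENNReal.mul_ne_top hf.2.ne hg.2.ne)
    (eLpNorm_smul_le_mul_eLpNorm (φ := f) hg.1 hf.1)

theorem supNorm_le_of_ae_abs_le {f : Space N → ℝ} {M : ℝ} (hM : 0 ≤ M)
    (h : ∀ᵐ x, |f x| ≤ M) : supNorm f ≤ M := by
  refine ENNReal.toReal_le_of_le_ofReal hM ?_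
  rw [eLpNorm_exponent_top]
  exact eLpNormEssSup_le_of_ae_bound h

theorem supNorm_mul_le {f g : Space N → ℝ} (hf : MemLp f ∞) (hg : MemLp g ∞) :
    supNorm (fun x => f x * g x) ≤ supNorm f * supNorm g := by
  refine supNorm_le_of_ae_abs_le (mul_nonneg (supNorm_nonneg _) (supNorm_nonneg _)) ?_
  filter_upwards [hf.ae_abs_le, hg.ae_abs_le] with x h1 h2
  rw [abs_mul]
  exact mul_le_mul h1 h2 (abs_nonneg _) (supNorm_nonneg _)

theorem supNorm_add_le {f g : Space N → ℝ} (hf : MemLp f ∞) (hg : MemLp g ∞) :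
    supNorm (fun x => f x + g x) ≤ supNorm f + supNorm g := by
  refine supNorm_le_of_ae_abs_le (add_nonneg (supNorm_nonneg _) (supNorm_nonneg _)) ?_
  filter_upwards [hf.ae_abs_le, hg.ae_abs_le] with x h1 h2
  exact (abs_add_le _ _).trans (add_le_add h1 h2)

theorem supNorm_sum_le {ι : Type*} (s : Finset ι) {u : ι → Space N → ℝ}
    (h : ∀ i ∈ s, MemLp (u i) ∞) :
    supNorm (fun x => ∑ i ∈ s, u i x) ≤ ∑ i ∈ s, supNorm (u i) := by
  classical
  induction s using Finset.induction_on with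
  | empty =>
    simp only [Finset.sum_empty]
    exact supNorm_le_of_ae_abs_le le_rfl (by simp)
  | insert a s ha ih =>
    simp only [Finset.sum_insert ha]
    have h' : ∀ i ∈ s, MemLp (u i) ∞ := fun i hi => h i (by simp [hi])
    exact (supNorm_add_le (h a (by simp)) (memLp_sum s h')).trans
      (add_le_add le_rfl (ih h'))

/-- The coefficients in the Leibniz formula. -/
noncomputable def leibCoeff (α : Fin N → ℕ) : (Fin N → ℕ) → ℝ := (exists_leibniz α).choose

theorem leibCoeff_zero (α : Fin N → ℕ) : leibCoeff α 0 = 1 := (exists_leibniz α).choose_spec.1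

theorem LocH.leibniz {α : Fin N → ℕ} {f g : Space N → ℝ} (hf : LocH (length α) f)
    (hg : LocH (length α) g) :
    HasWeakDeriv α (fun x => f x * g x)
      (fun x => ∑ β ∈ Finset.Iic α, leibCoeff α β * (weakDeriv β f x * weakDeriv (α - β) g x)) :=
  (exists_leibniz α).choose_spec.2 f g hf hg

theorem length_add_length_sub {α δ : Fin N → ℕ} (h : δ ≤ α) :
    length δ + length (α - δ) = length α := by
  rw [← length_add, add_tsub_cancel_of_le h]

theorem LocH.leibniz_weakDeriv {α β γ : Fin N → ℕ} {f g : Space N → ℝ}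
    (hf : LocH (length β + length α) f) (hg : LocH (length γ + length α) g) :
    HasWeakDeriv α (fun x => weakDeriv β f x * weakDeriv γ g x)
      (fun x => ∑ δ ∈ Finset.Iic α,
        leibCoeff α δ * (weakDeriv (β + δ) f x * weakDeriv (γ + (α - δ)) g x)) := by
  refine (LocH.leibniz (hf.of_weakDeriv le_rfl) (hg.of_weakDeriv le_rfl)).congr (ae_eq_refl _) ?_
  have h1 : ∀ δ ∈ Finset.Iic α, ∀ᵐ x, weakDeriv δ (weakDeriv β f) x = weakDeriv (β + δ) f x ∧
      weakDeriv (α - δ) (weakDeriv γ g) x = weakDeriv (γ + (α - δ)) g x := by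
    intro δ hδ
    have := length_add_length_sub (Finset.mem_Iic.1 hδ)
    exact (hf.weakDeriv_weakDeriv (by omega)).and (hg.weakDeriv_weakDeriv (by omega))
  have h2 := (Finset.eventually_all (Finset.Iic α)).2 h1
  filter_upwards [h2] with x hx
  refine Finset.sum_congr rfl fun δ hδ => ?_
  rw [(hx δ hδ).1, (hx δ hδ).2]

/-- The Moser inequality for derivatives of products of derivatives. -/
theorem exists_moser_shift (N s : ℕ) (hs : 1 ≤ s) : ∃ C : ℝ, 0 ≤ C ∧
    ∀ f g : Space N → ℝ, BddH s f → BddH s g → ∀ α β γ : Fin N → ℕ,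
      length α + length β + length γ = s →
      MemLp (weakDeriv α (fun x => weakDeriv β f x * weakDeriv γ g x)) 2 ∧
      HasWeakDeriv α (fun x => weakDeriv β f x * weakDeriv γ g x)
        (weakDeriv α (fun x => weakDeriv β f x * weakDeriv γ g x)) ∧
      l2n (weakDeriv α (fun x => weakDeriv β f x * weakDeriv γ g x)) ≤
        C * (supNorm f * hsn s g + hsn s f * supNorm g) := by
  obtain ⟨C, hC, hCm⟩ := exists_moser N s hs
  set A : (Fin N → ℕ) → ℝ := fun α => ∑ δ ∈ Finset.Iic α, |leibCoeff α δ| with hA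
  have hA0 : ∀ α, 0 ≤ A α := fun α => Finset.sum_nonneg fun _ _ => abs_nonneg _
  -- Summing over all multi-indices of length at most s makes the constant independent of α.
  set B : ℝ := ∑ j ∈ Finset.range (s + 1), ∑ α ∈ indices N j, A α with hB
  have hAB : ∀ α, length α ≤ s → A α ≤ B := by
    intro α hα
    have h1 : A α ≤ ∑ α' ∈ indices N (length α), A α' :=
      Finset.single_le_sum (f := A) (fun _ _ => hA0 _) (mem_indices.2 rfl)
    refine h1.trans (Finset.single_le_sum (f := fun j => ∑ α ∈ indices N j, A α)
      (fun _ _ => Finset.sum_nonneg fun _ _ => hA0 _) (by simp; omega))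
  have hB0 : 0 ≤ B := (hA0 0).trans (hAB 0 (by simp))
  refine ⟨B * C, mul_nonneg hB0 hC, fun f g hf hg α β γ hl => ?_⟩
  have hL := LocH.leibniz_weakDeriv (α := α) (β := β) (γ := γ)
    (hf.locH.mono (by omega)) (hg.locH.mono (by omega))
  have hm : ∀ δ ∈ Finset.Iic α, MemLp
      (fun x => leibCoeff α δ * (weakDeriv (β + δ) f x * weakDeriv (γ + (α - δ)) g x)) 2 ∧
      l2n (fun x => leibCoeff α δ * (weakDeriv (β + δ) f x * weakDeriv (γ + (α - δ)) g x)) ≤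
        |leibCoeff α δ| * (C * (supNorm f * hsn s g + hsn s f * supNorm g)) := by
    intro δ hδ
    have h0 := length_add_length_sub (Finset.mem_Iic.1 hδ)
    have := hCm f g hf hg (β + δ) (γ + (α - δ)) (by rw [length_add, length_add]; omega)
    refine ⟨this.1.const_mul _, ?_⟩
    rw [l2n_const_mul]
    exact mul_le_mul_of_nonneg_left this.2 (abs_nonneg _)
  have hsum := memLp_sum _ fun δ hδ => (hm δ hδ).1
  refine ⟨hsum.ae_eq hL.weakDeriv_ae_eq.symm, hL.weakDeriv, ?_⟩
  rw [l2n_congr hL.weakDeriv_ae_eq]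
  refine (l2n_sum_le _ fun δ hδ => (hm δ hδ).1).trans ?_
  refine (Finset.sum_le_sum fun δ hδ => (hm δ hδ).2).trans ?_
  rw [← Finset.sum_mul, mul_assoc]
  refine mul_le_mul_of_nonneg_right (hAB α (by omega)) (mul_nonneg hC ?_)
  exact add_nonneg (mul_nonneg (supNorm_nonneg _) (hsn_nonneg _ _))
    (mul_nonneg (hsn_nonneg _ _) (supNorm_nonneg _))

/-- A constant for the shifted Moser inequality. -/
noncomputable def moserConst (N s : ℕ) : ℝ :=
  if hs : 1 ≤ s then (exists_moser_shift N s hs).choose else 0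

theorem moserConst_nonneg (N s : ℕ) : 0 ≤ moserConst N s := by
  unfold moserConst
  split_ifs with hs
  · exact (exists_moser_shift N s hs).choose_spec.1
  · exact le_rfl

section

variable {s : ℕ} {f g : Space N → ℝ} {α β γ : Fin N → ℕ}

theorem BddH.memLp_weakDeriv_mul (hf : BddH s f) (hg : BddH s g) (hs : 1 ≤ s)
    (hl : length α + length β + length γ = s) :
    MemLp (weakDeriv α (fun x => weakDeriv β f x * weakDeriv γ g x)) 2 := by
  exact ((exists_moser_shift N s hs).choose_spec.2 f g hf hg α β γ hl).1

theorem BddH.hasWeakDeriv_weakDeriv_mul (hf : BddH s f) (hg : BddH s g) (hs : 1 ≤ s)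
    (hl : length α + length β + length γ = s) :
    HasWeakDeriv α (fun x => weakDeriv β f x * weakDeriv γ g x)
        (weakDeriv α (fun x => weakDeriv β f x * weakDeriv γ g x)) :=
  ((exists_moser_shift N s hs).choose_spec.2 f g hf hg α β γ hl).2.1

theorem BddH.l2n_weakDeriv_mul_le (hf : BddH s f) (hg : BddH s g) (hs : 1 ≤ s)
    (hl : length α + length β + length γ = s) :
    l2n (LandauLifshitz.weakDeriv α
        (fun x => LandauLifshitz.weakDeriv β f x * LandauLifshitz.weakDeriv γ g x)) ≤
      moserConst N s * (supNorm f * hsn s g + hsn s f * supNorm g) := by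
  rw [moserConst, dif_pos hs]
  exact ((exists_moser_shift N s hs).choose_spec.2 f g hf hg α β γ hl).2.2

theorem BddH.memLp_mul_weakDeriv (hf : BddH s f) (hg : BddH s g) (hs : 1 ≤ s)
    (hl : length β + length γ = s) :
    MemLp (fun x => weakDeriv β f x * weakDeriv γ g x) 2 := by
  exact ((exists_moser N s hs).choose_spec.2 f g hf hg β γ hl).1

theorem BddH.l2n_mul_weakDeriv_le (hf : BddH s f) (hg : BddH s g) (hs : 1 ≤ s)
    (hl : length β + length γ = s) :
    l2n (fun x => weakDeriv β f x * weakDeriv γ g x) ≤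
      moserConst N s * (supNorm f * hsn s g + hsn s f * supNorm g) := by
  have h1 : LocallyIntegrable fun x => weakDeriv β f x * weakDeriv γ g x :=
    (hf.locH.l2loc_weakDeriv (by omega)).mul (hg.locH.l2loc_weakDeriv (by omega))
  rw [← l2n_congr (weakDeriv_zero_ae_eq h1)]
  exact hf.l2n_weakDeriv_mul_le hg hs (by simpa using hl)

theorem BddH.mul_congr_zero (hf : BddH s f) (hg : BddH s g) :
    (fun x => weakDeriv 0 f x * weakDeriv 0 g x) =ᵐ[volume] fun x => f x * g x := by
  filter_upwards [weakDeriv_zero_ae_eq hf.locH.l2loc.1, weakDeriv_zero_ae_eq hg.locH.l2loc.1]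
    with x h1 h2
  rw [h1, h2]

/-- Moser's inequality at each order r with 1 ≤ r ≤ s, applied with β = γ = 0. Square integrability
of the factors themselves is not needed. -/
theorem BddH.mul (hf : BddH s f) (hg : BddH s g) : BddH s fun x => f x * g x := by
  refine ⟨MemLp.mul' hg.1 hf.1, fun α h1 h2 => ?_, fun α h1 h2 => ?_⟩
  · have := (hf.mono h2).hasWeakDeriv_weakDeriv_mul (hg.mono h2) h1 (α := α) (β := 0) (γ := 0)
      (by simp)
    exact (this.congr (hf.mul_congr_zero hg) (ae_eq_refl _)).weakDeriv
  · have := (hf.mono h2).memLp_weakDeriv_mul (hg.mono h2) h1 (α := α) (β := 0) (γ := 0)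
      (by simp)
    rwa [weakDeriv_congr α (hf.mul_congr_zero hg)] at this

theorem BddH.hsn_mul_le (hf : BddH s f) (hg : BddH s g) {r : ℕ} (hr : 1 ≤ r) (hrs : r ≤ s) :
    hsn r (fun x => f x * g x) ≤ (indices N r).card * moserConst N r *
      (supNorm f * hsn r g + hsn r f * supNorm g) := by
  unfold hsn
  rw [mul_assoc, ← nsmul_eq_mul]
  refine Finset.sum_le_card_nsmul _ _ _ fun α hα => ?_
  rw [mem_indices] at hα
  have := (hf.mono hrs).l2n_weakDeriv_mul_le (hg.mono hrs) hr (α := α) (β := 0) (γ := 0)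
      (by simpa using hα)
  rwa [weakDeriv_congr α (hf.mul_congr_zero hg)] at this

theorem BddH.add (hf : BddH s f) (hg : BddH s g) : BddH s fun x => f x + g x := by
  refine ⟨hf.1.add hg.1, fun α h1 h2 => ?_, fun α h1 h2 => ?_⟩
  · exact ((hf.2 α h1 h2).add (hg.2 α h1 h2)).weakDeriv
  · exact ((hf.3 α h1 h2).add (hg.3 α h1 h2)).ae_eq
      ((hf.2 α h1 h2).add (hg.2 α h1 h2)).weakDeriv_ae_eq.symm

theorem BddH.const_mul (hf : BddH s f) (c : ℝ) : BddH s fun x => c * f x := by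
  refine ⟨hf.1.const_mul c, fun α h1 h2 => ?_, fun α h1 h2 => ?_⟩
  · exact ((hf.2 α h1 h2).const_mul c).weakDeriv
  · exact ((hf.3 α h1 h2).const_mul c).ae_eq
      ((hf.2 α h1 h2).const_mul c).weakDeriv_ae_eq.symm

theorem BddH.sub (hf : BddH s f) (hg : BddH s g) : BddH s fun x => f x - g x := by
  simpa [sub_eq_add_neg] using hf.add (hg.const_mul (-1))

theorem BddH.zero (s : ℕ) : BddH s fun _ : Space N => (0 : ℝ) := by
  have h : ∀ α : Fin N → ℕ, weakDeriv α (fun _ : Space N => (0 : ℝ)) =ᵐ[volume] fun _ => 0 :=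
    fun α => (HasWeakDeriv.zero α).weakDeriv_ae_eq
  exact ⟨MemLp.zero', fun α _ _ => (HasWeakDeriv.zero α).weakDeriv,
    fun α _ _ => MemLp.zero'.ae_eq (h α).symm⟩

theorem BddH.sum {ι : Type*} (t : Finset ι) {u : ι → Space N → ℝ}
    (h : ∀ i ∈ t, BddH s (u i)) : BddH s fun x => ∑ i ∈ t, u i x := by
  classical
  induction t using Finset.induction_on with
  | empty => simpa using BddH.zero s
  | insert a t ha ih =>
    simp only [Finset.sum_insert ha]
    exact (h a (by simp)).add (ih fun i hi => h i (by simp [hi]))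

theorem LocH.hsn_weakDeriv_le {r : ℕ} (hf : LocH s f) (hα : length α + r ≤ s) :
    hsn r (LandauLifshitz.weakDeriv α f) ≤ hsn (length α + r) f := by
  unfold hsn
  have : ∀ β ∈ indices N r, l2n (LandauLifshitz.weakDeriv β (LandauLifshitz.weakDeriv α f)) =
      l2n (LandauLifshitz.weakDeriv (α + β) f) := fun β hβ => by
    rw [mem_indices] at hβ
    exact l2n_congr (hf.weakDeriv_weakDeriv (by omega))
  rw [Finset.sum_congr rfl this]
  have e : ∑ β ∈ indices N r, l2n (LandauLifshitz.weakDeriv (α + β) f) =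
      ∑ β ∈ (indices N r).image (fun β => α + β), l2n (LandauLifshitz.weakDeriv β f) := by
    rw [Finset.sum_image fun a _ b _ hab => add_left_cancel hab]
  rw [e]
  refine Finset.sum_le_sum_of_subset_of_nonneg ?_ fun _ _ _ => l2n_nonneg _
  intro β hβ
  obtain ⟨γ, hγ, rfl⟩ := Finset.mem_image.1 hβ
  rw [mem_indices] at hγ ⊢
  rw [length_add, hγ]

theorem BddH.hsn_add_le (hf : BddH s f) (hg : BddH s g) {r : ℕ} (hr : 1 ≤ r) (hrs : r ≤ s) :
    hsn r (fun x => f x + g x) ≤ hsn r f + hsn r g := by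
  unfold hsn
  rw [← Finset.sum_add_distrib]
  refine Finset.sum_le_sum fun α hα => ?_
  rw [mem_indices] at hα
  rw [l2n_congr ((hf.2 α (by omega) (by omega)).add (hg.2 α (by omega) (by omega))).weakDeriv_ae_eq]
  exact l2n_add_le (hf.3 α (by omega) (by omega)) (hg.3 α (by omega) (by omega))

theorem BddH.hsn_const_mul (hf : BddH s f) (c : ℝ) {r : ℕ} (hr : 1 ≤ r) (hrs : r ≤ s) :
    hsn r (fun x => c * f x) = |c| * hsn r f := by
  unfold hsn
  rw [Finset.mul_sum]
  refine Finset.sum_congr rfl fun α hα => ?_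
  rw [mem_indices] at hα
  rw [l2n_congr ((hf.2 α (by omega) (by omega)).const_mul c).weakDeriv_ae_eq, l2n_const_mul]

theorem BddH.hsn_sum_le {ι : Type*} (t : Finset ι) {u : ι → Space N → ℝ}
    (h : ∀ i ∈ t, BddH s (u i)) {r : ℕ} (hr : 1 ≤ r) (hrs : r ≤ s) :
    hsn r (fun x => ∑ i ∈ t, u i x) ≤ ∑ i ∈ t, hsn r (u i) := by
  classical
  induction t using Finset.induction_on with
  | empty =>
    simp only [Finset.sum_empty]
    have := (BddH.zero (N := N) s).hsn_const_mul 0 hr hrs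
    simp at this
    rw [this]
  | insert a t ha ih =>
    simp only [Finset.sum_insert ha]
    have h' : ∀ i ∈ t, BddH s (u i) := fun i hi => h i (by simp [hi])
    exact ((h a (by simp)).hsn_add_le (BddH.sum t h') hr hrs).trans (add_le_add le_rfl (ih h'))

end

end Products

end LandauLifshitz
namespace LandauLifshitz

/-! ### The spaces H^s and the embedding into L^∞, by averages at varying scales. -/

section Sobolev

variable {N : ℕ}

namespace MemH

variable {s : ℕ} {f g : Space N → ℝ} {α : Fin N → ℕ}

theorem locH (hf : MemH s f) : LocH s f := fun α hα => by
  obtain ⟨g, h1, h2⟩ := hf α hα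
  exact ⟨g, h1, h2.l2loc⟩

theorem memLp_weakDeriv (hf : MemH s f) (hα : length α ≤ s) : MemLp (weakDeriv α f) 2 := by
  obtain ⟨g, h1, h2⟩ := hf α hα
  exact h2.ae_eq h1.weakDeriv_ae_eq.symm

theorem memLp (hf : MemH s f) : MemLp f 2 :=
  (hf.memLp_weakDeriv (α := 0) (by simp)).ae_eq (weakDeriv_zero_ae_eq hf.locH.l2loc.1)

theorem mono {s' : ℕ} (hf : MemH s f) (h : s' ≤ s) : MemH s' f := fun α hα => hf α (hα.trans h)

theorem of_weakDeriv {r : ℕ} (hf : MemH s f) (h : length α + r ≤ s) : MemH r (weakDeriv α f) :=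
  fun β hβ => ⟨_, hf.locH.hasWeakDeriv_weakDeriv (by omega),
    hf.memLp_weakDeriv (by rw [length_add]; omega)⟩

theorem bddH (hf : MemH s f) (hb : MemLp f ∞) : BddH s f :=
  ⟨hb, fun _ _ h => hf.locH.hasWeakDeriv h, fun _ _ h => hf.memLp_weakDeriv h⟩

theorem add (hf : MemH s f) (hg : MemH s g) : MemH s fun x => f x + g x := fun _ hα =>
  ⟨_, (hf.locH.hasWeakDeriv hα).add (hg.locH.hasWeakDeriv hα),
    (hf.memLp_weakDeriv hα).add (hg.memLp_weakDeriv hα)⟩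

theorem const_mul (hf : MemH s f) (c : ℝ) : MemH s fun x => c * f x := fun _ hα =>
  ⟨_, (hf.locH.hasWeakDeriv hα).const_mul c, (hf.memLp_weakDeriv hα).const_mul c⟩

theorem sub (hf : MemH s f) (hg : MemH s g) : MemH s fun x => f x - g x := by
  simpa [sub_eq_add_neg] using hf.add (hg.const_mul (-1))

theorem congr (hf : MemH s f) (h : f =ᵐ[volume] g) : MemH s g := fun α hα => by
  obtain ⟨u, hu, h2⟩ := hf α hα
  exact ⟨u, hu.congr h (ae_eq_refl _), h2⟩

end MemH

/-- Averages of a function at scale `r`, with weight `η`. -/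
noncomputable def scaleAvg (u η : Space N → ℝ) (x : Space N) (r : ℝ) : ℝ :=
  ∫ y, u (x + r • y) * η y

/-- Both Φ and −Φ, after adding the primitive (A/b) t^{−b}, are nonincreasing on [r, 1]. For
negative b the bound stays finite as r → 0, which is the case that yields the embedding. -/
theorem abs_le_of_abs_deriv_le_rpow {Φ Φ' : ℝ → ℝ} {A A' b : ℝ} (hb : b ≠ 0)
    (hd : ∀ t, HasDerivAt Φ (Φ' t) t) (h1 : ∀ t, 0 < t → t ≤ 1 → |Φ' t| ≤ A * t ^ (-b - 1))
    (h2 : |Φ 1| ≤ A') {r : ℝ} (hr : 0 < r) (hr1 : r ≤ 1) :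
    |Φ r| ≤ A' + A / b * (r ^ (-b) - 1) := by
  set g : ℝ → ℝ := fun t => A / b * t ^ (-b) with hg
  have hgd : ∀ t, 0 < t → HasDerivAt g (-(A * t ^ (-b - 1))) t := by
    intro t ht
    have := (Real.hasDerivAt_rpow_const (x := t) (p := -b) (Or.inl ht.ne')).const_mul (A / b)
    refine this.congr_deriv ?_
    field_simp
  have key : ∀ ε : ℝ, (ε = 1 ∨ ε = -1) → ε * Φ 1 + g 1 ≤ ε * Φ r + g r := by
    intro ε hε
    have hanti : AntitoneOn (fun t => ε * Φ t + g t) (Icc r 1) := by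
      refine antitoneOn_of_deriv_nonpos (convex_Icc _ _) (fun t ht => ?_) (fun t ht => ?_)
        fun t ht => ?_
      · exact (((hd t).const_mul ε).add (hgd t (hr.trans_le ht.1))).continuousAt.continuousWithinAt
      · rw [interior_Icc] at ht
        exact (((hd t).const_mul ε).add
          (hgd t (hr.trans ht.1))).differentiableAt.differentiableWithinAt
      · rw [interior_Icc] at ht
        have e : deriv (fun t => ε * Φ t + g t) t = _ :=
          (((hd t).const_mul ε).add (hgd t (hr.trans ht.1))).deriv
        rw [e]
        have := abs_le.1 (h1 t (hr.trans ht.1) ht.2.le)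
        rcases hε with rfl | rfl <;> linarith [this.1, this.2]
    exact hanti ⟨le_rfl, hr1⟩ ⟨hr1, le_rfl⟩ hr1
  have k1 := key 1 (Or.inl rfl)
  have k2 := key (-1) (Or.inr rfl)
  have g1 : g 1 = A / b := by simp [hg]
  have gr : g r = A / b * r ^ (-b) := rfl
  rw [g1, gr] at k1 k2
  have := abs_le.1 h2
  rw [abs_le]
  constructor <;> linarith [this.1, this.2]

theorem fderiv_apply_eq_sum (u : Space N → ℝ) (x y : Space N) :
    fderiv ℝ u x y = ∑ i, y i * partialDeriv i u x := by
  have : y = ∑ i, y i • EuclideanSpace.single i (1 : ℝ) := by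
    ext j
    simp [Finset.sum_apply, Pi.single_apply]
  conv_lhs => rw [this]
  simp [partialDeriv]

theorem continuous_add_smul (x : Space N) (r : ℝ) : Continuous fun y : Space N => x + r • y :=
  continuous_const.add (continuous_const_smul r)

theorem hasDerivAt_scaleAvg {u η : Space N → ℝ} (hu : ContDiff ℝ ∞ u) {B' : ℝ}
    (hB' : ∀ i x, |partialDeriv i u x| ≤ B')
    (hη : Continuous η) (hηs : HasCompactSupport η) (x : Space N) (r : ℝ) :
    HasDerivAt (scaleAvg u η x)
      (∑ i, scaleAvg (partialDeriv i u) (fun y => y i * η y) x r) r := by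
  have hηi : ∀ i : Fin N, Continuous fun y : Space N => y i * η y := fun i => by fun_prop
  have hηis : ∀ i : Fin N, HasCompactSupport fun y : Space N => y i * η y := fun i =>
    hηs.mul_left
  have hint : ∀ i : Fin N, Integrable fun y : Space N => y i * η y := fun i =>
    (hηi i).integrable_of_hasCompactSupport (hηis i)
  have hcu : ∀ r, Continuous fun y : Space N => u (x + r • y) := fun r =>
    hu.continuous.comp (continuous_add_smul x r)
  have hcd : ∀ i r, Continuous fun y : Space N => partialDeriv i u (x + r • y) := fun i r =>
    (hu.partialDeriv i).continuous.comp (continuous_add_smul x r)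
  have hint2 : ∀ i r, Integrable fun y : Space N => partialDeriv i u (x + r • y) * (y i * η y) :=
    fun i r => ((hcd i r).mul (hηi i)).integrable_of_hasCompactSupport (hηis i).mul_left
  have h := hasDerivAt_integral_of_dominated_loc_of_deriv_le (μ := volume)
    (F := fun r y => u (x + r • y) * η y)
    (F' := fun r y => ∑ i, partialDeriv i u (x + r • y) * (y i * η y))
    (bound := fun y => ∑ i, B' * |y i * η y|) (x₀ := r) (s := univ) univ_mem
    (Eventually.of_forall fun r => ((hcu r).mul hη).aestronglyMeasurable)
    (((hcu r).mul hη).integrable_of_hasCompactSupport hηs.mul_left)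
    (continuous_finsetSum _ fun i _ => (hcd i r).mul (hηi i)).aestronglyMeasurable
    (Eventually.of_forall fun y r _ => ?_)
    (integrable_finsetSum _ fun i _ => (hint i).abs.const_mul B')
    (Eventually.of_forall fun y r _ => ?_)
  · have := h.2
    rw [integral_finsetSum _ fun i _ => hint2 i r] at this
    exact this
  · refine (norm_sum_le _ _).trans (Finset.sum_le_sum fun i _ => ?_)
    rw [norm_mul]
    exact mul_le_mul_of_nonneg_right (hB' i _) (abs_nonneg _)
  · have h1 : HasDerivAt (fun r : ℝ => x + r • y) y r := by
      simpa using ((hasDerivAt_id r).smul_const y).const_add x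
    have h2 := ((hu.differentiable (by simp) (x + r • y)).hasFDerivAt.comp_hasDerivAt r h1).mul_const
      (η y)
    refine h2.congr_deriv ?_
    rw [fderiv_apply_eq_sum, Finset.sum_mul]
    exact Finset.sum_congr rfl fun i _ => by ring

/-- Cauchy–Schwarz and the change of variables y ↦ x + ry cost r^{−N/2}, and N + 1 ≤ 2s gives N/2 ≤
s − 1/4. The offset 1/4 keeps all later exponents |α| − 1/4 away from 0, so that no logarithm arises
on integration in r. -/
theorem abs_scaleAvg_le {u η : Space N → ℝ} (hu : MemLp u 2) (huc : Continuous u)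
    (hη : Continuous η) (hηs : HasCompactSupport η) (x : Space N) {r : ℝ} (hr : 0 < r) {s : ℕ}
    (hs : N < 2 * s) (hr1 : r ≤ 1) :
    |scaleAvg u η x r| ≤ l2n η * l2n u * r ^ (-((s : ℝ) - 1 / 4)) := by
  have hη2 : MemLp η 2 := hη.memLp_of_hasCompactSupport hηs
  have hc : Continuous fun y : Space N => u (x + r • y) := huc.comp (continuous_add_smul x r)
  have hi : Integrable fun y => u (x + y) ^ 2 := hu.integrable_sq.comp_add_left x
  have hv : MemLp (fun y => u (x + r • y)) 2 := by
    rw [memLp_two_iff_integrable_sq hc.aestronglyMeasurable]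
    exact hi.comp_smul hr.ne'
  have e : ∫ y, u (x + r • y) ^ 2 = r⁻¹ ^ N * ∫ y, u y ^ 2 := by
    have := Measure.integral_comp_smul (volume : Measure (Space N)) (fun y => u (x + y) ^ 2) r
    rw [this, finrank_euclideanSpace_fin, integral_add_left_eq_self (fun y => u y ^ 2),
      abs_of_nonneg (by positivity), smul_eq_mul, inv_pow]
  have h := integral_mul_le_sqrt hv hη2
  have e2 : l2n (fun y => u (x + r • y)) = Real.sqrt (r⁻¹ ^ N) * l2n u := by
    unfold l2n
    rw [eLpNorm_two_eq hv, eLpNorm_two_eq hu, ENNReal.toReal_ofReal (Real.sqrt_nonneg _),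
      ENNReal.toReal_ofReal (Real.sqrt_nonneg _), e, Real.sqrt_mul (by positivity)]
  have e3 : Real.sqrt (r⁻¹ ^ N) ≤ r ^ (-((s : ℝ) - 1 / 4)) := by
    rw [Real.sqrt_eq_rpow, ← Real.rpow_natCast, ← Real.rpow_mul (by positivity),
      Real.inv_rpow hr.le, ← Real.rpow_neg hr.le]
    refine Real.rpow_le_rpow_of_exponent_ge hr hr1 ?_
    have : (N : ℝ) + 1 ≤ 2 * s := by exact_mod_cast hs
    linarith
  calc |scaleAvg u η x r| ≤ l2n (fun y => u (x + r • y)) * l2n η := h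
    _ = l2n η * l2n u * Real.sqrt (r⁻¹ ^ N) := by rw [e2]; ring
    _ ≤ _ := mul_le_mul_of_nonneg_left e3 (mul_nonneg (l2n_nonneg _) (l2n_nonneg _))

/-- The inhomogeneous Sobolev norm of order `s`. -/
noncomputable def sobn (s : ℕ) (f : Space N → ℝ) : ℝ := ∑ j ∈ Finset.range (s + 1), hsn j f

theorem sobn_nonneg (s : ℕ) (f : Space N → ℝ) : 0 ≤ sobn s f :=
  Finset.sum_nonneg fun _ _ => hsn_nonneg _ _

theorem hsn_le_sobn {s j : ℕ} (f : Space N → ℝ) (hj : j ≤ s) : hsn j f ≤ sobn s f :=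
  Finset.single_le_sum (f := fun j => hsn j f) (fun _ _ => hsn_nonneg _ _) (by simp; omega)

theorem l2n_weakDeriv_le_sobn {s : ℕ} (f : Space N → ℝ) {α : Fin N → ℕ} (hα : length α ≤ s) :
    l2n (weakDeriv α f) ≤ sobn s f :=
  (l2n_weakDeriv_le_hsn f rfl).trans (hsn_le_sobn f hα)

/-- Induction on d = s − |α|. The derivative in r of an average of ∂^α f is a sum of averages of
derivatives of order |α| + 1 with weights y_i η, so integrating from r to 1 gains one power of r;
this is why η is arbitrary. At α = 0 the power of r is r^{1/4}, which is bounded. -/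
theorem exists_abs_scaleAvg_moll_le {s : ℕ} (hs : N < 2 * s) (d : ℕ) (α : Fin N → ℕ)
    (hα : length α + d = s) (η : Space N → ℝ) (hη : Continuous η) (hηs : HasCompactSupport η) :
    ∃ C : ℝ, 0 ≤ C ∧ ∀ f : Space N → ℝ, MemH s f → ∀ n x r, 0 < r → r ≤ 1 →
      |scaleAvg (moll n (weakDeriv α f)) η x r| ≤
        C * sobn s f * (1 + r ^ (-((length α : ℝ) - 1 / 4))) := by
  have hbase : ∀ α : Fin N → ℕ, length α ≤ s → ∀ η : Space N → ℝ, Continuous η →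
      HasCompactSupport η → ∀ f : Space N → ℝ, MemH s f → ∀ n x r, 0 < r → r ≤ 1 →
      |scaleAvg (moll n (weakDeriv α f)) η x r| ≤
        l2n η * sobn s f * r ^ (-((s : ℝ) - 1 / 4)) := by
    intro α hα η hη hηs f hf n x r hr hr1
    have hm := hf.memLp_weakDeriv hα
    have hc := (contDiff_moll n hm.locallyIntegrable_two).continuous
    refine (abs_scaleAvg_le (memLp_moll n hm) hc hη hηs x hr hs hr1).trans ?_
    have h1 : l2n (moll n (weakDeriv α f)) ≤ sobn s f :=
      (ENNReal.toReal_mono hm.2.ne (eLpNorm_moll_le n hm)).trans (l2n_weakDeriv_le_sobn f hα)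
    have := l2n_nonneg η
    gcongr
  induction d generalizing α η with
  | zero =>
    refine ⟨l2n η, l2n_nonneg _, fun f hf n x r hr hr1 => ?_⟩
    have hα' : length α = s := by omega
    refine (hbase α (by omega) η hη hηs f hf n x r hr hr1).trans ?_
    rw [hα']
    refine mul_le_mul_of_nonneg_left ?_ (mul_nonneg (l2n_nonneg _) (sobn_nonneg _ _))
    linarith
  | succ d ih =>
    have hηi : ∀ i : Fin N, Continuous fun y : Space N => y i * η y := fun i => by fun_prop
    have hηis : ∀ i : Fin N, HasCompactSupport fun y : Space N => y i * η y := fun i =>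
      hηs.mul_left
    have := fun i => ih (α + Pi.single i 1) (by rw [length_add, length_single]; omega)
      (fun y => y i * η y) (hηi i) (hηis i)
    choose C hC hCb using this
    set b : ℝ := (length α : ℝ) - 1 / 4 with hb
    -- The number |α| − 1/4 is never zero, so the primitive is a power and not a logarithm.
    have hb0 : b ≠ 0 := by
      intro h0
      have h1 : ((4 * length α : ℕ) : ℝ) = (1 : ℕ) := by push_cast; linarith
      have h2 : 4 * length α = 1 := by exact_mod_cast h1
      omega
    have hb1 : 0 < b + 1 := by
      have : (0 : ℝ) ≤ length α := Nat.cast_nonneg _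
      linarith
    have hS : 0 ≤ ∑ i, C i := Finset.sum_nonneg fun i _ => hC i
    refine ⟨l2n η + 2 * (∑ i, C i) * (1 / |b|),
      add_nonneg (l2n_nonneg _) (by positivity), fun f hf n x r hr hr1 => ?_⟩
    have hM := sobn_nonneg s f
    have hsm : ContDiff ℝ ∞ (moll n (weakDeriv α f)) :=
      contDiff_moll n (hf.memLp_weakDeriv (by omega)).locallyIntegrable_two
    have hpd : ∀ i, partialDeriv i (moll n (weakDeriv α f)) =
        moll n (weakDeriv (α + Pi.single i 1) f) := fun i =>
      partialDeriv_moll n (hf.locH.hasWeakDeriv_weakDeriv (by rw [length_single]; omega))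
    have : ∃ B', ∀ i x, |partialDeriv i (moll n (weakDeriv α f)) x| ≤ B' := by
      have h1 : ∀ i, ∃ M, ∀ x, |partialDeriv i (moll n (weakDeriv α f)) x| ≤ M := fun i => by
        rw [hpd]
        exact exists_abs_moll_le n (hf.memLp_weakDeriv (by rw [length_add, length_single]; omega))
      choose M hM using h1
      refine ⟨∑ i, |M i|, fun i x => (hM i x).trans ((le_abs_self _).trans ?_)⟩
      exact Finset.single_le_sum (f := fun i => |M i|) (fun _ _ => abs_nonneg _) (by simp)
    obtain ⟨B', hB'⟩ := this
    have h1 := hbase α (by omega) η hη hηs f hf n x 1 one_pos le_rfl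
    rw [Real.one_rpow, mul_one] at h1
    have key := abs_le_of_abs_deriv_le_rpow (Φ := scaleAvg (moll n (weakDeriv α f)) η x)
      (A := 2 * (∑ i, C i) * sobn s f) hb0
      (fun t => hasDerivAt_scaleAvg hsm hB' hη hηs x t) (fun t ht ht1 => ?_) h1 hr hr1
    · refine key.trans ?_
      have hrb : 0 ≤ r ^ (-b) := Real.rpow_nonneg hr.le _
      have i1 : 2 * (∑ i, C i) * sobn s f / b * (r ^ (-b) - 1) ≤
          2 * (∑ i, C i) * sobn s f * (1 / |b|) * (1 + r ^ (-b)) := by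
        refine (le_abs_self _).trans ?_
        rw [abs_mul, abs_div, abs_of_nonneg (by positivity : 0 ≤ 2 * (∑ i, C i) * sobn s f),
          div_eq_mul_one_div]
        refine mul_le_mul_of_nonneg_left ?_ (by positivity)
        rw [abs_le]; constructor <;> linarith
      have i2 : l2n η * sobn s f ≤ l2n η * sobn s f * (1 + r ^ (-b)) :=
        le_mul_of_one_le_right (mul_nonneg (l2n_nonneg _) hM) (by linarith)
      calc _ ≤ _ := add_le_add i2 i1
        _ = _ := by ring
    · refine (Finset.abs_sum_le_sum_abs _ _).trans ?_
      have ht2 : 1 ≤ t ^ (-b - 1) := Real.one_le_rpow_of_pos_of_le_one_of_nonpos ht ht1 (by linarith)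
      have : ∀ i ∈ Finset.univ, |scaleAvg (partialDeriv i (moll n (weakDeriv α f)))
          (fun y => y i * η y) x t| ≤ C i * (sobn s f * (2 * t ^ (-b - 1))) := by
        intro i _
        rw [hpd]
        refine (hCb i f hf n x t ht ht1).trans ?_
        have e : -(((length (α + Pi.single i 1) : ℕ) : ℝ) - 1 / 4) = -b - 1 := by
          rw [length_add, length_single, hb]; push_cast; ring
        rw [e, mul_assoc]
        refine mul_le_mul_of_nonneg_left (mul_le_mul_of_nonneg_left ?_ hM) (hC i)
        linarith
      refine (Finset.sum_le_sum this).trans_eq ?_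
      rw [← Finset.sum_mul]; ring

/-- The Sobolev embedding of `H^s` into `L^∞` for `s > N / 2`. -/
theorem exists_sobolev {s : ℕ} (hs : N < 2 * s) : ∃ C : ℝ, 0 ≤ C ∧
    ∀ f : Space N → ℝ, MemH s f → MemLp f ∞ ∧ supNorm f ≤ C * sobn s f := by
  have hη := isTest_rho (N := N) 0
  obtain ⟨C, hC, hCb⟩ := exists_abs_scaleAvg_moll_le hs s 0 (by simp) (rho 0) hη.continuous hη.2
  -- The factor 2 bounds 1 + r^{1/4} for r ≤ 1.
  refine ⟨2 * C, by positivity, fun f hf => ?_⟩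
  have hM := sobn_nonneg s f
  have hf2 := hf.memLp_weakDeriv (α := 0) (by simp)
  have h1 : ∀ n x, |moll n (weakDeriv 0 f) x| ≤ 2 * C * sobn s f := by
    intro n x
    have hsm : ContDiff ℝ ∞ (moll n (weakDeriv 0 f)) := contDiff_moll n hf2.locallyIntegrable_two
    -- The scale r tends to 0; at r = 0 the average with the weight `rho 0`, of integral 1, is the
    -- value at x.
    have hc : ContinuousAt (scaleAvg (moll n (weakDeriv 0 f)) (rho 0) x) 0 := by
      have hs1 : 1 ≤ s := by omega
      have : ∃ B', ∀ i x, |partialDeriv i (moll n (weakDeriv 0 f)) x| ≤ B' := by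
        have h1 : ∀ i, ∃ M, ∀ x, |partialDeriv i (moll n (weakDeriv 0 f)) x| ≤ M := fun i => by
          rw [partialDeriv_moll n (hf.locH.hasWeakDeriv_weakDeriv (by simpa using hs1))]
          exact exists_abs_moll_le n (hf.memLp_weakDeriv (by simpa using hs1))
        choose M hM using h1
        refine ⟨∑ i, |M i|, fun i x => (hM i x).trans ((le_abs_self _).trans ?_)⟩
        exact Finset.single_le_sum (f := fun i => |M i|) (fun _ _ => abs_nonneg _) (by simp)
      obtain ⟨B', hB'⟩ := this
      exact (hasDerivAt_scaleAvg hsm hB' hη.continuous hη.2 x 0).continuousAt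
    have e0 : scaleAvg (moll n (weakDeriv 0 f)) (rho 0) x 0 = moll n (weakDeriv 0 f) x := by
      simp only [scaleAvg, zero_smul, add_zero]
      rw [integral_const_mul, integral_rho, mul_one]
    have hc' : Tendsto (fun r => |scaleAvg (moll n (weakDeriv 0 f)) (rho 0) x r|) (𝓝[>] 0)
        (𝓝 |moll n (weakDeriv 0 f) x|) := by
      rw [← e0]
      exact (hc.tendsto.mono_left nhdsWithin_le_nhds).abs
    refine le_of_tendsto hc' ?_
    filter_upwards [Ioo_mem_nhdsGT (zero_lt_one (α := ℝ))] with r hr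
    refine (hCb f hf n x r hr.1 hr.2.le).trans ?_
    have : r ^ (-(((length (0 : Fin N → ℕ) : ℕ) : ℝ) - 1 / 4)) ≤ 1 :=
      Real.rpow_le_one hr.1.le hr.2.le (by simp)
    have h2 : 0 ≤ C * sobn s f := mul_nonneg hC hM
    nlinarith
  have h2 : ∀ᵐ x, |f x| ≤ 2 * C * sobn s f := by
    filter_upwards [tendsto_moll_ae hf2.locallyIntegrable_two,
      weakDeriv_zero_ae_eq hf.locH.l2loc.1] with x hx hx2
    rw [← hx2]
    exact le_of_tendsto hx.abs (Eventually.of_forall fun n => h1 n x)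
  exact ⟨memLp_top_of_bound hf.memLp.1 _ h2, supNorm_le_of_ae_abs_le (by positivity) h2⟩

end Sobolev

end LandauLifshitz
namespace LandauLifshitz

/-! ### Curves of functions: continuity, time derivatives and product estimates. -/

section Curves

variable {N : ℕ} {T : ℝ}

open Classical in
/-- The class in `L²` of a square integrable function. -/
noncomputable def toL2 (f : Space N → ℝ) : Lp ℝ 2 (volume : Measure (Space N)) :=
  if h : MemLp f 2 then h.toLp f else 0

theorem toL2_of_memLp {f : Space N → ℝ} (hf : MemLp f 2) : toL2 f = hf.toLp f := dif_pos hf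

theorem inner_toL2 {f g : Space N → ℝ} (hf : MemLp f 2) (hg : MemLp g 2) :
    inner ℝ (toL2 f) (toL2 g) = ∫ x, f x * g x := by
  rw [toL2_of_memLp hf, toL2_of_memLp hg, L2.inner_def]
  refine integral_congr_ae ?_
  filter_upwards [hf.coeFn_toLp, hg.coeFn_toLp] with x h1 h2
  rw [h1, h2]
  simp [mul_comm]

theorem norm_toL2_sub {f g : Space N → ℝ} (hf : MemLp f 2) (hg : MemLp g 2) :
    ‖toL2 f - toL2 g‖ = l2n (fun x => f x - g x) := by
  rw [toL2_of_memLp hf, toL2_of_memLp hg, ← MemLp.toLp_sub hf hg, Lp.norm_toLp]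
  rfl

/-- Continuity of a curve of square integrable functions. -/
structure ContL2 (T : ℝ) (u : ℝ → Space N → ℝ) : Prop where
  memLp : ∀ t ∈ Icc 0 T, MemLp (u t) 2
  tendsto : ∀ t ∈ Icc 0 T,
    Tendsto (fun s => l2n (fun x => u s x - u t x)) (𝓝[Icc 0 T] t) (𝓝 0)

/-- Continuity of a curve of bounded functions. -/
structure ContSup (T : ℝ) (u : ℝ → Space N → ℝ) : Prop where
  memLp : ∀ t ∈ Icc 0 T, MemLp (u t) ∞
  tendsto : ∀ t ∈ Icc 0 T,
    Tendsto (fun s => supNorm (fun x => u s x - u t x)) (𝓝[Icc 0 T] t) (𝓝 0)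

theorem tendsto_zero_of_le {l : Filter ℝ} {f g : ℝ → ℝ} (h0 : ∀ s, 0 ≤ f s)
    (h : ∀ᶠ s in l, f s ≤ g s) (hg : Tendsto g l (𝓝 0)) : Tendsto f l (𝓝 0) :=
  tendsto_of_tendsto_of_tendsto_of_le_of_le' tendsto_const_nhds hg
    (Eventually.of_forall h0) h

namespace ContL2

variable {u v : ℝ → Space N → ℝ}

theorem continuousOn (hu : ContL2 T u) : ContinuousOn (fun t => toL2 (u t)) (Icc 0 T) := by
  intro t ht
  rw [ContinuousWithinAt, tendsto_iff_norm_sub_tendsto_zero]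
  refine (hu.tendsto t ht).congr' ?_
  filter_upwards [self_mem_nhdsWithin] with s hs
  rw [norm_toL2_sub (hu.memLp s hs) (hu.memLp t ht)]

theorem congr (hu : ContL2 T u) (h : ∀ t ∈ Icc 0 T, u t =ᵐ[volume] v t) : ContL2 T v := by
  refine ⟨fun t ht => (hu.1 t ht).ae_eq (h t ht), fun t ht => (hu.2 t ht).congr' ?_⟩
  filter_upwards [self_mem_nhdsWithin] with s hs
  refine l2n_congr ?_
  filter_upwards [h s hs, h t ht] with x h1 h2
  rw [h1, h2]

theorem add (hu : ContL2 T u) (hv : ContL2 T v) : ContL2 T fun t x => u t x + v t x := by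
  refine ⟨fun t ht => (hu.1 t ht).add (hv.1 t ht), fun t ht => ?_⟩
  refine tendsto_zero_of_le (fun _ => l2n_nonneg _) ?_
    (by simpa using (hu.2 t ht).add (hv.2 t ht))
  filter_upwards [self_mem_nhdsWithin] with s hs
  have e : (fun x => u s x + v s x - (u t x + v t x)) =
    fun x => (u s x - u t x) + (v s x - v t x) := by ext x; ring
  rw [e]
  exact l2n_add_le ((hu.1 s hs).sub (hu.1 t ht)) ((hv.1 s hs).sub (hv.1 t ht))

theorem const_mul (hu : ContL2 T u) (c : ℝ) : ContL2 T fun t x => c * u t x := by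
  refine ⟨fun t ht => (hu.1 t ht).const_mul c, fun t ht => ?_⟩
  have e : ∀ s, (fun x => c * u s x - c * u t x) = fun x => c * (u s x - u t x) := by
    intro s; ext x; ring
  simp only [e, l2n_const_mul]
  simpa using (hu.2 t ht).const_mul |c|

theorem sub (hu : ContL2 T u) (hv : ContL2 T v) : ContL2 T fun t x => u t x - v t x := by
  simpa [sub_eq_add_neg] using hu.add (hv.const_mul (-1))

theorem zero : ContL2 T fun _ (_ : Space N) => 0 :=
  ⟨fun _ _ => MemLp.zero', fun t _ => by simpa [l2n] using tendsto_const_nhds⟩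

theorem sum {ι : Type*} (s : Finset ι) {u : ι → ℝ → Space N → ℝ}
    (h : ∀ i ∈ s, ContL2 T (u i)) : ContL2 T fun t x => ∑ i ∈ s, u i t x := by
  classical
  induction s using Finset.induction_on with
  | empty => simpa using zero
  | insert a s ha ih =>
    simp only [Finset.sum_insert ha]
    exact (h a (by simp)).add (ih fun i hi => h i (by simp [hi]))

theorem continuousOn_integral_mul (hu : ContL2 T u) (hv : ContL2 T v) :
    ContinuousOn (fun t => ∫ x, u t x * v t x) (Icc 0 T) :=
  (hu.continuousOn.inner hv.continuousOn (𝕜 := ℝ)).congr fun t ht =>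
    (inner_toL2 (hu.1 t ht) (hv.1 t ht)).symm

theorem sup_mul (hu : ContSup T u) (hv : ContL2 T v) : ContL2 T fun t x => u t x * v t x := by
  refine ⟨fun t ht => memLp_bdd_mul (hu.1 t ht) (hv.1 t ht), fun t ht => ?_⟩
  refine tendsto_zero_of_le (fun _ => l2n_nonneg _)
    (g := fun s => supNorm (fun x => u s x - u t x) *
      (l2n (fun x => v s x - v t x) + l2n (v t)) +
      supNorm (u t) * l2n (fun x => v s x - v t x)) ?_ ?_
  · filter_upwards [self_mem_nhdsWithin] with s hs
    have e : (fun x => u s x * v s x - u t x * v t x) =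
      fun x => (u s x - u t x) * v s x + u t x * (v s x - v t x) := by ext x; ring
    have e2 : v s = fun x => (v s x - v t x) + v t x := by ext x; ring
    rw [e]
    have hud := (hu.1 s hs).sub (hu.1 t ht)
    have hvd := (hv.1 s hs).sub (hv.1 t ht)
    refine (l2n_add_le (memLp_bdd_mul hud (hv.1 s hs)) (memLp_bdd_mul (hu.1 t ht) hvd)).trans
      (add_le_add ((l2n_bdd_mul_le hud (hv.1 s hs)).trans ?_)
        (l2n_bdd_mul_le (hu.1 t ht) hvd))
    refine mul_le_mul_of_nonneg_left ?_ (supNorm_nonneg _)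
    conv_lhs => rw [e2]
    exact l2n_add_le hvd (hv.1 t ht)
  · have h1 := (hu.2 t ht).mul ((hv.2 t ht).add_const (l2n (v t)))
    have h2 := (hv.2 t ht).const_mul (supNorm (u t))
    simpa using h1.add h2

end ContL2

theorem IsTest.memLp_two {φ : Space N → ℝ} (hφ : IsTest φ) : MemLp φ 2 :=
  hφ.continuous.memLp_of_hasCompactSupport hφ.2

theorem IsTest.memLp_top {φ : Space N → ℝ} (hφ : IsTest φ) : MemLp φ ∞ :=
  hφ.continuous.memLp_of_hasCompactSupport hφ.2

/-- A curve whose time derivative in the sense of distributions is continuous with values in `L²` is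
differentiable with values in `L²`. -/
theorem hasDerivWithinAt_toL2 {u v : ℝ → Space N → ℝ} (hT : 0 < T)
    (hu : ∀ t ∈ Icc 0 T, MemLp (u t) 2) (hv : ContL2 T v) (huv : IsTimeDeriv T u v) :
    ∀ t ∈ Icc 0 T, HasDerivWithinAt (fun t => toL2 (u t)) (toL2 (v t)) (Icc 0 T) t := by
  -- The velocity is extended continuously to the whole line so that its primitive U is
  -- differentiable everywhere. It then remains to identify U with u on [0, T].
  set V : ℝ → Lp ℝ 2 (volume : Measure (Space N)) :=
    IccExtend hT.le ((Icc 0 T).domRestrict fun t => toL2 (v t)) with hVdef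
  have hVc : Continuous V := (continuousOn_iff_continuous_domRestrict.1 hv.continuousOn).Icc_extend'
  have hV : ∀ t ∈ Icc 0 T, V t = toL2 (v t) := fun t ht => by
    rw [hVdef, IccExtend_of_mem _ _ ht]; rfl
  set U : ℝ → Lp ℝ 2 (volume : Measure (Space N)) := fun t => toL2 (u 0) + ∫ s in (0 : ℝ)..t, V s
    with hUdef
  have hU : ∀ t, HasDerivAt U (V t) t := fun t =>
    (intervalIntegral.integral_hasDerivAt_right (hVc.intervalIntegrable _ _)
      (hVc.stronglyMeasurableAtFilter _ _) hVc.continuousAt).const_add _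
  have h0 : (0 : ℝ) ∈ Icc 0 T := ⟨le_rfl, hT.le⟩
  have key : ∀ t ∈ Icc 0 T, U t = toL2 (u t) := by
    intro t ht
    -- Against a test function, U and u have the same derivative on [0, T] and the same initial
    -- value. Test functions separate the elements of L².
    have horth : ∀ φ : Space N → ℝ, IsTest φ →
        inner ℝ (toL2 φ) (U t - toL2 (u t)) = 0 := by
      intro φ hφ
      have hd : ∀ s ∈ Icc 0 T, HasDerivWithinAt
          (fun s => inner ℝ (toL2 φ) (U s) - ∫ x, φ x • u s x) 0 (Icc 0 T) s := by
        intro s hs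
        have h1 := (hasDerivWithinAt_const s (Icc 0 T) (toL2 φ)).inner ℝ
          ((hU s).hasDerivWithinAt (s := Icc 0 T))
        have h2 := h1.sub (huv φ hφ s hs)
        refine h2.congr_deriv ?_
        rw [hV s hs, inner_toL2 hφ.memLp_two (hv.1 s hs)]
        simp
      have hc := constant_of_derivWithin_zero (fun s hs => (hd s hs).differentiableWithinAt)
        (fun s hs => (hd s (Ico_subset_Icc_self hs)).derivWithin
          (uniqueDiffOn_Icc hT s (Ico_subset_Icc_self hs))) t ht
      have hU0 : U 0 = toL2 (u 0) := by simp [hUdef]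
      rw [hU0, inner_toL2 hφ.memLp_two (hu 0 h0)] at hc
      simp only [smul_eq_mul, sub_self] at hc
      rw [inner_sub_right, inner_toL2 hφ.memLp_two (hu t ht)]
      exact hc
    have hz : U t - toL2 (u t) = 0 := by
      have hl : LocallyIntegrable (U t - toL2 (u t) : Lp ℝ 2 (volume : Measure (Space N))) :=
        (Lp.memLp (U t - toL2 (u t))).locallyIntegrable_two
      rw [Lp.eq_zero_iff_ae_eq_zero]
      refine ae_eq_of_forall_test hl (locallyIntegrable_const 0) fun φ hφ => ?_
      have h1 := horth φ hφ
      rw [toL2_of_memLp hφ.memLp_two, L2.inner_def] at h1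
      simp only [Pi.zero_apply, smul_zero, integral_zero]
      rw [← h1]
      refine integral_congr_ae ?_
      filter_upwards [hφ.memLp_two.coeFn_toLp] with x hx
      rw [hx]
      simp [mul_comm]
    exact sub_eq_zero.1 hz
  intro t ht
  rw [← hV t ht]
  exact ((hU t).hasDerivWithinAt (s := Icc 0 T)).congr (fun s hs => (key s hs).symm)
    (key t ht).symm

theorem hasDerivWithinAt_integral_mul {u u' v v' : ℝ → Space N → ℝ} (hT : 0 < T)
    (hu : ∀ t ∈ Icc 0 T, MemLp (u t) 2) (hu' : ContL2 T u') (huu : IsTimeDeriv T u u')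
    (hv : ∀ t ∈ Icc 0 T, MemLp (v t) 2) (hv' : ContL2 T v') (hvv : IsTimeDeriv T v v') :
    ∀ t ∈ Icc 0 T, HasDerivWithinAt (fun t => ∫ x, u t x * v t x)
      ((∫ x, u t x * v' t x) + ∫ x, u' t x * v t x) (Icc 0 T) t := by
  intro t ht
  have h := (hasDerivWithinAt_toL2 hT hu hu' huu t ht).inner ℝ
    (hasDerivWithinAt_toL2 hT hv hv' hvv t ht)
  rw [inner_toL2 (hu t ht) (hv'.1 t ht), inner_toL2 (hu'.1 t ht) (hv t ht)] at h
  exact h.congr (fun s hs => (inner_toL2 (hu s hs) (hv s hs)).symm)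
    (inner_toL2 (hu t ht) (hv t ht)).symm

theorem hasDerivWithinAt_integral_sq {u v : ℝ → Space N → ℝ} (hT : 0 < T)
    (hu : ∀ t ∈ Icc 0 T, MemLp (u t) 2) (hv : ContL2 T v) (huv : IsTimeDeriv T u v) :
    ∀ t ∈ Icc 0 T, HasDerivWithinAt (fun t => ∫ x, u t x ^ 2) (2 * ∫ x, u t x * v t x)
      (Icc 0 T) t := by
  intro t ht
  have h := hasDerivWithinAt_integral_mul hT hu hv huv hu hv huv t ht
  simp only [← sq] at h
  refine h.congr_deriv ?_
  simp only [mul_comm (v t _)]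
  ring

theorem IsTimeDeriv.weakDeriv {u v : ℝ → Space N → ℝ} (huv : IsTimeDeriv T u v) {s : ℕ}
    {α : Fin N → ℕ} (hα : length α ≤ s) (hu : ∀ t ∈ Icc 0 T, LocH s (u t))
    (hv : ∀ t ∈ Icc 0 T, LocH s (v t)) :
    IsTimeDeriv T (fun t => LandauLifshitz.weakDeriv α (u t))
      (fun t => LandauLifshitz.weakDeriv α (v t)) := by
  intro φ hφ t ht
  have e : ∀ (f : Space N → ℝ), LocH s f → ∫ x, φ x • LandauLifshitz.weakDeriv α f x =
      (-1) ^ length α * ∫ x, multiDeriv α φ x • f x := by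
    intro f hf
    rw [(hf.hasWeakDeriv hα).3 φ hφ, smul_eq_mul, ← mul_assoc, ← mul_pow]
    norm_num
  rw [e _ (hv t ht)]
  exact ((huv _ (hφ.multiDeriv α) t ht).const_mul _).congr (fun s hs => e _ (hu s hs))
    (e _ (hu t ht))

theorem IsTimeDeriv.congr {u u' v v' : ℝ → Space N → ℝ} (huv : IsTimeDeriv T u v)
    (hu : ∀ t ∈ Icc 0 T, u t =ᵐ[volume] u' t) (hv : ∀ t ∈ Icc 0 T, v t =ᵐ[volume] v' t) :
    IsTimeDeriv T u' v' := by
  intro φ hφ t ht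
  have e : ∀ {f g : Space N → ℝ}, f =ᵐ[volume] g → ∫ x, φ x • g x = ∫ x, φ x • f x :=
    fun h => integral_congr_ae (h.mono fun x hx => by simp [hx])
  rw [e (hv t ht)]
  exact (huv φ hφ t ht).congr (fun s hs => e (hu s hs)) (e (hu t ht))

theorem IsTimeDeriv.add {u u' v v' : ℝ → Space N → ℝ} (h1 : IsTimeDeriv T u v)
    (h2 : IsTimeDeriv T u' v') (lu : ∀ t ∈ Icc 0 T, LocallyIntegrable (u t))
    (lu' : ∀ t ∈ Icc 0 T, LocallyIntegrable (u' t)) (lv : ∀ t ∈ Icc 0 T, LocallyIntegrable (v t))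
    (lv' : ∀ t ∈ Icc 0 T, LocallyIntegrable (v' t)) :
    IsTimeDeriv T (fun t x => u t x + u' t x) (fun t x => v t x + v' t x) := by
  intro φ hφ t ht
  have e : ∀ {f g : Space N → ℝ}, LocallyIntegrable f → LocallyIntegrable g →
      ∫ x, φ x • (f x + g x) = (∫ x, φ x • f x) + ∫ x, φ x • g x := fun hf hg => by
    simp only [smul_add]
    exact integral_add (hφ.integrable_smul hf) (hφ.integrable_smul hg)
  rw [e (lv t ht) (lv' t ht)]
  exact ((h1 φ hφ t ht).add (h2 φ hφ t ht)).congr (fun s hs => e (lu s hs) (lu' s hs))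
    (e (lu t ht) (lu' t ht))

theorem IsTimeDeriv.const_mul {u v : ℝ → Space N → ℝ} (h : IsTimeDeriv T u v) (c : ℝ) :
    IsTimeDeriv T (fun t x => c * u t x) (fun t x => c * v t x) := by
  intro φ hφ t ht
  have e : ∀ f : Space N → ℝ, ∫ x, φ x • (c * f x) = c * ∫ x, φ x • f x := fun f => by
    rw [← integral_const_mul]
    congr 1; ext x; simp only [smul_eq_mul]; ring
  simp only [e]
  exact (h φ hφ t ht).const_mul c

/-- The product rule for time derivatives in the sense of distributions. -/
theorem IsTimeDeriv.mul {a a' b b' : ℝ → Space N → ℝ} (hT : 0 < T)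
    (ha : ∀ t ∈ Icc 0 T, L2loc (a t)) (ha' : ContL2 T a') (haa : IsTimeDeriv T a a')
    (hb : ∀ t ∈ Icc 0 T, MemLp (b t) 2) (hb' : ContL2 T b') (hbb : IsTimeDeriv T b b') :
    IsTimeDeriv T (fun t x => a t x * b t x) (fun t x => a t x * b' t x + a' t x * b t x) := by
  intro φ hφ t ht
  have hsup : ContSup T (fun _ : ℝ => φ) := ⟨fun _ _ => hφ.memLp_top, fun t _ => by
    have h : supNorm (fun x => φ x - φ x) = 0 :=
      le_antisymm (supNorm_le_of_ae_abs_le le_rfl (by simp)) (supNorm_nonneg _)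
    simp only [h, tendsto_const_nhds]⟩
  -- The test function is attached to the factor a, which only has to be locally square integrable;
  -- φa is then globally in L². This accommodates the component of m that is merely bounded.
  have h1 := hasDerivWithinAt_integral_mul hT (u := fun t x => φ x * a t x)
    (u' := fun t x => φ x * a' t x) (fun t ht => (ha t ht).test_mul hφ)
    (ContL2.sup_mul hsup ha') (fun ψ hψ s hs => by
      have h2 : IsTest fun x => ψ x * φ x := ⟨hψ.1.mul hφ.1, hψ.2.mul_right⟩
      have := haa _ h2 s hs
      simpa only [smul_eq_mul, mul_assoc] using this) hb hb' hbb t ht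
  simp only [smul_eq_mul, mul_add]
  have i1 : Integrable fun x => φ x * (a t x * b' t x) :=
    hφ.integrable_smul ((ha t ht).mul (hb'.1 t ht).l2loc)
  have i2 : Integrable fun x => φ x * (a' t x * b t x) :=
    hφ.integrable_smul ((ha'.1 t ht).l2loc.mul (hb t ht).l2loc)
  rw [integral_add i1 i2]
  simpa only [mul_assoc] using h1

/-- Continuity of a curve of bounded functions with square integrable weak derivatives. -/
structure ContBddH (s : ℕ) (T : ℝ) (u : ℝ → Space N → ℝ) : Prop where
  bddH : ∀ t ∈ Icc 0 T, BddH s (u t)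
  contSup : ContSup T u
  contL2 : ∀ α : Fin N → ℕ, 1 ≤ length α → length α ≤ s → ContL2 T fun t => weakDeriv α (u t)

namespace ContBddH

variable {s : ℕ} {u v : ℝ → Space N → ℝ}

theorem mono {s' : ℕ} (hu : ContBddH s T u) (h : s' ≤ s) : ContBddH s' T u :=
  ⟨fun t ht => (hu.1 t ht).mono h, hu.2, fun α h1 h2 => hu.3 α h1 (h2.trans h)⟩

theorem tendsto_hsn (hu : ContBddH s T u) {r : ℕ} (hr : 1 ≤ r) (hrs : r ≤ s) {t : ℝ}
    (ht : t ∈ Icc 0 T) :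
    Tendsto (fun τ => hsn r (fun x => u τ x - u t x)) (𝓝[Icc 0 T] t) (𝓝 0) := by
  have h : Tendsto (fun τ => ∑ α ∈ indices N r,
      l2n (fun x => weakDeriv α (u τ) x - weakDeriv α (u t) x)) (𝓝[Icc 0 T] t)
      (𝓝 (∑ α ∈ indices N r, 0)) := tendsto_finsetSum _ fun α hα => by
    rw [mem_indices] at hα
    exact (hu.3 α (by omega) (by omega)).2 t ht
  rw [Finset.sum_const_zero] at h
  refine h.congr' ?_
  filter_upwards [self_mem_nhdsWithin] with τ hτ
  refine Finset.sum_congr rfl fun α hα => ?_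
  rw [mem_indices] at hα
  exact (l2n_congr (((hu.1 τ hτ).2 α (by omega) (by omega)).sub
    ((hu.1 t ht).2 α (by omega) (by omega))).weakDeriv_ae_eq).symm

/-- Moser's inequality is applied to both terms of the splitting of the difference of products into
(u_τ − u_t) v_τ and u_t (v_τ − v_t). Norms of v_τ are controlled by those of v_t and of v_τ − v_t.
-/
theorem contL2_mul (hu : ContBddH s T u) (hv : ContBddH s T v) {β γ : Fin N → ℕ}
    (h1 : 1 ≤ length β + length γ) (h2 : length β + length γ ≤ s) :
    ContL2 T fun t x => weakDeriv β (u t) x * weakDeriv γ (v t) x := by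
  set r := length β + length γ with hr
  have Hu := fun t ht => (hu.1 t ht).mono h2
  have Hv := fun t ht => (hv.1 t ht).mono h2
  refine ⟨fun t ht => (Hu t ht).memLp_mul_weakDeriv (Hv t ht) h1 hr.symm, fun t ht => ?_⟩
  set C := moserConst N r
  set du := fun τ => supNorm (fun x => u τ x - u t x)
  set dv := fun τ => supNorm (fun x => v τ x - v t x)
  set Du := fun τ => hsn r (fun x => u τ x - u t x)
  set Dv := fun τ => hsn r (fun x => v τ x - v t x)
  refine tendsto_zero_of_le (fun _ => l2n_nonneg _)
    (g := fun τ => C * (du τ * (Dv τ + hsn r (v t)) + Du τ * (dv τ + supNorm (v t))) +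
      C * (supNorm (u t) * Dv τ + hsn r (u t) * dv τ)) ?_ ?_
  · filter_upwards [self_mem_nhdsWithin] with τ hτ
    have hud := (Hu τ hτ).sub (Hu t ht)
    have hvd := (Hv τ hτ).sub (Hv t ht)
    have a1 : weakDeriv β (fun x => u τ x - u t x) =ᵐ[volume]
        fun x => weakDeriv β (u τ) x - weakDeriv β (u t) x :=
      (((Hu τ hτ).locH.hasWeakDeriv (by omega)).sub
        ((Hu t ht).locH.hasWeakDeriv (by omega))).weakDeriv_ae_eq
    have a2 : weakDeriv γ (fun x => v τ x - v t x) =ᵐ[volume]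
        fun x => weakDeriv γ (v τ) x - weakDeriv γ (v t) x :=
      (((Hv τ hτ).locH.hasWeakDeriv (by omega)).sub
        ((Hv t ht).locH.hasWeakDeriv (by omega))).weakDeriv_ae_eq
    have e : (fun x => weakDeriv β (u τ) x * weakDeriv γ (v τ) x -
          weakDeriv β (u t) x * weakDeriv γ (v t) x) =ᵐ[volume]
        fun x => weakDeriv β (fun x => u τ x - u t x) x * weakDeriv γ (v τ) x +
          weakDeriv β (u t) x * weakDeriv γ (fun x => v τ x - v t x) x := by
      filter_upwards [a1, a2] with x h1 h2
      rw [h1, h2]; ring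
    rw [l2n_congr e]
    refine (l2n_add_le (hud.memLp_mul_weakDeriv (Hv τ hτ) h1 hr.symm)
      ((Hu t ht).memLp_mul_weakDeriv hvd h1 hr.symm)).trans (add_le_add
      ((hud.l2n_mul_weakDeriv_le (Hv τ hτ) h1 hr.symm).trans ?_)
      ((Hu t ht).l2n_mul_weakDeriv_le hvd h1 hr.symm))
    have e2 : v τ = fun x => (v τ x - v t x) + v t x := by ext x; ring
    have b1 : hsn r (v τ) ≤ Dv τ + hsn r (v t) := by
      conv_lhs => rw [e2]
      exact hvd.hsn_add_le (Hv t ht) h1 le_rfl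
    have b2 : supNorm (v τ) ≤ dv τ + supNorm (v t) := by
      conv_lhs => rw [e2]
      exact supNorm_add_le hvd.1 (Hv t ht).1
    refine mul_le_mul_of_nonneg_left (add_le_add ?_ ?_) (moserConst_nonneg _ _)
    · exact mul_le_mul_of_nonneg_left b1 (supNorm_nonneg _)
    · exact mul_le_mul_of_nonneg_left b2 (hsn_nonneg _ _)
  · have l1 := hu.2.2 t ht
    have l2 := hv.2.2 t ht
    have l3 := hu.tendsto_hsn h1 h2 ht
    have l4 := hv.tendsto_hsn h1 h2 ht
    have := (((l1.mul (l4.add_const (hsn r (v t)))).add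
      (l3.mul (l2.add_const (supNorm (v t))))).const_mul C).add
      (((l4.const_mul (supNorm (u t))).add (l2.const_mul (hsn r (u t)))).const_mul C)
    simpa using this

theorem contL2_weakDeriv_mul (hu : ContBddH s T u) (hv : ContBddH s T v) {α β γ : Fin N → ℕ}
    (h1 : 1 ≤ length α + length β + length γ) (h2 : length α + length β + length γ ≤ s) :
    ContL2 T fun t => weakDeriv α fun x => weakDeriv β (u t) x * weakDeriv γ (v t) x := by
  refine (ContL2.sum (Finset.Iic α) fun δ hδ =>
    (hu.contL2_mul hv (β := β + δ) (γ := γ + (α - δ)) ?_ ?_).const_mul (leibCoeff α δ)).congr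
    fun t ht => ?_
  · have := length_add_length_sub (Finset.mem_Iic.1 hδ)
    rw [length_add, length_add]; omega
  · have := length_add_length_sub (Finset.mem_Iic.1 hδ)
    rw [length_add, length_add]; omega
  · exact (LocH.leibniz_weakDeriv ((hu.1 t ht).locH.mono (by omega))
      ((hv.1 t ht).locH.mono (by omega))).weakDeriv_ae_eq.symm

end ContBddH

/-- Continuity of a curve with values in `H^s`. -/
structure ContH (s : ℕ) (T : ℝ) (u : ℝ → Space N → ℝ) : Prop where
  memH : ∀ t ∈ Icc 0 T, MemH s (u t)
  contL2 : ∀ α : Fin N → ℕ, length α ≤ s → ContL2 T fun t => weakDeriv α (u t)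

namespace ContH

variable {s : ℕ} {u v : ℝ → Space N → ℝ}

theorem contSup (hu : ContH s T u) (hs : N < 2 * s) : ContSup T u := by
  obtain ⟨C, hC, hCb⟩ := exists_sobolev hs
  refine ⟨fun t ht => (hCb _ (hu.1 t ht)).1, fun t ht => ?_⟩
  refine tendsto_zero_of_le (fun _ => supNorm_nonneg _)
    (g := fun τ => C * ∑ j ∈ Finset.range (s + 1), ∑ α ∈ indices N j,
      l2n (fun x => weakDeriv α (u τ) x - weakDeriv α (u t) x)) ?_ ?_
  · filter_upwards [self_mem_nhdsWithin] with τ hτ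
    refine (hCb _ ((hu.1 τ hτ).sub (hu.1 t ht))).2.trans_eq ?_
    congr 1
    refine Finset.sum_congr rfl fun j hj => Finset.sum_congr rfl fun α hα => ?_
    rw [mem_indices] at hα
    have hj' : j ≤ s := by simpa [Nat.lt_succ_iff] using hj
    exact l2n_congr (((hu.1 τ hτ).locH.hasWeakDeriv (by omega)).sub
      ((hu.1 t ht).locH.hasWeakDeriv (by omega))).weakDeriv_ae_eq
  · have : Tendsto (fun τ => C * ∑ j ∈ Finset.range (s + 1), ∑ α ∈ indices N j,
      l2n (fun x => weakDeriv α (u τ) x - weakDeriv α (u t) x)) (𝓝[Icc 0 T] t)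
      (𝓝 (C * ∑ j ∈ Finset.range (s + 1), ∑ α ∈ indices N j, 0)) := by
      refine (tendsto_finsetSum _ fun j hj => tendsto_finsetSum _ fun α hα => ?_).const_mul C
      rw [mem_indices] at hα
      have hj' : j ≤ s := by simpa [Nat.lt_succ_iff] using hj
      exact (hu.2 α (by omega)).2 t ht
    simpa using this

theorem contBddH (hu : ContH s T u) (hs : N < 2 * s) : ContBddH s T u :=
  ⟨fun t ht => (hu.1 t ht).bddH ((hu.contSup hs).1 t ht), hu.contSup hs,
    fun α _ h => hu.2 α h⟩

theorem of_weakDeriv {r : ℕ} {α : Fin N → ℕ} (hu : ContH s T u) (h : length α + r ≤ s) :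
    ContH r T fun t => weakDeriv α (u t) :=
  ⟨fun t ht => (hu.1 t ht).of_weakDeriv h, fun β hβ =>
    (hu.2 (α + β) (by rw [length_add]; omega)).congr fun t ht =>
      ((hu.1 t ht).locH.weakDeriv_weakDeriv (by omega)).symm⟩

end ContH

end Curves

end LandauLifshitz
namespace LandauLifshitz

/-! ### Reduction to scalar components. -/

section Components

variable {N : ℕ} {T : ℝ}

theorem eLpNorm_weakDeriv_le_hNorm {F : Type*} [NormedAddCommGroup F] [NormedSpace ℝ F]
    {k : ℕ} {α : Fin N → ℕ} (h : length α ≤ k) (f : Space N → F) :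
    eLpNorm (weakDeriv α f) 2 volume ≤ hNorm k f := by
  have h1 : eLpNorm (weakDeriv α f) 2 volume ^ 2 ≤
      ∑ j ∈ Finset.range (k + 1), ∑ α ∈ Finset.piAntidiag (Finset.univ : Finset (Fin N)) j,
        eLpNorm (weakDeriv α f) 2 volume ^ 2 := by
    refine le_trans ?_ (Finset.single_le_sum (f := fun j =>
      ∑ α ∈ Finset.piAntidiag (Finset.univ : Finset (Fin N)) j,
        eLpNorm (weakDeriv α f) 2 volume ^ 2) (fun _ _ => zero_le)
        (Finset.mem_range.2 (Nat.lt_succ_of_le h)))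
    exact Finset.single_le_sum (f := fun α => eLpNorm (weakDeriv α f) 2 volume ^ 2)
      (fun _ _ => zero_le) (mem_indices.2 rfl)
  refine le_trans (le_of_eq ?_) (ENNReal.rpow_le_rpow h1 (by norm_num : (0 : ℝ) ≤ 1 / 2))
  rw [← ENNReal.rpow_natCast, ← ENNReal.rpow_mul]
  norm_num

theorem le_rpow_half_of_sq_le {a b : ℝ≥0∞} (h : a ^ 2 ≤ b) : a ≤ b ^ (1 / 2 : ℝ) := by
  refine le_trans (le_of_eq ?_) (ENNReal.rpow_le_rpow h (by norm_num : (0 : ℝ) ≤ 1 / 2))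
  rw [← ENNReal.rpow_natCast, ← ENNReal.rpow_mul]
  norm_num

theorem hNorm_comp_le_zNorm {k : ℕ} (v : Space N → Vec3) {c : Fin 3} (hc : c ≠ 1) :
    hNorm k (comp c v) ≤ zNorm k v := by
  refine le_rpow_half_of_sq_le ?_
  fin_cases c
  · simp only [add_assoc]; exact le_self_add
  · exact absurd rfl hc
  · exact le_add_self

theorem eLpNorm_comp_one_le_zNorm (k : ℕ) (v : Space N → Vec3) :
    eLpNorm (comp 1 v) ∞ volume ≤ zNorm k v := by
  refine le_rpow_half_of_sq_le ?_
  rw [add_assoc, add_right_comm]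
  exact le_add_self

theorem hNorm_weakPartial_le_zNorm (k : ℕ) (v : Space N → Vec3) (i : Fin N) :
    hNorm (k - 1) (weakPartial i (comp 1 v)) ≤ zNorm k v := by
  refine le_rpow_half_of_sq_le ?_
  refine le_trans ?_ le_self_add
  refine le_trans ?_ le_add_self
  exact Finset.single_le_sum (f := fun i => hNorm (k - 1) (weakPartial i (comp 1 v)) ^ 2)
    (fun _ _ => zero_le) (Finset.mem_univ i)

theorem tendsto_toReal_zero {l : Filter ℝ} {f g : ℝ → ℝ≥0∞} (h : ∀ᶠ s in l, f s ≤ g s)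
    (hg : Tendsto g l (𝓝 0)) : Tendsto (fun s => (f s).toReal) l (𝓝 0) := by
  have h1 : Tendsto f l (𝓝 0) := tendsto_of_tendsto_of_tendsto_of_le_of_le' tendsto_const_nhds hg
    (Eventually.of_forall fun _ => zero_le) h
  simpa [Function.comp_def] using (ENNReal.tendsto_toReal ENNReal.zero_ne_top).comp h1

theorem MemEnergySet.exists_hasWeakDeriv {k : ℕ} {v : Space N → Vec3} (hv : MemEnergySet k v)
    {α : Fin N → ℕ} (h1 : 1 ≤ length α) (h2 : length α ≤ k) :
    ∃ g, HasWeakDeriv α v g ∧ MemLp g 2 := by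
  obtain ⟨i, β, rfl⟩ := exists_eq_add_single h1
  rw [length_add, length_single] at h2
  obtain ⟨⟨g, hg⟩, hm⟩ := hv.grad i
  obtain ⟨u, hu, hu2⟩ := hm β (by omega)
  refine ⟨u, ?_, hu2⟩
  rw [add_comm]
  exact hg.weakDeriv.trans hu

theorem MemLp.comp_vec {v : Space N → Vec3} {p : ℝ≥0∞} (hv : MemLp v p) (c : Fin 3) :
    MemLp (comp c v) p := (EuclideanSpace.proj c : Vec3 →L[ℝ] ℝ).comp_memLp' hv

theorem MemEnergySet.locallyIntegrable_comp {k : ℕ} {v : Space N → Vec3} (hv : MemEnergySet k v)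
    (c : Fin 3) : LocallyIntegrable (comp c v) :=
  ((HasWeakDeriv.zero_index hv.1).comp c).1

theorem MemEnergySet.bddH {k : ℕ} {v : Space N → Vec3} (hv : MemEnergySet k v) (c : Fin 3) :
    BddH k (comp c v) := by
  refine ⟨?_, fun α h1 h2 => ?_, fun α h1 h2 => ?_⟩
  · refine memLp_top_of_bound (hv.locallyIntegrable_comp c).aestronglyMeasurable 1 ?_
    filter_upwards [hv.sphere] with x hx
    exact (PiLp.norm_apply_le (v x) c).trans hx.le
  · obtain ⟨g, hg, -⟩ := hv.exists_hasWeakDeriv h1 h2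
    exact (hg.comp c).weakDeriv
  · obtain ⟨g, hg, hg2⟩ := hv.exists_hasWeakDeriv h1 h2
    exact (MemLp.comp_vec hg2 c).ae_eq (hg.comp c).weakDeriv_ae_eq.symm

theorem MemH.comp {k : ℕ} {v : Space N → Vec3} (hv : MemH k v) (c : Fin 3) :
    MemH k (comp c v) := fun α hα => by
  obtain ⟨g, hg, hg2⟩ := hv α hα
  exact ⟨_, hg.comp c, MemLp.comp_vec hg2 c⟩

theorem IsTimeDeriv.comp {m w : ℝ → Space N → Vec3} (h : IsTimeDeriv T m w)
    (hm : ∀ t ∈ Icc 0 T, LocallyIntegrable (m t)) (hw : ∀ t ∈ Icc 0 T, LocallyIntegrable (w t))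
    (c : Fin 3) :
    IsTimeDeriv T (fun t => LandauLifshitz.comp c (m t)) fun t => LandauLifshitz.comp c (w t) := by
  intro φ hφ t ht
  have e : ∀ v : Space N → Vec3, LocallyIntegrable v →
      ∫ x, φ x • LandauLifshitz.comp c v x =
        (EuclideanSpace.proj c : Vec3 →L[ℝ] ℝ) (∫ x, φ x • v x) := fun v hv => by
    rw [← ContinuousLinearMap.integral_comp_comm _ (hφ.integrable_smul hv)]
    rfl
  rw [e _ (hw t ht)]
  exact ((EuclideanSpace.proj c : Vec3 →L[ℝ] ℝ).hasFDerivAt.comp_hasDerivWithinAt t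
    (h φ hφ t ht)).congr (fun s hs => e _ (hm s hs)) (e _ (hm t ht))

/-- The component of index 1 is controlled in L² only after differentiation, hence the alternative
in the hypothesis. -/
theorem ContInEnergySet.contL2 {k : ℕ} {m : ℝ → Space N → Vec3} (h : ContInEnergySet k T m)
    {c : Fin 3} {α : Fin N → ℕ} (h2 : length α ≤ k) (h1 : c ≠ 1 ∨ 1 ≤ length α) :
    ContL2 T fun t => weakDeriv α (comp c (m t)) := by
  have hm : ∀ t ∈ Icc 0 T, MemLp (weakDeriv α (comp c (m t))) 2 := fun t ht => by
    rcases Nat.eq_zero_or_pos (length α) with h0 | h0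
    · rw [length_eq_zero.1 h0]
      have hc : MemLp (comp c (m t)) 2 := by
        fin_cases c
        · exact (h.mem t ht).memLp_one
        · simp [h0] at h1
        · exact (h.mem t ht).memLp_three
      exact hc.ae_eq (weakDeriv_zero_ae_eq ((h.mem t ht).locallyIntegrable_comp c)).symm
    · exact ((h.mem t ht).bddH c).memLp α h0 h2
  refine ⟨hm, fun t ht => ?_⟩
  refine tendsto_toReal_zero ?_ (h.tendsto t ht)
  filter_upwards [self_mem_nhdsWithin] with s hs
  have e : (fun x => weakDeriv α (comp c (m s)) x - weakDeriv α (comp c (m t)) x) =ᵐ[volume]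
      weakDeriv α (comp c fun x => m s x - m t x) :=
    ((((h.mem s hs).bddH c).locH.hasWeakDeriv h2).sub
      (((h.mem t ht).bddH c).locH.hasWeakDeriv h2)).weakDeriv_ae_eq.symm
  rw [eLpNorm_congr_ae e]
  -- For this component the norm of Z only contains the H^{k−1}-norms of the first derivatives, so
  -- one derivative is split off from α first.
  by_cases hc : c = 1
  · subst hc
    have h0 : 1 ≤ length α := by simpa using h1
    obtain ⟨i, β, rfl⟩ := exists_eq_add_single h0
    rw [length_add, length_single] at h2
    have hl : LocH k (comp 1 fun x => m s x - m t x) :=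
      (((h.mem s hs).bddH 1).sub ((h.mem t ht).bddH 1)).locH
    have e2 := hl.weakDeriv_weakDeriv (α := Pi.single i 1) (β := β) (by rw [length_single]; omega)
    rw [add_comm, ← eLpNorm_congr_ae e2]
    exact (eLpNorm_weakDeriv_le_hNorm (by omega) _).trans (hNorm_weakPartial_le_zNorm k _ i)
  · exact (eLpNorm_weakDeriv_le_hNorm h2 _).trans (hNorm_comp_le_zNorm _ hc)

theorem ContInEnergySet.contBddH {k : ℕ} {m : ℝ → Space N → Vec3} (h : ContInEnergySet k T m)
    (hk : N < 2 * k) (c : Fin 3) : ContBddH k T fun t => comp c (m t) := by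
  refine ⟨fun t ht => (h.mem t ht).bddH c, ?_, fun α h1 h2 => h.contL2 h2 (Or.inr h1)⟩
  by_cases hc : c = 1
  · subst hc
    refine ⟨fun t ht => ((h.mem t ht).bddH 1).memLp_top, fun t ht => ?_⟩
    exact tendsto_toReal_zero (f := fun s => eLpNorm (comp 1 fun x => m s x - m t x) ∞ volume)
      (Eventually.of_forall fun s => eLpNorm_comp_one_le_zNorm k fun x => m s x - m t x)
      (h.tendsto t ht)
  · have h1 : ∀ α : Fin N → ℕ, length α ≤ k → ContL2 T fun t => weakDeriv α (comp c (m t)) :=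
      fun α h2 => h.contL2 h2 (Or.inl hc)
    exact ContH.contSup (s := k) ⟨fun t ht α hα =>
      ⟨_, ((h.mem t ht).bddH c).locH.hasWeakDeriv hα, (h1 α hα).1 t ht⟩, h1⟩ hk

theorem ContInH.contH {k : ℕ} {w : ℝ → Space N → Vec3} (h : ContInH k T w) (c : Fin 3) :
    ContH k T fun t => comp c (w t) := by
  refine ⟨fun t ht => (h.mem t ht).comp c, fun α hα => ⟨fun t ht =>
    ((h.mem t ht).comp c).memLp_weakDeriv hα, fun t ht => ?_⟩⟩
  refine tendsto_toReal_zero ?_ (h.tendsto t ht)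
  filter_upwards [self_mem_nhdsWithin] with s hs
  obtain ⟨g1, hg1, -⟩ := h.mem s hs α hα
  obtain ⟨g2, hg2, -⟩ := h.mem t ht α hα
  have e : (fun x => weakDeriv α (comp c (w s)) x - weakDeriv α (comp c (w t)) x) =ᵐ[volume]
      comp c (weakDeriv α fun x => w s x - w t x) := by
    filter_upwards [(hg1.comp c).weakDeriv_ae_eq, (hg2.comp c).weakDeriv_ae_eq,
      (hg1.sub hg2).weakDeriv_ae_eq] with x h1 h2 h3
    rw [h1, h2]
    simp only [LandauLifshitz.comp, h3]
    rfl
  rw [eLpNorm_congr_ae e]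
  refine le_trans (eLpNorm_mono fun x => ?_) (eLpNorm_weakDeriv_le_hNorm hα _)
  exact PiLp.norm_apply_le _ c

/-- The anisotropy coefficients `(λ_1, 0, λ_3)`. -/
def anisoCoeff (lam1 lam3 : ℝ) : Fin 3 → ℝ := ![lam1, 0, lam3]

/-- The components of the effective field `Δv - (λ_1 v_1, 0, λ_3 v_3)`. -/
noncomputable def effField (A : Fin 3 → ℝ) (v : Fin 3 → Space N → ℝ) (c : Fin 3) : Space N → ℝ :=
  fun x => weakLaplacian (v c) x - A c * v c x

/-- A solution of the Landau–Lifshitz equation and its time derivative, in components. -/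
structure LLCurve (A : Fin 3 → ℝ) (k : ℕ) (T : ℝ) (m w : Fin 3 → ℝ → Space N → ℝ) : Prop where
  contBddH : ∀ c, ContBddH (k + 2) T (m c)
  contL2 : ∀ c, A c ≠ 0 → ContL2 T (m c)
  contH : ∀ c, ContH k T (w c)
  timeDeriv : ∀ c, IsTimeDeriv T (m c) (w c)
  sphere : ∀ t ∈ Icc 0 T, ∀ᵐ x, ∑ c, m c t x ^ 2 = 1
  eq : ∀ t ∈ Icc 0 T, ∀ᵐ x, ∀ c, w c t x =
    m (c + 2) t x * effField A (fun c => m c t) (c + 1) x -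
      m (c + 1) t x * effField A (fun c => m c t) (c + 2) x

theorem MemEnergySet.comp_weakLaplacian_ae_eq {k : ℕ} {v : Space N → Vec3}
    (hv : MemEnergySet k v) (hk : 2 ≤ k) :
    ∀ᵐ x, ∀ c, weakLaplacian v x c = weakLaplacian (comp c v) x := by
  have h : ∀ᵐ x, ∀ c, ∀ i : Fin N,
      weakDeriv (Pi.single i 2) v x c = weakDeriv (Pi.single i 2) (comp c v) x := by
    rw [ae_all_iff]; intro c
    rw [ae_all_iff]; intro i
    obtain ⟨g, hg, -⟩ := hv.exists_hasWeakDeriv (α := Pi.single i 2)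
      (by rw [length_single]; norm_num) (by rw [length_single]; exact hk)
    exact (hg.weakDeriv.comp c).weakDeriv_ae_eq.symm
  filter_upwards [h] with x hx c
  simp only [weakLaplacian, ← hx]
  simp

theorem IsSmoothSolution.llCurve {lam1 lam3 : ℝ} {k : ℕ} {m mt : ℝ → Space N → Vec3}
    (h : IsSmoothSolution lam1 lam3 k T m mt) (hk : N < 2 * (k + 2)) :
    LLCurve (anisoCoeff lam1 lam3) k T (fun c t => comp c (m t)) fun c t => comp c (mt t) where
  contBddH c := h.cont.contBddH hk c
  contL2 c hc := by
    have hc1 : c ≠ 1 := by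
      rintro rfl
      exact hc rfl
    exact (h.cont.contL2 (c := c) (α := 0) (by simp) (Or.inl hc1)).congr fun t ht =>
      weakDeriv_zero_ae_eq ((h.cont.mem t ht).locallyIntegrable_comp c)
  contH c := h.cont_deriv.contH c
  timeDeriv c := h.timeDeriv.comp (fun t ht => (h.cont.mem t ht).1)
    (fun t ht => by
      obtain ⟨g, hg, -⟩ := h.cont_deriv.mem t ht 0 (by simp)
      exact hg.1) c
  sphere t ht := by
    filter_upwards [(h.cont.mem t ht).sphere] with x hx
    have := EuclideanSpace.norm_sq_eq (m t x)
    rw [hx] at this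
    simpa [comp] using this.symm
  eq t ht := by
    filter_upwards [h.solves t ht, (h.cont.mem t ht).comp_weakLaplacian_ae_eq (by omega)]
      with x hx hL c
    have hc := congrFun hx c
    fin_cases c <;>
    · simp [cross_apply, aniso] at hc
      simp [effField, anisoCoeff, ← hL, comp, Matrix.vecHead, Matrix.vecTail] at hc ⊢
      linarith

end Components

end LandauLifshitz
namespace LandauLifshitz

/-! ### The second time derivative of m and its regularity. -/

section Dynamics

variable {N : ℕ} {T : ℝ} {s r : ℕ} {u v : ℝ → Space N → ℝ}

namespace ContH

theorem contL2_self (hu : ContH s T u) : ContL2 T u :=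
  (hu.contL2 0 (by simp)).congr fun t ht =>
    weakDeriv_zero_ae_eq ((hu.memH t ht).locH.l2loc.1)

theorem congr (hu : ContH s T u) (h : ∀ t ∈ Icc 0 T, u t =ᵐ[volume] v t) : ContH s T v :=
  ⟨fun t ht => (hu.1 t ht).congr (h t ht), fun α hα => (hu.2 α hα).congr fun t ht => by
    rw [weakDeriv_congr α (h t ht)]⟩

theorem add (hu : ContH s T u) (hv : ContH s T v) : ContH s T fun t x => u t x + v t x :=
  ⟨fun t ht => (hu.1 t ht).add (hv.1 t ht), fun α hα =>
    ((hu.2 α hα).add (hv.2 α hα)).congr fun t ht =>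
      (((hu.1 t ht).locH.hasWeakDeriv hα).add
        ((hv.1 t ht).locH.hasWeakDeriv hα)).weakDeriv_ae_eq.symm⟩

theorem const_mul (hu : ContH s T u) (c : ℝ) : ContH s T fun t x => c * u t x :=
  ⟨fun t ht => (hu.1 t ht).const_mul c, fun α hα =>
    ((hu.2 α hα).const_mul c).congr fun t ht =>
      (((hu.1 t ht).locH.hasWeakDeriv hα).const_mul c).weakDeriv_ae_eq.symm⟩

theorem sub (hu : ContH s T u) (hv : ContH s T v) : ContH s T fun t x => u t x - v t x := by
  simpa [sub_eq_add_neg] using hu.add (hv.const_mul (-1))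

theorem sum {ι : Type*} (a : Finset ι) (ha : a.Nonempty) {u : ι → ℝ → Space N → ℝ}
    (h : ∀ i ∈ a, ContH s T (u i)) : ContH s T fun t x => ∑ i ∈ a, u i t x := by
  classical
  induction ha using Finset.Nonempty.cons_induction with
  | singleton b => simpa using h b
  | cons b a hb _ ih =>
    simp only [Finset.sum_cons]
    exact (h b (by simp)).add (ih fun i hi => h i (by simp [hi]))

end ContH

namespace ContBddH

theorem contH_weakDeriv (hu : ContBddH s T u) {α : Fin N → ℕ} (h1 : 1 ≤ length α)
    (h2 : length α + r ≤ s) : ContH r T fun t => weakDeriv α (u t) := by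
  have key : ∀ β : Fin N → ℕ, length β ≤ r →
      ContL2 T fun t => weakDeriv β (weakDeriv α (u t)) := fun β hβ =>
    (hu.contL2 (α + β) (by rw [length_add]; omega) (by rw [length_add]; omega)).congr
      fun t ht => ((hu.1 t ht).locH.weakDeriv_weakDeriv (by omega)).symm
  exact ⟨fun t ht β hβ => ⟨_, ((hu.1 t ht).locH.of_weakDeriv h2).hasWeakDeriv hβ,
    (key β hβ).1 t ht⟩, key⟩

/-- The derivative carried by v makes the total order |α| + 1 at least 1, which is the range of
Moser's inequality. Hence the product is square integrable although u is only bounded. -/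
theorem contH_mul_weakDeriv (hu : ContBddH (r + 1) T u) (hv : ContBddH (r + 1) T v)
    {γ : Fin N → ℕ} (hγ : length γ = 1) :
    ContH r T fun t x => u t x * weakDeriv γ (v t) x := by
  have h : ContH r T fun t x => weakDeriv 0 (u t) x * weakDeriv γ (v t) x := by
    have key : ∀ α : Fin N → ℕ, length α ≤ r →
        ContL2 T fun t => weakDeriv α fun x => weakDeriv 0 (u t) x * weakDeriv γ (v t) x :=
      fun α hα => hu.contL2_weakDeriv_mul hv (by omega) (by rw [length_zero]; omega)
    refine ⟨fun t ht α hα => ⟨_, ?_, (key α hα).1 t ht⟩, key⟩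
    exact ((hu.1 t ht).mono (s' := length α + 1) (by omega)).hasWeakDeriv_weakDeriv_mul
      ((hv.1 t ht).mono (by omega)) (by omega) (by simp [hγ])
  refine h.congr fun t ht => ?_
  filter_upwards [weakDeriv_zero_ae_eq (hu.1 t ht).locH.l2loc.1] with x hx
  rw [hx]

theorem contH_mul (hu : ContBddH r T u) (hv : ContBddH r T v) (hv2 : ContL2 T v) :
    ContH r T fun t x => u t x * v t x := by
  have hz : ∀ t ∈ Icc 0 T, (fun x => weakDeriv 0 (u t) x * weakDeriv 0 (v t) x) =ᵐ[volume]
      fun x => u t x * v t x := fun t ht => (hu.1 t ht).mul_congr_zero (hv.1 t ht)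
  have hm : ContL2 T fun t x => u t x * v t x := ContL2.sup_mul hu.2 hv2
  have key : ∀ α : Fin N → ℕ, length α ≤ r →
      ContL2 T fun t => weakDeriv α fun x => u t x * v t x := by
    intro α hα
    rcases Nat.eq_zero_or_pos (length α) with h | h
    · rw [length_eq_zero.1 h]
      exact hm.congr fun t ht => (weakDeriv_zero_ae_eq (hm.1 t ht).l2loc.1).symm
    · refine (hu.contL2_weakDeriv_mul hv (α := α) (β := 0) (γ := 0) (by simp; omega)
        (by simpa using hα)).congr fun t ht => ?_
      rw [weakDeriv_congr α (hz t ht)]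
  exact ⟨fun t ht α hα => ⟨_, ((hu.1 t ht).mul (hv.1 t ht)).locH.hasWeakDeriv hα,
    (key α hα).1 t ht⟩, key⟩

end ContBddH

theorem IsTimeDeriv.sum {ι : Type*} (a : Finset ι) {u v : ι → ℝ → Space N → ℝ}
    (h : ∀ i ∈ a, IsTimeDeriv T (u i) (v i))
    (hu : ∀ i ∈ a, ∀ t ∈ Icc 0 T, LocallyIntegrable (u i t))
    (hv : ∀ i ∈ a, ∀ t ∈ Icc 0 T, LocallyIntegrable (v i t)) :
    IsTimeDeriv T (fun t x => ∑ i ∈ a, u i t x) fun t x => ∑ i ∈ a, v i t x := by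
  intro φ hφ t ht
  have e : ∀ {f : ι → Space N → ℝ}, (∀ i ∈ a, LocallyIntegrable (f i)) →
      ∫ x, φ x • ∑ i ∈ a, f i x = ∑ i ∈ a, ∫ x, φ x • f i x := fun hf => by
    simp only [Finset.smul_sum]
    exact integral_finsetSum _ fun i hi => hφ.integrable_smul (hf i hi)
  rw [e fun i hi => hv i hi t ht]
  exact (HasDerivWithinAt.fun_sum fun i hi => h i hi φ hφ t ht).congr
    (fun s hs => e fun i hi => hu i hi s hs) (e fun i hi => hu i hi t ht)

/-- The formal time derivative of `-v × (Δv - (λ_1 v_1, 0, λ_3 v_3))` along a curve with velocity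
`w`. -/
noncomputable def llAccel (A : Fin 3 → ℝ) (v w : Fin 3 → Space N → ℝ) (c : Fin 3) :
    Space N → ℝ :=
  fun x => (v (c + 2) x * effField A w (c + 1) x + w (c + 2) x * effField A v (c + 1) x) -
    (v (c + 1) x * effField A w (c + 2) x + w (c + 1) x * effField A v (c + 2) x)

namespace LLCurve

variable {A : Fin 3 → ℝ} {k : ℕ} {m w : Fin 3 → ℝ → Space N → ℝ}

theorem contL2_aniso (h : LLCurve A k T m w) (c : Fin 3) :
    ContL2 T fun t x => A c * m c t x := by
  by_cases hc : A c = 0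
  · simpa [hc] using ContL2.zero
  · exact (h.contL2 c hc).const_mul _

theorem timeDeriv_weakDeriv (h : LLCurve A k T m w) (c : Fin 3) {α : Fin N → ℕ}
    (hα : length α ≤ k) :
    IsTimeDeriv T (fun t => weakDeriv α (m c t)) fun t => weakDeriv α (w c t) :=
  (h.timeDeriv c).weakDeriv hα (fun t ht => (((h.contBddH c).1 t ht).mono (by omega)).locH)
    fun t ht => ((h.contH c).1 t ht).locH

theorem contL2_effField (h : LLCurve A k T m w) (c : Fin 3) :
    ContL2 T fun t => effField A (fun c => m c t) c :=
  (ContL2.sum Finset.univ fun i _ => (h.contBddH c).contL2 (Pi.single i 2)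
    (by rw [length_single]; omega) (by rw [length_single]; omega)).sub (h.contL2_aniso c)

theorem contL2_effField_deriv (h : LLCurve A k T m w) (hk : 2 ≤ k) (c : Fin 3) :
    ContL2 T fun t => effField A (fun c => w c t) c :=
  (ContL2.sum Finset.univ fun i _ => (h.contH c).contL2 (Pi.single i 2)
    (by rw [length_single]; omega)).sub ((h.contH c).contL2_self.const_mul (A c))

theorem timeDeriv_effField (h : LLCurve A k T m w) (hk : 2 ≤ k) (c : Fin 3) :
    IsTimeDeriv T (fun t => effField A (fun c => m c t) c)
      fun t => effField A (fun c => w c t) c := by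
  have lm := fun t ht => ((h.contBddH c).1 t ht).locH
  have lw := fun t ht => ((h.contH c).1 t ht).locH
  have h1 : IsTimeDeriv T (fun t x => ∑ i : Fin N, weakDeriv (Pi.single i 2) (m c t) x)
      fun t x => ∑ i : Fin N, weakDeriv (Pi.single i 2) (w c t) x :=
    IsTimeDeriv.sum _ (fun i _ => h.timeDeriv_weakDeriv c (by rw [length_single]; omega))
      (fun i _ t ht => ((lm t ht).l2loc_weakDeriv (by rw [length_single]; omega)).1)
      fun i _ t ht => ((lw t ht).l2loc_weakDeriv (by rw [length_single]; omega)).1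
  have h2 := (h.timeDeriv c).const_mul (-A c)
  have h3 := h1.add h2
    (fun t ht => (ContL2.sum Finset.univ fun i _ => (h.contBddH c).contL2 (Pi.single i 2)
      (by rw [length_single]; omega) (by rw [length_single]; omega)).1 t ht |>.l2loc.1)
    (fun t ht => ((lm t ht).l2loc.const_mul _).1)
    (fun t ht => (ContL2.sum Finset.univ fun i _ => (h.contH c).contL2 (Pi.single i 2)
      (by rw [length_single]; omega)).1 t ht |>.l2loc.1)
    (fun t ht => ((lw t ht).l2loc.const_mul _).1)
  refine h3.congr (fun t _ => ae_of_all _ fun x => ?_) fun t _ => ae_of_all _ fun x => ?_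
  · simp [effField, weakLaplacian]; ring
  · simp [effField, weakLaplacian]; ring

/-- The product rule in time applied to −m × h. It asks for m to be only locally square integrable,
while the effective field h and its time derivative are in L². -/
theorem timeDeriv_accel (h : LLCurve A k T m w) (hT : 0 < T) (hk : 2 ≤ k) (c : Fin 3) :
    IsTimeDeriv T (w c) fun t => llAccel A (fun c => m c t) (fun c => w c t) c := by
  have key : ∀ a b : Fin 3, IsTimeDeriv T
      (fun t x => m a t x * effField A (fun c => m c t) b x)
      fun t x => m a t x * effField A (fun c => w c t) b x +
        w a t x * effField A (fun c => m c t) b x := fun a b =>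
    IsTimeDeriv.mul hT (fun t ht => ((h.contBddH a).1 t ht).locH.l2loc) (h.contH a).contL2_self
      (h.timeDeriv a) (h.contL2_effField b).1 (h.contL2_effField_deriv hk b)
      (h.timeDeriv_effField hk b)
  have l1 : ∀ a b : Fin 3, ∀ t ∈ Icc 0 T,
      LocallyIntegrable fun x => m a t x * effField A (fun c => m c t) b x := fun a b t ht =>
    (((h.contBddH a).1 t ht).locH.l2loc).mul ((h.contL2_effField b).1 t ht).l2loc
  have l2 : ∀ a b : Fin 3, ∀ t ∈ Icc 0 T,
      LocallyIntegrable fun x => m a t x * effField A (fun c => w c t) b x +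
        w a t x * effField A (fun c => m c t) b x := fun a b t ht =>
    ((((h.contBddH a).1 t ht).locH.l2loc).mul ((h.contL2_effField_deriv hk b).1 t ht).l2loc).add
    (((h.contH a).1 t ht).locH.l2loc.mul ((h.contL2_effField b).1 t ht).l2loc)
  have h1 := (key (c + 2) (c + 1)).add ((key (c + 1) (c + 2)).const_mul (-1)) (l1 _ _)
    (fun t ht => (l1 (c + 1) (c + 2) t ht).smul (-1 : ℝ)) (l2 _ _)
    (fun t ht => (l2 (c + 1) (c + 2) t ht).smul (-1 : ℝ))
  refine h1.congr (fun t ht => ?_) fun t _ => ae_of_all _ fun x => ?_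
  · filter_upwards [h.eq t ht] with x hx
    rw [hx c]; ring
  · simp only [llAccel]; ring

/-- Each second derivative is written as ∂_i(∂_i m) or ∂_i(∂_i w), so that every term is a bounded
function times a first derivative of a bounded function. The condition N < 2(k − 1) makes ∂_i w,
which lies in H^{k−1}, bounded. -/
theorem contH_accel (h : LLCurve A k T m w) (hN : 1 ≤ N) (hk : N < 2 * (k - 1)) (c : Fin 3) :
    ContH (k - 2) T fun t => llAccel A (fun c => m c t) (fun c => w c t) c := by
  have hne : (Finset.univ : Finset (Fin N)).Nonempty := ⟨⟨0, hN⟩, Finset.mem_univ _⟩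
  have hw : ∀ a, ContBddH k T (w a) := fun a => (h.contH a).contBddH (by omega)
  have hmi : ∀ a (i : Fin N), ContBddH (k + 1) T fun t => weakDeriv (Pi.single i 1) (m a t) :=
    fun a i => ((h.contBddH a).contH_weakDeriv (by simp) (by rw [length_single]; omega)).contBddH
      (by omega)
  have hwi : ∀ a (i : Fin N), ContBddH (k - 1) T fun t => weakDeriv (Pi.single i 1) (w a t) :=
    fun a i => ((h.contH a).of_weakDeriv (by rw [length_single]; omega)).contBddH (by omega)
  have e2 : ∀ i : Fin N, (Pi.single i 1 + Pi.single i 1 : Fin N → ℕ) = Pi.single i 2 := fun i => by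
    rw [← Pi.single_add]
  have q1 : ∀ a b, ContH (k - 2) T fun t x => w a t x * effField A (fun c => m c t) b x := by
    intro a b
    refine ((ContH.sum Finset.univ hne fun i _ =>
      ContBddH.contH_mul_weakDeriv ((hw a).mono (s' := k - 2 + 1) (by omega))
        ((hmi b i).mono (by omega)) (γ := Pi.single i 1) (by simp)).sub
      ((ContBddH.contH_mul ((h.contBddH b).mono (s' := k - 2) (by omega))
        ((hw a).mono (by omega)) (h.contH a).contL2_self).const_mul (A b))).congr fun t ht => ?_
    have := eventually_all.2 fun i : Fin N => ((h.contBddH b).1 t ht).locH.weakDeriv_weakDeriv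
      (α := Pi.single i 1) (β := Pi.single i 1) (by simp)
    filter_upwards [this] with x hx
    simp only [effField, weakLaplacian, hx, e2, mul_sub, Finset.mul_sum]
    ring
  have q2 : ∀ a b, ContH (k - 2) T fun t x => m a t x * effField A (fun c => w c t) b x := by
    intro a b
    refine ((ContH.sum Finset.univ hne fun i _ =>
      ContBddH.contH_mul_weakDeriv ((h.contBddH a).mono (s' := k - 2 + 1) (by omega))
        ((hwi b i).mono (by omega)) (γ := Pi.single i 1) (by simp)).sub
      ((ContBddH.contH_mul ((h.contBddH a).mono (s' := k - 2) (by omega))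
        ((hw b).mono (by omega)) (h.contH b).contL2_self).const_mul (A b))).congr fun t ht => ?_
    have := eventually_all.2 fun i : Fin N => ((h.contH b).1 t ht).locH.weakDeriv_weakDeriv
      (α := Pi.single i 1) (β := Pi.single i 1) (by rw [length_single]; omega)
    filter_upwards [this] with x hx
    simp only [effField, weakLaplacian, hx, e2, mul_sub, Finset.mul_sum]
    ring
  exact ((q2 (c + 2) (c + 1)).add (q1 (c + 2) (c + 1))).sub
    ((q2 (c + 1) (c + 2)).add (q1 (c + 1) (c + 2)))

end LLCurve

end Dynamics

end LandauLifshitz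
namespace LandauLifshitz

/-! ### The algebraic identity for ∂_t²m + Δ²m on the sphere. -/

section Algebra

variable {N : ℕ}

/-- The algebra of the second time derivative, with `m` standing for the values of the components,
and `m1 i`, `m2 i j`, `m3 i j`, `m3' i j`, `m4 i j` for their derivatives `∂_i`, `∂_i∂_j`, `∂_i²∂_j`,
`∂_i∂_j²`, `∂_i²∂_j²`. -/
theorem accel_add_bilaplacian_eq {A m w dw h : Fin 3 → ℝ} {m1 : Fin N → Fin 3 → ℝ}
    {m2 m3 m3' m4 : Fin N → Fin N → Fin 3 → ℝ}
    (S0 : ∑ c, m c ^ 2 = 1) (S1 : ∀ j, ∑ c, m c * m1 j c = 0)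
    (S2 : ∀ i, ∑ c, (m1 i c ^ 2 + m c * m2 i i c) = 0)
    (S3 : ∀ i j, ∑ c, (2 * m2 i j c * m1 i c + m1 j c * m2 i i c + m c * m3 i j c) = 0)
    (S4 : ∀ i j, ∑ c, (m c * m4 i j c + 2 * m1 j c * m3 i j c + 2 * m1 i c * m3' i j c +
      2 * m2 i j c ^ 2 + m2 i i c * m2 j j c) = 0)
    (hh : ∀ c, h c = ∑ i, m2 i i c - A c * m c)
    (hw : ∀ c, w c = m (c + 2) * h (c + 1) - m (c + 1) * h (c + 2))
    (hdw : ∀ c, dw c = ∑ j,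
      ((m2 j j (c + 2) * h (c + 1) + 2 * (m1 j (c + 2) * (∑ i, m3 i j (c + 1) - A (c + 1) *
          m1 j (c + 1))) + m (c + 2) * (∑ i, m4 i j (c + 1) - A (c + 1) * m2 j j (c + 1))) -
        (m2 j j (c + 1) * h (c + 2) + 2 * (m1 j (c + 1) * (∑ i, m3 i j (c + 2) - A (c + 2) *
          m1 j (c + 2))) + m (c + 1) * (∑ i, m4 i j (c + 2) - A (c + 2) * m2 j j (c + 2)))))
    (c : Fin 3) :
    (m (c + 2) * (dw (c + 1) - A (c + 1) * w (c + 1)) + w (c + 2) * h (c + 1)) -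
        (m (c + 1) * (dw (c + 2) - A (c + 2) * w (c + 2)) + w (c + 1) * h (c + 2)) +
        ∑ i, ∑ j, m4 i j c =
      (∑ i, ∑ j, ∑ d, (-1 * (m1 i d * m1 i d * m2 j j c) + -4 * (m1 i d * m1 j c * m2 i j d) +
        -2 * (m1 j d * m1 j c * m2 i i d))) +
      (m c * ∑ i, ∑ j, -2 * ∑ d, (m3 i j d * m1 j d + m2 i i d * m2 j j d +
        m2 i j d * m2 i j d + m1 i d * m3' i j d)) +
      (∑ i, (A c * m2 i i c + ∑ d, (-2 * A d * (m d * m d * m2 i i c) +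
          A d * (m c * m d * m2 i i d) + -2 * A d * (m d * m1 i c * m1 i d)) +
        -A (c + 2) * (m (c + 1) * m c * m2 i i (c + 1)) +
        A (c + 2) * (m (c + 1) * m (c + 1) * m2 i i c) +
        A (c + 1) * (m (c + 2) * m (c + 2) * m2 i i c) +
        -A (c + 1) * (m (c + 2) * m c * m2 i i (c + 2)))) +
      (∑ d, (A d * (m d * m d * (A c * m c)) + -A d * (m c * m d * (A d * m d))) +
        A (c + 2) * (m (c + 1) * m c * (A (c + 1) * m (c + 1))) +
        -A (c + 2) * (m (c + 1) * m (c + 1) * (A c * m c)) +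
        -A (c + 1) * (m (c + 2) * m (c + 2) * (A c * m c)) +
        A (c + 1) * (m (c + 2) * m c * (A (c + 2) * m (c + 2)))) := by
  -- L is Δm, LL is Δ²m, e is |∇m|², q is −2 ∑ ∂_i∂_j(∂_i m·∂_j m), and Y is ∑ ∂_j m × ∂_j h.
  set L : Fin 3 → ℝ := fun c => ∑ i, m2 i i c with hL
  set LL : Fin 3 → ℝ := fun c => ∑ i, ∑ j, m4 i j c with hLL
  set e := ∑ i, ∑ d, m1 i d * m1 i d with he
  set q := ∑ i, ∑ j, -2 * ∑ d, (m3 i j d * m1 j d + m2 i i d * m2 j j d +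
        m2 i j d * m2 i j d + m1 i d * m3' i j d) with hq
  set Y : Fin 3 → ℝ := fun c => ∑ j,
    (m1 j (c + 1) * (∑ i, m3 i j (c + 2) - A (c + 2) * m1 j (c + 2)) -
      m1 j (c + 2) * (∑ i, m3 i j (c + 1) - A (c + 1) * m1 j (c + 1))) with hY
  -- The constraint differentiated twice: m·Δm = −|∇m|².
  have d1 : ∑ d, m d * L d = -e := by
    have := Finset.sum_congr (rfl : (Finset.univ : Finset (Fin N)) = Finset.univ)
      fun i _ => S2 i
    simp only [Finset.sum_add_distrib, Finset.sum_const_zero] at this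
    have h2 : ∑ d, m d * L d = ∑ i, ∑ d, m d * m2 i i d := by
      simp only [hL, Finset.mul_sum]
      exact Finset.sum_comm
    rw [h2, he]
    simp only [← sq]
    linarith
  -- The constraint differentiated four times: m·Δ²m = |Δm|² + q. This replaces four derivatives of
  -- m by a second derivative of products of gradients.
  have d4 : ∑ d, m d * LL d = ∑ d, L d ^ 2 + q := by
    have h2 : ∑ d, m d * LL d = ∑ i, ∑ j, ∑ d, m d * m4 i j d := by
      simp only [hLL, Finset.mul_sum]
      rw [Finset.sum_comm]
      exact Finset.sum_congr rfl fun i _ => Finset.sum_comm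
    have h3 : ∑ d, L d ^ 2 = ∑ i, ∑ j, ∑ d, m2 i i d * m2 j j d := by
      simp only [hL, sq, Finset.sum_mul_sum]
      rw [Finset.sum_comm]
      exact Finset.sum_congr rfl fun i _ => Finset.sum_comm
    rw [h2, h3, hq, ← Finset.sum_add_distrib]
    refine Finset.sum_congr rfl fun i _ => ?_
    rw [← Finset.sum_add_distrib]
    refine Finset.sum_congr rfl fun j _ => ?_
    have := S4 i j
    simp only [Fin.sum_univ_three] at this ⊢
    linarith
  -- By the double product formula, m × (∂_j m × ∂_j h) = (m·∂_j h) ∂_j m − (m·∂_j m) ∂_j h. The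
  -- last term vanishes, and the thrice differentiated constraint turns m·∂_jΔm into products of
  -- first and second derivatives. Third derivatives thus disappear.
  have dY : ∀ c, m (c + 1) * Y (c + 2) - m (c + 2) * Y (c + 1) =
      (∑ i, ∑ j, ∑ d, (-2 * (m1 i d * m1 j c * m2 i j d) + -1 * (m1 j d * m1 j c * m2 i i d))) +
      ∑ i, ∑ d, -1 * (A d * (m d * m1 i c * m1 i d)) := by
    intro c
    rw [hY, Finset.mul_sum, Finset.mul_sum, ← Finset.sum_sub_distrib, Finset.sum_comm,
      ← Finset.sum_add_distrib]
    refine Finset.sum_congr rfl fun j _ => ?_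
    have h3 : ∑ d, m d * ∑ i, m3 i j d = ∑ i, -∑ d, (2 * m2 i j d * m1 i d + m1 j d * m2 i i d) := by
      simp only [Finset.mul_sum]
      rw [Finset.sum_comm]
      refine Finset.sum_congr rfl fun i _ => ?_
      have := S3 i j
      simp only [Fin.sum_univ_three] at this ⊢
      linarith
    have h4 : ∑ i, ∑ d, (-2 * (m1 i d * m1 j c * m2 i j d) + -1 * (m1 j d * m1 j c * m2 i i d)) =
        m1 j c * ∑ i, -∑ d, (2 * m2 i j d * m1 i d + m1 j d * m2 i i d) := by
      simp only [Finset.mul_sum, ← Finset.sum_neg_distrib]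
      exact Finset.sum_congr rfl fun i _ => Finset.sum_congr rfl fun d _ => by ring
    rw [h4, ← h3]
    have hs := S1 j
    simp only [Fin.sum_univ_three] at hs ⊢
    fin_cases c <;> simp
    · linear_combination (-(∑ i, m3 i j 0 - A 0 * m1 j 0)) * hs
    · linear_combination (-(∑ i, m3 i j 1 - A 1 * m1 j 1)) * hs
    · linear_combination (-(∑ i, m3 i j 2 - A 2 * m1 j 2)) * hs
  -- Δw = −(Δm × h + 2Y + m × Δh), written in components.
  have hdw' : ∀ c, dw c = (L (c + 2) * h (c + 1) - L (c + 1) * h (c + 2)) - 2 * Y c +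
      (m (c + 2) * (LL (c + 1) - A (c + 1) * L (c + 1)) -
        m (c + 1) * (LL (c + 2) - A (c + 2) * L (c + 2))) := by
    intro c
    have e4 : ∀ c, LL c = ∑ j, ∑ i, m4 i j c := fun c => Finset.sum_comm
    rw [hdw, hY, e4, e4]
    simp only [hL, Finset.mul_sum, Finset.sum_mul, Finset.sum_sub_distrib, Finset.sum_add_distrib,
      mul_sub]
    have e5 : ∀ a b : Fin 3, ∑ i, A a * m b * m2 i i a = ∑ i, m b * (A a * m2 i i a) :=
      fun a b => Finset.sum_congr rfl fun i _ => by ring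
    ring
  have R1 : ∑ i, ∑ j, ∑ d, (-1 * (m1 i d * m1 i d * m2 j j c) + -4 * (m1 i d * m1 j c * m2 i j d) +
        -2 * (m1 j d * m1 j c * m2 i i d)) = -e * L c +
      2 * ∑ i, ∑ j, ∑ d, (-2 * (m1 i d * m1 j c * m2 i j d) +
        -1 * (m1 j d * m1 j c * m2 i i d)) := by
    have h1 : -e * L c = ∑ i, ∑ j, ∑ d, -1 * (m1 i d * m1 i d * m2 j j c) := by
      rw [he, hL, ← Finset.sum_neg_distrib, Finset.sum_mul_sum]
      refine Finset.sum_congr rfl fun i _ => Finset.sum_congr rfl fun j _ => ?_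
      rw [← Finset.sum_neg_distrib, Finset.sum_mul]
      exact Finset.sum_congr rfl fun d _ => by ring
    rw [h1, Finset.mul_sum, ← Finset.sum_add_distrib]
    refine Finset.sum_congr rfl fun i _ => ?_
    rw [Finset.mul_sum, ← Finset.sum_add_distrib]
    refine Finset.sum_congr rfl fun j _ => ?_
    rw [Finset.mul_sum, ← Finset.sum_add_distrib]
    exact Finset.sum_congr rfl fun d _ => by ring
  have R2 : (∑ i, (A c * m2 i i c + ∑ d, (-2 * A d * (m d * m d * m2 i i c) +
          A d * (m c * m d * m2 i i d) + -2 * A d * (m d * m1 i c * m1 i d)) +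
        -A (c + 2) * (m (c + 1) * m c * m2 i i (c + 1)) +
        A (c + 2) * (m (c + 1) * m (c + 1) * m2 i i c) +
        A (c + 1) * (m (c + 2) * m (c + 2) * m2 i i c) +
        -A (c + 1) * (m (c + 2) * m c * m2 i i (c + 2)))) =
      A c * L c + ∑ d, (-2 * A d * (m d * m d * L c) + A d * (m c * m d * L d)) +
        2 * (∑ i, ∑ d, -1 * (A d * (m d * m1 i c * m1 i d))) +
        -A (c + 2) * (m (c + 1) * m c * L (c + 1)) +
        A (c + 2) * (m (c + 1) * m (c + 1) * L c) +
        A (c + 1) * (m (c + 2) * m (c + 2) * L c) +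
        -A (c + 1) * (m (c + 2) * m c * L (c + 2)) := by
    simp only [Fin.sum_univ_three, hL, Finset.mul_sum, ← Finset.sum_add_distrib]
    exact Finset.sum_congr rfl fun i _ => by ring
  rw [R1, R2]
  have hY' := dY c
  have hL' : ∀ c, ∑ i, m2 i i c = L c := fun _ => rfl
  have hLL' : ∀ c, ∑ i, ∑ j, m4 i j c = LL c := fun _ => rfl
  -- What remains is a polynomial identity between abstract quantities, in the ideal of the
  -- relations for |m|², m·Δm, m·Δ²m and m × Y.
  clear_value L LL e q Y
  simp only [hdw', hw, hh, hL', hLL']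
  clear hdw' hw hh hdw dY R1 R2 S1 S2 S3 S4 hL hLL hY he hq
  generalize (∑ i, ∑ j, ∑ d, (-2 * (m1 i d * m1 j c * m2 i j d) +
    -1 * (m1 j d * m1 j c * m2 i i d))) = y1 at *
  generalize (∑ i, ∑ d, -1 * (A d * (m d * m1 i c * m1 i d))) = y2 at *
  simp only [Fin.sum_univ_three] at *
  fin_cases c <;> simp at hY' ⊢
  · linear_combination 2 * hY' + L 0 * d1 - (LL 0 - A 0 * L 0) * S0 + m 0 * d4
  · linear_combination 2 * hY' + L 1 * d1 - (LL 1 - A 1 * L 1) * S0 + m 1 * d4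
  · linear_combination 2 * hY' + L 2 * d1 - (LL 2 - A 2 * L 2) * S0 + m 2 * d4

end Algebra

end LandauLifshitz
namespace LandauLifshitz

/-! ### The same identity for weak derivatives, almost everywhere. -/

section Pointwise

variable {N : ℕ}

/-- The multi-index of the first-order derivative `∂_i`. -/
abbrev ee (i : Fin N) : Fin N → ℕ := Pi.single i 1

theorem single_two (i : Fin N) : (Pi.single i 2 : Fin N → ℕ) = ee i + ee i := by
  rw [← Pi.single_add]

/-- The sum of the products `∂^β f ∂^γ g` over a list of pairs `(β, γ)`. -/
noncomputable def pairSum (L : List ((Fin N → ℕ) × (Fin N → ℕ))) (f g : Space N → ℝ) :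
    Space N → ℝ := fun x => (L.map fun p => weakDeriv p.1 f x * weakDeriv p.2 g x).sum

/-- The list of pairs obtained by differentiating each product once. -/
def pairDeriv (j : Fin N) (L : List ((Fin N → ℕ) × (Fin N → ℕ))) :
    List ((Fin N → ℕ) × (Fin N → ℕ)) :=
  L.flatMap fun p => [(p.1 + ee j, p.2), (p.1, p.2 + ee j)]

theorem hasWeakDeriv_pairSum {s : ℕ} {f g : Space N → ℝ} (hf : LocH s f) (hg : LocH s g)
    (j : Fin N) (L : List ((Fin N → ℕ) × (Fin N → ℕ)))
    (hL : ∀ p ∈ L, length p.1 + 1 ≤ s ∧ length p.2 + 1 ≤ s) :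
    HasWeakDeriv (ee j) (pairSum L f g) (pairSum (pairDeriv j L) f g) := by
  induction L with
  | nil => exact HasWeakDeriv.zero _
  | cons p L ih =>
    have h1 := hL p (by simp)
    have l1 : length (ee j) = 1 := length_single _ _
    have a1 := hf.hasWeakDeriv_weakDeriv (α := p.1) (β := ee j) (by rw [l1]; exact h1.1)
    have a2 := hg.hasWeakDeriv_weakDeriv (α := p.2) (β := ee j) (by rw [l1]; exact h1.2)
    have h2 := (a1.mul a2 (hf.l2loc_weakDeriv (by omega))
      (hf.l2loc_weakDeriv (by rw [length_add]; omega)) (hg.l2loc_weakDeriv (by omega))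
      (hg.l2loc_weakDeriv (by rw [length_add]; omega))).add
      (ih fun q hq => hL q (by simp [hq]))
    refine h2.congr (ae_of_all _ fun x => ?_) (ae_of_all _ fun x => ?_)
    · simp [pairSum]
    · simp [pairSum, pairDeriv]; ring

/-- By uniqueness of weak derivatives, differentiating an identity whose right-hand side is constant
gives zero. Iterated from the single pair (0, 0), this produces the constraint |m|² = 1
differentiated up to four times. -/
theorem ae_sum_pairDeriv_eq_zero {s : ℕ} {m : Fin 3 → Space N → ℝ} (hm : ∀ c, LocH s (m c))
    {κ : ℝ} {L : List ((Fin N → ℕ) × (Fin N → ℕ))}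
    (h : ∀ᵐ x, ∑ c, pairSum L (m c) (m c) x = κ) (j : Fin N)
    (hL : ∀ p ∈ L, length p.1 + 1 ≤ s ∧ length p.2 + 1 ≤ s) :
    ∀ᵐ x, ∑ c, pairSum (pairDeriv j L) (m c) (m c) x = 0 := by
  have h1 := HasWeakDeriv.sum (Finset.univ : Finset (Fin 3)) fun c _ =>
    hasWeakDeriv_pairSum (hm c) (hm c) j L hL
  exact h1.unique ((HasWeakDeriv.const_single κ j).congr
    (h.mono fun x hx => hx.symm) (ae_eq_refl _))

theorem weakDeriv_pairSum_ae_eq {s : ℕ} {f g : Space N → ℝ} (hf : LocH s f) (hg : LocH s g)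
    (i j : Fin N) (L : List ((Fin N → ℕ) × (Fin N → ℕ)))
    (hL : ∀ p ∈ L, length p.1 + 2 ≤ s ∧ length p.2 + 2 ≤ s) :
    HasWeakDeriv (ee i + ee j) (pairSum L f g) (pairSum (pairDeriv j (pairDeriv i L)) f g) := by
  refine (hasWeakDeriv_pairSum hf hg i L fun p hp => ?_).trans
    (hasWeakDeriv_pairSum hf hg j _ fun p hp => ?_)
  · have := hL p hp; omega
  · simp only [pairDeriv, List.mem_flatMap] at hp
    obtain ⟨q, hq, hp⟩ := hp
    have := hL q hq
    have l1 : length (ee i) = 1 := length_single _ _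
    simp at hp
    rcases hp with rfl | rfl <;> simp only [length_add, l1] <;> omega

/-- The products `∂_i m · ∂_j m`. -/
noncomputable def gradProd (m : Fin 3 → Space N → ℝ) (i j : Fin N) : Space N → ℝ :=
  fun x => ∑ d, weakDeriv (ee i) (m d) x * weakDeriv (ee j) (m d) x

theorem hasWeakDeriv_gradProd {m : Fin 3 → Space N → ℝ} (hm : ∀ c, LocH 4 (m c)) (i j : Fin N) :
    HasWeakDeriv (ee i + ee j) (gradProd m i j) (fun x => ∑ d,
      (weakDeriv (ee i + ee i + ee j) (m d) x * weakDeriv (ee j) (m d) x +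
        weakDeriv (ee i + ee i) (m d) x * weakDeriv (ee j + ee j) (m d) x +
        weakDeriv (ee i + ee j) (m d) x * weakDeriv (ee i + ee j) (m d) x +
        weakDeriv (ee i) (m d) x * weakDeriv (ee i + ee j + ee j) (m d) x)) := by
  have h := HasWeakDeriv.sum (Finset.univ : Finset (Fin 3)) fun c _ =>
    weakDeriv_pairSum_ae_eq (hm c) (hm c) i j [(ee i, ee j)] (by simp)
  refine h.congr (ae_of_all _ fun x => ?_) (ae_of_all _ fun x => ?_)
  · simp [pairSum, gradProd]
  · refine Finset.sum_congr rfl fun d _ => ?_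
    simp only [pairSum, pairDeriv, List.flatMap_cons, List.flatMap_nil, List.append_nil,
      List.cons_append, List.nil_append, List.map_cons, List.map_nil, List.sum_cons, List.sum_nil,
      add_comm (ee j) (ee i)]
    ring

theorem ae_all_pairs {p : Fin N → Fin N → Space N → Prop} (h : ∀ i j, ∀ᵐ x, p i j x) :
    ∀ᵐ x, ∀ i j, p i j x :=
  ae_all_iff.2 fun i => ae_all_iff.2 fun j => h i j

variable {A : Fin 3 → ℝ} {m w : Fin 3 → Space N → ℝ}

theorem ae_weakLaplacian_velocity (hm : ∀ c, LocH 4 (m c))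
    (heq : ∀ᵐ x, ∀ c, w c x = m (c + 2) x * effField A m (c + 1) x -
      m (c + 1) x * effField A m (c + 2) x) :
    ∀ᵐ x, ∀ c, weakLaplacian (w c) x = ∑ j,
      ((weakDeriv (ee j + ee j) (m (c + 2)) x * effField A m (c + 1) x +
        2 * (weakDeriv (ee j) (m (c + 2)) x * (∑ i, weakDeriv (ee i + ee i + ee j) (m (c + 1)) x -
          A (c + 1) * weakDeriv (ee j) (m (c + 1)) x)) +
        m (c + 2) x * (∑ i, weakDeriv (ee i + ee i + ee j + ee j) (m (c + 1)) x -
          A (c + 1) * weakDeriv (ee j + ee j) (m (c + 1)) x)) -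
        (weakDeriv (ee j + ee j) (m (c + 1)) x * effField A m (c + 2) x +
        2 * (weakDeriv (ee j) (m (c + 1)) x * (∑ i, weakDeriv (ee i + ee i + ee j) (m (c + 2)) x -
          A (c + 2) * weakDeriv (ee j) (m (c + 2)) x)) +
        m (c + 1) x * (∑ i, weakDeriv (ee i + ee i + ee j + ee j) (m (c + 2)) x -
          A (c + 2) * weakDeriv (ee j + ee j) (m (c + 2)) x))) := by
  have l1 : ∀ i : Fin N, length (ee i) = 1 := fun i => length_single _ _
  have h0 : ∀ᵐ x, ∀ c, weakDeriv 0 (m c) x = m c x :=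
    ae_all_iff.2 fun c => weakDeriv_zero_ae_eq (hm c).l2loc.1
  have key : ∀ a b : Fin 3, ∀ j : Fin N, HasWeakDeriv (ee j + ee j)
      (fun x => m a x * effField A m b x)
      (fun x => weakDeriv (ee j + ee j) (m a) x * effField A m b x +
        2 * (weakDeriv (ee j) (m a) x * (∑ i, weakDeriv (ee i + ee i + ee j) (m b) x -
          A b * weakDeriv (ee j) (m b) x)) +
        m a x * (∑ i, weakDeriv (ee i + ee i + ee j + ee j) (m b) x -
          A b * weakDeriv (ee j + ee j) (m b) x)) := by
    intro a b j
    have h1 := (HasWeakDeriv.sum (Finset.univ : Finset (Fin N)) fun i _ =>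
      weakDeriv_pairSum_ae_eq (hm a) (hm b) j j [(0, ee i + ee i)] (by simp [length_add])).sub
      ((weakDeriv_pairSum_ae_eq (hm a) (hm b) j j [(0, 0)] (by simp)).const_mul (A b))
    refine h1.congr ?_ ?_
    · filter_upwards [h0] with x hx
      simp only [pairSum, List.map_cons, List.map_nil, List.sum_cons, List.sum_nil, hx, effField,
        weakLaplacian, single_two, add_zero, mul_sub, Finset.mul_sum]
      ring
    · filter_upwards [h0] with x hx
      simp only [pairSum, pairDeriv, List.flatMap_cons, List.flatMap_nil, List.append_nil,
        List.cons_append, List.nil_append, List.map_cons, List.map_nil, List.sum_cons,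
        List.sum_nil, add_zero, zero_add, hx, effField, weakLaplacian, single_two,
        Finset.sum_add_distrib, ← Finset.mul_sum]
      ring
  have h2 : ∀ᵐ x, ∀ c, ∀ j, weakDeriv (ee j + ee j) (w c) x = _ :=
    ae_all_iff.2 fun c => ae_all_iff.2 fun j =>
      (((key (c + 2) (c + 1) j).sub (key (c + 1) (c + 2) j)).congr
        (heq.mono fun x hx => (hx c).symm) (ae_eq_refl _)).weakDeriv_ae_eq
  filter_upwards [h2] with x hx c
  simp only [weakLaplacian, single_two, hx]

/-- The third-order terms are kept inside ∂_i∂_j(∂_i m·∂_j m), multiplied by the vector m. Only this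
form lets the orthogonality of m and ∂_t m absorb the loss of a derivative. -/
theorem llAccel_add_bilaplacian_ae_eq (hm : ∀ c, LocH 4 (m c)) (hS : ∀ᵐ x, ∑ c, m c x ^ 2 = 1)
    (heq : ∀ᵐ x, ∀ c, w c x = m (c + 2) x * effField A m (c + 1) x -
      m (c + 1) x * effField A m (c + 2) x) :
    ∀ᵐ x, ∀ c, llAccel A m w c x + ∑ i, ∑ j, weakDeriv (ee i + ee i + ee j + ee j) (m c) x =
      (∑ i, ∑ j, ∑ d, (-1 * (weakDeriv (ee i) (m d) x * weakDeriv (ee i) (m d) x *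
          weakDeriv (ee j + ee j) (m c) x) +
        -4 * (weakDeriv (ee i) (m d) x * weakDeriv (ee j) (m c) x *
          weakDeriv (ee i + ee j) (m d) x) +
        -2 * (weakDeriv (ee j) (m d) x * weakDeriv (ee j) (m c) x *
          weakDeriv (ee i + ee i) (m d) x))) +
      (m c x * ∑ i, ∑ j, -2 * weakDeriv (ee i + ee j) (gradProd m i j) x) +
      (∑ i, (A c * weakDeriv (ee i + ee i) (m c) x +
        ∑ d, (-2 * A d * (m d x * m d x * weakDeriv (ee i + ee i) (m c) x) +
          A d * (m c x * m d x * weakDeriv (ee i + ee i) (m d) x) +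
          -2 * A d * (m d x * weakDeriv (ee i) (m c) x * weakDeriv (ee i) (m d) x)) +
        -A (c + 2) * (m (c + 1) x * m c x * weakDeriv (ee i + ee i) (m (c + 1)) x) +
        A (c + 2) * (m (c + 1) x * m (c + 1) x * weakDeriv (ee i + ee i) (m c) x) +
        A (c + 1) * (m (c + 2) x * m (c + 2) x * weakDeriv (ee i + ee i) (m c) x) +
        -A (c + 1) * (m (c + 2) x * m c x * weakDeriv (ee i + ee i) (m (c + 2)) x))) +
      (∑ d, (A d * (m d x * m d x * (A c * m c x)) + -A d * (m c x * m d x * (A d * m d x))) +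
        A (c + 2) * (m (c + 1) x * m c x * (A (c + 1) * m (c + 1) x)) +
        -A (c + 2) * (m (c + 1) x * m (c + 1) x * (A c * m c x)) +
        -A (c + 1) * (m (c + 2) x * m (c + 2) x * (A c * m c x)) +
        A (c + 1) * (m (c + 2) x * m c x * (A (c + 2) * m (c + 2) x))) := by
  have l1 : ∀ i : Fin N, length (ee i) = 1 := fun i => length_single _ _
  have h0 : ∀ᵐ x, ∀ c, weakDeriv 0 (m c) x = m c x :=
    ae_all_iff.2 fun c => weakDeriv_zero_ae_eq (hm c).l2loc.1
  have hS' : ∀ᵐ x, ∑ c, pairSum [(0, 0)] (m c) (m c) x = 1 := by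
    filter_upwards [h0, hS] with x hx hx2
    simp only [pairSum, List.map_cons, List.map_nil, List.sum_cons, List.sum_nil, hx, add_zero,
      ← sq, hx2]
  have d1 := fun i : Fin N => ae_sum_pairDeriv_eq_zero hm hS' i (by simp)
  have d2 := fun i j : Fin N => ae_sum_pairDeriv_eq_zero hm (d1 i) j (by simp [pairDeriv])
  have d3 := fun i j k : Fin N => ae_sum_pairDeriv_eq_zero hm (d2 i j) k
    (by simp [pairDeriv, length_add])
  have d4 := fun i j k l : Fin N => ae_sum_pairDeriv_eq_zero hm (d3 i j k) l
    (by simp [pairDeriv, length_add])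
  have hP : ∀ᵐ x, ∀ i j, weakDeriv (ee i + ee j) (gradProd m i j) x = _ :=
    ae_all_pairs fun i j => (hasWeakDeriv_gradProd hm i j).weakDeriv_ae_eq
  filter_upwards [h0, hS, ae_all_iff.2 d1, ae_all_iff.2 fun i => d2 i i,
    ae_all_pairs fun i j => d3 i i j, ae_all_pairs fun i j => d4 i i j j, hP,
    ae_weakLaplacian_velocity hm heq, heq] with x h0 hS d1 d2 d3 d4 hP hL heq c
  simp only [pairSum, pairDeriv, List.flatMap_cons, List.flatMap_nil, List.append_nil,
    List.cons_append, List.nil_append, List.map_cons, List.map_nil, List.sum_cons,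
    List.sum_nil, add_zero, zero_add, h0] at d1 d2 d3 d4
  have := accel_add_bilaplacian_eq (A := A) (m := fun c => m c x) (w := fun c => w c x)
    (dw := fun c => weakLaplacian (w c) x) (h := fun c => effField A m c x)
    (m1 := fun i c => weakDeriv (ee i) (m c) x)
    (m2 := fun i j c => weakDeriv (ee i + ee j) (m c) x)
    (m3 := fun i j c => weakDeriv (ee i + ee i + ee j) (m c) x)
    (m3' := fun i j c => weakDeriv (ee i + ee j + ee j) (m c) x)
    (m4 := fun i j c => weakDeriv (ee i + ee i + ee j + ee j) (m c) x) hS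
    (fun j => by
      have := d1 j
      simp only [Fin.sum_univ_three] at this ⊢
      linarith)
    (fun i => by
      have := d2 i
      simp only [Fin.sum_univ_three] at this ⊢
      linarith)
    (fun i j => by
      have := d3 i j
      simp only [Fin.sum_univ_three] at this ⊢
      linarith)
    (fun i j => by
      have := d4 i j
      simp only [Fin.sum_univ_three] at this ⊢
      linarith)
    (fun c => by simp only [effField, weakLaplacian, single_two]) heq hL c
  simp only [hP]
  rw [← this]
  simp only [llAccel, effField]

end Pointwise

end LandauLifshitz
namespace LandauLifshitz

/-! ### Bounds at a fixed time for the terms without loss of derivatives. -/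

section State

variable {N : ℕ}

/-- The weak derivative `∂^α u` exists in `L²`, with norm at most `B`. -/
structure DerivBound (α : Fin N → ℕ) (u : Space N → ℝ) (B : ℝ) : Prop where
  hasWeakDeriv : HasWeakDeriv α u (weakDeriv α u)
  memLp : MemLp (weakDeriv α u) 2
  le : l2n (weakDeriv α u) ≤ B

namespace DerivBound

variable {α : Fin N → ℕ} {u v : Space N → ℝ} {B B' : ℝ}

theorem mono (hu : DerivBound α u B) (h : B ≤ B') : DerivBound α u B' :=
  ⟨hu.1, hu.2, hu.3.trans h⟩

theorem congr (hu : DerivBound α u B) (h : u =ᵐ[volume] v) : DerivBound α v B := by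
  obtain ⟨h1, h2, h3⟩ := hu
  rw [weakDeriv_congr α h] at h1 h2 h3
  exact ⟨h1.congr h (ae_eq_refl _), h2, h3⟩

theorem add (hu : DerivBound α u B) (hv : DerivBound α v B') :
    DerivBound α (fun x => u x + v x) (B + B') := by
  have h := hu.1.add hv.1
  refine ⟨h.weakDeriv, (hu.2.add hv.2).ae_eq h.weakDeriv_ae_eq.symm, ?_⟩
  rw [l2n_congr h.weakDeriv_ae_eq]
  exact (l2n_add_le hu.2 hv.2).trans (add_le_add hu.3 hv.3)

theorem const_mul (hu : DerivBound α u B) {c C : ℝ} (hc : |c| ≤ C) :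
    DerivBound α (fun x => c * u x) (C * B) := by
  have h := hu.1.const_mul c
  refine ⟨h.weakDeriv, (hu.2.const_mul c).ae_eq h.weakDeriv_ae_eq.symm, ?_⟩
  rw [l2n_congr h.weakDeriv_ae_eq, l2n_const_mul]
  exact mul_le_mul hc hu.3 (l2n_nonneg _) ((abs_nonneg _).trans hc)

theorem zero : DerivBound α (fun _ => 0) 0 := by
  have h := (HasWeakDeriv.zero (F := ℝ) α).weakDeriv_ae_eq
  refine ⟨(HasWeakDeriv.zero α).weakDeriv, MemLp.zero'.ae_eq h.symm, ?_⟩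
  rw [l2n_congr h]
  simp [l2n]

theorem sum_le {ι : Type*} (s : Finset ι) {u : ι → Space N → ℝ} {B : ι → ℝ}
    (h : ∀ i ∈ s, DerivBound α (u i) (B i)) :
    DerivBound α (fun x => ∑ i ∈ s, u i x) (∑ i ∈ s, B i) := by
  classical
  induction s using Finset.induction_on with
  | empty => simpa using zero
  | insert a s ha ih =>
    simp only [Finset.sum_insert ha]
    exact (h a (by simp)).add (ih fun i hi => h i (by simp [hi]))

theorem sum {n : ℕ} {u : Fin n → Space N → ℝ} (h : ∀ i, DerivBound α (u i) B) :
    DerivBound α (fun x => ∑ i, u i x) (n * B) := by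
  simpa using sum_le Finset.univ fun i _ => h i

theorem moser {s : ℕ} {f g : Space N → ℝ} (hf : BddH s f) (hg : BddH s g) (hs : 1 ≤ s)
    {β γ : Fin N → ℕ} (hl : length α + length β + length γ = s) {a b p q M : ℝ}
    (ha : supNorm f ≤ a) (hp : hsn s f ≤ p) (hb : supNorm g ≤ b) (hq : hsn s g ≤ q)
    (hM : moserConst N s ≤ M) :
    DerivBound α (fun x => weakDeriv β f x * weakDeriv γ g x) (M * (a * q + p * b)) := by
  refine ⟨hf.hasWeakDeriv_weakDeriv_mul hg hs hl, hf.memLp_weakDeriv_mul hg hs hl,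
    (hf.l2n_weakDeriv_mul_le hg hs hl).trans ?_⟩
  have h1 := supNorm_nonneg f
  have h2 := supNorm_nonneg g
  have h3 := hsn_nonneg s f
  have h4 := hsn_nonneg s g
  have h5 := moserConst_nonneg N s
  have h6 := h1.trans ha
  have h7 := h3.trans hp
  gcongr
  · exact h5.trans hM

theorem moser_left {s : ℕ} {f g : Space N → ℝ} (hf : BddH s f) (hg : BddH s g) (hs : 1 ≤ s)
    {γ : Fin N → ℕ} (hl : length α + length γ = s) {a b p q M : ℝ}
    (ha : supNorm f ≤ a) (hp : hsn s f ≤ p) (hb : supNorm g ≤ b) (hq : hsn s g ≤ q)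
    (hM : moserConst N s ≤ M) :
    DerivBound α (fun x => f x * weakDeriv γ g x) (M * (a * q + p * b)) := by
  refine (moser hf hg hs (β := 0) (γ := γ) (by rw [length_zero]; omega) ha hp hb hq hM).congr ?_
  filter_upwards [weakDeriv_zero_ae_eq hf.locH.l2loc.1] with x hx
  rw [hx]

end DerivBound

/-- The state at a given time of a solution of the Landau–Lifshitz equation with velocity `w`, with
bounds on its norms: `K` for the gradient in `L^∞`, `X` for the energy norm of order `l`; `M` bounds
the constants. -/
structure LLState (A : Fin 3 → ℝ) (l : ℕ) (M K X : ℝ) (m w : Fin 3 → Space N → ℝ) : Prop where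
  two_le : 2 ≤ l
  one_le_const : 1 ≤ M
  const_le : ∀ r s, r ≤ l → s ≤ l → 2 * (1 + (indices N r).card) * (1 + moserConst N s) ^ 2 ≤ M
  aniso_le : ∀ c, |A c| ≤ M
  nonneg : 0 ≤ K
  bddH : ∀ c, BddH (l + 2) (m c)
  bddH_partial : ∀ c i, BddH (l + 1) (weakDeriv (ee i) (m c))
  memH : ∀ c, MemH l (w c)
  memLp_aniso : ∀ c, MemLp (fun x => A c * m c x) 2
  sphere : ∀ᵐ x, ∑ c, m c x ^ 2 = 1
  eq : ∀ᵐ x, ∀ c, w c x = m (c + 2) x * effField A m (c + 1) x -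
    m (c + 1) x * effField A m (c + 2) x
  supNorm_partial_le : ∀ c i, supNorm (weakDeriv (ee i) (m c)) ≤ K
  hsn_le : ∀ c j, 1 ≤ j → j ≤ l → hsn j (m c) ≤ X
  l2n_velocity_le : ∀ c (α : Fin N → ℕ), length α + 2 = l → l2n (weakDeriv α (w c)) ≤ X
  l2n_aniso_le : ∀ c, l2n (fun x => A c * m c x) ≤ X

namespace LLState

variable {A : Fin 3 → ℝ} {l : ℕ} {M K X : ℝ} {m w : Fin 3 → Space N → ℝ}

theorem X_nonneg (h : LLState A l M K X m w) : 0 ≤ X :=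
  (hsn_nonneg 1 (m 0)).trans (h.hsn_le 0 1 le_rfl (by have := h.two_le; omega))

theorem ae_abs_le_one (h : LLState A l M K X m w) (c : Fin 3) : ∀ᵐ x, |m c x| ≤ 1 := by
  filter_upwards [h.sphere] with x hx
  rw [← sq_le_one_iff_abs_le_one, ← hx]
  exact Finset.single_le_sum (f := fun c => m c x ^ 2) (fun _ _ => sq_nonneg _)
    (Finset.mem_univ c)

theorem supNorm_le_one (h : LLState A l M K X m w) (c : Fin 3) : supNorm (m c) ≤ 1 :=
  supNorm_le_of_ae_abs_le zero_le_one (h.ae_abs_le_one c)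

theorem moserConst_le (h : LLState A l M K X m w) {s : ℕ} (hs : s ≤ l) : moserConst N s ≤ M := by
  have h1 := h.const_le 0 s (by omega) hs
  have h2 := moserConst_nonneg N s
  have h3 : (0 : ℝ) ≤ (indices N 0).card := by positivity
  nlinarith [mul_nonneg h3 (sq_nonneg (1 + moserConst N s))]

/-- The factor 2 is what produces the M/2 in the product estimate that follows, and keeps later
constants monomial in M. -/
theorem card_mul_moserConst_le (h : LLState A l M K X m w) {r s : ℕ} (hr : r ≤ l) (hs : s ≤ l) :
    2 * ((indices N r).card * moserConst N s) ≤ M := by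
  have h1 := h.const_le r s hr hs
  have h2 := moserConst_nonneg N s
  have h3 : (0 : ℝ) ≤ (indices N r).card := by positivity
  nlinarith [mul_nonneg h3 (sq_nonneg (moserConst N s)), mul_nonneg h3 h2]

theorem hsn_partial_le (h : LLState A l M K X m w) (c : Fin 3) (i : Fin N) {j : ℕ}
    (hj : j + 1 ≤ l) : hsn j (weakDeriv (ee i) (m c)) ≤ X := by
  have l1 : length (ee i) = 1 := length_single _ _
  have h1 := (h.bddH c).locH.hsn_weakDeriv_le (α := ee i) (r := j) (by omega)
  rw [l1] at h1
  exact h1.trans (h.hsn_le c _ (by omega) (by omega))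

theorem hsn_mul_le (h : LLState A l M K X m w) {f g : Space N → ℝ} {s : ℕ} (hs : 1 ≤ s)
    (hsl : s ≤ l) (hf : BddH s f) (hg : BddH s g) {a b p q : ℝ}
    (ha : supNorm f ≤ a) (hp : hsn s f ≤ p) (hb : supNorm g ≤ b) (hq : hsn s g ≤ q) :
    hsn s (fun x => f x * g x) ≤ M / 2 * (a * q + p * b) := by
  refine (hf.hsn_mul_le hg hs le_rfl).trans ?_
  have h1 := supNorm_nonneg f
  have h2 := supNorm_nonneg g
  have h3 := hsn_nonneg s f
  have h4 := hsn_nonneg s g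
  have h5 := h.card_mul_moserConst_le hsl hsl
  have h6 := h1.trans ha
  have h7 := h3.trans hp
  have h8 := h.one_le_const
  gcongr
  linarith

theorem weakDeriv_ee_ee (h : LLState A l M K X m w) (c : Fin 3) (i j : Fin N) :
    weakDeriv (ee j) (weakDeriv (ee i) (m c)) =ᵐ[volume] weakDeriv (ee i + ee j) (m c) :=
  (h.bddH c).locH.weakDeriv_weakDeriv (by simp)

variable {α : Fin N → ℕ}

/-- With ∂_p∂_q m = ∂_q(∂_p m), the total order |α| + 1 = l − 1 is shared among three first
derivatives of m. Each has sup norm at most K and seminorm of order l − 1 at most X, so Moser's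
inequality gives K²X. -/
theorem derivBound_cubic (h : LLState A l M K X m w) (hα : length α + 2 = l) (a b c : Fin 3)
    (i j p q : Fin N) :
    DerivBound α (fun x => weakDeriv (ee i) (m a) x * weakDeriv (ee j) (m b) x *
      weakDeriv (ee p + ee q) (m c) x) (2 * M ^ 2 * ((1 + K ^ 2) * X)) := by
  have l1 : ∀ i : Fin N, length (ee i) = 1 := fun i => length_single _ _
  have hX := h.X_nonneg
  have hK := h.nonneg
  have hM := h.one_le_const
  have b1 : BddH (l - 1) (weakDeriv (ee i) (m a)) := (h.bddH_partial a i).mono (by omega)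
  have b2 : BddH (l - 1) (weakDeriv (ee j) (m b)) := (h.bddH_partial b j).mono (by omega)
  have b3 : BddH (l - 1) (weakDeriv (ee p) (m c)) := (h.bddH_partial c p).mono (by omega)
  have s1 := h.supNorm_partial_le a i
  have s2 := h.supNorm_partial_le b j
  have s3 := h.supNorm_partial_le c p
  have n1 := h.hsn_partial_le a i (j := l - 1) (by omega)
  have n2 := h.hsn_partial_le b j (j := l - 1) (by omega)
  have n3 := h.hsn_partial_le c p (j := l - 1) (by omega)
  have s12 : supNorm (fun x => weakDeriv (ee i) (m a) x * weakDeriv (ee j) (m b) x) ≤ K * K :=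
    (supNorm_mul_le b1.1 b2.1).trans (mul_le_mul s1 s2 (supNorm_nonneg _) hK)
  have := DerivBound.moser_left (α := α) (b1.mul b2) b3 (by omega) (γ := ee q)
    (by rw [l1]; omega) s12 (h.hsn_mul_le (by omega) (by omega) b1 b2 s1 n1 s2 n2) s3 n3
    (h.moserConst_le (by omega))
  refine (this.congr ?_).mono ?_
  · filter_upwards [h.weakDeriv_ee_ee c p q] with x hx
    rw [hx]
  · have e : M * (K * K * X + M / 2 * (K * X + X * K) * K) = M * (1 + M) * (K ^ 2 * X) := by ring
    rw [e]
    have h1 : K ^ 2 * X ≤ (1 + K ^ 2) * X := by nlinarith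
    exact mul_le_mul (by nlinarith) h1 (by positivity) (by positivity)

/-- The undifferentiated factors have sup norm at most 1, so that only 1 + K multiplies X; it is
absorbed in 1 + K². -/
theorem derivBound_quadratic (h : LLState A l M K X m w) (hα : length α + 2 = l) (a b c : Fin 3)
    (p q : Fin N) :
    DerivBound α (fun x => m a x * m b x * weakDeriv (ee p + ee q) (m c) x)
      (2 * M ^ 2 * ((1 + K ^ 2) * X)) := by
  have l1 : ∀ i : Fin N, length (ee i) = 1 := fun i => length_single _ _
  have hX := h.X_nonneg
  have hK := h.nonneg
  have hM := h.one_le_const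
  have b1 : BddH (l - 1) (m a) := (h.bddH a).mono (by omega)
  have b2 : BddH (l - 1) (m b) := (h.bddH b).mono (by omega)
  have b3 : BddH (l - 1) (weakDeriv (ee p) (m c)) := (h.bddH_partial c p).mono (by omega)
  have s1 := h.supNorm_le_one a
  have s2 := h.supNorm_le_one b
  have s3 := h.supNorm_partial_le c p
  have n1 := h.hsn_le a (l - 1) (by omega) (by omega)
  have n2 := h.hsn_le b (l - 1) (by omega) (by omega)
  have n3 := h.hsn_partial_le c p (j := l - 1) (by omega)
  have s12 : supNorm (fun x => m a x * m b x) ≤ 1 * 1 :=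
    (supNorm_mul_le b1.1 b2.1).trans (mul_le_mul s1 s2 (supNorm_nonneg _) zero_le_one)
  have := DerivBound.moser_left (α := α) (b1.mul b2) b3 (by omega) (γ := ee q)
    (by rw [l1]; omega) s12 (h.hsn_mul_le (by omega) (by omega) b1 b2 s1 n1 s2 n2) s3 n3
    (h.moserConst_le (by omega))
  refine (this.congr ?_).mono ?_
  · filter_upwards [h.weakDeriv_ee_ee c p q] with x hx
    rw [hx]
  · have e : M * (1 * 1 * X + M / 2 * (1 * X + X * 1) * K) = M * (1 + M * K) * X := by ring
    rw [e, ← mul_assoc]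
    refine mul_le_mul_of_nonneg_right ?_ hX
    have h1 : K ≤ 1 + K ^ 2 := by nlinarith [sq_nonneg (K - 1)]
    nlinarith [mul_le_mul_of_nonneg_left h1 (sq_nonneg M), sq_nonneg K, mul_nonneg (sq_nonneg M) (sq_nonneg K)]

theorem derivBound_mixed (h : LLState A l M K X m w) (hα : length α + 2 = l) (a b c : Fin 3)
    (i j : Fin N) :
    DerivBound α (fun x => m a x * weakDeriv (ee i) (m b) x * weakDeriv (ee j) (m c) x)
      (2 * M ^ 2 * ((1 + K ^ 2) * X)) := by
  have l1 : ∀ i : Fin N, length (ee i) = 1 := fun i => length_single _ _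
  have hX := h.X_nonneg
  have hK := h.nonneg
  have hM := h.one_le_const
  have b1 : BddH (l - 1) (m a) := (h.bddH a).mono (by omega)
  have b2 : BddH (l - 1) (weakDeriv (ee i) (m b)) := (h.bddH_partial b i).mono (by omega)
  have b3 : BddH (l - 1) (m c) := (h.bddH c).mono (by omega)
  have s1 := h.supNorm_le_one a
  have s2 := h.supNorm_partial_le b i
  have s3 := h.supNorm_le_one c
  have n1 := h.hsn_le a (l - 1) (by omega) (by omega)
  have n2 := h.hsn_partial_le b i (j := l - 1) (by omega)
  have n3 := h.hsn_le c (l - 1) (by omega) (by omega)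
  have s12 : supNorm (fun x => m a x * weakDeriv (ee i) (m b) x) ≤ 1 * K :=
    (supNorm_mul_le b1.1 b2.1).trans (mul_le_mul s1 s2 (supNorm_nonneg _) zero_le_one)
  have := DerivBound.moser_left (α := α) (b1.mul b2) b3 (by omega) (γ := ee j)
    (by rw [l1]; omega) s12 (h.hsn_mul_le (by omega) (by omega) b1 b2 s1 n1 s2 n2) s3 n3
    (h.moserConst_le (by omega))
  refine this.mono ?_
  have e : M * (1 * K * X + M / 2 * (1 * X + X * K) * 1) = M * (K + M / 2 * (1 + K)) * X := by ring
  rw [e, ← mul_assoc]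
  refine mul_le_mul_of_nonneg_right ?_ hX
  have h1 : K ≤ 1 + K ^ 2 := by nlinarith [sq_nonneg (K - 1)]
  have h2 : (1 + K) ≤ 2 * (1 + K ^ 2) := by nlinarith [sq_nonneg (K - 1)]
  have h3 : M / 2 * (1 + K) ≤ M * (1 + K ^ 2) := by nlinarith
  have h4 : K ≤ M * (1 + K ^ 2) := by nlinarith
  calc M * (K + M / 2 * (1 + K)) ≤ M * (M * (1 + K ^ 2) + M * (1 + K ^ 2)) := by gcongr
    _ = _ := by ring

theorem derivBound_linear (h : LLState A l M K X m w) (hα : length α + 2 = l) (c : Fin 3)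
    (i : Fin N) :
    DerivBound α (weakDeriv (ee i + ee i) (m c)) (2 * M ^ 2 * ((1 + K ^ 2) * X)) := by
  have l1 : length (ee i + ee i) = 2 := by simp [length_add]
  have hX := h.X_nonneg
  have hM := h.one_le_const
  have hl := (h.bddH c).locH
  have e := hl.weakDeriv_weakDeriv (α := ee i + ee i) (β := α) (by omega)
  refine ⟨(hl.hasWeakDeriv_weakDeriv (by omega)).weakDeriv, ((h.bddH c).memLp (ee i + ee i + α)
    (by rw [length_add]; omega) (by rw [length_add]; omega)).ae_eq e.symm, ?_⟩
  rw [l2n_congr e]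
  refine (l2n_weakDeriv_le_hsn _ (by rw [length_add, l1, add_comm, hα])).trans
    ((h.hsn_le c l (by omega) le_rfl).trans ?_)
  have h1 : X ≤ (1 + K ^ 2) * X := by nlinarith [mul_nonneg (sq_nonneg K) hX]
  nlinarith [mul_nonneg (sub_nonneg.2 hM) (h1.trans' hX), mul_nonneg (mul_nonneg (sub_nonneg.2 hM) (sub_nonneg.2 hM)) (h1.trans' hX)]

/-- For α = 0 the function m_c may fail to be square integrable; only the product A_c m_c is
controlled, and this is why the factor A_c is kept next to m_c. For |α| ≥ 1 Moser's inequality of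
order l − 2 applies. -/
theorem derivBound_lower (h : LLState A l M K X m w) (hα : length α + 2 = l) (a b c : Fin 3) :
    DerivBound α (fun x => m a x * m b x * (A c * m c x)) (2 * M ^ 3 * ((1 + K ^ 2) * X)) := by
  have hX := h.X_nonneg
  have hM := h.one_le_const
  have hb := (h.bddH a).mul (h.bddH b)
  have s1 := h.supNorm_le_one a
  have s2 := h.supNorm_le_one b
  have s12 : supNorm (fun x => m a x * m b x) ≤ 1 * 1 :=
    (supNorm_mul_le (h.bddH a).1 (h.bddH b).1).trans
      (mul_le_mul s1 s2 (supNorm_nonneg _) zero_le_one)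
  have h1 : X ≤ (1 + K ^ 2) * X := by
    nlinarith [mul_nonneg (sq_nonneg K) hX]
  have hM3 : 1 ≤ M ^ 3 := one_le_pow₀ hM
  rcases Nat.eq_zero_or_pos (length α) with h0 | h0
  · rw [length_eq_zero.1 h0]
    have hm : MemLp (fun x => m a x * m b x * (A c * m c x)) 2 :=
      memLp_bdd_mul hb.1 (h.memLp_aniso c)
    have e := weakDeriv_zero_ae_eq hm.l2loc.1
    refine ⟨(HasWeakDeriv.zero_index hm.l2loc.1).weakDeriv, hm.ae_eq e.symm, ?_⟩
    rw [l2n_congr e]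
    refine (l2n_bdd_mul_le hb.1 (h.memLp_aniso c)).trans ?_
    have := mul_le_mul s12 (h.l2n_aniso_le c) (l2n_nonneg _) (by norm_num)
    nlinarith
  · have b1 : BddH (l - 2) (m a) := (h.bddH a).mono (by omega)
    have b2 : BddH (l - 2) (m b) := (h.bddH b).mono (by omega)
    have b3 : BddH (l - 2) (m c) := (h.bddH c).mono (by omega)
    have s3 := h.supNorm_le_one c
    have n1 := h.hsn_le a (l - 2) (by omega) (by omega)
    have n2 := h.hsn_le b (l - 2) (by omega) (by omega)
    have n3 := h.hsn_le c (l - 2) (by omega) (by omega)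
    have := (DerivBound.moser_left (α := α) (b1.mul b2) b3 (by omega) (γ := 0)
      (by rw [length_zero]; omega) s12 (h.hsn_mul_le (by omega) (by omega) b1 b2 s1 n1 s2 n2) s3 n3
      (h.moserConst_le (by omega))).const_mul (h.aniso_le c)
    refine (this.congr ?_).mono ?_
    · filter_upwards [weakDeriv_zero_ae_eq b3.locH.l2loc.1] with x hx
      rw [hx]; ring
    · have e : M * (M * (1 * 1 * X + M / 2 * (1 * X + X * 1) * 1)) = M ^ 2 * (1 + M) * X := by ring
      rw [e]
      refine mul_le_mul ?_ h1 hX (by positivity)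
      nlinarith [mul_nonneg (sub_nonneg.2 hM) (sq_nonneg M)]

end LLState

end State

end LandauLifshitz
namespace LandauLifshitz

/-! ### The term with a loss of one derivative, and the bound for ∂_t²m + Δ²m. -/

section State

variable {N : ℕ}

/-- The sum of the absolute values of the Leibniz coefficients. -/
noncomputable def leibSum (α : Fin N → ℕ) : ℝ := ∑ δ ∈ Finset.Iic α, |leibCoeff α δ|

theorem leibSum_nonneg (α : Fin N → ℕ) : 0 ≤ leibSum α :=
  Finset.sum_nonneg fun _ _ => abs_nonneg _

theorem sum_erase_leibCoeff_le (α : Fin N → ℕ) {B : ℝ} (hB : 0 ≤ B) :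
    ∑ δ ∈ (Finset.Iic α).erase 0, |leibCoeff α δ| * B ≤ leibSum α * B := by
  rw [leibSum, Finset.sum_mul]
  exact Finset.sum_le_sum_of_subset_of_nonneg (Finset.erase_subset _ _)
    fun _ _ _ => by positivity

/-- The terms of the second time derivative which are controlled in `L²`. -/
noncomputable def accelRemainder (A : Fin 3 → ℝ) (m : Fin 3 → Space N → ℝ) (c : Fin 3) :
    Space N → ℝ := fun x =>
  (∑ i, ∑ j, ∑ d, (-1 * (weakDeriv (ee i) (m d) x * weakDeriv (ee i) (m d) x *
          weakDeriv (ee j + ee j) (m c) x) +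
        -4 * (weakDeriv (ee i) (m d) x * weakDeriv (ee j) (m c) x *
          weakDeriv (ee i + ee j) (m d) x) +
        -2 * (weakDeriv (ee j) (m d) x * weakDeriv (ee j) (m c) x *
          weakDeriv (ee i + ee i) (m d) x))) +
      (∑ i, (A c * weakDeriv (ee i + ee i) (m c) x +
        ∑ d, (-2 * A d * (m d x * m d x * weakDeriv (ee i + ee i) (m c) x) +
          A d * (m c x * m d x * weakDeriv (ee i + ee i) (m d) x) +
          -2 * A d * (m d x * weakDeriv (ee i) (m c) x * weakDeriv (ee i) (m d) x)) +
        -A (c + 2) * (m (c + 1) x * m c x * weakDeriv (ee i + ee i) (m (c + 1)) x) +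
        A (c + 2) * (m (c + 1) x * m (c + 1) x * weakDeriv (ee i + ee i) (m c) x) +
        A (c + 1) * (m (c + 2) x * m (c + 2) x * weakDeriv (ee i + ee i) (m c) x) +
        -A (c + 1) * (m (c + 2) x * m c x * weakDeriv (ee i + ee i) (m (c + 2)) x))) +
      (∑ d, (A d * (m d x * m d x * (A c * m c x)) + -A d * (m c x * m d x * (A d * m d x))) +
        A (c + 2) * (m (c + 1) x * m c x * (A (c + 1) * m (c + 1) x)) +
        -A (c + 2) * (m (c + 1) x * m (c + 1) x * (A c * m c x)) +
        -A (c + 1) * (m (c + 2) x * m (c + 2) x * (A c * m c x)) +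
        A (c + 1) * (m (c + 2) x * m c x * (A (c + 2) * m (c + 2) x)))

theorem integrable_mul_of_memLp_two {f g : Space N → ℝ} (hf : MemLp f 2) (hg : MemLp g 2) :
    Integrable fun x => f x * g x := hf.integrable_mul hg

theorem abs_integral_le {f g : Space N → ℝ} (hf : MemLp f 2) (hg : MemLp g 2) {a b : ℝ}
    (ha : l2n f ≤ a) (hb : l2n g ≤ b) : |∫ x, f x * g x| ≤ a * b :=
  (integral_mul_le_sqrt hf hg).trans
    (mul_le_mul ha hb (l2n_nonneg _) ((l2n_nonneg _).trans ha))

namespace LLState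

variable {A : Fin 3 → ℝ} {l : ℕ} {M K X : ℝ} {m w : Fin 3 → Space N → ℝ} {α : Fin N → ℕ}

/-- The constant counts terms: 3N²(1 + 4 + 2) cubic ones of size 2M²; for each i, anisotropy
coefficients M + 15M + 4M times 2M²; and 6M + 4M times 2M³ for the terms without derivatives. -/
theorem derivBound_remainder (h : LLState A l M K X m w) (hα : length α + 2 = l) (c : Fin 3) :
    DerivBound α (accelRemainder A m c)
      ((42 * N ^ 2 * M ^ 2 + 40 * N * M ^ 3 + 20 * M ^ 4) * ((1 + K ^ 2) * X)) := by
  have hA : ∀ c, |-A c| ≤ M := fun c => by rw [abs_neg]; exact h.aniso_le c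
  have hA2 : ∀ c, |-2 * A c| ≤ 2 * M := fun c => by
    rw [abs_mul]; norm_num; exact h.aniso_le c
  refine DerivBound.mono ((DerivBound.add (DerivBound.add
    (DerivBound.sum fun i => DerivBound.sum fun j => DerivBound.sum fun d =>
      (((h.derivBound_cubic hα d d c i i j j).const_mul (C := 1) (by norm_num)).add
        ((h.derivBound_cubic hα d c d i j i j).const_mul (C := 4) (by norm_num))).add
        ((h.derivBound_cubic hα d c d j j i i).const_mul (C := 2) (by norm_num)))
    (DerivBound.sum fun i => ((((
      ((h.derivBound_linear hα c i).const_mul (h.aniso_le c)).add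
      (DerivBound.sum fun d => (((h.derivBound_quadratic hα d d c i i).const_mul (hA2 d)).add
        ((h.derivBound_quadratic hα c d d i i).const_mul (h.aniso_le d))).add
        ((h.derivBound_mixed hα d c d i i).const_mul (hA2 d)))).add
      ((h.derivBound_quadratic hα (c + 1) c (c + 1) i i).const_mul (hA (c + 2)))).add
      ((h.derivBound_quadratic hα (c + 1) (c + 1) c i i).const_mul (h.aniso_le (c + 2)))).add
      ((h.derivBound_quadratic hα (c + 2) (c + 2) c i i).const_mul (h.aniso_le (c + 1)))).add
      ((h.derivBound_quadratic hα (c + 2) c (c + 2) i i).const_mul (hA (c + 1)))))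
    (((((DerivBound.sum fun d => ((h.derivBound_lower hα d d c).const_mul (h.aniso_le d)).add
        ((h.derivBound_lower hα c d d).const_mul (hA d))).add
      ((h.derivBound_lower hα (c + 1) c (c + 1)).const_mul (h.aniso_le (c + 2)))).add
      ((h.derivBound_lower hα (c + 1) (c + 1) c).const_mul (hA (c + 2)))).add
      ((h.derivBound_lower hα (c + 2) (c + 2) c).const_mul (hA (c + 1)))).add
      ((h.derivBound_lower hα (c + 2) c (c + 2)).const_mul (h.aniso_le (c + 1)))))) ?_
  refine le_of_eq ?_
  push_cast
  ring

theorem bddH_gradProd (h : LLState A l M K X m w) (i j : Fin N) :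
    BddH (l + 1) (gradProd m i j) :=
  BddH.sum Finset.univ fun d _ => (h.bddH_partial d i).mul (h.bddH_partial d j)

theorem supNorm_gradProd_le (h : LLState A l M K X m w) (i j : Fin N) :
    supNorm (gradProd m i j) ≤ 3 * K ^ 2 := by
  refine (supNorm_sum_le Finset.univ fun d _ =>
    ((h.bddH_partial d i).mul (h.bddH_partial d j)).1).trans ?_
  refine (Finset.sum_le_sum fun d _ => (supNorm_mul_le (h.bddH_partial d i).1
    (h.bddH_partial d j).1).trans (mul_le_mul (h.supNorm_partial_le d i)
    (h.supNorm_partial_le d j) (supNorm_nonneg _) h.nonneg)).trans ?_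
  simp [sq]

theorem hsn_gradProd_le (h : LLState A l M K X m w) (i j : Fin N) :
    hsn (l - 1) (gradProd m i j) ≤ 3 * (M * (K * X)) := by
  have h2 := h.two_le
  refine (BddH.hsn_sum_le (s := l - 1) Finset.univ (fun d _ =>
    ((h.bddH_partial d i).mul (h.bddH_partial d j)).mono (by omega)) (by omega) le_rfl).trans ?_
  refine (Finset.sum_le_sum fun d _ => h.hsn_mul_le (by omega) (by omega)
    ((h.bddH_partial d i).mono (by omega)) ((h.bddH_partial d j).mono (by omega))
    (h.supNorm_partial_le d i) (h.hsn_partial_le d i (by omega)) (h.supNorm_partial_le d j)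
    (h.hsn_partial_le d j (by omega))).trans ?_
  refine le_of_eq ?_
  simp
  ring

/-- In every Leibniz term other than δ = 0 at least one derivative ∂_s falls on m. The remaining l −
1 derivatives are shared by ∂_s m and P = ∂_i m·∂_j m, both bounded in terms of K, and Moser's
inequality applies. -/
theorem exists_commutator (h : LLState A l M K X m w) (hα : length α + 2 = l) (c : Fin 3)
    (i j : Fin N) : ∃ r : Space N → ℝ, MemLp r 2 ∧
      l2n r ≤ leibSum α * (6 * M ^ 2 * ((1 + K ^ 2) * X)) ∧
      HasWeakDeriv α (fun x => m c x * weakDeriv (ee i + ee j) (gradProd m i j) x)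
        fun x => m c x * weakDeriv (ee i + ee j + α) (gradProd m i j) x + r x := by
  have l1 : ∀ i : Fin N, length (ee i) = 1 := fun i => length_single _ _
  have hX := h.X_nonneg
  have hK := h.nonneg
  have hM := h.one_le_const
  set P := gradProd m i j with hP
  have hPb := h.bddH_gradProd i j
  have hm := (h.bddH c).locH
  have key : ∀ δ ∈ (Finset.Iic α).erase 0,
      MemLp (fun x => weakDeriv δ (m c) x * weakDeriv (ee i + ee j + (α - δ)) P x) 2 ∧
      l2n (fun x => weakDeriv δ (m c) x * weakDeriv (ee i + ee j + (α - δ)) P x) ≤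
        6 * M ^ 2 * ((1 + K ^ 2) * X) := by
    intro δ hδ
    rw [Finset.mem_erase, Finset.mem_Iic] at hδ
    have hl := length_add_length_sub hδ.2
    have hpos : 0 < length δ := Nat.pos_of_ne_zero fun h0 => hδ.1 (length_eq_zero.1 h0)
    obtain ⟨s, β, hβ⟩ := exists_eq_add_single hpos
    change δ = β + ee s at hβ
    subst hβ
    rw [length_add, l1] at hl
    have e : (fun x => weakDeriv β (weakDeriv (ee s) (m c)) x *
        weakDeriv (ee i + ee j + (α - (β + ee s))) P x) =ᵐ[volume]
        fun x => weakDeriv (β + ee s) (m c) x *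
          weakDeriv (ee i + ee j + (α - (β + ee s))) P x := by
      filter_upwards [hm.weakDeriv_weakDeriv (α := ee s) (β := β) (by rw [l1]; omega)] with x hx
      rw [hx, add_comm]
    have hlen : length β + length (ee i + ee j + (α - (β + ee s))) = l - 1 := by
      rw [length_add, length_add, l1, l1]; omega
    have b1 : BddH (l - 1) (weakDeriv (ee s) (m c)) := (h.bddH_partial c s).mono (by omega)
    have b2 : BddH (l - 1) P := hPb.mono (by omega)
    refine ⟨(b1.memLp_mul_weakDeriv b2 (by omega) hlen).ae_eq e, ?_⟩
    rw [← l2n_congr e]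
    refine (b1.l2n_mul_weakDeriv_le b2 (by omega) hlen).trans ?_
    have n1 := h.supNorm_partial_le c s
    have n2 := h.hsn_partial_le c s (j := l - 1) (by omega)
    have n3 := h.supNorm_gradProd_le i j
    have n4 := h.hsn_gradProd_le i j
    have n5 := h.moserConst_le (s := l - 1) (by omega)
    have n6 := moserConst_nonneg N (l - 1)
    calc _ ≤ M * (K * (3 * (M * (K * X))) + X * (3 * K ^ 2)) := by
          have := supNorm_nonneg P
          have := hsn_nonneg (l - 1) P
          have := supNorm_nonneg (weakDeriv (ee s) (m c))
          have := hsn_nonneg (l - 1) (weakDeriv (ee s) (m c))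
          gcongr
      _ = 3 * (M * (M + 1)) * (K ^ 2 * X) := by ring
      _ ≤ 6 * M ^ 2 * ((1 + K ^ 2) * X) :=
          mul_le_mul (by nlinarith) (by nlinarith) (by positivity) (by positivity)
  refine ⟨fun x => ∑ δ ∈ (Finset.Iic α).erase 0, leibCoeff α δ *
    (weakDeriv δ (m c) x * weakDeriv (ee i + ee j + (α - δ)) P x), ?_, ?_, ?_⟩
  · exact memLp_sum _ fun δ hδ => (key δ hδ).1.const_mul _
  · refine (l2n_sum_le _ fun δ hδ => (key δ hδ).1.const_mul _).trans ?_
    refine (Finset.sum_le_sum fun δ hδ => ?_).trans (sum_erase_leibCoeff_le α (by positivity))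
    rw [l2n_const_mul]
    exact mul_le_mul_of_nonneg_left (key δ hδ).2 (abs_nonneg _)
  · have h1 := LocH.leibniz_weakDeriv (α := α) (β := 0) (γ := ee i + ee j) (f := m c) (g := P)
      (hm.mono (by rw [length_zero]; omega))
      (hPb.locH.mono (by rw [length_add, l1, l1]; omega))
    have h0 : weakDeriv 0 (m c) =ᵐ[volume] m c := weakDeriv_zero_ae_eq hm.l2loc.1
    refine h1.congr ?_ ?_
    · filter_upwards [h0] with x hx
      rw [hx]
    · filter_upwards [h0] with x hx
      rw [← Finset.add_sum_erase _ _ (Finset.mem_Iic.2 (zero_le : 0 ≤ α)), leibCoeff_zero]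
      simp only [zero_add, tsub_zero, hx, one_mul]

theorem ae_sum_mul_velocity (h : LLState A l M K X m w) : ∀ᵐ x, ∑ c, m c x * w c x = 0 := by
  filter_upwards [h.eq] with x hx
  simp only [hx, Fin.sum_univ_three]
  simp
  ring

/-- Since ∂_r m × ∂_r m = 0, the product m × Δm is the divergence ∑ ∂_r(m × ∂_r m). The velocity has
no sup bound in terms of K, but the fields under the divergence do. -/
theorem velocity_ae_eq (h : LLState A l M K X m w) (c : Fin 3) :
    w c =ᵐ[volume] fun x => (∑ r, (weakDeriv (ee r)
        (fun x => m (c + 2) x * weakDeriv (ee r) (m (c + 1)) x) x +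
      -1 * weakDeriv (ee r) (fun x => m (c + 1) x * weakDeriv (ee r) (m (c + 2)) x) x)) +
      (A (c + 2) - A (c + 1)) * (m (c + 1) x * m (c + 2) x) := by
  have hm := fun c => (h.bddH c).locH
  have l1 : ∀ i : Fin N, length (ee i) = 1 := fun i => length_single _ _
  have key : ∀ a b : Fin 3, ∀ᵐ x, ∀ r : Fin N,
      weakDeriv (ee r) (fun x => m a x * weakDeriv (ee r) (m b) x) x =
        m a x * weakDeriv (ee r + ee r) (m b) x +
          weakDeriv (ee r) (m a) x * weakDeriv (ee r) (m b) x := by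
    intro a b
    refine ae_all_iff.2 fun r => ?_
    have h2 := ((hm a).hasWeakDeriv (α := ee r) (by rw [l1]; omega)).mul
      ((hm b).hasWeakDeriv_weakDeriv (α := ee r) (β := ee r) (by rw [l1]; omega)) (hm a).l2loc
      ((hm a).l2loc_weakDeriv (by rw [l1]; omega)) ((hm b).l2loc_weakDeriv (by rw [l1]; omega))
      ((hm b).l2loc_weakDeriv (by rw [length_add, l1]; omega))
    filter_upwards [h2.weakDeriv_ae_eq] with x hx
    rw [hx]; ring
  filter_upwards [h.eq, key (c + 2) (c + 1), key (c + 1) (c + 2)] with x hx h1 h2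
  rw [hx c]
  simp only [h1, h2, effField, weakLaplacian, single_two, mul_sub,
    Finset.sum_add_distrib, ← Finset.mul_sum]
  have : ∑ i : Fin N, weakDeriv (ee i) (m (c + 1)) x * weakDeriv (ee i) (m (c + 2)) x =
    ∑ i : Fin N, weakDeriv (ee i) (m (c + 2)) x * weakDeriv (ee i) (m (c + 1)) x :=
    Finset.sum_congr rfl fun i _ => mul_comm _ _
  rw [this]
  ring

/-- Moser's inequality of order l is applied to the two components of m, whose sup norms are at most
1, so that no power of K appears. -/
theorem hsn_mul_partial_le (h : LLState A l M K X m w) (a b : Fin 3) (r : Fin N) :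
    hsn (l - 1) (fun x => m a x * weakDeriv (ee r) (m b) x) ≤ M * X := by
  have l1 : ∀ i : Fin N, length (ee i) = 1 := fun i => length_single _ _
  have h2 := h.two_le
  have hb : ∀ β ∈ indices N (l - 1),
      l2n (weakDeriv β fun x => m a x * weakDeriv (ee r) (m b) x) ≤
        moserConst N l * (1 * X + X * 1) := fun β hβ => by
    rw [mem_indices] at hβ
    exact (DerivBound.moser_left ((h.bddH a).mono (by omega)) ((h.bddH b).mono (by omega))
      (by omega) (by rw [l1]; omega) (h.supNorm_le_one a) (h.hsn_le a l (by omega) le_rfl)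
      (h.supNorm_le_one b) (h.hsn_le b l (by omega) le_rfl) le_rfl).le
  refine (Finset.sum_le_card_nsmul _ _ _ hb).trans ?_
  rw [nsmul_eq_mul]
  have := mul_le_mul_of_nonneg_right
    (h.card_mul_moserConst_le (r := l - 1) (s := l) (by omega) le_rfl) h.X_nonneg
  linarith

/-- Because δ ≠ 0, one derivative ∂_s sits on m. In divergence form, w contributes one more
derivative of m × ∂_r m, so the total order, including ∂_i, is l − 1 on a pair of functions with sup
norms of order K. The anisotropic part of w has order l − 2 only. -/
theorem derivBound_cross_term (h : LLState A l M K X m w) (hα : length α + 2 = l) (c : Fin 3)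
    (i : Fin N) {δ : Fin N → ℕ} (h0 : δ ≠ 0) (hδ : δ ≤ α) :
    DerivBound (ee i) (fun x => weakDeriv δ (m c) x * weakDeriv (α - δ) (w c) x)
      ((4 * N + 4) * M ^ 3 * ((1 + K) * X)) := by
  have l1 : ∀ i : Fin N, length (ee i) = 1 := fun i => length_single _ _
  have hX := h.X_nonneg
  have hK := h.nonneg
  have hM := h.one_le_const
  have hl := length_add_length_sub hδ
  have hpos : 0 < length δ := Nat.pos_of_ne_zero fun h1 => h0 (length_eq_zero.1 h1)
  obtain ⟨s, β, hβ⟩ := exists_eq_add_single hpos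
  change δ = β + ee s at hβ
  subst hβ
  rw [length_add, l1] at hl
  set γ := α - (β + ee s)
  have bg : ∀ a b (r : Fin N), BddH (l + 1) (fun x => m a x * weakDeriv (ee r) (m b) x) :=
    fun a b r => ((h.bddH a).mono (by omega)).mul (h.bddH_partial b r)
  have bs : BddH (l + 1) (weakDeriv (ee s) (m c)) := h.bddH_partial c s
  have n1 := h.supNorm_partial_le c s
  have n2 := h.hsn_partial_le c s (j := l - 1) (by omega)
  have n3 := h.hsn_partial_le c s (j := l - 2) (by omega)
  have key1 : ∀ a b (r : Fin N), DerivBound (ee i)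
      (fun x => weakDeriv β (weakDeriv (ee s) (m c)) x *
        weakDeriv (ee r + γ) (fun x => m a x * weakDeriv (ee r) (m b) x) x)
      (M * (K * (M * X) + X * (1 * K))) := fun a b r =>
    DerivBound.moser (s := l - 1) (bs.mono (by omega)) ((bg a b r).mono (by omega)) (by omega)
      (by rw [length_add, l1, l1]; omega) n1 n2
      ((supNorm_mul_le (h.bddH a).1 (h.bddH_partial b r).1).trans
        (mul_le_mul (h.supNorm_le_one a) (h.supNorm_partial_le b r) (supNorm_nonneg _)
        zero_le_one)) (h.hsn_mul_partial_le a b r) (h.moserConst_le (by omega))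
  have key2 : DerivBound (ee i) (fun x => weakDeriv β (weakDeriv (ee s) (m c)) x *
        weakDeriv γ (fun x => m (c + 1) x * m (c + 2) x) x)
      (M * (K * (M / 2 * (1 * X + X * 1)) + X * (1 * 1))) :=
    DerivBound.moser (s := l - 2) (bs.mono (by omega))
      (((h.bddH (c + 1)).mul (h.bddH (c + 2))).mono (by omega)) (by omega)
      (by rw [l1]; omega) n1 n3
      ((supNorm_mul_le (h.bddH _).1 (h.bddH _).1).trans
        (mul_le_mul (h.supNorm_le_one _) (h.supNorm_le_one _) (supNorm_nonneg _) zero_le_one))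
      (h.hsn_mul_le (by omega) (by omega) ((h.bddH _).mono (by omega))
        ((h.bddH _).mono (by omega)) (h.supNorm_le_one _) (h.hsn_le _ _ (by omega) (by omega))
        (h.supNorm_le_one _) (h.hsn_le _ _ (by omega) (by omega))) (h.moserConst_le (by omega))
  have hA : |A (c + 2) - A (c + 1)| ≤ 2 * M := by
    have := abs_sub (A (c + 2)) (A (c + 1))
    have := h.aniso_le (c + 2)
    have := h.aniso_le (c + 1)
    linarith
  have key := ((DerivBound.sum fun r => (key1 (c + 2) (c + 1) r).add
    ((key1 (c + 1) (c + 2) r).const_mul (c := -1) (C := 1) (by norm_num))).add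
      (key2.const_mul hA))
  refine (key.congr ?_).mono ?_
  · have e1 : weakDeriv β (weakDeriv (ee s) (m c)) =ᵐ[volume] weakDeriv (ee s + β) (m c) :=
      (h.bddH c).locH.weakDeriv_weakDeriv (by rw [l1]; omega)
    have hd : ∀ a b (r : Fin N), HasWeakDeriv γ
        (weakDeriv (ee r) (fun x => m a x * weakDeriv (ee r) (m b) x))
        (weakDeriv (ee r + γ) (fun x => m a x * weakDeriv (ee r) (m b) x)) := fun a b r =>
      (bg a b r).locH.hasWeakDeriv_weakDeriv (by rw [l1]; omega)
    have e2 := (((HasWeakDeriv.sum (Finset.univ : Finset (Fin N)) fun r _ =>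
      (hd (c + 2) (c + 1) r).add ((hd (c + 1) (c + 2) r).const_mul (-1))).add
      ((((h.bddH (c + 1)).mul (h.bddH (c + 2))).locH.hasWeakDeriv (α := γ) (by omega)).const_mul
        (A (c + 2) - A (c + 1)))).congr (h.velocity_ae_eq c).symm (ae_eq_refl _)).weakDeriv_ae_eq
    filter_upwards [e1, e2] with x h1 h2
    rw [h2, add_comm β, ← h1, mul_add, Finset.mul_sum]
    congr 1
    · exact Finset.sum_congr rfl fun r _ => by ring
    · ring
  · have hN : (0 : ℝ) ≤ N := by positivity
    have a1 : M * (K * (M * X) + X * (1 * K)) ≤ 2 * M ^ 3 * ((1 + K) * X) := by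
      have e : M * (K * (M * X) + X * (1 * K)) = M * (M + 1) * (K * X) := by ring
      rw [e]
      exact mul_le_mul (by nlinarith [mul_nonneg (sub_nonneg.2 hM) (sq_nonneg M)])
        (by nlinarith) (by positivity) (by positivity)
    have a2 : M * (K * (M / 2 * (1 * X + X * 1)) + X * (1 * 1)) ≤ 2 * M ^ 2 * ((1 + K) * X) := by
      have e : M * (K * (M / 2 * (1 * X + X * 1)) + X * (1 * 1)) = M * ((M * K + 1) * X) := by ring
      have e2 : (M * K + 1) * X ≤ M * ((1 + K) * X) := by
        rw [← mul_assoc]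
        exact mul_le_mul_of_nonneg_right (by nlinarith) hX
      rw [e]
      nlinarith [mul_le_mul_of_nonneg_left e2 (by linarith : 0 ≤ M), mul_nonneg (sq_nonneg M) (mul_nonneg (by linarith : 0 ≤ 1 + K) hX)]
    calc _ ≤ N * (2 * M ^ 3 * ((1 + K) * X) + 1 * (2 * M ^ 3 * ((1 + K) * X))) +
          2 * M * (2 * M ^ 2 * ((1 + K) * X)) := by gcongr
      _ = _ := by ring

/-- Applying ∂^α to m·w = 0 expresses m·∂^α w by the terms with δ ≠ 0, which contain at most |α| − 1
derivatives of w. The scalar product therefore admits one more derivative than ∂^α w itself. -/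
theorem derivBound_inner_velocity (h : LLState A l M K X m w) (hα : length α + 2 = l)
    (i : Fin N) :
    DerivBound (ee i) (fun x => ∑ c, m c x * weakDeriv α (w c) x)
      (leibSum α * (3 * ((4 * N + 4) * M ^ 3 * ((1 + K) * X)))) := by
  have hX := h.X_nonneg
  have hK := h.nonneg
  have hM := h.one_le_const
  have h1 := HasWeakDeriv.sum (Finset.univ : Finset (Fin 3)) fun c _ =>
    LocH.leibniz (α := α) ((h.bddH c).locH.mono (by omega)) ((h.memH c).locH.mono (by omega))
  have h2 := h1.unique ((HasWeakDeriv.zero (F := ℝ) α).congr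
    (h.ae_sum_mul_velocity.mono fun x hx => hx.symm) (ae_eq_refl _))
  have h0 : ∀ᵐ x, ∀ c, weakDeriv 0 (m c) x = m c x :=
    ae_all_iff.2 fun c => weakDeriv_zero_ae_eq (h.bddH c).locH.l2loc.1
  have e : (fun x => ∑ δ ∈ (Finset.Iic α).erase 0, -leibCoeff α δ *
      ∑ c, weakDeriv δ (m c) x * weakDeriv (α - δ) (w c) x) =ᵐ[volume]
      fun x => ∑ c, m c x * weakDeriv α (w c) x := by
    filter_upwards [h2, h0] with x hx h0
    rw [Finset.sum_comm, ← Finset.add_sum_erase _ _ (Finset.mem_Iic.2 (zero_le : 0 ≤ α)),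
      leibCoeff_zero] at hx
    simp only [tsub_zero, h0, one_mul] at hx
    rw [← sub_eq_zero, ← neg_eq_zero, neg_sub, ← hx, sub_eq_add_neg, ← Finset.sum_neg_distrib]
    congr 1
    refine Finset.sum_congr rfl fun δ _ => ?_
    rw [neg_mul, neg_neg, Finset.mul_sum]
  refine ((DerivBound.sum_le _ fun δ hδ => ?_).congr e).mono
    (sum_erase_leibCoeff_le α (B := 3 * ((4 * N + 4) * M ^ 3 * ((1 + K) * X))) (by positivity))
  rw [Finset.mem_erase, Finset.mem_Iic] at hδ
  exact (DerivBound.sum fun c => h.derivBound_cross_term hα c i hδ.1 hδ.2).const_mul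
    (by rw [abs_neg])

/-- Up to the commutator, summing over c brings out the scalar product m·∂^α w. One integration by
parts in x_j moves the excess derivative from P = ∂_i m·∂_j m onto this scalar product, which can
bear it. -/
theorem abs_sum_integral_le (h : LLState A l M K X m w) (hα : length α + 2 = l) (i j : Fin N) :
    |∑ c, ∫ x, weakDeriv α (w c) x *
        weakDeriv α (fun x => m c x * weakDeriv (ee i + ee j) (gradProd m i j) x) x| ≤
      leibSum α * (18 * M ^ 2 + 72 * (N + 1) * M ^ 4) * ((1 + K ^ 2) * X ^ 2) := by
  have l1 : ∀ i : Fin N, length (ee i) = 1 := fun i => length_single _ _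
  have hX := h.X_nonneg
  have hK := h.nonneg
  have hM := h.one_le_const
  have hΛ := leibSum_nonneg α
  choose r hr2 hrl hr using fun c => h.exists_commutator hα c i j
  set P := gradProd m i j with hP
  have hPb : BddH (l + 1) P := h.bddH_gradProd i j
  have hw : ∀ c, MemLp (weakDeriv α (w c)) 2 := fun c => (h.memH c).memLp_weakDeriv (by omega)
  have hPl : MemLp (weakDeriv (ee i + ee j + α) P) 2 :=
    hPb.memLp _ (by rw [length_add, length_add, l1, l1]; omega)
      (by rw [length_add, length_add, l1, l1]; omega)
  have hP1 : MemLp (weakDeriv (ee i + α) P) 2 :=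
    hPb.memLp _ (by rw [length_add, l1]; omega) (by rw [length_add, l1]; omega)
  have hmw : ∀ c, MemLp (fun x => m c x * weakDeriv α (w c) x) 2 := fun c =>
    memLp_bdd_mul (h.bddH c).1 (hw c)
  have hG : MemLp (fun x => ∑ c, m c x * weakDeriv α (w c) x) 2 :=
    memLp_sum Finset.univ fun c _ => hmw c
  have hGd := h.derivBound_inner_velocity hα j
  have e1 : ∑ c, ∫ x, weakDeriv α (w c) x *
        weakDeriv α (fun x => m c x * weakDeriv (ee i + ee j) P x) x =
      (∫ x, (∑ c, m c x * weakDeriv α (w c) x) * weakDeriv (ee i + ee j + α) P x) +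
      ∑ c, ∫ x, weakDeriv α (w c) x * r c x := by
    simp only [Finset.sum_mul]
    rw [integral_finsetSum _ fun c _ => integrable_mul_of_memLp_two (hmw c) hPl, ← Finset.sum_add_distrib]
    refine Finset.sum_congr rfl fun c _ => ?_
    rw [← integral_add (integrable_mul_of_memLp_two (hmw c) hPl) (integrable_mul_of_memLp_two (hw c) (hr2 c))]
    refine integral_congr_ae ?_
    filter_upwards [(hr c).weakDeriv_ae_eq] with x hx
    rw [hx]; ring
  have hPd : HasWeakDeriv (ee j) (weakDeriv (ee i + α) P) (weakDeriv (ee i + ee j + α) P) := by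
    have := hPb.locH.hasWeakDeriv_weakDeriv (α := ee i + α) (β := ee j)
      (by rw [length_add, l1, l1]; omega)
    rwa [add_right_comm] at this
  have e2 : (∫ x, (∑ c, m c x * weakDeriv α (w c) x) * weakDeriv (ee i + ee j + α) P x) =
      -∫ x, weakDeriv (ee j) (fun x => ∑ c, m c x * weakDeriv α (w c) x) x *
        weakDeriv (ee i + α) P x := by
    rw [hGd.1.integral_mul hPd hG hGd.2 hP1 hPl, neg_neg]
  have b1 : |∫ x, (∑ c, m c x * weakDeriv α (w c) x) * weakDeriv (ee i + ee j + α) P x| ≤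
      leibSum α * (72 * (N + 1) * M ^ 4) * ((1 + K ^ 2) * X ^ 2) := by
    rw [e2, abs_neg]
    refine (abs_integral_le hGd.2 hP1 hGd.3 ((l2n_weakDeriv_le_hsn (s := l - 1) _
      (by rw [length_add, l1]; omega)).trans (h.hsn_gradProd_le i j))).trans ?_
    have e3 : leibSum α * (3 * ((4 * N + 4) * M ^ 3 * ((1 + K) * X))) * (3 * (M * (K * X))) =
      leibSum α * (36 * (N + 1) * M ^ 4) * ((K + K ^ 2) * X ^ 2) := by ring
    have e4 : leibSum α * (72 * (N + 1) * M ^ 4) * ((1 + K ^ 2) * X ^ 2) =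
      leibSum α * (36 * (N + 1) * M ^ 4) * (2 * (1 + K ^ 2) * X ^ 2) := by ring
    rw [e3, e4]
    gcongr
    nlinarith [sq_nonneg (K - 1)]
  have b2 : |∑ c, ∫ x, weakDeriv α (w c) x * r c x| ≤
      leibSum α * (18 * M ^ 2) * ((1 + K ^ 2) * X ^ 2) := by
    refine (Finset.abs_sum_le_sum_abs _ _).trans ((Finset.sum_le_sum fun c _ =>
      abs_integral_le (hw c) (hr2 c) (h.l2n_velocity_le c α hα) (hrl c)).trans ?_)
    refine le_of_eq ?_
    simp
    ring
  rw [e1]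
  refine (abs_add_le _ _).trans ((add_le_add b1 b2).trans (le_of_eq ?_))
  ring

/-- The constant in the estimate of the second time derivative. -/
noncomputable def accelConst (M : ℝ) (α : Fin N → ℕ) : ℝ :=
  3 * (42 * N ^ 2 * M ^ 2 + 40 * N * M ^ 3 + 20 * M ^ 4) +
    2 * N ^ 2 * (leibSum α * (18 * M ^ 2 + 72 * (N + 1) * M ^ 4))

/-- Neither ∂^α∂_t²m nor ∂^αΔ²m is bounded by X separately; their sum is rewritten by the identity
on the sphere before it is paired with ∂^α w. -/
theorem abs_sum_integral_accel_le (h : LLState A l M K X m w) (hα : length α + 2 = l)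
    (hz : ∀ c, HasWeakDeriv α (llAccel A m w c) (weakDeriv α (llAccel A m w c))) :
    |∑ c, ∫ x, weakDeriv α (w c) x * (weakDeriv α (llAccel A m w c) x +
        ∑ i, ∑ j, weakDeriv (ee i + ee i + ee j + ee j + α) (m c) x)| ≤
      accelConst M α * ((1 + K ^ 2) * X ^ 2) := by
  have l1 : ∀ i : Fin N, length (ee i) = 1 := fun i => length_single _ _
  have hX := h.X_nonneg
  have hl := h.two_le
  have hw : ∀ c, MemLp (weakDeriv α (w c)) 2 := fun c => (h.memH c).memLp_weakDeriv (by omega)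
  set Q : Fin 3 → Fin N → Fin N → Space N → ℝ := fun c i j =>
    weakDeriv α (fun x => m c x * weakDeriv (ee i + ee j) (gradProd m i j) x) with hQ
  have bQ : ∀ c i j, MemLp (Q c i j) 2 ∧ HasWeakDeriv α
      (fun x => m c x * weakDeriv (ee i + ee j) (gradProd m i j) x) (Q c i j) := fun c i j => by
    have := DerivBound.moser_left (α := α) ((h.bddH c).mono (s' := l) (by omega))
      ((h.bddH_gradProd i j).mono (s' := l) (by omega)) (by omega) (γ := ee i + ee j)
      (by rw [length_add, l1, l1, ← hα]) le_rfl le_rfl le_rfl le_rfl le_rfl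
    exact ⟨this.2, this.1⟩
  have hR := h.derivBound_remainder hα
  have e1 : ∀ c, (fun x => weakDeriv α (llAccel A m w c) x +
        ∑ i, ∑ j, weakDeriv (ee i + ee i + ee j + ee j + α) (m c) x) =ᵐ[volume]
      fun x => weakDeriv α (accelRemainder A m c) x + ∑ i, ∑ j, -2 * Q c i j x := by
    intro c
    have d1 := (hz c).add (HasWeakDeriv.sum (Finset.univ : Finset (Fin N)) fun i _ =>
      HasWeakDeriv.sum (Finset.univ : Finset (Fin N)) fun j _ =>
        (h.bddH c).locH.hasWeakDeriv_weakDeriv (α := ee i + ee i + ee j + ee j) (β := α)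
        (by simp only [length_add, l1]; omega))
    have d2 := (hR c).1.add (HasWeakDeriv.sum (Finset.univ : Finset (Fin N)) fun i _ =>
      HasWeakDeriv.sum (Finset.univ : Finset (Fin N)) fun j _ => (bQ c i j).2.const_mul (-2))
    refine d1.unique (d2.congr ?_ (ae_eq_refl _))
    filter_upwards [llAccel_add_bilaplacian_ae_eq (fun c => (h.bddH c).locH.mono (by omega))
      h.sphere h.eq] with x hx
    rw [hx c, accelRemainder]
    simp only [Finset.mul_sum]
    have e : ∀ i j, m c x * (-2 * weakDeriv (ee i + ee j) (gradProd m i j) x) =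
      -2 * (m c x * weakDeriv (ee i + ee j) (gradProd m i j) x) := fun i j => by ring
    simp only [e]
    ring
  have e2 : ∑ c, ∫ x, weakDeriv α (w c) x * (weakDeriv α (llAccel A m w c) x +
        ∑ i, ∑ j, weakDeriv (ee i + ee i + ee j + ee j + α) (m c) x) =
      (∑ c, ∫ x, weakDeriv α (w c) x * weakDeriv α (accelRemainder A m c) x) +
        ∑ i, ∑ j, -2 * ∑ c, ∫ x, weakDeriv α (w c) x * Q c i j x := by
    have e3 : ∑ i, ∑ j, -2 * ∑ c, ∫ x, weakDeriv α (w c) x * Q c i j x =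
        ∑ c, ∑ i, ∑ j, -2 * ∫ x, weakDeriv α (w c) x * Q c i j x := by
      simp only [Finset.mul_sum]
      exact (Finset.sum_congr rfl fun i _ => Finset.sum_comm).trans Finset.sum_comm
    rw [e3, ← Finset.sum_add_distrib]
    refine Finset.sum_congr rfl fun c _ => ?_
    have i1 : ∀ i j, Integrable fun x => weakDeriv α (w c) x * Q c i j x := fun i j =>
      (hw c).integrable_mul (bQ c i j).1
    have e4 : ∑ i, ∑ j, -2 * ∫ x, weakDeriv α (w c) x * Q c i j x =
        ∫ x, ∑ i, ∑ j, -2 * (weakDeriv α (w c) x * Q c i j x) := by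
      rw [integral_finsetSum _ fun i _ => integrable_finsetSum _ fun j _ => (i1 i j).const_mul _]
      refine Finset.sum_congr rfl fun i _ => ?_
      rw [integral_finsetSum _ fun j _ => (i1 i j).const_mul _]
      exact Finset.sum_congr rfl fun j _ => (integral_const_mul _ _).symm
    rw [e4, ← integral_add (integrable_mul_of_memLp_two (hw c) (hR c).2)
      (integrable_finsetSum _ fun i _ => integrable_finsetSum _ fun j _ => (i1 i j).const_mul _)]
    refine integral_congr_ae ?_
    filter_upwards [e1 c] with x hx
    rw [hx, mul_add, Finset.mul_sum]
    simp only [Finset.mul_sum]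
    have e : ∀ i j, weakDeriv α (w c) x * (-2 * Q c i j x) =
      -2 * (weakDeriv α (w c) x * Q c i j x) := fun i j => by ring
    simp only [e]
  rw [e2]
  have b1 : |∑ c, ∫ x, weakDeriv α (w c) x * weakDeriv α (accelRemainder A m c) x| ≤
      3 * (X * ((42 * N ^ 2 * M ^ 2 + 40 * N * M ^ 3 + 20 * M ^ 4) * ((1 + K ^ 2) * X))) := by
    refine (Finset.abs_sum_le_sum_abs _ _).trans ((Finset.sum_le_sum fun c _ =>
      abs_integral_le (hw c) (hR c).2 (h.l2n_velocity_le c α hα) (hR c).3).trans ?_)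
    simp
  have b2 : |∑ i, ∑ j, -2 * ∑ c, ∫ x, weakDeriv α (w c) x * Q c i j x| ≤
      N * (N * (2 * (leibSum α * (18 * M ^ 2 + 72 * (N + 1) * M ^ 4) *
        ((1 + K ^ 2) * X ^ 2)))) := by
    have b3 : ∀ i j, |-2 * ∑ c, ∫ x, weakDeriv α (w c) x * Q c i j x| ≤
        2 * (leibSum α * (18 * M ^ 2 + 72 * (N + 1) * M ^ 4) * ((1 + K ^ 2) * X ^ 2)) :=
      fun i j => by
        rw [abs_mul]
        have := h.abs_sum_integral_le hα i j
        norm_num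
        exact this
    refine (Finset.abs_sum_le_sum_abs _ _).trans ((Finset.sum_le_sum fun i _ =>
      (Finset.abs_sum_le_sum_abs _ _).trans (Finset.sum_le_sum fun j _ => b3 i j)).trans ?_)
    simp
  refine (abs_add_le _ _).trans ((add_le_add b1 b2).trans (le_of_eq ?_))
  rw [accelConst]
  ring

end LLState

end State

end LandauLifshitz
namespace LandauLifshitz

/-! ### Differentiation of the energies in time. -/

section Energies

variable {N : ℕ} {T : ℝ}

/-- Twice the Landau–Lifshitz energy, in components. -/
noncomputable def compEnergy (A : Fin 3 → ℝ) (m : Fin 3 → Space N → ℝ) : ℝ :=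
  ∑ c, ((∑ i, ∫ x, weakDeriv (ee i) (m c) x ^ 2) + A c * ∫ x, m c x ^ 2)

/-- The Laplacian of `∂^α f`. -/
noncomputable def lapDeriv (α : Fin N → ℕ) (f : Space N → ℝ) : Space N → ℝ :=
  fun x => ∑ i, weakDeriv (ee i + ee i + α) f x

/-- The integral of the higher-order density, in components. -/
noncomputable def compHigher (a b : Fin 3 → ℝ) (α : Fin N → ℕ) (m w : Fin 3 → Space N → ℝ) : ℝ :=
  ∑ c, ((∫ x, weakDeriv α (w c) x ^ 2) + (∫ x, lapDeriv α (m c) x ^ 2) +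
    a c * (∑ i, ∫ x, weakDeriv (ee i + α) (m c) x ^ 2) + b c * ∫ x, weakDeriv α (m c) x ^ 2)

/-- Half the time derivative of `compHigher`. -/
noncomputable def higherRate (a b : Fin 3 → ℝ) (α : Fin N → ℕ) (m w z : Fin 3 → Space N → ℝ) :
    ℝ :=
  ∑ c, ((∫ x, weakDeriv α (w c) x * weakDeriv α (z c) x) +
    (∫ x, lapDeriv α (m c) x * lapDeriv α (w c) x) +
    a c * (∑ i, ∫ x, weakDeriv (ee i + α) (m c) x * weakDeriv (ee i + α) (w c) x) +
    b c * ∫ x, weakDeriv α (m c) x * weakDeriv α (w c) x)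

theorem integral_partial_mul_partial {i : Fin N} {f g : Space N → ℝ} {β γ : Fin N → ℕ} {s r : ℕ}
    (hf : LocH s f) (hg : LocH r g) (h1 : length β + 2 ≤ s) (h2 : length γ + 1 ≤ r)
    (f1 : MemLp (weakDeriv (ee i + β) f) 2) (f2 : MemLp (weakDeriv (ee i + ee i + β) f) 2)
    (g0 : MemLp (weakDeriv γ g) 2) (g1 : MemLp (weakDeriv (ee i + γ) g) 2) :
    ∫ x, weakDeriv (ee i + β) f x * weakDeriv (ee i + γ) g x =
      -∫ x, weakDeriv (ee i + ee i + β) f x * weakDeriv γ g x := by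
  have l1 : length (ee i) = 1 := length_single _ _
  have d1 := hf.hasWeakDeriv_weakDeriv (α := ee i + β) (β := ee i)
    (by rw [length_add, l1]; omega)
  have d2 := hg.hasWeakDeriv_weakDeriv (α := γ) (β := ee i) (by rw [l1]; omega)
  rw [add_comm (ee i + β), ← add_assoc] at d1
  rw [add_comm γ] at d2
  have := d1.integral_mul d2 f1 f2 g0 g1
  linarith

namespace LLCurve

variable {A a b : Fin 3 → ℝ} {k : ℕ} {m w : Fin 3 → ℝ → Space N → ℝ}

theorem contL2_weakDeriv (h : LLCurve A k T m w) (c : Fin 3) {α : Fin N → ℕ}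
    (hα : length α ≤ k + 2) (h0 : 1 ≤ length α ∨ A c ≠ 0) :
    ContL2 T fun t => weakDeriv α (m c t) := by
  rcases Nat.eq_zero_or_pos (length α) with h1 | h1
  · have hA : A c ≠ 0 := by
      rcases h0 with h0 | h0
      · omega
      · exact h0
    rw [length_eq_zero.1 h1]
    exact (h.contL2 c hA).congr fun t ht =>
      (weakDeriv_zero_ae_eq ((h.contBddH c).1 t ht).locH.l2loc.1).symm
  · exact (h.contBddH c).contL2 α h1 hα

theorem hasDerivWithinAt_integral_weakDeriv_sq (h : LLCurve A k T m w) (hT : 0 < T) (c : Fin 3)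
    {α : Fin N → ℕ} (hα : length α ≤ k) (h0 : 1 ≤ length α ∨ A c ≠ 0) {t : ℝ}
    (ht : t ∈ Icc 0 T) :
    HasDerivWithinAt (fun t => ∫ x, weakDeriv α (m c t) x ^ 2)
      (2 * ∫ x, weakDeriv α (m c t) x * weakDeriv α (w c t) x) (Icc 0 T) t :=
  hasDerivWithinAt_integral_sq hT (h.contL2_weakDeriv c (by omega) h0).1
    ((h.contH c).contL2 α hα) (h.timeDeriv_weakDeriv c hα) t ht

/-- Integration by parts turns the rate into −2∫ h·w, and w = −m × h is pointwise orthogonal to the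
effective field h. -/
theorem compEnergy_rate_eq_zero (h : LLCurve A k T m w) (hk : 2 ≤ k) {t : ℝ}
    (ht : t ∈ Icc 0 T) :
    ∑ c, ((∑ i, 2 * ∫ x, weakDeriv (ee i) (m c t) x * weakDeriv (ee i) (w c t) x) +
      A c * (2 * ∫ x, m c t x * w c t x)) = 0 := by
  have l1 : ∀ i : Fin N, length (ee i) = 1 := fun i => length_single _ _
  have hw : ∀ c, MemLp (w c t) 2 := fun c => ((h.contH c).1 t ht).memLp
  have hm2 : ∀ c (i : Fin N), MemLp (weakDeriv (ee i + ee i) (m c t)) 2 := fun c i =>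
    ((h.contBddH c).1 t ht).memLp _ (by rw [length_add, l1]; omega)
      (by rw [length_add, l1]; omega)
  have e1 : ∀ c (i : Fin N), ∫ x, weakDeriv (ee i) (m c t) x * weakDeriv (ee i) (w c t) x =
      -∫ x, weakDeriv (ee i + ee i) (m c t) x * w c t x := by
    intro c i
    have d1 := ((h.contBddH c).1 t ht).locH.hasWeakDeriv_weakDeriv (α := ee i) (β := ee i)
      (by rw [l1]; omega)
    have d2 := ((h.contH c).1 t ht).locH.hasWeakDeriv (α := ee i) (by rw [l1]; omega)
    have := d1.integral_mul d2 (((h.contBddH c).1 t ht).memLp _ (by rw [l1]) (by rw [l1]; omega))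
      (hm2 c i) (hw c) (((h.contH c).1 t ht).memLp_weakDeriv (by rw [l1]; omega))
    linarith
  have e2 : ∀ c, (∑ i, 2 * ∫ x, weakDeriv (ee i) (m c t) x * weakDeriv (ee i) (w c t) x) +
      A c * (2 * ∫ x, m c t x * w c t x) =
      -2 * ∫ x, effField A (fun c => m c t) c x * w c t x := by
    intro c
    have i1 : ∀ i : Fin N, Integrable fun x => weakDeriv (ee i + ee i) (m c t) x * w c t x :=
      fun i => integrable_mul_of_memLp_two (hm2 c i) (hw c)
    have i2 : Integrable fun x => A c * m c t x * w c t x :=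
      integrable_mul_of_memLp_two ((h.contL2_aniso c).1 t ht) (hw c)
    have e3 : ∫ x, effField A (fun c => m c t) c x * w c t x =
        (∑ i, ∫ x, weakDeriv (ee i + ee i) (m c t) x * w c t x) -
          A c * ∫ x, m c t x * w c t x := by
      rw [← integral_finsetSum _ fun i _ => i1 i, ← integral_const_mul]
      simp only [← mul_assoc]
      rw [← integral_sub (integrable_finsetSum _ fun i _ => i1 i) i2]
      congr 1
      ext x
      simp only [effField, weakLaplacian, single_two, sub_mul, Finset.sum_mul]
    rw [e3]
    simp only [e1, Finset.mul_sum, mul_sub, mul_neg, neg_mul]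
    rw [sub_eq_add_neg, neg_neg]
    simp only [Finset.sum_neg_distrib]
    ring
  rw [Finset.sum_congr rfl fun c _ => e2 c, ← Finset.mul_sum,
    ← integral_finsetSum _ fun c _ =>
      integrable_mul_of_memLp_two ((h.contL2_effField c).1 t ht) (hw c)]
  have e4 : (fun x => ∑ c, effField A (fun c => m c t) c x * w c t x) =ᵐ[volume] fun _ => 0 := by
    filter_upwards [h.eq t ht] with x hx
    simp only [hx, Fin.sum_univ_three]
    simp
    ring
  rw [integral_congr_ae e4]
  simp

theorem hasDerivWithinAt_compEnergy (h : LLCurve A k T m w) (hT : 0 < T) (hk : 2 ≤ k) {t : ℝ}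
    (ht : t ∈ Icc 0 T) :
    HasDerivWithinAt (fun t => compEnergy A fun c => m c t) 0 (Icc 0 T) t := by
  refine HasDerivWithinAt.congr_deriv ?_ (h.compEnergy_rate_eq_zero hk ht)
  refine HasDerivWithinAt.fun_sum fun c _ => HasDerivWithinAt.add
    (HasDerivWithinAt.fun_sum fun i _ =>
      h.hasDerivWithinAt_integral_weakDeriv_sq hT c (α := ee i) ((length_single i 1).trans_le
        (by omega)) (Or.inl (length_single i 1).ge) ht) ?_
  by_cases hA : A c = 0
  · simpa [hA] using hasDerivWithinAt_const t (Icc 0 T) (0 : ℝ)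
  · exact (hasDerivWithinAt_integral_sq hT (h.contL2 c hA).1 (h.contH c).contL2_self
      (h.timeDeriv c) t ht).const_mul _

theorem compEnergy_eq (h : LLCurve A k T m w) (hT : 0 < T) (hk : 2 ≤ k) {t : ℝ}
    (ht : t ∈ Icc 0 T) : compEnergy A (fun c => m c t) = compEnergy A fun c => m c 0 :=
  constant_of_derivWithin_zero
    (fun _ hs => (h.hasDerivWithinAt_compEnergy hT hk hs).differentiableWithinAt)
    (fun s hs => (h.hasDerivWithinAt_compEnergy hT hk (Ico_subset_Icc_self hs)).derivWithin
      (uniqueDiffOn_Icc hT s (Ico_subset_Icc_self hs))) t ht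

theorem contL2_lapDeriv (h : LLCurve A k T m w) (c : Fin 3) {α : Fin N → ℕ}
    (hα : length α + 2 ≤ k) : ContL2 T fun t => lapDeriv α (m c t) :=
  ContL2.sum Finset.univ fun i _ => (h.contBddH c).contL2 _
    (by simp only [length_add, length_single]; omega)
    (by simp only [length_add, length_single]; omega)

theorem contL2_lapDeriv_velocity (h : LLCurve A k T m w) (c : Fin 3) {α : Fin N → ℕ}
    (hα : length α + 2 ≤ k) : ContL2 T fun t => lapDeriv α (w c t) :=
  ContL2.sum Finset.univ fun i _ => (h.contH c).contL2 _
    (by simp only [length_add, length_single]; omega)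

theorem timeDeriv_lapDeriv (h : LLCurve A k T m w) (c : Fin 3) {α : Fin N → ℕ}
    (hα : length α + 2 ≤ k) :
    IsTimeDeriv T (fun t => lapDeriv α (m c t)) fun t => lapDeriv α (w c t) :=
  IsTimeDeriv.sum _ (fun i _ => h.timeDeriv_weakDeriv c
      (by simp only [length_add, length_single]; omega))
    (fun i _ t ht => (((h.contBddH c).1 t ht).locH.l2loc_weakDeriv
      (by simp only [length_add, length_single]; omega)).1)
    fun i _ t ht => (((h.contH c).1 t ht).locH.l2loc_weakDeriv
      (by simp only [length_add, length_single]; omega)).1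

variable {α : Fin N → ℕ}

/-- A component with A c = 0 need not be square integrable, so its zeroth-order coefficient b c has
to vanish. The restriction |α| ≤ k − 2 is what the regularity of ∂_t²m allows. -/
theorem hasDerivWithinAt_compHigher (h : LLCurve A k T m w) (hT : 0 < T) (hN : 1 ≤ N)
    (hk : N < 2 * (k - 1)) (hα : length α + 2 ≤ k) (hb : ∀ c, b c ≠ 0 → A c ≠ 0) {t : ℝ}
    (ht : t ∈ Icc 0 T) :
    HasDerivWithinAt (fun t => compHigher a b α (fun c => m c t) fun c => w c t)
      (2 * higherRate a b α (fun c => m c t) (fun c => w c t)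
        (llAccel A (fun c => m c t) fun c => w c t)) (Icc 0 T) t := by
  have hz := fun c => h.contH_accel hN hk c
  have key : ∀ c, HasDerivWithinAt (fun t => (∫ x, weakDeriv α (w c t) x ^ 2) +
      (∫ x, lapDeriv α (m c t) x ^ 2) +
      a c * (∑ i, ∫ x, weakDeriv (ee i + α) (m c t) x ^ 2) +
      b c * ∫ x, weakDeriv α (m c t) x ^ 2)
      ((2 * ∫ x, weakDeriv α (w c t) x *
        weakDeriv α (llAccel A (fun c => m c t) (fun c => w c t) c) x) +
      (2 * ∫ x, lapDeriv α (m c t) x * lapDeriv α (w c t) x) +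
      a c * (∑ i, 2 * ∫ x, weakDeriv (ee i + α) (m c t) x * weakDeriv (ee i + α) (w c t) x) +
      b c * (2 * ∫ x, weakDeriv α (m c t) x * weakDeriv α (w c t) x)) (Icc 0 T) t := by
    intro c
    refine (((hasDerivWithinAt_integral_sq hT ((h.contH c).contL2 α (by omega)).1
      ((hz c).contL2 α (by omega)) ((h.timeDeriv_accel hT (by omega) c).weakDeriv (s := k - 2)
        (by omega) (fun t ht => ((h.contH c).1 t ht).locH.mono (by omega))
        fun t ht => ((hz c).1 t ht).locH) t ht).add
      (hasDerivWithinAt_integral_sq hT (h.contL2_lapDeriv c hα).1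
        (h.contL2_lapDeriv_velocity c hα) (h.timeDeriv_lapDeriv c hα) t ht)).add
      ((HasDerivWithinAt.fun_sum fun i _ => h.hasDerivWithinAt_integral_weakDeriv_sq hT c
        (by simp only [length_add, length_single]; omega)
        (Or.inl (by simp only [length_add, length_single]; omega)) ht).const_mul (a c))).add ?_
    by_cases hbc : b c = 0
    · simpa [hbc] using hasDerivWithinAt_const t (Icc 0 T) (0 : ℝ)
    · exact (h.hasDerivWithinAt_integral_weakDeriv_sq hT c (by omega) (Or.inr (hb c hbc))
        ht).const_mul _
  refine (HasDerivWithinAt.fun_sum fun c _ => key c).congr_deriv ?_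
  rw [higherRate, Finset.mul_sum]
  refine Finset.sum_congr rfl fun c _ => ?_
  rw [← Finset.mul_sum]
  ring

theorem continuousOn_higherRate (h : LLCurve A k T m w) (hN : 1 ≤ N)
    (hk : N < 2 * (k - 1)) (hα : length α + 2 ≤ k) (hb : ∀ c, b c ≠ 0 → A c ≠ 0) :
    ContinuousOn (fun t => higherRate a b α (fun c => m c t) (fun c => w c t)
        (llAccel A (fun c => m c t) fun c => w c t)) (Icc 0 T) := by
  have hz := fun c => h.contH_accel hN hk c
  refine continuousOn_finsetSum _ fun c _ => (((((h.contH c).contL2 α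
    (by omega)).continuousOn_integral_mul ((hz c).contL2 α (by omega))).add
    ((h.contL2_lapDeriv c hα).continuousOn_integral_mul (h.contL2_lapDeriv_velocity c hα))).add
    (continuousOn_const.mul (continuousOn_finsetSum _ fun i _ =>
      ((h.contBddH c).contL2 _ (by simp only [length_add, length_single]; omega)
        (by simp only [length_add, length_single]; omega)).continuousOn_integral_mul
      ((h.contH c).contL2 _ (by simp only [length_add, length_single]; omega))))).add ?_
  by_cases hbc : b c = 0
  · simpa [hbc] using continuousOn_const
  · exact continuousOn_const.mul ((h.contL2_weakDeriv c (by omega)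
      (Or.inr (hb c hbc))).continuousOn_integral_mul ((h.contH c).contL2 α (by omega)))

end LLCurve

end Energies

end LandauLifshitz
namespace LandauLifshitz

/-! ### From the rate of change to the energies. -/

section Bounds

variable {N : ℕ}

theorem l2n_sq {f : Space N → ℝ} (hf : MemLp f 2) : l2n f ^ 2 = ∫ x, f x ^ 2 := by
  have h1 := inner_toL2 hf hf
  rw [real_inner_self_eq_norm_sq, toL2_of_memLp hf, Lp.norm_toLp] at h1
  simpa only [l2n, ← sq] using h1

theorem l2n_le_sqrt {f : Space N → ℝ} (hf : MemLp f 2) {B : ℝ} (h : ∫ x, f x ^ 2 ≤ B) :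
    l2n f ≤ Real.sqrt B :=
  Real.le_sqrt_of_sq_le ((l2n_sq hf).trans_le h)

variable {A a b : Fin 3 → ℝ} {α : Fin N → ℕ}

/-- Two integrations by parts move ∂_j² from g onto f, so that in the energy rate ∂^αΔ²m is paired
with ∂^α w. -/
theorem integral_lapDeriv_term {s r : ℕ} {f g : Space N → ℝ} (hf : BddH s f) (hg : LocH r g)
    (h1 : length α + 4 ≤ s) (h2 : length α + 2 ≤ r) (g0 : MemLp (weakDeriv α g) 2)
    (i j : Fin N) (g1 : MemLp (weakDeriv (ee j + α) g) 2)
    (g2 : MemLp (weakDeriv (ee j + ee j + α) g) 2) :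
    ∫ x, weakDeriv (ee i + ee i + α) f x * weakDeriv (ee j + ee j + α) g x =
      ∫ x, weakDeriv (ee i + ee i + ee j + ee j + α) f x * weakDeriv α g x := by
  have l1 : ∀ i : Fin N, length (ee i) = 1 := fun i => length_single _ _
  have f2 : MemLp (weakDeriv (ee i + ee i + α) f) 2 := hf.memLp _
    (by simp only [length_add, l1]; omega) (by simp only [length_add, l1]; omega)
  have f3 : MemLp (weakDeriv (ee j + (ee i + ee i + α)) f) 2 := hf.memLp _
    (by simp only [length_add, l1]; omega) (by simp only [length_add, l1]; omega)
  have f4 : MemLp (weakDeriv (ee j + ee j + (ee i + ee i + α)) f) 2 := hf.memLp _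
    (by simp only [length_add, l1]; omega) (by simp only [length_add, l1]; omega)
  have d1 := hf.locH.hasWeakDeriv_weakDeriv (α := ee i + ee i + α) (β := ee j)
    (by simp only [length_add, l1]; omega)
  have d2 := hg.hasWeakDeriv_weakDeriv (α := ee j + α) (β := ee j)
    (by simp only [length_add, l1]; omega)
  rw [add_comm (ee i + ee i + α)] at d1
  rw [add_comm (ee j + α), ← add_assoc] at d2
  have e1 := d1.integral_mul d2 f2 f3 g1 g2
  have e2 := integral_partial_mul_partial (i := j) (β := ee i + ee i + α) (γ := α) hf.locH hg
    (by simp only [length_add, l1]; omega) (by omega) f3 f4 g0 g1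
  have e3 : ee j + ee j + (ee i + ee i + α) = ee i + ee i + ee j + ee j + α := by abel
  rw [e3] at e2
  linarith

theorem integral_mixed_sq {s : ℕ} {f : Space N → ℝ} (hf : BddH s f) (h1 : length α + 3 ≤ s)
    (i j : Fin N) :
    ∫ x, weakDeriv (ee i + ee j + α) f x ^ 2 =
      ∫ x, weakDeriv (ee i + ee i + α) f x * weakDeriv (ee j + ee j + α) f x := by
  have l1 : ∀ i : Fin N, length (ee i) = 1 := fun i => length_single _ _
  have hm : ∀ β : Fin N → ℕ, 1 ≤ length β → length β ≤ s → MemLp (weakDeriv β f) 2 := hf.memLp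
  have e1 := integral_partial_mul_partial (i := i) (β := ee j + α) (γ := ee j + α) hf.locH hf.locH
    (by simp only [length_add, l1]; omega) (by simp only [length_add, l1]; omega)
    (hm _ (by simp only [length_add, l1]; omega) (by simp only [length_add, l1]; omega))
    (hm _ (by simp only [length_add, l1]; omega) (by simp only [length_add, l1]; omega))
    (hm _ (by simp only [length_add, l1]; omega) (by simp only [length_add, l1]; omega))
    (hm _ (by simp only [length_add, l1]; omega) (by simp only [length_add, l1]; omega))
  have d1 := hf.locH.hasWeakDeriv_weakDeriv (α := ee i + ee i + α) (β := ee j)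
    (by simp only [length_add, l1]; omega)
  have d2 := hf.locH.hasWeakDeriv_weakDeriv (α := ee j + α) (β := ee j)
    (by simp only [length_add, l1]; omega)
  rw [add_assoc (ee i + ee i), add_comm α] at d1
  rw [add_comm (ee j + α), ← add_assoc] at d2
  have e2 := d1.integral_mul d2
    (hm _ (by simp only [length_add, l1]; omega) (by simp only [length_add, l1]; omega))
    (hm _ (by simp only [length_add, l1]; omega) (by simp only [length_add, l1]; omega))
    (hm _ (by simp only [length_add, l1]; omega) (by simp only [length_add, l1]; omega))
    (hm _ (by simp only [length_add, l1]; omega) (by simp only [length_add, l1]; omega))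
  simp only [sq]
  rw [← add_assoc] at e1
  linarith

theorem memLp_lapDeriv {s : ℕ} {f : Space N → ℝ} (hf : BddH s f) (h1 : length α + 2 ≤ s) :
    MemLp (lapDeriv α f) 2 :=
  memLp_sum Finset.univ fun i _ => hf.memLp _ (by simp only [length_add, length_single]; omega)
    (by simp only [length_add, length_single]; omega)

/-- Summed over i and j, two integrations by parts give ‖D²u‖ = ‖Δu‖ in L² for u = ∂^α f. The
energies contain the Laplacian only, but this controls every second derivative. -/
theorem integral_mixed_sq_le {s : ℕ} {f : Space N → ℝ} (hf : BddH s f) (h1 : length α + 3 ≤ s)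
    (i j : Fin N) :
    ∫ x, weakDeriv (ee i + ee j + α) f x ^ 2 ≤ ∫ x, lapDeriv α f x ^ 2 := by
  have hm : ∀ i : Fin N, MemLp (weakDeriv (ee i + ee i + α) f) 2 := fun i => hf.memLp _
    (by simp only [length_add, length_single]; omega)
    (by simp only [length_add, length_single]; omega)
  have hi : ∀ i j : Fin N, Integrable fun x =>
      weakDeriv (ee i + ee i + α) f x * weakDeriv (ee j + ee j + α) f x := fun i j =>
    integrable_mul_of_memLp_two (hm i) (hm j)
  have e : ∫ x, lapDeriv α f x ^ 2 = ∑ i, ∑ j, ∫ x, weakDeriv (ee i + ee j + α) f x ^ 2 := by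
    simp only [lapDeriv, sq, Finset.sum_mul_sum]
    rw [integral_finsetSum _ fun i _ => integrable_finsetSum _ fun j _ => hi i j]
    refine Finset.sum_congr rfl fun i _ => ?_
    rw [integral_finsetSum _ fun j _ => hi i j]
    refine Finset.sum_congr rfl fun j _ => ?_
    simp only [← sq]
    exact (integral_mixed_sq hf h1 i j).symm
  have h0 : ∀ i j, 0 ≤ ∫ x, weakDeriv (ee i + ee j + α) f x ^ 2 := fun i j =>
    integral_nonneg fun x => sq_nonneg _
  rw [e]
  exact (Finset.single_le_sum (f := fun j => ∫ x, weakDeriv (ee i + ee j + α) f x ^ 2)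
    (fun j _ => h0 i j) (Finset.mem_univ j)).trans (Finset.single_le_sum
    (f := fun i => ∑ j, ∫ x, weakDeriv (ee i + ee j + α) f x ^ 2)
    (fun i _ => Finset.sum_nonneg fun j _ => h0 i j) (Finset.mem_univ i))

/-- The constant in the energy estimate. -/
noncomputable def rateConst (M : ℝ) (α : Fin N → ℕ) : ℝ :=
  LLState.accelConst M α + 6 * M * N + 3 * M * (1 + M)

namespace LLState

variable {l : ℕ} {M K X : ℝ} {m w : Fin 3 → Space N → ℝ} {b' : Fin 3 → ℝ}

/-- The zeroth-order coefficient has the form b'A because for α = 0 only A_c m_c, and not m_c, is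
controlled in L². -/
theorem higherRate_le (h : LLState A l M K X m w) (hα : length α + 2 = l)
    (hz : ∀ c, HasWeakDeriv α (llAccel A m w c) (weakDeriv α (llAccel A m w c)))
    (hz2 : ∀ c, MemLp (weakDeriv α (llAccel A m w c)) 2)
    (ha : ∀ c, |a c| ≤ 2 * M) (hb : ∀ c, |b' c| ≤ M) :
    higherRate a (fun c => b' c * A c) α m w (llAccel A m w) ≤
      rateConst M α * ((1 + K ^ 2) * X ^ 2) := by
  have l1 : ∀ i : Fin N, length (ee i) = 1 := fun i => length_single _ _
  have hX := h.X_nonneg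
  have hM := h.one_le_const
  have hw : ∀ c (β : Fin N → ℕ), length β ≤ l → MemLp (weakDeriv β (w c)) 2 := fun c β hβ =>
    (h.memH c).memLp_weakDeriv hβ
  have hm : ∀ c (β : Fin N → ℕ), 1 ≤ length β → length β ≤ l + 2 →
      MemLp (weakDeriv β (m c)) 2 := fun c => (h.bddH c).memLp
  have hwα : ∀ c, MemLp (weakDeriv α (w c)) 2 := fun c => hw c α (by omega)
  have hwX : ∀ c, l2n (weakDeriv α (w c)) ≤ X := fun c => h.l2n_velocity_le c α hα
  have hm4 : ∀ c (i j : Fin N), MemLp (weakDeriv (ee i + ee i + ee j + ee j + α) (m c)) 2 :=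
    fun c i j => hm c _ (by simp only [length_add, l1]; omega)
      (by simp only [length_add, l1]; omega)
  have t1 : ∀ c, (∫ x, weakDeriv α (w c) x * weakDeriv α (llAccel A m w c) x) +
      (∫ x, lapDeriv α (m c) x * lapDeriv α (w c) x) =
      ∫ x, weakDeriv α (w c) x * (weakDeriv α (llAccel A m w c) x +
        ∑ i, ∑ j, weakDeriv (ee i + ee i + ee j + ee j + α) (m c) x) := by
    intro c
    have i1 : ∀ i j : Fin N, Integrable fun x =>
        weakDeriv (ee i + ee i + α) (m c) x * weakDeriv (ee j + ee j + α) (w c) x := fun i j =>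
      integrable_mul_of_memLp_two (hm c _ (by simp only [length_add, l1]; omega)
        (by simp only [length_add, l1]; omega)) (hw c _ (by simp only [length_add, l1]; omega))
    have i2 : ∀ i j : Fin N, Integrable fun x =>
        weakDeriv (ee i + ee i + ee j + ee j + α) (m c) x * weakDeriv α (w c) x := fun i j =>
      integrable_mul_of_memLp_two (hm4 c i j) (hwα c)
    have e : ∫ x, lapDeriv α (m c) x * lapDeriv α (w c) x =
        ∫ x, ∑ i, ∑ j, weakDeriv (ee i + ee i + ee j + ee j + α) (m c) x * weakDeriv α (w c) x := by
      simp only [lapDeriv, Finset.sum_mul_sum]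
      rw [integral_finsetSum _ fun i _ => integrable_finsetSum _ fun j _ => i1 i j,
        integral_finsetSum _ fun i _ => integrable_finsetSum _ fun j _ => i2 i j]
      refine Finset.sum_congr rfl fun i _ => ?_
      rw [integral_finsetSum _ fun j _ => i1 i j, integral_finsetSum _ fun j _ => i2 i j]
      exact Finset.sum_congr rfl fun j _ => integral_lapDeriv_term (h.bddH c) (h.memH c).locH
        (by omega) (by omega) (hwα c) i j (hw c _ (by simp only [length_add, l1]; omega))
        (hw c _ (by simp only [length_add, l1]; omega))
    rw [e, ← integral_add (integrable_mul_of_memLp_two (hwα c) (hz2 c))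
      (integrable_finsetSum _ fun i _ => integrable_finsetSum _ fun j _ => i2 i j)]
    congr 1
    ext x
    rw [mul_comm (weakDeriv α (w c) x), mul_comm (weakDeriv α (w c) x)]
    simp only [add_mul, Finset.sum_mul]
  -- The energies do not control ∂_i∂^α w; the derivative is moved back onto m, whose derivatives of
  -- order l are bounded by X.
  have t2 : ∀ c, a c * (∑ i, ∫ x, weakDeriv (ee i + α) (m c) x * weakDeriv (ee i + α) (w c) x) ≤
      2 * M * (N * (X * X)) := by
    intro c
    refine (le_abs_self _).trans ?_
    rw [abs_mul]
    refine mul_le_mul (ha c) ?_ (abs_nonneg _) (by positivity)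
    have e : ∀ i : Fin N, |∫ x, weakDeriv (ee i + α) (m c) x * weakDeriv (ee i + α) (w c) x| ≤
        X * X := by
      intro i
      have m2 : MemLp (weakDeriv (ee i + ee i + α) (m c)) 2 :=
        hm c _ (by simp only [length_add, l1]; omega) (by simp only [length_add, l1]; omega)
      rw [integral_partial_mul_partial (i := i) (h.bddH c).locH (h.memH c).locH (β := α) (γ := α)
        (by omega) (by omega)
        (hm c _ (by simp only [length_add, l1]; omega) (by simp only [length_add, l1]; omega)) m2
        (hwα c) (hw c _ (by simp only [length_add, l1]; omega)), abs_neg]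
      exact abs_integral_le m2 (hwα c) ((l2n_weakDeriv_le_hsn (s := l) _
        (by simp only [length_add, l1]; omega)).trans (h.hsn_le c l (by omega) le_rfl)) (hwX c)
    refine (Finset.abs_sum_le_sum_abs _ _).trans ((Finset.sum_le_sum fun i _ => e i).trans ?_)
    simp
  -- The factor A c stays with m. For α = 0 this uses the bound on A_c m_c, otherwise a seminorm of
  -- order l − 2; 1 + M covers both cases.
  have t3 : ∀ c, b' c * A c * ∫ x, weakDeriv α (m c) x * weakDeriv α (w c) x ≤
      M * ((1 + M) * X * X) := by
    intro c
    have key : MemLp (fun x => A c * weakDeriv α (m c) x) 2 ∧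
        l2n (fun x => A c * weakDeriv α (m c) x) ≤ (1 + M) * X := by
      rcases Nat.eq_zero_or_pos (length α) with h0 | h0
      · have e : (fun x => A c * weakDeriv α (m c) x) =ᵐ[volume] fun x => A c * m c x := by
          rw [length_eq_zero.1 h0]
          filter_upwards [weakDeriv_zero_ae_eq (h.bddH c).locH.l2loc.1] with x hx
          rw [hx]
        refine ⟨(h.memLp_aniso c).ae_eq e.symm, ?_⟩
        rw [l2n_congr e]
        have := h.l2n_aniso_le c
        nlinarith
      · have hmα := hm c α h0 (by omega)
        refine ⟨hmα.const_mul _, ?_⟩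
        rw [l2n_const_mul]
        have := mul_le_mul (h.aniso_le c) ((l2n_weakDeriv_le_hsn (s := l - 2) (m c)
          (α := α) (by omega)).trans (h.hsn_le c (l - 2) (by omega) (by omega))) (l2n_nonneg _)
          (by linarith)
        nlinarith
    have e : b' c * A c * ∫ x, weakDeriv α (m c) x * weakDeriv α (w c) x =
        b' c * ∫ x, A c * weakDeriv α (m c) x * weakDeriv α (w c) x := by
      rw [mul_assoc, ← integral_const_mul]
      simp only [mul_assoc]
    rw [e]
    refine (le_abs_self _).trans ?_
    rw [abs_mul]
    exact mul_le_mul (hb c) (abs_integral_le key.1 (hwα c) key.2 (hwX c)) (abs_nonneg _)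
      (by linarith)
  have e : higherRate a (fun c => b' c * A c) α m w (llAccel A m w) ≤
      (∑ c, ∫ x, weakDeriv α (w c) x * (weakDeriv α (llAccel A m w c) x +
        ∑ i, ∑ j, weakDeriv (ee i + ee i + ee j + ee j + α) (m c) x)) +
      ∑ _c : Fin 3, (2 * M * (N * (X * X)) + M * ((1 + M) * X * X)) := by
    rw [higherRate, ← Finset.sum_add_distrib]
    refine Finset.sum_le_sum fun c _ => ?_
    rw [t1 c]
    linarith [t2 c, t3 c]
  have e2 := (le_abs_self _).trans (h.abs_sum_integral_accel_le hα hz)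
  refine e.trans ((add_le_add e2 le_rfl).trans ?_)
  have e3 : X ^ 2 ≤ (1 + K ^ 2) * X ^ 2 := by nlinarith [mul_nonneg (sq_nonneg K) (sq_nonneg X)]
  have e4 : 0 ≤ 6 * M * N + 3 * M * (1 + M) := by positivity
  rw [rateConst]
  simp only [Finset.sum_const, Finset.card_univ, Fintype.card_fin, nsmul_eq_mul]
  push_cast
  nlinarith [mul_le_mul_of_nonneg_left e3 e4]

end LLState

variable {k l : ℕ} {T M K S : ℝ} {m w : Fin 3 → ℝ → Space N → ℝ}

/-- The state of a solution at a given time, with bounds in terms of its energies. -/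
theorem LLCurve.llState (h : LLCurve A k T m w) (hl : 2 ≤ l) (hlk : l ≤ k) (hN : N < 2 * (k - 1))
    (hM : 1 ≤ M) (hc : ∀ r s, r ≤ l → s ≤ l →
      2 * (1 + (indices N r).card) * (1 + moserConst N s) ^ 2 ≤ M)
    (hA : ∀ c, |A c| ≤ M) (hA0 : ∀ c, 0 ≤ A c) (ha : ∀ c, 0 ≤ a c) (hb : ∀ c, 0 ≤ b c)
    (hK : 0 ≤ K) {t : ℝ} (ht : t ∈ Icc 0 T)
    (hmK : ∀ c i, supNorm (weakDeriv (ee i) (m c t)) ≤ K)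
    (hS1 : compEnergy A (fun c => m c t) ≤ 2 * S)
    (hS2 : ∀ α : Fin N → ℕ, length α + 2 ≤ l →
      compHigher a b α (fun c => m c t) (fun c => w c t) ≤ 2 * S) :
    LLState A l M K (M * Real.sqrt (2 * S)) (fun c => m c t) fun c => w c t := by
  have l1 : ∀ i : Fin N, length (ee i) = 1 := fun i => length_single _ _
  have hmb := fun c => (h.contBddH c).1 t ht
  have nn : ∀ f : Space N → ℝ, 0 ≤ ∫ x, f x ^ 2 := fun f => integral_nonneg fun x => sq_nonneg _
  have hR := Real.sqrt_nonneg (2 * S)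
  have key1 : ∀ c, (∑ i, ∫ x, weakDeriv (ee i) (m c t) x ^ 2) + A c * ∫ x, m c t x ^ 2 ≤ 2 * S :=
    fun c => (Finset.single_le_sum (f := fun c => (∑ i, ∫ x, weakDeriv (ee i) (m c t) x ^ 2) +
      A c * ∫ x, m c t x ^ 2) (fun c _ => add_nonneg (Finset.sum_nonneg fun i _ => nn _)
        (mul_nonneg (hA0 c) (nn _))) (Finset.mem_univ c)).trans hS1
  have key2 : ∀ c (α : Fin N → ℕ), length α + 2 ≤ l →
      (∫ x, weakDeriv α (w c t) x ^ 2) + (∫ x, lapDeriv α (m c t) x ^ 2) ≤ 2 * S := by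
    intro c α hα
    have h1 := (Finset.single_le_sum (f := fun c => (∫ x, weakDeriv α (w c t) x ^ 2) +
      (∫ x, lapDeriv α (m c t) x ^ 2) +
      a c * (∑ i, ∫ x, weakDeriv (ee i + α) (m c t) x ^ 2) +
      b c * ∫ x, weakDeriv α (m c t) x ^ 2) (fun c _ => by
        have := ha c
        have := hb c
        have := nn (weakDeriv α (w c t))
        have := nn (lapDeriv α (m c t))
        have := nn (weakDeriv α (m c t))
        have : 0 ≤ ∑ i, ∫ x, weakDeriv (ee i + α) (m c t) x ^ 2 :=
          Finset.sum_nonneg fun i _ => nn _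
        positivity) (Finset.mem_univ c)).trans (hS2 α hα)
    have h2 : 0 ≤ a c * (∑ i, ∫ x, weakDeriv (ee i + α) (m c t) x ^ 2) :=
      mul_nonneg (ha c) (Finset.sum_nonneg fun i _ => nn _)
    have h3 := mul_nonneg (hb c) (nn (weakDeriv α (m c t)))
    linarith
  -- First derivatives are read off the Landau–Lifshitz energy. For longer α two derivatives are
  -- split off and bounded through the Laplacian in the energy of order |α|.
  have key3 : ∀ c (α : Fin N → ℕ), 1 ≤ length α → length α ≤ l →
      l2n (weakDeriv α (m c t)) ≤ Real.sqrt (2 * S) := by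
    intro c α h1 h2
    refine l2n_le_sqrt ((hmb c).memLp α h1 (by omega)) ?_
    obtain ⟨i, β, hβ⟩ := exists_eq_add_single h1
    change α = β + ee i at hβ
    subst hβ
    rw [length_add, l1] at h2
    rcases Nat.eq_zero_or_pos (length β) with h0 | h0
    · rw [length_eq_zero.1 h0, zero_add]
      have h3 := mul_nonneg (hA0 c) (nn (m c t))
      exact (Finset.single_le_sum (f := fun i => ∫ x, weakDeriv (ee i) (m c t) x ^ 2)
        (fun i _ => nn _) (Finset.mem_univ i)).trans (by linarith [key1 c])
    · obtain ⟨j, γ, hγ⟩ := exists_eq_add_single h0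
      change β = γ + ee j at hγ
      subst hγ
      rw [length_add, l1] at h2
      have e : γ + ee j + ee i = ee i + ee j + γ := by abel
      rw [e]
      refine (integral_mixed_sq_le (hmb c) (by omega) i j).trans ?_
      linarith [key2 c γ (by omega), nn (weakDeriv γ (w c t))]
  have hXX : Real.sqrt (2 * S) ≤ M * Real.sqrt (2 * S) := by nlinarith
  exact
    { two_le := hl
      one_le_const := hM
      const_le := hc
      aniso_le := hA
      nonneg := hK
      bddH := fun c => (hmb c).mono (by omega)
      bddH_partial := fun c i => (((h.contBddH c).contH_weakDeriv (r := k + 1) (l1 i).ge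
        (by rw [l1]; omega)).contBddH (by omega)).1 t ht |>.mono (by omega)
      memH := fun c => ((h.contH c).1 t ht).mono hlk
      memLp_aniso := fun c => (h.contL2_aniso c).1 t ht
      sphere := h.sphere t ht
      eq := h.eq t ht
      supNorm_partial_le := hmK
      -- The factor M in X = M √(2S) absorbs the number of multi-indices of length j.
      hsn_le := fun c j h1 h2 => by
        refine (Finset.sum_le_card_nsmul _ _ (Real.sqrt (2 * S)) fun α hα => ?_).trans ?_
        · rw [mem_indices] at hα
          exact key3 c α (by omega) (by omega)
        · rw [nsmul_eq_mul]
          refine mul_le_mul_of_nonneg_right ?_ hR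
          have h3 := hc j 0 h2 (by omega)
          have h4 := moserConst_nonneg N 0
          have h5 : (0 : ℝ) ≤ (indices N j).card := by positivity
          nlinarith [mul_nonneg h5 h4, mul_nonneg h5 (sq_nonneg (moserConst N 0))]
      l2n_velocity_le := fun c α hα => by
        refine (l2n_le_sqrt (((h.contH c).1 t ht).memLp_weakDeriv (by omega)) ?_).trans hXX
        linarith [key2 c α hα.le, nn (lapDeriv α (m c t))]
      -- The energy contains A_c ∫ m_c², hence A_c² ∫ m_c² ≤ M · 2S. No lower bound on the
      -- anisotropy is needed, and no negative power of λ₁ or λ₃ appears.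
      l2n_aniso_le := fun c => by
        have h1 : l2n (fun x => A c * m c t x) ≤ Real.sqrt (M ^ 2 * (2 * S)) := by
          refine l2n_le_sqrt ((h.contL2_aniso c).1 t ht) ?_
          simp only [mul_pow]
          rw [integral_const_mul, sq, mul_assoc]
          have h2 := key1 c
          have h3 : 0 ≤ ∑ i, ∫ x, weakDeriv (ee i) (m c t) x ^ 2 :=
            Finset.sum_nonneg fun i _ => nn _
          have h4 := (le_abs_self _).trans (hA c)
          have h5 := mul_nonneg (hA0 c) (nn (m c t))
          have h6 : A c * ∫ x, m c t x ^ 2 ≤ 2 * S := by linarith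
          have h7 := mul_le_mul h4 h6 h5 (by linarith)
          have h8 : M * 1 * (2 * S) ≤ M * M * (2 * S) := mul_le_mul_of_nonneg_right
            (mul_le_mul_of_nonneg_left hM (by linarith)) (h5.trans h6)
          rw [sq]
          linarith
        rwa [Real.sqrt_mul (sq_nonneg M), Real.sqrt_sq (by linarith)] at h1 }

end Bounds

end LandauLifshitz
namespace LandauLifshitz

/-! ### Integrability of the energy densities and their expression in components. -/

section Densities

variable {N : ℕ}

theorem norm_sq_eq_sum_comp (u : Space N → Vec3) (x : Space N) :
    ‖u x‖ ^ 2 = ∑ c, comp c u x ^ 2 := by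
  rw [EuclideanSpace.norm_sq_eq]
  simp [comp]

theorem HasWeakDeriv.norm_sq_ae_eq {α : Fin N → ℕ} {v g : Space N → Vec3}
    (h : HasWeakDeriv α v g) : ∀ᵐ x, ‖LandauLifshitz.weakDeriv α v x‖ ^ 2 =
      ∑ c, LandauLifshitz.weakDeriv α (LandauLifshitz.comp c v) x ^ 2 := by
  have e : ∀ᵐ x, ∀ c, LandauLifshitz.weakDeriv α (LandauLifshitz.comp c v) x =
      LandauLifshitz.comp c (LandauLifshitz.weakDeriv α v) x :=
    ae_all_iff.2 fun c => (h.weakDeriv.comp c).weakDeriv_ae_eq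
  filter_upwards [e] with x hx
  rw [norm_sq_eq_sum_comp]
  simp only [hx]

namespace MemEnergySet

variable {s : ℕ} {v : Space N → Vec3}

theorem gradSq_ae_eq (hv : MemEnergySet s v) (hs : 1 ≤ s) :
    gradSq v =ᵐ[volume] fun x => ∑ c, ∑ i, weakDeriv (ee i) (comp c v) x ^ 2 := by
  have e : ∀ᵐ x, ∀ i : Fin N, ‖weakDeriv (ee i) v x‖ ^ 2 =
      ∑ c, weakDeriv (ee i) (comp c v) x ^ 2 := ae_all_iff.2 fun i => by
    obtain ⟨g, hg, -⟩ := hv.exists_hasWeakDeriv (α := ee i) (length_single i 1).ge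
      ((length_single i 1).trans_le hs)
    exact hg.norm_sq_ae_eq
  filter_upwards [e] with x hx
  rw [Finset.sum_comm]
  exact Finset.sum_congr rfl fun i _ => hx i

theorem memLp_comp (hv : MemEnergySet s v) {c : Fin 3} (hc : c ≠ 1) : MemLp (comp c v) 2 := by
  fin_cases c
  · exact hv.memLp_one
  · exact absurd rfl hc
  · exact hv.memLp_three

theorem memLp_weakDeriv_comp (hv : MemEnergySet s v) {c : Fin 3} {α : Fin N → ℕ}
    (hα : length α ≤ s) (h : c ≠ 1 ∨ 1 ≤ length α) : MemLp (weakDeriv α (comp c v)) 2 := by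
  rcases Nat.eq_zero_or_pos (length α) with h0 | h0
  · rw [length_eq_zero.1 h0]
    exact (hv.memLp_comp (h.resolve_right (by omega))).ae_eq
      (weakDeriv_zero_ae_eq (hv.locallyIntegrable_comp c)).symm
  · exact (hv.bddH c).memLp α h0 hα

theorem anisoCoeff_one (lam1 lam3 : ℝ) : anisoCoeff lam1 lam3 1 = 0 := rfl

theorem integrable_energyDensity (hv : MemEnergySet s v) (hs : 1 ≤ s) (lam1 lam3 : ℝ) :
    Integrable (energyDensity lam1 lam3 v) ∧
      ∫ x, energyDensity lam1 lam3 v x = compEnergy (anisoCoeff lam1 lam3) fun c => comp c v := by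
  have e : energyDensity lam1 lam3 v =ᵐ[volume] fun x => ∑ c,
      ((∑ i, weakDeriv (ee i) (comp c v) x ^ 2) + anisoCoeff lam1 lam3 c * comp c v x ^ 2) := by
    filter_upwards [hv.gradSq_ae_eq hs] with x hx
    rw [energyDensity, hx, Finset.sum_add_distrib]
    simp [Fin.sum_univ_three, anisoCoeff, comp]
    ring
  have i1 : ∀ c (i : Fin N), Integrable fun x => weakDeriv (ee i) (comp c v) x ^ 2 := fun c i =>
    (hv.memLp_weakDeriv_comp ((length_single i 1).trans_le hs)
      (Or.inr (length_single i 1).ge)).integrable_sq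
  have i2 : ∀ c, Integrable fun x => anisoCoeff lam1 lam3 c * comp c v x ^ 2 := fun c => by
    by_cases hc : c = 1
    · subst hc
      simp [anisoCoeff_one]
    · exact (hv.memLp_comp hc).integrable_sq.const_mul _
  have i3 : ∀ c, Integrable fun x => ∑ i, weakDeriv (ee i) (comp c v) x ^ 2 := fun c =>
    integrable_finsetSum _ fun i _ => i1 c i
  have i4 : ∀ c, Integrable fun x => (∑ i, weakDeriv (ee i) (comp c v) x ^ 2) +
      anisoCoeff lam1 lam3 c * comp c v x ^ 2 := fun c => (i3 c).add (i2 c)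
  refine ⟨(integrable_finsetSum _ fun c _ => i4 c).congr e.symm, ?_⟩
  rw [integral_congr_ae e, integral_finsetSum _ fun c _ => i4 c, compEnergy]
  refine Finset.sum_congr rfl fun c _ => ?_
  rw [integral_add (i3 c) (i2 c), integral_finsetSum _ fun i _ => i1 c i, integral_const_mul]

variable {α : Fin N → ℕ}

theorem norm_sq_laplacian_ae_eq (hv : MemEnergySet s v) (hα : length α + 2 ≤ s) :
    ∀ᵐ x, ‖weakLaplacian (weakDeriv α v) x‖ ^ 2 = ∑ c, lapDeriv α (comp c v) x ^ 2 := by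
  have h0 : HasWeakDeriv α v (weakDeriv α v) := by
    rcases Nat.eq_zero_or_pos (length α) with h0 | h0
    · rw [length_eq_zero.1 h0]
      exact (HasWeakDeriv.zero_index hv.1).weakDeriv
    · obtain ⟨g, hg, -⟩ := hv.exists_hasWeakDeriv h0 (by omega)
      exact hg.weakDeriv
  have h : ∀ᵐ x, ∀ c, ∀ i : Fin N, weakDeriv (Pi.single i 2) (weakDeriv α v) x c =
      weakDeriv (ee i + ee i + α) (comp c v) x := by
    rw [ae_all_iff]; intro c
    rw [ae_all_iff]; intro i
    obtain ⟨g, hg, -⟩ := hv.exists_hasWeakDeriv (α := α + Pi.single i 2)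
      (by rw [length_add, length_single]; omega) (by rw [length_add, length_single]; omega)
    have e := (hg.comp c).weakDeriv_ae_eq
    rw [single_two, add_comm] at e
    filter_upwards [(h0.of_add hg).weakDeriv_ae_eq, e] with x h1 h2
    rw [h1, h2, comp]
  filter_upwards [h] with x hx
  rw [EuclideanSpace.norm_sq_eq]
  refine Finset.sum_congr rfl fun c _ => ?_
  rw [Real.norm_eq_abs, sq_abs, weakLaplacian, lapDeriv]
  simp only [← hx]
  simp

theorem gradSq_weakDeriv_ae_eq (hv : MemEnergySet s v) (hα : length α + 1 ≤ s) :
    ∀ᵐ x, ∀ c, gradSq (weakDeriv α (comp c v)) x =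
      ∑ i, weakDeriv (ee i + α) (comp c v) x ^ 2 := by
  have h : ∀ᵐ x, ∀ c, ∀ i : Fin N, weakPartial i (weakDeriv α (comp c v)) x =
      weakDeriv (ee i + α) (comp c v) x := by
    rw [ae_all_iff]; intro c
    rw [ae_all_iff]; intro i
    have := (hv.bddH c).locH.weakDeriv_weakDeriv (α := α) (β := ee i)
      (by rw [length_single]; omega)
    rwa [add_comm] at this
  filter_upwards [h] with x hx c
  simp only [gradSq, hx, Real.norm_eq_abs, sq_abs]

/-- The coefficient λ₁λ₃ of the components of index 0 and 2 is written as a product of two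
anisotropy vectors with swapped parameters. It vanishes at index 1, and it exhibits A_c as a factor,
as the energy estimate requires. -/
theorem integrable_higherDensity (hv : MemEnergySet s v) {r : ℕ} {w : Space N → Vec3}
    (hw : MemH r w) (hα : length α + 2 ≤ s) (hr : length α ≤ r) (lam1 lam3 : ℝ) :
    Integrable (higherDensity lam1 lam3 α v w) ∧ ∫ x, higherDensity lam1 lam3 α v w x =
      compHigher (anisoCoeff (lam1 + lam3) (lam1 + lam3))
        (fun c => anisoCoeff lam3 lam1 c * anisoCoeff lam1 lam3 c) α (fun c => comp c v)
        fun c => comp c w := by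
  have e : higherDensity lam1 lam3 α v w =ᵐ[volume] fun x => ∑ c,
      (weakDeriv α (comp c w) x ^ 2 + lapDeriv α (comp c v) x ^ 2 +
        anisoCoeff (lam1 + lam3) (lam1 + lam3) c * (∑ i, weakDeriv (ee i + α) (comp c v) x ^ 2) +
        anisoCoeff lam3 lam1 c * anisoCoeff lam1 lam3 c * weakDeriv α (comp c v) x ^ 2) := by
    obtain ⟨g, hg, -⟩ := hw α hr
    filter_upwards [hg.norm_sq_ae_eq, hv.norm_sq_laplacian_ae_eq hα,
      hv.gradSq_weakDeriv_ae_eq (α := α) (by omega)] with x h1 h2 h3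
    rw [higherDensity, h1, h2, h3, h3]
    simp [Fin.sum_univ_three, anisoCoeff]
    ring
  have i1 : ∀ c, Integrable fun x => weakDeriv α (comp c w) x ^ 2 := fun c =>
    ((hw.comp c).memLp_weakDeriv hr).integrable_sq
  have i2 : ∀ c, Integrable fun x => lapDeriv α (comp c v) x ^ 2 := fun c =>
    (memLp_lapDeriv (hv.bddH c) hα).integrable_sq
  have i3 : ∀ c (i : Fin N), Integrable fun x => weakDeriv (ee i + α) (comp c v) x ^ 2 :=
    fun c i => (hv.memLp_weakDeriv_comp (by simp only [length_add, length_single]; omega)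
      (Or.inr (by simp only [length_add, length_single]; omega))).integrable_sq
  have i4 : ∀ c, Integrable fun x => anisoCoeff (lam1 + lam3) (lam1 + lam3) c *
      ∑ i, weakDeriv (ee i + α) (comp c v) x ^ 2 := fun c =>
    (integrable_finsetSum _ fun i _ => i3 c i).const_mul _
  have i5 : ∀ c, Integrable fun x =>
      anisoCoeff lam3 lam1 c * anisoCoeff lam1 lam3 c * weakDeriv α (comp c v) x ^ 2 := fun c => by
    by_cases hc : c = 1
    · subst hc
      simp [anisoCoeff_one]
    · exact (hv.memLp_weakDeriv_comp (by omega) (Or.inl hc)).integrable_sq.const_mul _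
  have i6 : ∀ c, Integrable fun x => weakDeriv α (comp c w) x ^ 2 + lapDeriv α (comp c v) x ^ 2 :=
    fun c => (i1 c).add (i2 c)
  have i7 : ∀ c, Integrable fun x => weakDeriv α (comp c w) x ^ 2 + lapDeriv α (comp c v) x ^ 2 +
      anisoCoeff (lam1 + lam3) (lam1 + lam3) c * ∑ i, weakDeriv (ee i + α) (comp c v) x ^ 2 :=
    fun c => (i6 c).add (i4 c)
  have i8 : ∀ c, Integrable fun x => weakDeriv α (comp c w) x ^ 2 + lapDeriv α (comp c v) x ^ 2 +
      anisoCoeff (lam1 + lam3) (lam1 + lam3) c * (∑ i, weakDeriv (ee i + α) (comp c v) x ^ 2) +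
      anisoCoeff lam3 lam1 c * anisoCoeff lam1 lam3 c * weakDeriv α (comp c v) x ^ 2 :=
    fun c => (i7 c).add (i5 c)
  refine ⟨(integrable_finsetSum _ fun c _ => i8 c).congr e.symm, ?_⟩
  rw [integral_congr_ae e, integral_finsetSum _ fun c _ => i8 c, compHigher]
  refine Finset.sum_congr rfl fun c _ => ?_
  rw [integral_add (i7 c) (i5 c), integral_add (i6 c) (i4 c),
    integral_add (i1 c) (i2 c), integral_const_mul, integral_const_mul,
    integral_finsetSum _ fun i _ => i3 c i]

theorem memLp_gradNorm (hv : MemEnergySet s v) (hs : 1 ≤ s)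
    (h : ∀ c (i : Fin N), MemLp (weakDeriv (ee i) (comp c v)) ∞) : MemLp (gradNorm v) ∞ := by
  have hm : AEStronglyMeasurable (gradNorm v) := by
    refine Real.continuous_sqrt.comp_aestronglyMeasurable
      (AEStronglyMeasurable.congr ?_ (hv.gradSq_ae_eq hs).symm)
    refine Finset.aestronglyMeasurable_fun_sum _ fun c _ =>
      Finset.aestronglyMeasurable_fun_sum _ fun i _ => ?_
    exact (h c i).aestronglyMeasurable.pow 2
  have hb : ∀ᵐ x, ∀ c (i : Fin N), |weakDeriv (ee i) (comp c v) x| ≤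
      supNorm (weakDeriv (ee i) (comp c v)) :=
    ae_all_iff.2 fun c => ae_all_iff.2 fun i => (h c i).ae_abs_le
  refine memLp_top_of_bound hm
    (Real.sqrt (∑ c, ∑ i, supNorm (weakDeriv (ee i) (comp c v)) ^ 2)) ?_
  filter_upwards [hb, hv.gradSq_ae_eq hs] with x hx hg
  rw [gradNorm, Real.norm_of_nonneg (Real.sqrt_nonneg _), hg]
  exact Real.sqrt_le_sqrt (Finset.sum_le_sum fun c _ => Finset.sum_le_sum fun i _ =>
    sq_le_sq' (by linarith [neg_abs_le (weakDeriv (ee i) (comp c v) x), hx c i])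
      ((le_abs_self _).trans (hx c i)))

theorem supNorm_weakDeriv_le (hv : MemEnergySet s v) (hs : 1 ≤ s) (h : MemLp (gradNorm v) ∞)
    (c : Fin 3) (i : Fin N) : supNorm (weakDeriv (ee i) (comp c v)) ≤ supNorm (gradNorm v) := by
  refine ENNReal.toReal_mono h.eLpNorm_ne_top (eLpNorm_mono_ae ?_)
  filter_upwards [hv.gradSq_ae_eq hs] with x hx
  rw [gradNorm, Real.norm_eq_abs, Real.norm_of_nonneg (Real.sqrt_nonneg _), hx]
  refine Real.abs_le_sqrt ?_
  exact (Finset.single_le_sum (f := fun i => weakDeriv (ee i) (comp c v) x ^ 2)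
    (fun i _ => sq_nonneg _) (Finset.mem_univ i)).trans (Finset.single_le_sum
    (f := fun c => ∑ i, weakDeriv (ee i) (comp c v) x ^ 2)
    (fun c _ => Finset.sum_nonneg fun i _ => sq_nonneg _) (Finset.mem_univ c))

end MemEnergySet

end Densities

end LandauLifshitz
namespace LandauLifshitz

/-! ### Assembly of the estimate and uniformity of the constant. -/

section Main

variable {N : ℕ}

/-- A bound for the parameters and for the constants of the product estimates. -/
noncomputable def paramConst (lam1 lam3 : ℝ) (k N : ℕ) : ℝ :=
  1 + lam1 + lam3 + ∑ r ∈ Finset.range (k + 1), ∑ s ∈ Finset.range (k + 1),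
    2 * (1 + (indices N r).card) * (1 + moserConst N s) ^ 2

theorem le_paramConst (lam1 lam3 : ℝ) (k N : ℕ) :
    1 + lam1 + lam3 ≤ paramConst lam1 lam3 k N :=
  le_add_of_nonneg_right (Finset.sum_nonneg fun r _ => Finset.sum_nonneg fun s _ => by positivity)

theorem productConst_le_paramConst {lam1 lam3 : ℝ} (h1 : 0 ≤ lam1) (h3 : 0 ≤ lam3) {k r s : ℕ}
    (hr : r ≤ k) (hs : s ≤ k) : 2 * (1 + (indices N r).card) * (1 + moserConst N s) ^ 2 ≤
      paramConst lam1 lam3 k N := by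
  refine le_trans ?_ (le_add_of_nonneg_left (by linarith))
  refine (Finset.single_le_sum
    (f := fun s => 2 * (1 + ((indices N r).card : ℝ)) * (1 + moserConst N s) ^ 2)
    (fun s _ => by positivity) (Finset.mem_range.2 (Nat.lt_succ_of_le hs))).trans ?_
  exact Finset.single_le_sum (f := fun r => ∑ s ∈ Finset.range (k + 1),
    2 * (1 + ((indices N r).card : ℝ)) * (1 + moserConst N s) ^ 2)
    (fun r _ => Finset.sum_nonneg fun s _ => by positivity)
    (Finset.mem_range.2 (Nat.lt_succ_of_le hr))

theorem rateConst_nonneg {M : ℝ} (hM : 0 ≤ M) (α : Fin N → ℕ) : 0 ≤ rateConst M α := by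
  have := leibSum_nonneg α
  unfold rateConst LLState.accelConst
  positivity

/-- The constant in the estimate of the energy of order `l` in dimension `N`. -/
noncomputable def estimateConst (lam1 lam3 : ℝ) (k N l : ℕ) : ℝ :=
  ∑ α ∈ indices N (l - 2), rateConst (paramConst lam1 lam3 k N) α *
    (2 * paramConst lam1 lam3 k N ^ 2)

theorem estimateConst_nonneg {lam1 lam3 : ℝ} (h1 : 0 ≤ lam1) (h3 : 0 ≤ lam3) (k N l : ℕ) :
    0 ≤ estimateConst lam1 lam3 k N l :=
  Finset.sum_nonneg fun α _ => mul_nonneg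
    (rateConst_nonneg (by linarith [le_paramConst lam1 lam3 k N]) α) (by positivity)

theorem anisoCoeff_nonneg {lam1 lam3 : ℝ} (h1 : 0 ≤ lam1) (h3 : 0 ≤ lam3) (c : Fin 3) :
    0 ≤ anisoCoeff lam1 lam3 c := by
  fin_cases c <;> simp [anisoCoeff, h1, h3]

theorem anisoCoeff_le {lam1 lam3 B : ℝ} (h0 : 0 ≤ B) (h1 : lam1 ≤ B) (h3 : lam3 ≤ B) (c : Fin 3) :
    anisoCoeff lam1 lam3 c ≤ B := by
  fin_cases c <;> simp [anisoCoeff, h0, h1, h3]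

theorem compEnergy_nonneg {A : Fin 3 → ℝ} (hA : ∀ c, 0 ≤ A c) (m : Fin 3 → Space N → ℝ) :
    0 ≤ compEnergy A m :=
  Finset.sum_nonneg fun c _ => add_nonneg
    (Finset.sum_nonneg fun i _ => integral_nonneg fun x => sq_nonneg _)
    (mul_nonneg (hA c) (integral_nonneg fun x => sq_nonneg _))

theorem compHigher_nonneg {a b : Fin 3 → ℝ} (ha : ∀ c, 0 ≤ a c) (hb : ∀ c, 0 ≤ b c)
    (α : Fin N → ℕ) (m w : Fin 3 → Space N → ℝ) : 0 ≤ compHigher a b α m w :=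
  Finset.sum_nonneg fun c _ => add_nonneg (add_nonneg (add_nonneg
    (integral_nonneg fun x => sq_nonneg _) (integral_nonneg fun x => sq_nonneg _))
    (mul_nonneg (ha c) (Finset.sum_nonneg fun i _ => integral_nonneg fun x => sq_nonneg _)))
    (mul_nonneg (hb c) (integral_nonneg fun x => sq_nonneg _))

namespace IsSmoothSolution

variable {lam1 lam3 T : ℝ} {k : ℕ} {m mt : ℝ → Space N → Vec3}

theorem energyOrder_one (h : IsSmoothSolution lam1 lam3 k T m mt) {t : ℝ} (ht : t ∈ Icc 0 T) :
    energyOrder lam1 lam3 m mt 1 t =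
      1 / 2 * compEnergy (anisoCoeff lam1 lam3) fun c => comp c (m t) := by
  rw [energyOrder, energy,
    ((h.cont.mem t ht).integrable_energyDensity (by omega) lam1 lam3).2]

theorem energyOrder_add_two (h : IsSmoothSolution lam1 lam3 k T m mt) {t : ℝ}
    (ht : t ∈ Icc 0 T) {j : ℕ} (hj : j + 2 ≤ k) :
    energyOrder lam1 lam3 m mt (j + 2) t = 1 / 2 * ∑ α ∈ indices N j,
      compHigher (anisoCoeff (lam1 + lam3) (lam1 + lam3))
        (fun c => anisoCoeff lam3 lam1 c * anisoCoeff lam1 lam3 c) α (fun c => comp c (m t))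
        fun c => comp c (mt t) := by
  rw [energyOrder]
  congr 1
  refine Finset.sum_congr rfl fun α hα => ?_
  have hα' := mem_indices.1 hα
  exact ((h.cont.mem t ht).integrable_higherDensity (h.cont_deriv.mem t ht) (by omega)
    (by omega) lam1 lam3).2

theorem energyOrder_nonneg (h : IsSmoothSolution lam1 lam3 k T m mt) (h1 : 0 ≤ lam1)
    (h3 : 0 ≤ lam3) {t : ℝ} (ht : t ∈ Icc 0 T) {j : ℕ} (hj : j ≤ k) :
    0 ≤ energyOrder lam1 lam3 m mt j t := by
  match j with
  | 0 => exact le_rfl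
  | 1 =>
    rw [h.energyOrder_one ht]
    exact mul_nonneg (by norm_num) (compEnergy_nonneg (anisoCoeff_nonneg h1 h3) _)
  | j + 2 =>
    rw [h.energyOrder_add_two ht hj]
    exact mul_nonneg (by norm_num) (Finset.sum_nonneg fun α _ => compHigher_nonneg
      (anisoCoeff_nonneg (add_nonneg h1 h3) (add_nonneg h1 h3))
      (fun c => mul_nonneg (anisoCoeff_nonneg h3 h1 c) (anisoCoeff_nonneg h1 h3 c)) _ _ _)

theorem energyOrder_le_energySum (h : IsSmoothSolution lam1 lam3 k T m mt) (h1 : 0 ≤ lam1)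
    (h3 : 0 ≤ lam3) {t : ℝ} (ht : t ∈ Icc 0 T) {j l : ℕ} (hj : 1 ≤ j) (hjl : j ≤ l)
    (hl : l ≤ k) : energyOrder lam1 lam3 m mt j t ≤ energySum lam1 lam3 m mt l t :=
  Finset.single_le_sum (f := fun j => energyOrder lam1 lam3 m mt j t)
    (fun i hi => h.energyOrder_nonneg h1 h3 ht ((Finset.mem_Icc.1 hi).2.trans hl))
    (Finset.mem_Icc.2 ⟨hj, hjl⟩)

theorem compEnergy_le_energySum (h : IsSmoothSolution lam1 lam3 k T m mt) (h1 : 0 ≤ lam1)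
    (h3 : 0 ≤ lam3) {t : ℝ} (ht : t ∈ Icc 0 T) {l : ℕ} (hl0 : 1 ≤ l) (hl : l ≤ k) :
    compEnergy (anisoCoeff lam1 lam3) (fun c => comp c (m t)) ≤
      2 * energySum lam1 lam3 m mt l t := by
  have := h.energyOrder_le_energySum h1 h3 ht le_rfl hl0 hl
  rw [h.energyOrder_one ht] at this
  linarith

theorem compHigher_le_energySum (h : IsSmoothSolution lam1 lam3 k T m mt) (h1 : 0 ≤ lam1)
    (h3 : 0 ≤ lam3) {t : ℝ} (ht : t ∈ Icc 0 T) {l : ℕ} {α : Fin N → ℕ} (hα : length α + 2 ≤ l)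
    (hl : l ≤ k) : compHigher (anisoCoeff (lam1 + lam3) (lam1 + lam3))
        (fun c => anisoCoeff lam3 lam1 c * anisoCoeff lam1 lam3 c) α (fun c => comp c (m t))
        (fun c => comp c (mt t)) ≤ 2 * energySum lam1 lam3 m mt l t := by
  have h4 := h.energyOrder_le_energySum h1 h3 ht (j := length α + 2) (by omega) hα hl
  rw [h.energyOrder_add_two ht (hα.trans hl)] at h4
  have h5 := Finset.single_le_sum (f := fun α =>
    compHigher (anisoCoeff (lam1 + lam3) (lam1 + lam3))
      (fun c => anisoCoeff lam3 lam1 c * anisoCoeff lam1 lam3 c) α (fun c => comp c (m t))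
      (fun c => comp c (mt t))) (fun α _ => compHigher_nonneg
      (anisoCoeff_nonneg (add_nonneg h1 h3) (add_nonneg h1 h3))
      (fun c => mul_nonneg (anisoCoeff_nonneg h3 h1 c) (anisoCoeff_nonneg h1 h3 c)) _ _ _)
    (mem_indices.2 (rfl : length α = length α))
  linarith

theorem memLp_gradNorm (h : IsSmoothSolution lam1 lam3 k T m mt) (hk : N < 2 * (k + 1)) {t : ℝ}
    (ht : t ∈ Icc 0 T) : MemLp (gradNorm (m t)) ∞ :=
  (h.cont.mem t ht).memLp_gradNorm (by omega) fun c i =>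
    ((((h.llCurve (by omega)).contBddH c).contH_weakDeriv (r := k + 1) (length_single i 1).ge
      (by rw [length_single]; omega)).contSup hk).1 t ht

/-- The state bounds hold with X = M √(2S), S being the sum of the energies up to order l; the
factor 2M² is X²/S. -/
theorem higherRate_le (h : IsSmoothSolution lam1 lam3 k T m mt) (h1 : 0 ≤ lam1) (h3 : 0 ≤ lam3)
    (hN : 1 ≤ N) (hk : N < 2 * (k - 1)) {t : ℝ} (ht : t ∈ Icc 0 T) {α : Fin N → ℕ} {l : ℕ}
    (hα : length α + 2 = l) (hl : l ≤ k) :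
    higherRate (anisoCoeff (lam1 + lam3) (lam1 + lam3))
        (fun c => anisoCoeff lam3 lam1 c * anisoCoeff lam1 lam3 c) α (fun c => comp c (m t))
        (fun c => comp c (mt t)) (llAccel (anisoCoeff lam1 lam3) (fun c => comp c (m t))
          fun c => comp c (mt t)) ≤
      rateConst (paramConst lam1 lam3 k N) α * (2 * paramConst lam1 lam3 k N ^ 2) *
        ((1 + supNorm (gradNorm (m t)) ^ 2) * energySum lam1 lam3 m mt l t) := by
  have hc := h.llCurve (by omega)
  have hM := le_paramConst lam1 lam3 k N
  have hS := h.compEnergy_le_energySum h1 h3 ht (l := l) (by omega) hl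
  have hS0 := (compEnergy_nonneg (anisoCoeff_nonneg h1 h3) _).trans hS
  have hst := hc.llState (a := anisoCoeff (lam1 + lam3) (lam1 + lam3))
    (b := fun c => anisoCoeff lam3 lam1 c * anisoCoeff lam1 lam3 c)
    (M := paramConst lam1 lam3 k N) (l := l) (by omega) hl hk (by linarith)
    (fun r s hr hs => productConst_le_paramConst h1 h3 (hr.trans hl) (hs.trans hl))
    (fun c => by
      rw [abs_of_nonneg (anisoCoeff_nonneg h1 h3 c)]
      exact anisoCoeff_le (by linarith) (by linarith) (by linarith) c)
    (anisoCoeff_nonneg h1 h3) (anisoCoeff_nonneg (add_nonneg h1 h3) (add_nonneg h1 h3))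
    (fun c => mul_nonneg (anisoCoeff_nonneg h3 h1 c) (anisoCoeff_nonneg h1 h3 c))
    (supNorm_nonneg (gradNorm (m t))) ht
    (fun c i => (h.cont.mem t ht).supNorm_weakDeriv_le (by omega)
      (h.memLp_gradNorm (by omega) ht) c i) hS
    fun α hα => h.compHigher_le_energySum h1 h3 ht hα hl
  have hz := fun c => hc.contH_accel hN hk c
  refine (hst.higherRate_le hα (fun c => ((hz c).1 t ht).locH.hasWeakDeriv (by omega))
    (fun c => ((hz c).1 t ht).memLp_weakDeriv (by omega)) (fun c => ?_) fun c => ?_).trans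
    (le_of_eq ?_)
  · rw [abs_of_nonneg (anisoCoeff_nonneg (add_nonneg h1 h3) (add_nonneg h1 h3) c)]
    exact anisoCoeff_le (by linarith) (by linarith) (by linarith) c
  · rw [abs_of_nonneg (anisoCoeff_nonneg h3 h1 c)]
    exact anisoCoeff_le (by linarith) (by linarith) (by linarith) c
  · rw [mul_pow, Real.sq_sqrt hS0]
    ring

theorem hasDerivWithinAt_energyOrder (h : IsSmoothSolution lam1 lam3 k T m mt) (hT : 0 < T)
    (hN : 1 ≤ N) (hk : N < 2 * (k - 1)) {t : ℝ} (ht : t ∈ Icc 0 T) {j : ℕ} (hj : j + 2 ≤ k) :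
    HasDerivWithinAt (energyOrder lam1 lam3 m mt (j + 2)) (∑ α ∈ indices N j,
      higherRate (anisoCoeff (lam1 + lam3) (lam1 + lam3))
        (fun c => anisoCoeff lam3 lam1 c * anisoCoeff lam1 lam3 c) α (fun c => comp c (m t))
        (fun c => comp c (mt t)) (llAccel (anisoCoeff lam1 lam3) (fun c => comp c (m t))
          fun c => comp c (mt t))) (Icc 0 T) t := by
  refine HasDerivWithinAt.congr (((HasDerivWithinAt.fun_sum fun α hα =>
    (h.llCurve (by omega)).hasDerivWithinAt_compHigher hT hN hk
      ((congrArg (· + 2) (mem_indices.1 hα)).trans_le hj)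
      (fun c => right_ne_zero_of_mul) ht).const_mul (1 / 2)).congr_deriv ?_)
    (fun s hs => h.energyOrder_add_two hs hj) (h.energyOrder_add_two ht hj)
  rw [← Finset.mul_sum]
  ring

theorem contDiffOn_energyOrder (h : IsSmoothSolution lam1 lam3 k T m mt) (hT : 0 < T)
    (hN : 1 ≤ N) (hk : N < 2 * (k - 1)) {j : ℕ} (hj : j + 2 ≤ k) :
    ContDiffOn ℝ 1 (energyOrder lam1 lam3 m mt (j + 2)) (Icc 0 T) := by
  have hu := uniqueDiffOn_Icc hT
  rw [show (1 : WithTop ℕ∞) = 0 + 1 from (zero_add 1).symm, contDiffOn_succ_iff_derivWithin hu]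
  refine ⟨fun t ht => (h.hasDerivWithinAt_energyOrder hT hN hk ht hj).differentiableWithinAt,
    by simp, contDiffOn_zero.2 ?_⟩
  refine ContinuousOn.congr (continuousOn_finsetSum (indices N j) fun α hα =>
    (h.llCurve (by omega)).continuousOn_higherRate hN hk
      ((congrArg (· + 2) (mem_indices.1 hα)).trans_le hj) (fun c => right_ne_zero_of_mul)) fun t ht =>
    (h.hasDerivWithinAt_energyOrder hT hN hk ht hj).derivWithin (hu t ht)

theorem derivWithin_energyOrder_le (h : IsSmoothSolution lam1 lam3 k T m mt) (h1 : 0 ≤ lam1)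
    (h3 : 0 ≤ lam3) (hT : 0 < T) (hN : 1 ≤ N) (hk : N < 2 * (k - 1)) {t : ℝ} (ht : t ∈ Icc 0 T)
    {j : ℕ} (hj : j + 2 ≤ k) :
    derivWithin (energyOrder lam1 lam3 m mt (j + 2)) (Icc 0 T) t ≤
      estimateConst lam1 lam3 k N (j + 2) *
        ((1 + supNorm (gradNorm (m t)) ^ 2) * energySum lam1 lam3 m mt (j + 2) t) := by
  rw [(h.hasDerivWithinAt_energyOrder hT hN hk ht hj).derivWithin (uniqueDiffOn_Icc hT t ht),
    estimateConst, Nat.add_sub_cancel, Finset.sum_mul]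
  exact Finset.sum_le_sum fun α hα => h.higherRate_le h1 h3 hN hk ht
    (congrArg (· + 2) (mem_indices.1 hα)) hj

theorem energySum_nonneg (h : IsSmoothSolution lam1 lam3 k T m mt) (h1 : 0 ≤ lam1)
    (h3 : 0 ≤ lam3) {t : ℝ} (ht : t ∈ Icc 0 T) {l : ℕ} (hl : l ≤ k) :
    0 ≤ energySum lam1 lam3 m mt l t :=
  Finset.sum_nonneg fun _ hi => h.energyOrder_nonneg h1 h3 ht ((Finset.mem_Icc.1 hi).2.trans hl)

theorem energyOrder_one_eq (h : IsSmoothSolution lam1 lam3 k T m mt) (hT : 0 < T)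
    (hk : N < 2 * (k + 2)) (hk2 : 2 ≤ k) {t : ℝ} (ht : t ∈ Icc 0 T) :
    energyOrder lam1 lam3 m mt 1 t = energyOrder lam1 lam3 m mt 1 0 := by
  rw [h.energyOrder_one ht, h.energyOrder_one (left_mem_Icc.2 hT.le),
    (h.llCurve hk).compEnergy_eq hT hk2 ht]

end IsSmoothSolution

end Main

end LandauLifshitz

theorem mainTheorem7 (lam1 lam3 : ℝ) (hlam1 : 0 ≤ lam1) (hlam3 : 0 ≤ lam3) (k : ℕ) :
    ∃ C : ℝ, 0 < C ∧
      ∀ (N : ℕ), 1 ≤ N → 1 + (N : ℝ) / 2 < (k : ℝ) →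
      ∀ (T : ℝ), 0 < T →
      ∀ (m mt : ℝ → Space N → Vec3), IsSmoothSolution lam1 lam3 k T m mt →
        -- (i) the Landau-Lifshitz energy is well-defined and conserved
        (∀ t ∈ Icc 0 T, Integrable (energyDensity lam1 lam3 (m t)) ∧
          energyOrder lam1 lam3 m mt 1 t = energyOrder lam1 lam3 m mt 1 0) ∧
        -- (ii) the higher-order energies are well-defined, of class C¹, and satisfy the estimate,
        -- in which the norms are finite
        (∀ t ∈ Icc 0 T, ∀ α : Fin N → ℕ, length α + 2 ≤ k →
          Integrable (higherDensity lam1 lam3 α (m t) (mt t))) ∧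
        (∀ t ∈ Icc 0 T, MemLp (comp 0 (m t)) ∞ ∧ MemLp (comp 2 (m t)) ∞ ∧
          MemLp (gradNorm (m t)) ∞) ∧
        (∀ l : ℕ, 2 ≤ l → l ≤ k →
          ContDiffOn ℝ 1 (energyOrder lam1 lam3 m mt l) (Icc 0 T) ∧
          ∀ t ∈ Icc 0 T,
            derivWithin (energyOrder lam1 lam3 m mt l) (Icc 0 T) t ≤
              C * (1 + supNorm (comp 0 (m t)) ^ 2 + supNorm (comp 2 (m t)) ^ 2
                  + supNorm (gradNorm (m t)) ^ 2) * energySum lam1 lam3 m mt l t) := by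
  set E : ℕ → ℕ → ℝ := estimateConst lam1 lam3 k with hE
  have hE0 : ∀ N l, 0 ≤ E N l := estimateConst_nonneg hlam1 hlam3 k
  -- The condition 1 + N/2 < k leaves only finitely many dimensions, all below 2k, so summing over N
  -- and l gives a constant that depends on k, λ₁ and λ₃ alone. The leading 1 ensures positivity.
  set C : ℝ := 1 + ∑ N ∈ Finset.range (2 * k + 1), ∑ l ∈ Finset.range (k + 1), E N l with hC
  have hC0 : 0 < C := add_pos_of_pos_of_nonneg one_pos
    (Finset.sum_nonneg fun N _ => Finset.sum_nonneg fun l _ => hE0 N l)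
  refine ⟨C, hC0, fun N hN hNk T hT m mt h => ?_⟩
  have hNk' : N + 2 < 2 * k := by
    have : ((N + 2 : ℕ) : ℝ) < (2 * k : ℕ) := by
      push_cast
      linarith
    exact_mod_cast this
  refine ⟨fun t ht => ⟨((h.cont.mem t ht).integrable_energyDensity (by omega) lam1 lam3).1,
    h.energyOrder_one_eq hT (by omega) (by omega) ht⟩,
    fun t ht α hα => ((h.cont.mem t ht).integrable_higherDensity (h.cont_deriv.mem t ht)
      (by omega) (by omega) lam1 lam3).1,
    fun t ht => ⟨((h.cont.mem t ht).bddH 0).memLp_top, ((h.cont.mem t ht).bddH 2).memLp_top,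
      h.memLp_gradNorm (by omega) ht⟩, fun l hl2 hl => ?_⟩
  obtain ⟨j, rfl⟩ : ∃ j, l = j + 2 := ⟨l - 2, by omega⟩
  refine ⟨h.contDiffOn_energyOrder hT hN (by omega) hl, fun t ht => ?_⟩
  have hEC : E N (j + 2) ≤ C := by
    have e1 := Finset.single_le_sum (f := fun l => E N l) (fun l _ => hE0 N l)
      (Finset.mem_range.2 (Nat.lt_succ_of_le hl))
    have e2 := Finset.single_le_sum (f := fun N => ∑ l ∈ Finset.range (k + 1), E N l)
      (fun N _ => Finset.sum_nonneg fun l _ => hE0 N l)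
      (Finset.mem_range.2 (show N < 2 * k + 1 by omega))
    linarith
  have hS := h.energySum_nonneg hlam1 hlam3 ht hl
  refine (h.derivWithin_energyOrder_le hlam1 hlam3 hT hN (by omega) ht hl).trans ?_
  rw [mul_assoc]
  refine mul_le_mul hEC (mul_le_mul_of_nonneg_right ?_ hS) (by positivity) hC0.le
  -- The estimate obtained has only the gradient norm, since |m| = 1 bounds the components; the
  -- squares of the norms of m₁ and m₃ are added as nonnegative terms.
  linarith [sq_nonneg (supNorm (comp 0 (m t))), sq_nonneg (supNorm (comp 2 (m t)))]
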